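/- **Setting.** Let $M$ be a smooth (Hausdorff, second countable) manifold with (possibly empty) boundary $\partial M$ and $\dim M\ge 1$. For a $\mathbb Z$-graded real vector bundle $E$ of finite rank write $\mathscr E$ for its sheaf of smooth sections; $\mathscr E(U)$ is regarded as a convenient vector space, whose smooth maps from a manifold $X$ are the smooth sections over $X\times U$ of the pullback of $E$. *Classical theories.* A classical theory on a manifold $X$ with pairing of degree $m$ is given by $E\to X$ together with polydifferential brackets $\ell_k$ ($k\ge 1$) of degree $2-k$ making $\mathscr E[-1]$ a sheaf of $L_\infty$ algebras, such that $(\mathscr E,\ell_1)$ is an elliptic complex, and a fibrewise non-degenerate bundle map $\langle\ ,\ \rangle_{loc}\colon E\otimes E\to \mathrm{Dens}_X$ of degree $m$ for which, after integration, the compactly supported sections of $E[-1]$ form a cyclic $L_\infty$ algebra. *TNBFT.* A field theory on $M$ that is topological normal to the boundary consists of a graded bundle $E\to M$ with brackets $\ell_k$ and a pairing $\langle\ ,\ \rangle_{loc}$ that restrict to a classical theory with pairing of degree $-1$ on the interior of $M$; a classical theory $(E_\partial,\ell_{k,\partial},\langle\ ,\ \rangle_{loc,\partial})$ with pairing of degree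 $0$ on $\partial M$; and, on some tubular neighbourhood $T\cong\partial M\times[0,\varepsilon)$, a bundle isomorphism $E|_T\cong E_\partial\boxtimes\Lambda^\bullet T^*[0,\varepsilon)$ which is an isomorphism of sheaves of $L_\infty$ algebras $\mathscr E[-1]|_T\cong\mathscr E_\partial[-1]\,\widehat\otimes\,\Omega^\bullet_{[0,\varepsilon)}$ and identifies $\langle\ ,\ \rangle_{loc}$ with the tensor product of $\langle\ ,\ \rangle_{loc,\partial}$ and the wedge product. Pullback to $t=0$ gives a map $\rho\colon\mathscr E(U)\to\mathscr E_\partial(U\cap\partial M)$. *Boundary condition.* A local boundary condition is a graded subbundle $L\subset E_\partial$ whose sections are preserved by the brackets $\ell_{k,\partial}$, on which the pairing of $E_\partial$ vanishes, and which has a graded complementary subbundle $L'$ on which the pairing also vanishes. The $L$-conditioned fields are $\mathscr E_{\mathscr L}(U)=\{e\in\mathscr E(U):\rho(e)\in L\}$. A classical bulk-boundary system is a TNBFT with a local boundary condition. *Classical observables.* For $U\subset M$ open put $$\mathrm{Obs}^{cl}_{\mathscr E,\mathscr L}(U)=\Big(\prod_{k\ge 0}\underline{\mathrm{CVS}}\big(\mathscr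 E_{\mathscr L}(U)^{\widehat\otimes_\beta k},\mathbb R\big)_{S_k},\ d_{CE}\Big),$$ where $\underline{\mathrm{CVS}}$ is the inner hom of convenient vector spaces (bounded $k$-linear functionals), $S_k$ acts with Koszul signs, the subscript denotes coinvariants, and $d_{CE}$ is the Chevalley–Eilenberg differential, the derivation $F\mapsto F\circ\sum_j \ell_j/j!$ extended over all slots, with the brackets written after the degree shift as graded symmetric maps of degree $1$ on $\mathscr E_{\mathscr L}(U)$. It is a cochain complex of differentiable vector spaces (sheaves of $C^\infty$-modules with flat connection on the site of smooth manifolds; a smooth map from $X$ to the inner hom is a family of functionals that takes smooth families of fields to smooth functions), with the complete filtration $F^N=\prod_{k\ge N}$. For pairwise disjoint open $U_1,\dots,U_k$ contained in an open $V$ let $$m^V_{U_1,\dots,U_k}\colon \mathrm{Obs}^{cl}_{\mathscr E,\mathscr L}(U_1)\times\cdots\times\mathrm{Obs}^{cl}_{\mathscr E,\mathscr L}(U_k)\to\mathrm{Obs}^{cl}_{\mathscr E,\mathscr L}(V)$$ be the multilinear map that pulls functionals back along the restrictions $\mathscr E_{\mathscr L}(V)\to\mathscr E_{\mathscr L}(U_i)$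 and then multiplies them. **Theorem.** For every classical bulk-boundary system $(\mathscr E,\mathscr L)$ on $M$, the complexes $\mathrm{Obs}^{cl}_{\mathscr E,\mathscr L}(U)$ together with the structure maps $m^V_{U_1,\dots,U_k}$ form a factorization algebra on $M$ valued in complete filtered cochain complexes of differentiable vector spaces. That is: 1. They form a prefactorization algebra: the $\mathrm{Obs}^{cl}_{\mathscr E,\mathscr L}(U)$ are well defined complexes of differentiable vector spaces, complete for the filtration $F^N$, and the $m^V_{U_1,\dots,U_k}$ (for $k=0$: the unit of $\mathrm{Obs}^{cl}_{\mathscr E,\mathscr L}(V)$) are well defined multilinear cochain maps of differentiable vector spaces, compatible with the filtrations, unital, equivariant for permutations, and associative. 2. They satisfy the Weiss cosheaf condition: for every open $U\subset M$ and every family $\{U_i\}_{i\in I}$ of open subsets of $U$ such that each finite subset of $U$ lies in some $U_i$, the augmentation $$\bigoplus_{n\ge 0}\ \bigoplus_{i_0,\dots,i_n\in I}\mathrm{Obs}^{cl}_{\mathscr E,\mathscr L}(U_{i_0}\cap\cdots\cap U_{i_n})[n]\longrightarrow\mathrm{Obs}^{cl}_{\mathscr E,\mathscr L}(U)$$ from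 the Čech complex, where $\bigoplus$ is the (completed) direct sum of complete filtered differentiable vector spaces, is a quasi-isomorphism of complexes of differentiable vector spaces, and so is the induced map of quotients by $F^N$ for every $N\ge 0$. -/

import Mathlib

open scoped Manifold ContDiff BigOperators
open Set TopologicalSpace Bundle MeasureTheory

universe u

noncomputable section

namespace BulkBoundary

/-! ### Signs and indices -/

/-- The sign `(-1)^z`. -/
def sgn (z : ℤ) : ℤ := if Even z then 1 else -1

/-- The Koszul sign `ε` with `v₁ ⋯ vₙ = ε v_{σ 1} ⋯ v_{σ n}` for `vᵢ` of degree `κ i`. -/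
def koszul {n : ℕ} (σ : Equiv.Perm (Fin n)) (κ : Fin n → ℤ) : ℤ :=
  ∏ p : Fin n × Fin n,
    if p.1 < p.2 ∧ σ p.2 < σ p.1 then sgn (κ (σ p.1) * κ (σ p.2)) else 1

/-- A finite tuple read with natural number indices (`0` out of range). -/
def ext {S : Type*} [Zero S] {m : ℕ} (v : Fin m → S) (n : ℕ) : S :=
  if h : n < m then v ⟨n, h⟩ else 0

/-! ### Graded vector bundles and their sections -/

/-- A smooth real `ℤ`-graded vector bundle of finite rank, as a smooth vector bundle with a smooth
decomposition into the images of fibrewise projections `pr k`, finitely many of which are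
non-zero. -/
structure GrBundle {n : ℕ} {H : Type} [TopologicalSpace H]
    (I : ModelWithCorners ℝ (EuclideanSpace ℝ (Fin n)) H)
    (X : Type u) [TopologicalSpace X] [ChartedSpace H X] where
  rank : ℕ
  Fib : X → Type u
  [acg : ∀ x, AddCommGroup (Fib x)]
  [mod : ∀ x, Module ℝ (Fib x)]
  [top : ∀ x, TopologicalSpace (Fib x)]
  [topTotal : TopologicalSpace (TotalSpace (Fin rank → ℝ) Fib)]
  [fiberBundle : FiberBundle (Fin rank → ℝ) Fib]
  [vectorBundle : VectorBundle ℝ (Fin rank → ℝ) Fib]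
  [smoothBundle : ContMDiffVectorBundle ∞ (Fin rank → ℝ) Fib I]
  pr : ℤ → ∀ x, Fib x →ₗ[ℝ] Fib x
  pr_pr : ∀ j k x e, pr j x (pr k x e) = if j = k then pr k x e else 0
  bound : ℕ
  pr_eq_zero : ∀ k : ℤ, (bound : ℤ) < |k| → ∀ x, pr k x = 0
  pr_sum : ∀ x e, ∑ k ∈ Finset.Icc (-(bound : ℤ)) bound, pr k x e = e
  /-- The projections are smooth bundle maps. -/
  pr_smooth : ∀ (k : ℤ) (r : ℕ) (U : Opens X) (s : (Fin r → ℝ) → ∀ x, Fib x),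
    ContMDiffOn (𝓘(ℝ, Fin r → ℝ).prod I) (I.prod 𝓘(ℝ, Fin rank → ℝ)) ∞
      (fun p : (Fin r → ℝ) × X => TotalSpace.mk' (Fin rank → ℝ) p.2 (s p.1 p.2))
      (univ ×ˢ (U : Set X)) →
    ContMDiffOn (𝓘(ℝ, Fin r → ℝ).prod I) (I.prod 𝓘(ℝ, Fin rank → ℝ)) ∞
      (fun p : (Fin r → ℝ) × X => TotalSpace.mk' (Fin rank → ℝ) p.2 (pr k p.2 (s p.1 p.2)))
      (univ ×ˢ (U : Set X))

attribute [instance] GrBundle.acg GrBundle.mod GrBundle.top GrBundle.topTotal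
  GrBundle.fiberBundle GrBundle.vectorBundle GrBundle.smoothBundle

section Sections

variable {n : ℕ} {H : Type} [TopologicalSpace H]
  {I : ModelWithCorners ℝ (EuclideanSpace ℝ (Fin n)) H}
  {X : Type u} [TopologicalSpace X] [ChartedSpace H X]

/-- The set-theoretic section `s` is smooth on the set `U`. -/
def GrBundle.SmoothOn (A : GrBundle I X) (U : Set X) (s : ∀ x, A.Fib x) : Prop :=
  ContMDiffOn I (I.prod 𝓘(ℝ, Fin A.rank → ℝ)) ∞
    (fun x : X => TotalSpace.mk' (Fin A.rank → ℝ) x (s x)) U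

/-- `s` is a smooth section over `ℝ^r × U` of the pulled back bundle, that is, a smooth map from
`ℝ^r` to the space of sections over `U`. -/
def GrBundle.SmoothFam (A : GrBundle I X) (r : ℕ) (U : Set X)
    (s : (Fin r → ℝ) → ∀ x, A.Fib x) : Prop :=
  ContMDiffOn (𝓘(ℝ, Fin r → ℝ).prod I) (I.prod 𝓘(ℝ, Fin A.rank → ℝ)) ∞
    (fun p : (Fin r → ℝ) × X => TotalSpace.mk' (Fin A.rank → ℝ) p.2 (s p.1 p.2))
    (univ ×ˢ U)

/-- The section takes values in degree `k`. -/
def GrBundle.IsHomog (A : GrBundle I X) (k : ℤ) (s : ∀ x, A.Fib x) : Prop :=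
  ∀ x, A.pr k x (s x) = s x

/-- The space of smooth sections over the open set `U`. A section is represented by its extension
by zero to all of `X` (no regularity at the boundary of `U` is implied). -/
def GrBundle.Sec (A : GrBundle I X) (U : Opens X) : Submodule ℝ (∀ x, A.Fib x) where
  carrier := {s | (∀ x, x ∉ U → s x = 0) ∧ A.SmoothOn U s}
  add_mem' := by
    rintro s t ⟨hs, hs'⟩ ⟨ht, ht'⟩
    refine ⟨fun x hx => ?_, ?_⟩
    · simp [hs x hx, ht x hx]
    · exact ContMDiffOn.add_section hs' ht'
  zero_mem' := ⟨fun _ _ => rfl, (contMDiff_zeroSection ℝ A.Fib).contMDiffOn⟩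
  smul_mem' := by
    rintro c s ⟨hs, hs'⟩
    refine ⟨fun x hx => ?_, ?_⟩
    · simp [hs x hx]
    · exact ContMDiffOn.const_smul_section hs'

open Classical in
/-- Restriction of sections. -/
def GrBundle.res (A : GrBundle I X) {U V : Opens X} (h : U ≤ V) : A.Sec V →ₗ[ℝ] A.Sec U where
  toFun s := ⟨fun x => if x ∈ U then s.1 x else 0, fun x hx => by simp [hx], by
    refine (s.2.2.mono h).congr fun x hx => ?_
    have hx' : x ∈ U := hx
    simp [hx']⟩
  map_add' s t := by
    ext x
    by_cases hx : x ∈ U <;> simp [hx]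
  map_smul' c s := by
    ext x
    by_cases hx : x ∈ U <;> simp [hx]

/-- A smooth subbundle: a family of subspaces spanned locally by linearly independent smooth
sections. -/
def GrBundle.IsSubbundle (A : GrBundle I X) (L : ∀ x, Submodule ℝ (A.Fib x)) : Prop :=
  ∀ x₀ : X, ∃ (U : Opens X) (r : ℕ) (s : Fin r → A.Sec U), x₀ ∈ U ∧
    ∀ x ∈ U, LinearIndependent ℝ (fun i => (s i).1 x) ∧
      Submodule.span ℝ (range fun i => (s i).1 x) = L x

/-- The family of subspaces is graded. -/
def GrBundle.IsGradedSub (A : GrBundle I X) (L : ∀ x, Submodule ℝ (A.Fib x)) : Prop :=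
  ∀ (k : ℤ) (x : X), ∀ e ∈ L x, A.pr k x e ∈ L x

/-- A measure that is a smooth positive density: in each chart it has a smooth positive density
with respect to Lebesgue measure. -/
def IsSmoothDensity (I : ModelWithCorners ℝ (EuclideanSpace ℝ (Fin n)) H)
    [MeasurableSpace X] (μ : Measure X) : Prop :=
  ∀ x : X, ∃ g : EuclideanSpace ℝ (Fin n) → ℝ,
    ContDiffOn ℝ ∞ g (extChartAt I x).target ∧ (∀ y ∈ (extChartAt I x).target, 0 < g y) ∧
    (μ.restrict (extChartAt I x).source).map (extChartAt I x) =
      (volume.restrict (extChartAt I x).target).withDensity (fun y => ENNReal.ofReal (g y))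

/-! ### Classical field theories -/

/-- The data of a classical field theory on `X`. The brackets on `ℰ[-1]` are written on `ℰ`, after
the degree shift, where they are graded symmetric of degree `+1`. The density-valued pairing is
`pair · dens`, where `dens` is a smooth positive density. -/
structure FieldData (I : ModelWithCorners ℝ (EuclideanSpace ℝ (Fin n)) H)
    (X : Type u) [TopologicalSpace X] [ChartedSpace H X] [MeasurableSpace X] where
  bdl : GrBundle I X
  /-- The `k`-ary bracket on sections over `U`. -/
  op : ∀ (k : ℕ) (U : Opens X), MultilinearMap ℝ (fun _ : Fin k => bdl.Sec U) (bdl.Sec U)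
  /-- There is no bracket of arity zero. -/
  op_zero : ∀ U v, op 0 U v = 0
  /-- The brackets are maps of sheaves. -/
  op_res : ∀ (k : ℕ) {U V : Opens X} (h : U ≤ V) (v : Fin k → bdl.Sec V),
    bdl.res h (op k V v) = op k U (fun i => bdl.res h (v i))
  /-- The brackets are smooth (equivalently, bounded) multilinear maps of section spaces. -/
  op_smooth : ∀ (k r : ℕ) (U : Opens X) (v : Fin k → (Fin r → ℝ) → bdl.Sec U),
    (∀ i, bdl.SmoothFam r U (fun y => (v i y).1)) →
    bdl.SmoothFam r U (fun y => (op k U (fun i => v i y)).1)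
  dens : Measure X
  dens_smooth : IsSmoothDensity I dens
  pair : ∀ x, bdl.Fib x →ₗ[ℝ] bdl.Fib x →ₗ[ℝ] ℝ
  /-- The pairing is a smooth bundle map. -/
  pair_smooth : ∀ (U : Opens X) (s t : bdl.Sec U),
    ContMDiffOn I 𝓘(ℝ, ℝ) ∞ (fun x => pair x (s.1 x) (t.1 x)) U

/-- The brackets are polydifferential operators: locally on `X` there is an `N` such that in each
slot the value at `y` vanishes on sections in the `(N+1)`-st power of the ideal of `y` (powers of
one function suffice, by polarization). -/
def FieldData.IsPolyDifferential [MeasurableSpace X] (D : FieldData I X) : Prop :=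
  ∀ (k : ℕ) (x : X), ∃ (O : Opens X) (N : ℕ), x ∈ O ∧ ∀ y ∈ O,
    ∀ (f : X → ℝ), ContMDiff I 𝓘(ℝ, ℝ) ∞ f → f y = 0 →
    ∀ (v : Fin k → D.bdl.Sec ⊤) (i : Fin k),
      (∃ s : D.bdl.Sec ⊤, ∀ x, (v i).1 x = f x ^ (N + 1) • s.1 x) → (D.op k ⊤ v).1 y = 0

/-- The brackets make `ℰ[-1]` a sheaf of `L∞` algebras. -/
structure FieldData.IsLInfty [MeasurableSpace X] (D : FieldData I X) : Prop where
  degree : ∀ (k : ℕ) (U : Opens X) (κ : Fin k → ℤ) (v : Fin k → D.bdl.Sec U),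
    (∀ i, D.bdl.IsHomog (κ i) (v i).1) → D.bdl.IsHomog (∑ i, κ i + 1) (D.op k U v).1
  symm : ∀ (k : ℕ) (U : Opens X) (κ : Fin k → ℤ) (v : Fin k → D.bdl.Sec U),
    (∀ i, D.bdl.IsHomog (κ i) (v i).1) → ∀ σ : Equiv.Perm (Fin k),
      D.op k U v = koszul σ κ • D.op k U (fun i => v (σ i))
  /-- The higher Jacobi identities; the sum over `(i, m - i)`-unshuffles is written as a sum over
  all permutations divided by `i! (m - i)!`. -/
  jacobi : ∀ (m : ℕ) (U : Opens X) (κ : Fin m → ℤ) (v : Fin m → D.bdl.Sec U),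
    (∀ i, D.bdl.IsHomog (κ i) (v i).1) →
    ∑ σ : Equiv.Perm (Fin m), ∑ i ∈ Finset.Icc 1 m,
      ((koszul σ κ : ℝ) / ((i.factorial : ℝ) * ((m - i).factorial : ℝ))) •
        D.op (m - i + 1) U (Fin.cons (D.op i U (fun b => ext (fun a => v (σ a)) b))
          (fun b : Fin (m - i) => ext (fun a => v (σ a)) (i + b))) = 0

/-- The complex `(ℰ, ℓ₁)` is elliptic on `W`: in each degree `p` the operator `ℓ₁` has some
order `ord p`, and the complex of principal symbols `e ↦ ℓ₁ (f^{ord p} s) (x)`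
(with `f x = 0`, `df_x = ξ`, `s x = e`; up to the factor `(ord p)!`) is exact for `ξ ≠ 0`. -/
def FieldData.IsEllipticOn [MeasurableSpace X] (D : FieldData I X) (W : Set X) : Prop :=
  ∃ ord : ℤ → ℕ, ∀ (p : ℤ), ∀ x ∈ W, ∀ f : X → ℝ, ContMDiff I 𝓘(ℝ, ℝ) ∞ f → f x = 0 →
    ∀ s : D.bdl.Sec ⊤, D.bdl.IsHomog p s.1 →
      (∀ t : D.bdl.Sec ⊤, (∀ y, t.1 y = f y ^ (ord p + 1) • s.1 y) →
        (D.op 1 ⊤ (fun _ => t)).1 x = 0) ∧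
      (mfderiv I 𝓘(ℝ, ℝ) f x ≠ 0 →
        ∀ t : D.bdl.Sec ⊤, (∀ y, t.1 y = f y ^ ord p • s.1 y) →
          (D.op 1 ⊤ (fun _ => t)).1 x = 0 →
          ∃ s' t' : D.bdl.Sec ⊤, D.bdl.IsHomog (p - 1) s'.1 ∧
            (∀ y, t'.1 y = f y ^ ord (p - 1) • s'.1 y) ∧
            (D.op 1 ⊤ (fun _ => t')).1 x = s.1 x)

/-- The pairing is of degree `m`, graded skew-symmetric (that is, graded symmetric on `ℰ[-1]`),
non-degenerate on `W`, and the brackets are cyclic for the integrated pairing on sections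
compactly supported in `W`. -/
structure FieldData.IsCyclicOn [MeasurableSpace X] (D : FieldData I X) (m : ℤ) (W : Set X) :
    Prop where
  degree : ∀ (x : X) (i j : ℤ) (e e' : D.bdl.Fib x), i + j + m ≠ 0 →
    D.pair x (D.bdl.pr i x e) (D.bdl.pr j x e') = 0
  skew : ∀ (x : X) (i j : ℤ) (e e' : D.bdl.Fib x),
    D.pair x (D.bdl.pr i x e) (D.bdl.pr j x e') =
      -(sgn (i * j) : ℝ) * D.pair x (D.bdl.pr j x e') (D.bdl.pr i x e)
  nondeg : ∀ x ∈ W, ∀ e, (∀ e', D.pair x e e' = 0) → e = 0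
  cyclic : ∀ (k : ℕ) (κ : Fin (k + 1) → ℤ) (v : Fin (k + 1) → D.bdl.Sec ⊤),
    (∀ i, D.bdl.IsHomog (κ i) (v i).1) →
    (∀ i, ∃ K : Set X, IsCompact K ∧ K ⊆ W ∧ ∀ x, x ∉ K → (v i).1 x = 0) →
    ∀ σ : Equiv.Perm (Fin (k + 1)),
      (sgn (κ 0) : ℝ) *
          ∫ x, D.pair x ((v 0).1 x) ((D.op k ⊤ (fun i => v i.succ)).1 x) ∂D.dens =
        (koszul σ κ : ℝ) * ((sgn (κ (σ 0)) : ℝ) *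
          ∫ x, D.pair x ((v (σ 0)).1 x) ((D.op k ⊤ (fun i => v (σ i.succ))).1 x) ∂D.dens)

/-- The axioms of a perturbative classical BV theory with pairing of degree `m`, where ellipticity,
non-degeneracy and cyclicity are required on the open set `W`. -/
structure FieldData.IsClassicalBV [MeasurableSpace X] (D : FieldData I X) (m : ℤ) (W : Set X) :
    Prop where
  lInfty : D.IsLInfty
  polyDifferential : D.IsPolyDifferential
  elliptic : D.IsEllipticOn W
  cyclicPairing : D.IsCyclicOn m W

end Sections

/-! ### Theories that are topological normal to the boundary -/

/-- A collar `N × [0, ε) ≅ T` of the boundary of `M`, identifying `N` with `∂M`. -/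
structure Collar (d : ℕ) (M N : Type u) [TopologicalSpace M]
    [ChartedSpace (EuclideanHalfSpace (d + 1)) M] [TopologicalSpace N]
    [ChartedSpace (EuclideanSpace ℝ (Fin d)) N] where
  ε : ℝ
  ε_pos : 0 < ε
  toFun : N × ℝ → M
  smooth : ContMDiffOn ((𝓡 d).prod 𝓘(ℝ, ℝ)) (𝓡∂ (d + 1)) ∞ toFun (univ ×ˢ Ico 0 ε)
  isOpen_image : IsOpen (toFun '' (univ ×ˢ Ico 0 ε))
  injOn : InjOn toFun (univ ×ˢ Ico 0 ε)
  /-- The inverse is smooth (the boundary may be empty). -/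
  smooth_inv : Nonempty N → ∃ g : M → N × ℝ,
    (∀ p ∈ (univ : Set N) ×ˢ Ico 0 ε, g (toFun p) = p) ∧
    ContMDiffOn (𝓡∂ (d + 1)) ((𝓡 d).prod 𝓘(ℝ, ℝ)) ∞ g (toFun '' (univ ×ˢ Ico 0 ε))
  boundary : toFun '' (univ ×ˢ {0}) = (𝓡∂ (d + 1)).boundary M

/-- The domain `N × [0, ε)` of a collar. -/
def Collar.dom {d : ℕ} {M N : Type u} [TopologicalSpace M]
    [ChartedSpace (EuclideanHalfSpace (d + 1)) M] [TopologicalSpace N]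
    [ChartedSpace (EuclideanSpace ℝ (Fin d)) N] (c : Collar d M N) : Set (N × ℝ) :=
  univ ×ˢ Ico 0 c.ε

/-- A field theory on `M` that is topological normal to the boundary `N = ∂M`. The fibre of
`E_∂ ⊠ Λ T^*[0, ε)` at `(n, t)` is written as the space of pairs `(a, b)`, standing for
`a + b dt`. -/
structure TNBFT (d : ℕ) (M N : Type u) [TopologicalSpace M]
    [ChartedSpace (EuclideanHalfSpace (d + 1)) M] [MeasurableSpace M] [TopologicalSpace N]
    [ChartedSpace (EuclideanSpace ℝ (Fin d)) N] [MeasurableSpace N] where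
  bulk : FieldData (𝓡∂ (d + 1)) M
  bulk_isBV : bulk.IsClassicalBV (-1) ((𝓡∂ (d + 1)).interior M)
  bdry : FieldData (𝓡 d) N
  bdry_isBV : bdry.IsClassicalBV 0 univ
  collar : Collar d M N
  /-- The isomorphism `E|_T ≅ E_∂ ⊠ Λ T^*[0, ε)`. -/
  φ : ∀ p : N × ℝ, bulk.bdl.Fib (collar.toFun p) →ₗ[ℝ] bdry.bdl.Fib p.1 × bdry.bdl.Fib p.1
  φ_bijective : ∀ p ∈ collar.dom, Function.Bijective (φ p)
  φ_degree : ∀ p ∈ collar.dom, ∀ (k : ℤ) (e : bulk.bdl.Fib (collar.toFun p)),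
    φ p (bulk.bdl.pr k _ e) = (bdry.bdl.pr k _ (φ p e).1, bdry.bdl.pr (k - 1) _ (φ p e).2)
  /-- `φ` and its inverse take smooth sections to smooth sections. -/
  φ_smooth : ∀ (U : Opens M) (s : ∀ x, bulk.bdl.Fib x),
    bulk.bdl.SmoothOn (U ∩ collar.toFun '' collar.dom) s ↔
      ContMDiffOn ((𝓡 d).prod 𝓘(ℝ, ℝ)) ((𝓡 d).prod 𝓘(ℝ, Fin bdry.bdl.rank → ℝ)) ∞
          (fun p : N × ℝ => TotalSpace.mk' (Fin bdry.bdl.rank → ℝ) p.1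
            (φ p (s (collar.toFun p))).1) (collar.dom ∩ collar.toFun ⁻¹' U) ∧
        ContMDiffOn ((𝓡 d).prod 𝓘(ℝ, ℝ)) ((𝓡 d).prod 𝓘(ℝ, Fin bdry.bdl.rank → ℝ)) ∞
          (fun p : N × ℝ => TotalSpace.mk' (Fin bdry.bdl.rank → ℝ) p.1
            (φ p (s (collar.toFun p))).2) (collar.dom ∩ collar.toFun ⁻¹' U)
  /-- `φ` intertwines the brackets with those of the tensor product of `ℰ_∂[-1]` and the de Rham
  algebra of `[0, ε)`: the component without `dt`. Here `a i` is the component without `dt` of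
  `v i` on the slice `W × {t}`. -/
  bracket_fst : ∀ (k : ℕ) (U : Opens M) (v : Fin k → bulk.bdl.Sec U) (W : Opens N),
    ∀ t ∈ Ico 0 collar.ε, (∀ x ∈ W, collar.toFun (x, t) ∈ U) →
    ∀ a : Fin k → bdry.bdl.Sec W,
      (∀ i, ∀ x ∈ W, (a i).1 x = (φ (x, t) ((v i).1 (collar.toFun (x, t)))).1) →
    ∀ x ∈ W, (φ (x, t) ((bulk.op k U v).1 (collar.toFun (x, t)))).1 = (bdry.op k W a).1 x
  /-- The `dt`-component for brackets of arity other than one: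
  `∑ᵢ (-1)^{|a_{i+1}| + ⋯ + |a_k|} ℓ_∂(a₁, …, bᵢ, …, a_k) dt`. -/
  bracket_snd : ∀ (k : ℕ), k ≠ 1 → ∀ (U : Opens M) (v : Fin k → bulk.bdl.Sec U) (κ : Fin k → ℤ),
    (∀ i, bulk.bdl.IsHomog (κ i) (v i).1) → ∀ W : Opens N,
    ∀ t ∈ Ico 0 collar.ε, (∀ x ∈ W, collar.toFun (x, t) ∈ U) →
    ∀ a b : Fin k → bdry.bdl.Sec W,
      (∀ i, ∀ x ∈ W, ((a i).1 x, (b i).1 x) = φ (x, t) ((v i).1 (collar.toFun (x, t)))) →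
    ∀ x ∈ W, (φ (x, t) ((bulk.op k U v).1 (collar.toFun (x, t)))).2 =
      ∑ i, sgn (∑ j ∈ Finset.Ioi i, κ j) • (bdry.op k W (Function.update a i (b i))).1 x
  /-- The `dt`-component of `ℓ₁ (a + b dt)` is `(ℓ_{1,∂} b + (-1)^{|a|} ∂ₜ a) dt`. The derivative
  in the fibre of `E_∂` is tested with linear functionals. -/
  bracket_one_snd : ∀ (U : Opens M) (v : bulk.bdl.Sec U) (κ : ℤ), bulk.bdl.IsHomog κ v.1 →
    ∀ W : Opens N, ∀ t ∈ Ico 0 collar.ε, (∀ x ∈ W, collar.toFun (x, t) ∈ U) →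
    ∀ b : bdry.bdl.Sec W,
      (∀ x ∈ W, b.1 x = (φ (x, t) (v.1 (collar.toFun (x, t)))).2) →
    ∀ x ∈ W, ∀ l : bdry.bdl.Fib x →ₗ[ℝ] ℝ,
      HasDerivWithinAt (fun s : ℝ => l (φ (x, s) (v.1 (collar.toFun (x, s)))).1)
        (l (sgn κ • ((φ (x, t) ((bulk.op 1 U (fun _ => v)).1 (collar.toFun (x, t)))).2 -
          (bdry.op 1 W (fun _ => b)).1 x))) (Ico 0 collar.ε) t
  /-- The density of `bulk.dens` with respect to `bdry.dens × dt` on the collar. -/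
  J : N × ℝ → ℝ
  J_smooth : ContMDiffOn ((𝓡 d).prod 𝓘(ℝ, ℝ)) 𝓘(ℝ, ℝ) ∞ J collar.dom
  J_pos : ∀ p ∈ collar.dom, 0 < J p
  J_density : (((bdry.dens.prod volume).restrict collar.dom).withDensity
      (fun p => ENNReal.ofReal (J p))).map collar.toFun =
    bulk.dens.restrict (collar.toFun '' collar.dom)
  /-- `φ` identifies the pairing with the tensor product of the boundary pairing and the wedge
  product: `⟨a + b dt, a' + b' dt⟩ = (⟨a, b'⟩_∂ + (-1)^{|a'|} ⟨b, a'⟩_∂) dt`. -/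
  pair_collar : ∀ p ∈ collar.dom, ∀ (κ : ℤ) (e e' : bulk.bdl.Fib (collar.toFun p)),
    bulk.bdl.pr κ _ e' = e' →
    J p * bulk.pair _ e e' =
      bdry.pair p.1 (φ p e).1 (φ p e').2 + (sgn κ : ℝ) * bdry.pair p.1 (φ p e).2 (φ p e').1

/-- A classical bulk-boundary system: a theory that is topological normal to the boundary and a
local boundary condition `L ⊆ E_∂`. As `L → E_∂` is injective, brackets on `L` that are strictly
intertwined by the inclusion exist if and only if the brackets of `E_∂` preserve sections of `L`,
and are then unique (and form a local `L∞` algebra). -/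
structure System (d : ℕ) (M N : Type u) [TopologicalSpace M]
    [ChartedSpace (EuclideanHalfSpace (d + 1)) M] [MeasurableSpace M] [TopologicalSpace N]
    [ChartedSpace (EuclideanSpace ℝ (Fin d)) N] [MeasurableSpace N] extends TNBFT d M N where
  L : ∀ x, Submodule ℝ (bdry.bdl.Fib x)
  L_subbundle : bdry.bdl.IsSubbundle L
  L_graded : bdry.bdl.IsGradedSub L
  L_bracket : ∀ (k : ℕ) (W : Opens N) (v : Fin k → bdry.bdl.Sec W),
    (∀ i, ∀ x ∈ W, (v i).1 x ∈ L x) → ∀ x ∈ W, (bdry.op k W v).1 x ∈ L x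
  L_isotropic : ∀ x, ∀ e ∈ L x, ∀ e' ∈ L x, bdry.pair x e e' = 0
  exists_complement : ∃ L' : ∀ x, Submodule ℝ (bdry.bdl.Fib x),
    bdry.bdl.IsSubbundle L' ∧ bdry.bdl.IsGradedSub L' ∧ (∀ x, IsCompl (L x) (L' x)) ∧
      ∀ x, ∀ e ∈ L' x, ∀ e' ∈ L' x, bdry.pair x e e' = 0

namespace System

variable {d : ℕ} {M N : Type u} [TopologicalSpace M]
  [ChartedSpace (EuclideanHalfSpace (d + 1)) M] [MeasurableSpace M] [TopologicalSpace N]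
  [ChartedSpace (EuclideanSpace ℝ (Fin d)) N] [MeasurableSpace N] (B : System d M N)

theorem mem_dom_zero (x : N) : (x, (0 : ℝ)) ∈ B.collar.dom :=
  ⟨mem_univ _, le_refl _, B.collar.ε_pos⟩

theorem continuous_boundary : Continuous (fun x : N => B.collar.toFun (x, 0)) :=
  B.collar.smooth.continuousOn.comp_continuous (by fun_prop) fun x => B.mem_dom_zero x

/-- The part of the boundary `N = ∂M` that lies in `U`. -/
def bdryOpens (U : Opens M) : Opens N :=
  ⟨{x | B.collar.toFun (x, 0) ∈ U}, U.isOpen.preimage B.continuous_boundary⟩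

open Classical in
/-- The canonical submersion `ρ` on a section: restriction to the collar, `φ`, and pullback to
`t = 0`. -/
def rho {U : Opens M} (e : B.bulk.bdl.Sec U) : B.bdry.bdl.Sec (B.bdryOpens U) :=
  ⟨fun x => if x ∈ B.bdryOpens U then (B.φ (x, 0) (e.1 (B.collar.toFun (x, 0)))).1 else 0,
    fun x hx => by simp [hx], by
    have h1 := ((B.φ_smooth U e.1).1 (e.2.2.mono inter_subset_left)).1
    have h2 : ContMDiffOn (𝓡 d) ((𝓡 d).prod 𝓘(ℝ, ℝ)) ∞ (fun x : N => (x, (0 : ℝ)))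
        (B.bdryOpens U : Set N) := (contMDiff_id.prodMk contMDiff_const).contMDiffOn
    have h3 := h1.comp h2 (fun x hx => ⟨B.mem_dom_zero x, hx⟩)
    refine h3.congr fun x hx => ?_
    have hx' : x ∈ B.bdryOpens U := hx
    simp [hx']⟩

theorem rho_apply {U : Opens M} (e : B.bulk.bdl.Sec U) {x : N} (hx : B.collar.toFun (x, 0) ∈ U) :
    (B.rho e).1 x = (B.φ (x, 0) (e.1 (B.collar.toFun (x, 0)))).1 := by
  have hx' : x ∈ B.bdryOpens U := hx
  simp [rho, hx']

/-- The `L`-conditioned fields over `U`: the sections `e` of `E` over `U` with `ρ(e)` in `L`. -/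
def fields (U : Opens M) : Submodule ℝ (B.bulk.bdl.Sec U) where
  carrier := {e | ∀ x ∈ B.bdryOpens U, (B.rho e).1 x ∈ B.L x}
  add_mem' := by
    intro e e' he he' x hx
    have h1 := he x hx
    have h2 := he' x hx
    rw [rho_apply B _ hx] at h1 h2 ⊢
    simpa using (B.L x).add_mem h1 h2
  zero_mem' := by
    intro x hx
    rw [rho_apply B _ hx]
    simp
  smul_mem' := by
    intro c e he x hx
    have h1 := he x hx
    rw [rho_apply B _ hx] at h1 ⊢
    simpa using (B.L x).smul_mem c h1

/-- Restriction of `L`-conditioned fields. -/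
def fieldsRes {U V : Opens M} (h : U ≤ V) (e : B.fields V) : B.fields U :=
  ⟨B.bulk.bdl.res h e.1, by
    intro x hx
    have hx' : B.collar.toFun (x, 0) ∈ U := hx
    have h1 := e.2 x (h hx')
    rw [rho_apply B _ (h hx')] at h1
    rw [rho_apply B _ hx']
    simpa [GrBundle.res, hx'] using h1⟩

/-- The brackets of `E` preserve the `L`-conditioned fields. -/
theorem op_mem_fields (k : ℕ) (U : Opens M) (v : Fin k → B.fields U) :
    B.bulk.op k U (fun i => (v i).1) ∈ B.fields U := by
  intro x hx
  rw [rho_apply B _ hx, B.bracket_fst k U (fun i => (v i).1) (B.bdryOpens U) 0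
    ⟨le_refl _, B.collar.ε_pos⟩ (fun _ h => h) (fun i => B.rho (v i).1)
    (fun i y hy => rho_apply B _ hy) x hx]
  exact B.L_bracket k _ _ (fun i y hy => (v i).2 y hy) x hx

/-- The brackets on the `L`-conditioned fields. -/
def ell (k : ℕ) (U : Opens M) (v : Fin k → B.fields U) : B.fields U :=
  ⟨B.bulk.op k U (fun i => (v i).1), B.op_mem_fields k U v⟩

end System

/-! ### Differentiable vector spaces

Sheaves on the site of smooth manifolds are the same as sheaves on its dense subsite of the spaces
`ℝ^r`, so that a differentiable vector space `V` is given by the `C^∞(ℝ^r)`-modules `C^∞(ℝ^r, V)`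
with their pullbacks and their flat connections. -/

/-- The algebra `C^∞(ℝ^r)`. -/
def SmoothFn (r : ℕ) : Subalgebra ℝ ((Fin r → ℝ) → ℝ) where
  carrier := {f | ContDiff ℝ ∞ f}
  mul_mem' := by
    intro f g (hf : ContDiff ℝ ∞ f) (hg : ContDiff ℝ ∞ g)
    exact hf.mul hg
  add_mem' := by
    intro f g (hf : ContDiff ℝ ∞ f) (hg : ContDiff ℝ ∞ g)
    exact hf.add hg
  algebraMap_mem' := by
    intro c
    exact (contDiff_const : ContDiff ℝ ∞ fun _ : Fin r → ℝ => c)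

/-- Smooth maps `ℝ^s → ℝ^r`. -/
def SmoothMap (s r : ℕ) : Type := {g : (Fin s → ℝ) → (Fin r → ℝ) // ContDiff ℝ ∞ g}

/-- The identity map. -/
def SmoothMap.id (r : ℕ) : SmoothMap r r := ⟨_root_.id, contDiff_id⟩

/-- Composition of smooth maps. -/
def SmoothMap.comp {q r s : ℕ} (g : SmoothMap s r) (h : SmoothMap q s) : SmoothMap q r :=
  ⟨g.1 ∘ h.1, g.2.comp h.2⟩

/-- Open embeddings `ℝ^r → ℝ^r`. -/
def SmoothMap.IsOpenEmb {r : ℕ} (g : SmoothMap r r) : Prop :=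
  Function.Injective g.1 ∧ ∀ x, Function.Bijective (fderiv ℝ g.1 x)

/-- Pullback of functions. -/
def SmoothFn.pull {s r : ℕ} (g : SmoothMap s r) (f : SmoothFn r) : SmoothFn s :=
  ⟨f.1 ∘ g.1, by
    have hf : ContDiff ℝ ∞ f.1 := f.2
    exact hf.comp g.2⟩

/-- The `i`-th partial derivative of a function. -/
def SmoothFn.pd {r : ℕ} (i : Fin r) (f : SmoothFn r) : SmoothFn r :=
  ⟨fun x => fderiv ℝ f.1 x (Pi.single i 1), by
    have hf : ContDiff ℝ ∞ f.1 := f.2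
    have h : ContDiff ℝ ∞ (fderiv ℝ f.1) := hf.fderiv_right (by norm_cast)
    exact h.clm_apply contDiff_const⟩

/-- The `i`-th coordinate of a smooth map. -/
def SmoothMap.coord {s r : ℕ} (g : SmoothMap s r) (i : Fin r) : SmoothFn s :=
  ⟨fun x => g.1 x i, contDiff_pi.1 g.2 i⟩

/-- A cochain complex of differentiable vector spaces with a complete decreasing filtration.
`carrier r` is the direct sum over all degrees of the spaces of smooth maps from `ℝ^r`, and `hom r p`
is its part of degree `p`. -/
structure DiffComplex where
  carrier : ℕ → Type u
  [acg : ∀ r, AddCommGroup (carrier r)]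
  [mod : ∀ r, Module (SmoothFn r) (carrier r)]
  hom : ∀ r, ℤ → Submodule (SmoothFn r) (carrier r)
  hom_internal : ∀ r, DirectSum.IsInternal (hom r)
  /-- Pullback along smooth maps. -/
  pull : ∀ {s r : ℕ}, SmoothMap s r → carrier r →+ carrier s
  pull_id : ∀ {r : ℕ} (a : carrier r), pull (SmoothMap.id r) a = a
  pull_comp : ∀ {q r s : ℕ} (g : SmoothMap s r) (h : SmoothMap q s) (a : carrier r),
    pull (g.comp h) a = pull h (pull g a)
  pull_smul : ∀ {s r : ℕ} (g : SmoothMap s r) (f : SmoothFn r) (a : carrier r),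
    pull g (f • a) = SmoothFn.pull g f • pull g a
  pull_hom : ∀ {s r : ℕ} (g : SmoothMap s r) (p : ℤ), ∀ a ∈ hom r p, pull g a ∈ hom s p
  /-- The sheaf property: locality. -/
  separated : ∀ (r : ℕ) (p : ℤ), ∀ a ∈ hom r p,
    (∀ x, ∃ g : SmoothMap r r, g.IsOpenEmb ∧ x ∈ range g.1 ∧ pull g a = 0) → a = 0
  /-- The sheaf property: gluing. -/
  glue : ∀ (r : ℕ) (p : ℤ) (T : Type) (g : T → SmoothMap r r) (a : T → carrier r),
    (∀ i, (g i).IsOpenEmb) → (∀ x, ∃ i, x ∈ range (g i).1) → (∀ i, a i ∈ hom r p) →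
    (∀ (i j : T) (s : ℕ) (h h' : SmoothMap s r), (g i).comp h = (g j).comp h' →
      pull h (a i) = pull h' (a j)) →
    ∃ b ∈ hom r p, ∀ i, pull (g i) b = a i
  /-- The flat connection, in the coordinate directions. -/
  pd : ∀ {r : ℕ}, Fin r → carrier r →+ carrier r
  pd_smul : ∀ {r : ℕ} (i : Fin r) (f : SmoothFn r) (a : carrier r),
    pd i (f • a) = SmoothFn.pd i f • a + f • pd i a
  pd_comm : ∀ {r : ℕ} (i j : Fin r) (a : carrier r), pd i (pd j a) = pd j (pd i a)
  pd_pull : ∀ {s r : ℕ} (g : SmoothMap s r) (j : Fin s) (a : carrier r),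
    pd j (pull g a) = ∑ i, SmoothFn.pd j (g.coord i) • pull g (pd i a)
  pd_hom : ∀ {r : ℕ} (i : Fin r) (p : ℤ), ∀ a ∈ hom r p, pd i a ∈ hom r p
  /-- The differential of the complex. -/
  d : ∀ {r : ℕ}, carrier r →ₗ[SmoothFn r] carrier r
  d_hom : ∀ {r : ℕ} (p : ℤ), ∀ a ∈ hom r p, d a ∈ hom r (p + 1)
  d_d : ∀ {r : ℕ} (a : carrier r), d (d a) = 0
  d_pull : ∀ {s r : ℕ} (g : SmoothMap s r) (a : carrier r), d (pull g a) = pull g (d a)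
  d_pd : ∀ {r : ℕ} (i : Fin r) (a : carrier r), d (pd i a) = pd i (d a)
  /-- The filtration by subcomplexes of differentiable vector spaces. -/
  fil : ∀ r, ℕ → Submodule (SmoothFn r) (carrier r)
  fil_zero : ∀ r, fil r 0 = ⊤
  fil_anti : ∀ r, Antitone (fil r)
  fil_graded : ∀ r n, fil r n = ⨆ p, fil r n ⊓ hom r p
  fil_pull : ∀ {s r : ℕ} (g : SmoothMap s r) (n : ℕ), ∀ a ∈ fil r n, pull g a ∈ fil s n
  fil_local : ∀ (r n : ℕ) (a : carrier r),
    (∀ x, ∃ g : SmoothMap r r, g.IsOpenEmb ∧ x ∈ range g.1 ∧ pull g a ∈ fil r n) → a ∈ fil r n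
  fil_pd : ∀ {r : ℕ} (i : Fin r) (n : ℕ), ∀ a ∈ fil r n, pd i a ∈ fil r n
  fil_d : ∀ (r n : ℕ), ∀ a ∈ fil r n, d a ∈ fil r n
  fil_complete : ∀ (r : ℕ) (p : ℤ) (a : ℕ → carrier r), (∀ n, a n ∈ hom r p) →
    (∀ n, a (n + 1) - a n ∈ fil r n) → ∃! b, b ∈ hom r p ∧ ∀ n, b - a n ∈ fil r n

attribute [instance] DiffComplex.acg DiffComplex.mod

/-- `F^n` for `n : ℕ`, and `⋂ F^n = 0` for `n = ∞`. -/
def DiffComplex.filE (D : DiffComplex.{u}) (r : ℕ) (n : ℕ∞) : Submodule (SmoothFn r) (D.carrier r) :=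
  ⨅ (k : ℕ) (_ : (k : ℕ∞) ≤ n), D.fil r k

/-- `s` is the sum of the family `f`, which modulo each `F^n` is locally a finite sum. -/
def DiffComplex.HasLocSum (D : DiffComplex.{u}) {r : ℕ} {T : Type u} (f : T → D.carrier r)
    (s : D.carrier r) : Prop :=
  ∀ (n : ℕ) (x : Fin r → ℝ), ∃ g : SmoothMap r r, g.IsOpenEmb ∧ x ∈ range g.1 ∧
    ∃ S₀ : Finset T, ∀ S : Finset T, S₀ ⊆ S → D.pull g (s - ∑ t ∈ S, f t) ∈ D.fil r n

/-! ### Factorization algebras -/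

/-- A prefactorization algebra on `M` valued in complete filtered cochain complexes of
differentiable vector spaces. -/
structure PrefactorizationAlgebra (M : Type u) [TopologicalSpace M] where
  obj : Opens M → DiffComplex.{u}
  /-- The structure maps (for `k = 0` they give the unit), as multilinear maps of differentiable
  vector spaces. -/
  mul : ∀ {k : ℕ} (U : Fin k → Opens M) (V : Opens M),
    Pairwise (fun i j => Disjoint (U i) (U j)) → (∀ i, U i ≤ V) → ∀ r : ℕ,
    MultilinearMap (SmoothFn r) (fun i => (obj (U i)).carrier r) ((obj V).carrier r)
  mul_hom : ∀ {k : ℕ} (U : Fin k → Opens M) (V : Opens M) (hd) (hV) (r : ℕ) (p : Fin k → ℤ)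
    (a : ∀ i, (obj (U i)).carrier r), (∀ i, a i ∈ (obj (U i)).hom r (p i)) →
    mul U V hd hV r a ∈ (obj V).hom r (∑ i, p i)
  mul_fil : ∀ {k : ℕ} (U : Fin k → Opens M) (V : Opens M) (hd) (hV) (r : ℕ) (n : Fin k → ℕ)
    (a : ∀ i, (obj (U i)).carrier r), (∀ i, a i ∈ (obj (U i)).fil r (n i)) →
    mul U V hd hV r a ∈ (obj V).fil r (∑ i, n i)
  mul_pull : ∀ {k : ℕ} (U : Fin k → Opens M) (V : Opens M) (hd) (hV) {s r : ℕ}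
    (g : SmoothMap s r) (a : ∀ i, (obj (U i)).carrier r),
    (obj V).pull g (mul U V hd hV r a) = mul U V hd hV s (fun i => (obj (U i)).pull g (a i))
  mul_pd : ∀ {k : ℕ} (U : Fin k → Opens M) (V : Opens M) (hd) (hV) (r : ℕ) (j : Fin r)
    (a : ∀ i, (obj (U i)).carrier r),
    (obj V).pd j (mul U V hd hV r a) =
      ∑ i, mul U V hd hV r (Function.update a i ((obj (U i)).pd j (a i)))
  /-- The structure maps are cochain maps. -/
  mul_d : ∀ {k : ℕ} (U : Fin k → Opens M) (V : Opens M) (hd) (hV) (r : ℕ) (p : Fin k → ℤ)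
    (a : ∀ i, (obj (U i)).carrier r), (∀ i, a i ∈ (obj (U i)).hom r (p i)) →
    (obj V).d (mul U V hd hV r a) =
      ∑ i, sgn (∑ j ∈ Finset.Iio i, p j) •
        mul U V hd hV r (Function.update a i ((obj (U i)).d (a i)))
  mul_one : ∀ (U : Opens M) (hd) (hV) (r : ℕ) (a : (obj U).carrier r),
    mul (fun _ : Fin 1 => U) U hd hV r (fun _ => a) = a
  mul_symm : ∀ {k : ℕ} (U : Fin k → Opens M) (V : Opens M) (hd) (hV) (r : ℕ) (p : Fin k → ℤ)
    (a : ∀ i, (obj (U i)).carrier r), (∀ i, a i ∈ (obj (U i)).hom r (p i)) →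
    ∀ (σ : Equiv.Perm (Fin k)) (hd') (hV'),
    mul U V hd hV r a =
      koszul σ p • mul (fun i => U (σ i)) V hd' hV' r (fun i => a (σ i))
  mul_assoc : ∀ {k : ℕ} (n : Fin k → ℕ) (W : ∀ i, Fin (n i) → Opens M) (U : Fin k → Opens M)
    (V : Opens M) (hW : ∀ i, Pairwise fun j l => Disjoint (W i j) (W i l))
    (hWU : ∀ i j, W i j ≤ U i) (hU) (hUV) (hd) (hV) (r : ℕ)
    (a : ∀ i (j : Fin (n i)), (obj (W i j)).carrier r),
    mul U V hU hUV r (fun i => mul (W i) (U i) (hW i) (hWU i) r (a i)) =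
      mul (fun x : Fin (∑ i, n i) => W (finSigmaFinEquiv.symm x).1 (finSigmaFinEquiv.symm x).2)
        V hd hV r (fun x => a (finSigmaFinEquiv.symm x).1 (finSigmaFinEquiv.symm x).2)

/-- A Weiss cover of `U`: each finite subset of `U` lies in a member of the cover. -/
def IsWeissCover {M : Type u} [TopologicalSpace M] (U : Opens M) {T : Type u}
    (𝓤 : T → Opens M) : Prop :=
  (∀ i, 𝓤 i ≤ U) ∧ ∀ S : Finset M, (S : Set M) ⊆ U → ∃ i, (S : Set M) ⊆ 𝓤 i

/-- The intersection `U_{i₀} ∩ ⋯ ∩ U_{iₙ}`. -/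
def inter {M : Type u} [TopologicalSpace M] {T : Type u} (𝓤 : T → Opens M) {n : ℕ}
    (α : Fin (n + 1) → T) : Opens M :=
  Finset.univ.inf fun j => 𝓤 (α j)

theorem inter_insertNth_le {M : Type u} [TopologicalSpace M] {T : Type u} (𝓤 : T → Opens M)
    {n : ℕ} (j : Fin (n + 2)) (i : T) (α : Fin (n + 1) → T) :
    inter 𝓤 (Fin.insertNth j i α : Fin (n + 2) → T) ≤ inter 𝓤 α := by
  refine Finset.le_inf fun k _ => ?_
  have h := Finset.inf_le (f := fun l => 𝓤 ((Fin.insertNth j i α : Fin (n + 2) → T) l))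
    (Finset.mem_univ (j.succAbove k))
  simpa [inter] using h

theorem inter_le {M : Type u} [TopologicalSpace M] {T : Type u} {U : Opens M} {𝓤 : T → Opens M}
    (h : IsWeissCover U 𝓤) {n : ℕ} (α : Fin (n + 1) → T) : inter 𝓤 α ≤ U :=
  (Finset.inf_le (Finset.mem_univ 0)).trans (h.1 _)

namespace PrefactorizationAlgebra

variable {M : Type u} [TopologicalSpace M] (𝓕 : PrefactorizationAlgebra M)

/-- The unary structure map of an inclusion of open sets. -/
def incl {U V : Opens M} (h : U ≤ V) (r : ℕ) (a : (𝓕.obj U).carrier r) : (𝓕.obj V).carrier r :=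
  𝓕.mul (fun _ : Fin 1 => U) V (fun i j hij => absurd (Subsingleton.elim i j) hij) (fun _ => h) r
    (fun _ => a)

/-- Families of elements of all `𝓕(U_{i₀} ∩ ⋯ ∩ U_{iₙ})`, parametrized by `ℝ^r`. -/
abbrev CechFamily {T : Type u} (𝓤 : T → Opens M) (r : ℕ) : Type u :=
  ∀ (n : ℕ) (α : Fin (n + 1) → T), (𝓕.obj (inter 𝓤 α)).carrier r

variable {𝓕}

/-- The family is an element of degree `q` of the Čech complex
`⨁ₙ ⨁_{i₀, …, iₙ} 𝓕(U_{i₀} ∩ ⋯ ∩ U_{iₙ})[n]`, where `⨁` is the direct sum of complete filtered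
differentiable vector spaces: modulo each `F^N`, locally only finitely many members are non-zero. -/
def IsCechChain {T : Type u} {𝓤 : T → Opens M} {r : ℕ} (q : ℤ) (c : 𝓕.CechFamily 𝓤 r) : Prop :=
  (∀ (n : ℕ) (α : Fin (n + 1) → T), c n α ∈ (𝓕.obj (inter 𝓤 α)).hom r (q + n)) ∧
  ∀ (N : ℕ) (x : Fin r → ℝ), ∃ g : SmoothMap r r, g.IsOpenEmb ∧ x ∈ range g.1 ∧
    {t : Σ n : ℕ, (Fin (n + 1) → T) |
      (𝓕.obj (inter 𝓤 t.2)).pull g (c t.1 t.2) ∉ (𝓕.obj (inter 𝓤 t.2)).fil r N}.Finite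

/-- `c'` is the total differential `∑ⱼ (-1)^j ∂ⱼ + (-1)^n d` of `c`, where `∂ⱼ` omits the `j`-th
index. -/
def IsCechDiff {T : Type u} {𝓤 : T → Opens M} {r : ℕ} (c c' : 𝓕.CechFamily 𝓤 r) : Prop :=
  ∀ (n : ℕ) (α : Fin (n + 1) → T), (𝓕.obj (inter 𝓤 α)).HasLocSum
    (fun t : ULift.{u} (Fin (n + 2)) × T => sgn (t.1.down : ℕ) •
      𝓕.incl (inter_insertNth_le 𝓤 t.1.down t.2 α) r (c (n + 1) (Fin.insertNth t.1.down t.2 α)))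
    (c' n α - sgn (n : ℤ) • (𝓕.obj (inter 𝓤 α)).d (c n α))

/-- `s` is the image of `c` under the augmentation of the Čech complex to `𝓕(U)`. -/
def IsCechAug {U : Opens M} {T : Type u} {𝓤 : T → Opens M} (h : IsWeissCover U 𝓤) {r : ℕ}
    (c : 𝓕.CechFamily 𝓤 r) (s : (𝓕.obj U).carrier r) : Prop :=
  (𝓕.obj U).HasLocSum (fun i : T => 𝓕.incl (inter_le h fun _ : Fin 1 => i) r (c 0 fun _ => i)) s

variable (𝓕)

/-- The Weiss cosheaf condition: for each Weiss cover, the map from the Čech complex to `𝓕(U)` is a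
quasi-isomorphism of complexes of differentiable vector spaces (that is, of sheaves), and so is the
induced map of quotients by `F^N` for all `N` (`N = ∞` is the map itself). -/
def IsFactorizationAlgebra : Prop :=
  ∀ (U : Opens M) (T : Type u) (𝓤 : T → Opens M) (h : IsWeissCover U 𝓤) (N : ℕ∞) (r : ℕ) (q : ℤ),
    -- injectivity on the cohomology sheaves
    (∀ (c c' : 𝓕.CechFamily 𝓤 r) (s b : (𝓕.obj U).carrier r),
      IsCechChain q c → IsCechDiff c c' → (∀ n α, c' n α ∈ (𝓕.obj (inter 𝓤 α)).filE r N) →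
      IsCechAug h c s → b ∈ (𝓕.obj U).hom r (q - 1) →
      s - (𝓕.obj U).d b ∈ (𝓕.obj U).filE r N →
      ∀ x, ∃ g : SmoothMap r r, g.IsOpenEmb ∧ x ∈ range g.1 ∧
        ∃ e e' : 𝓕.CechFamily 𝓤 r, IsCechChain (q - 1) e ∧ IsCechDiff e e' ∧
          ∀ n α, (𝓕.obj (inter 𝓤 α)).pull g (c n α) - e' n α ∈ (𝓕.obj (inter 𝓤 α)).filE r N) ∧
    -- surjectivity on the cohomology sheaves
    (∀ b ∈ (𝓕.obj U).hom r q, (𝓕.obj U).d b ∈ (𝓕.obj U).filE r N →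
      ∀ x, ∃ g : SmoothMap r r, g.IsOpenEmb ∧ x ∈ range g.1 ∧
        ∃ (c c' : 𝓕.CechFamily 𝓤 r) (s e : (𝓕.obj U).carrier r),
          IsCechChain q c ∧ IsCechDiff c c' ∧
          (∀ n α, c' n α ∈ (𝓕.obj (inter 𝓤 α)).filE r N) ∧ IsCechAug h c s ∧
          e ∈ (𝓕.obj U).hom r (q - 1) ∧
          (𝓕.obj U).pull g b - s - (𝓕.obj U).d e ∈ (𝓕.obj U).filE r N)

end PrefactorizationAlgebra

/-! ### Classical observables -/

namespace System

variable {d : ℕ} {M N : Type u} [TopologicalSpace M]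
  [ChartedSpace (EuclideanHalfSpace (d + 1)) M] [MeasurableSpace M] [TopologicalSpace N]
  [ChartedSpace (EuclideanSpace ℝ (Fin d)) N] [MeasurableSpace N] (B : System d M N)

/-- The field has degree `k`. -/
def HomogField {U : Opens M} (k : ℤ) (e : B.fields U) : Prop := B.bulk.bdl.IsHomog k e.1.1

/-- `m`-linear functionals on the `L`-conditioned fields, depending on a parameter in `ℝ^r`. -/
abbrev Fam (U : Opens M) (r m : ℕ) : Type u :=
  (Fin r → ℝ) → MultilinearMap ℝ (fun _ : Fin m => B.fields U) ℝ

/-- The smooth maps from `ℝ^r` to the inner hom from the `m`-fold completed tensor power of the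
`L`-conditioned fields to `ℝ`: the families of `m`-linear functionals that take smooth families of
fields to smooth functions. (For `r = 0` these are the bounded `m`-linear functionals.) -/
def SmoothFunctional (U : Opens M) (r m : ℕ) : Submodule ℝ (B.Fam U r m) where
  carrier := {F | ∀ (s : ℕ) (v : Fin m → (Fin s → ℝ) → B.fields U),
    (∀ i, B.bulk.bdl.SmoothFam s U (fun y => (v i y).1.1)) →
    ContDiff ℝ ∞ fun z : (Fin r → ℝ) × (Fin s → ℝ) => F z.1 (fun i => v i z.2)}
  add_mem' := fun hF hG s v hv => (hF s v hv).add (hG s v hv)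
  zero_mem' := fun _ _ _ => contDiff_const
  smul_mem' := fun _ _ hF s v hv => contDiff_const.mul (hF s v hv)

/-- The relations defining the coinvariants of the symmetric group on `m` letters, which acts with
Koszul signs: the span of all `σ · F - F`. -/
def coinvRel (U : Opens M) (r m : ℕ) : Submodule ℝ (B.Fam U r m) :=
  Submodule.span ℝ {R | ∃ F ∈ B.SmoothFunctional U r m, ∃ G ∈ B.SmoothFunctional U r m,
    ∃ σ : Equiv.Perm (Fin m),
      (∀ x (κ : Fin m → ℤ) (v : Fin m → B.fields U), (∀ i, B.HomogField (κ i) (v i)) →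
        G x v = (koszul σ κ : ℝ) * F x (fun i => v (σ i))) ∧
      R = G - F}

/-- Power series of functionals that are homogeneous of degree `p`: on fields of degrees `κ i` they
vanish unless `∑ κ i = -p`. Here `F m` is the component of arity `m`, before passing to
coinvariants. -/
def Series (U : Opens M) (r : ℕ) (p : ℤ) : Submodule ℝ (∀ m, B.Fam U r m) where
  carrier := {F | ∀ m, F m ∈ B.SmoothFunctional U r m ∧
    ∀ x (κ : Fin m → ℤ) (v : Fin m → B.fields U), (∀ i, B.HomogField (κ i) (v i)) →
      ∑ i, κ i + p ≠ 0 → F m x v = 0}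
  add_mem' := fun hF hG m => ⟨(B.SmoothFunctional U r m).add_mem (hF m).1 (hG m).1,
    fun x κ v hv hp => by simp [(hF m).2 x κ v hv hp, (hG m).2 x κ v hv hp]⟩
  zero_mem' := fun m => ⟨(B.SmoothFunctional U r m).zero_mem, fun _ _ _ _ _ => rfl⟩
  smul_mem' := fun c F hF m => ⟨(B.SmoothFunctional U r m).smul_mem c (hF m).1,
    fun x κ v hv hp => by simp [(hF m).2 x κ v hv hp]⟩

/-- The Chevalley–Eilenberg differential of `F`, in arity `m` on fields `v i` of degrees `κ i`: the
derivation dual to the brackets, which inserts `ℓⱼ / j!` into each slot. -/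
def dCE {U : Opens M} {r : ℕ} (F : ∀ m, B.Fam U r m) (m : ℕ) (x : Fin r → ℝ) (κ : Fin m → ℤ)
    (v : Fin m → B.fields U) : ℝ :=
  ∑ q ∈ Finset.HasAntidiagonal.antidiagonal (m + 1), ∑ i ∈ Finset.range q.1,
    ((q.2.factorial : ℝ)⁻¹ * (sgn (∑ a : Fin m, if (a : ℕ) < i then κ a else 0) : ℝ)) *
      F q.1 x (fun a : Fin q.1 =>
        if (a : ℕ) < i then ext v a
        else if (a : ℕ) = i then B.ell q.2 U (fun b => ext v (i + b))
        else ext v (a + q.2 - 1))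

/-- The prefactorization algebra `𝓕` is that of the classical observables: `𝓕(U)` in degree `p` is
`∏ₘ Hom(ℰ_L(U)^{⊗ m}, ℝ)_{S_m}`, with `cls` the class of a series of functionals, as a
differentiable vector space filtered by arity; its differential is the Chevalley–Eilenberg
differential, and its structure maps are restriction of fields followed by the product. -/
structure IsClassicalObservables (𝓕 : PrefactorizationAlgebra M)
    (cls : ∀ (U : Opens M) (r : ℕ) (p : ℤ), B.Series U r p →+ (𝓕.obj U).carrier r) : Prop where
  /-- Each element of degree `p` is the class of a series, -/
  range_cls : ∀ U r p, range (cls U r p) = (𝓕.obj U).hom r p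
  /-- and a series is zero if and only if its components are zero in the coinvariants. -/
  cls_eq_zero : ∀ U r p (F : B.Series U r p),
    cls U r p F = 0 ↔ ∀ m, F.1 m ∈ B.coinvRel U r m
  cls_smul : ∀ U r p (f : SmoothFn r) (F : B.Series U r p), ∃ G : B.Series U r p,
    (∀ m x, G.1 m x = f.1 x • F.1 m x) ∧ f • cls U r p F = cls U r p G
  cls_pull : ∀ U s r p (g : SmoothMap s r) (F : B.Series U r p), ∃ G : B.Series U s p,
    (∀ m x, G.1 m x = F.1 m (g.1 x)) ∧ (𝓕.obj U).pull g (cls U r p F) = cls U s p G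
  cls_pd : ∀ U r p (i : Fin r) (F : B.Series U r p), ∃ G : B.Series U r p,
    (∀ m x v, G.1 m x v = fderiv ℝ (fun y => F.1 m y v) x (Pi.single i 1)) ∧
      (𝓕.obj U).pd i (cls U r p F) = cls U r p G
  cls_fil : ∀ U r p n (F : B.Series U r p),
    cls U r p F ∈ (𝓕.obj U).fil r n ↔ ∀ m < n, F.1 m ∈ B.coinvRel U r m
  cls_d : ∀ U r p (F : B.Series U r p), ∃ G : B.Series U r (p + 1),
    (∀ m x (κ : Fin m → ℤ) (v : Fin m → B.fields U), (∀ i, B.HomogField (κ i) (v i)) →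
      G.1 m x v = B.dCE F.1 m x κ v) ∧
    (𝓕.obj U).d (cls U r p F) = cls U r (p + 1) G
  cls_mul : ∀ (k : ℕ) (U : Fin k → Opens M) (V : Opens M) (hd) (hV : ∀ i, U i ≤ V) (r : ℕ)
    (p : Fin k → ℤ) (F : ∀ i, B.Series (U i) r (p i)), ∃ G : B.Series V r (∑ i, p i),
    (∀ m x v, G.1 m x v = ∑ n ∈ Finset.Nat.antidiagonalTuple k m, ∏ i,
      (F i).1 (n i) x (fun j : Fin (n i) =>
        B.fieldsRes (hV i) (ext v (∑ l ∈ Finset.Iio i, n l + j)))) ∧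
    𝓕.mul U V hd hV r (fun i => cls (U i) r (p i) (F i)) = cls V r (∑ i, p i) G

end System

end BulkBoundary

end

/-!
Observables are modelled as functions on words of homogeneous fields that are graded symmetric,
linear in each letter, and smooth along smooth families of letters. These are invariants rather than
coinvariants, but over `ℝ` the symmetrization `sym` identifies the two: it is surjective
(`exists_sym_eq`), and its kernel in each arity is the span of all `σ · F - F` (`mem_coinv_iff`).
Under this identification the concatenation product becomes the signed shuffle product `unsh`
(`sym_star`), and insertion of the brackets into all slots becomes the sum over all ways to replace
a subword by its bracket (`LInfAlg.ce_psum`). In this form `d² = 0` is the Jacobi identity for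
nested brackets together with a pairwise cancellation for separate ones (`LInfAlg.ce_ce`), and `d`
is a derivation because it is built from a coassociative and cocommutative coproduct
(`LInfAlg.ce_mul`). This gives the prefactorization algebra `LInfPresheaf.prefact`, for each
presheaf of `L∞` algebras.

The Weiss condition rests on two facts about functionals on sections. First, a smooth family of
multilinear functionals has compact support, uniformly for parameters in a compact set
(`exists_compact_support`): otherwise counterexamples with supports leaving each compact set could
be superposed, at the parameters `2⁻ᵏ`, into smooth curves of fields through `0` along which the
functional is not continuous. Second, given a Weiss cover and a compact set `K`, there is a
partition of unity on `K` with supports so small that any `m` of them lie in a common member of the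
cover; the size is a Lebesgue number of the cover of `Kᵐ` by the `m`-th powers of the members
(`exists_cutoffs_arity`). Multiplication of the arguments by these functions decomposes an `m`-ary
functional supported in `K` into parts, each of which factors through a member of the cover
(`Cutoffs.sum_part`). Boundary conditions are not disturbed, since they are linear over functions.

The decomposition defines a contracting homotopy `h` of the augmented Čech complex
(`Cutoffs.cech_htpy`) that preserves arities but does not commute with the Chevalley–Eilenberg
differential `d`. As `h` raises the Čech level and `d` preserves it, `1 + d h` can be inverted by
recursion on the level, and `h (1 + d h)⁻¹` is a contracting homotopy for the total differential
(`Cutoffs.cech_add_dSgn_htpy_corr`). There is no bracket without arguments, so `d` does not lower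
arities; hence this homotopy preserves the filtration, and the augmentation is a quasi-isomorphism
modulo each `F^N` and also without truncation. The choices depend on a compact set of parameters;
this suffices as quasi-isomorphisms of complexes of sheaves are tested locally in the parameter.
-/

noncomputable section

set_option linter.unusedSectionVars false

namespace BulkBoundary

/-! ### Signed sums over unshuffles and permutations of words -/

/-- The sign `(-1)^z` as a real number. -/
def eps (z : ℤ) : ℝ := (sgn z : ℝ)

theorem sgn_add (a b : ℤ) : sgn (a + b) = sgn a * sgn b := by
  unfold sgn
  by_cases ha : Even a <;> by_cases hb : Even b <;> simp [Int.even_add, ha, hb]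

theorem sgn_zero : sgn 0 = 1 := by simp [sgn]

@[simp] theorem eps_zero : eps 0 = 1 := by simp [eps, sgn_zero]

theorem eps_add (a b : ℤ) : eps (a + b) = eps a * eps b := by simp [eps, sgn_add]

@[simp] theorem eps_mul_self (a : ℤ) : eps a * eps a = 1 := by
  unfold eps sgn
  split_ifs <;> norm_num

@[simp] theorem eps_neg (a : ℤ) : eps (-a) = eps a := by simp [eps, sgn]

@[simp] theorem eps_one : eps 1 = -1 := by simp [eps, sgn]

theorem eps_smul_eps_smul {Y : Type*} [AddCommGroup Y] [Module ℝ Y] (a : ℤ) (y : Y) :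
    eps a • eps a • y = y := by
  rw [smul_smul, eps_mul_self, one_smul]

theorem sgn_smul_eq {Y : Type*} [AddCommGroup Y] [Module ℝ Y] (a : ℤ) (y : Y) :
    sgn a • y = eps a • y := by
  rw [eps, Int.cast_smul_eq_zsmul]

/-- An alphabet of letters with integer degrees. -/
class Alphabet (A : Type*) where
  /-- The degree of a letter. -/
  deg : A → ℤ

open Alphabet (deg)

section Words

variable {A : Type*} [Alphabet A] {Y Z : Type*} [AddCommGroup Y] [Module ℝ Y]
  [AddCommGroup Z] [Module ℝ Z]

/-- The total degree of a word. -/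
def tdeg (l : List A) : ℤ := (l.map Alphabet.deg).sum

@[simp] theorem tdeg_nil : tdeg ([] : List A) = 0 := rfl

@[simp] theorem tdeg_cons (a : A) (l : List A) : tdeg (a :: l) = Alphabet.deg a + tdeg l := by
  simp [tdeg]

@[simp] theorem tdeg_append (l l' : List A) : tdeg (l ++ l') = tdeg l + tdeg l' := by
  simp [tdeg]

theorem tdeg_perm {l l' : List A} (h : l.Perm l') : tdeg l = tdeg l' :=
  (h.map _).sum_eq

/-- The sum of `± g S T` over all ways to distribute the letters of a word to two subwords `S` and
`T`, with the Koszul sign of the corresponding unshuffle. -/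
def unsh : List A → (List A → List A → Y) → Y
  | [], g => g [] []
  | v :: l, g => unsh l (fun S T => g (v :: S) T) +
      unsh l (fun S T => eps (Alphabet.deg v * tdeg S) • g S (v :: T))

theorem unsh_congr {l : List A} {g g' : List A → List A → Y}
    (h : ∀ S T, (S ++ T).Perm l → g S T = g' S T) : unsh l g = unsh l g' := by
  induction l generalizing g g' with
  | nil => exact h [] [] (List.Perm.refl _)
  | cons v l ih =>
    simp only [unsh]
    congr 1
    · exact ih fun S T hST => h _ _ (hST.cons v)
    · exact ih fun S T hST => by
        rw [h S (v :: T) (List.perm_middle.trans (hST.cons v))]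

theorem unsh_add (l : List A) (g g' : List A → List A → Y) :
    unsh l (fun S T => g S T + g' S T) = unsh l g + unsh l g' := by
  induction l generalizing g g' with
  | nil => rfl
  | cons v l ih =>
    simp only [unsh, smul_add, ih]
    abel

theorem map_unsh (φ : Y →ₗ[ℝ] Z) (l : List A) (g : List A → List A → Y) :
    φ (unsh l g) = unsh l (fun S T => φ (g S T)) := by
  induction l generalizing g with
  | nil => rfl
  | cons v l ih => simp only [unsh, map_add, ih, map_smul]

theorem unsh_smul (c : ℝ) (l : List A) (g : List A → List A → Y) :
    unsh l (fun S T => c • g S T) = c • unsh l g :=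
  (map_unsh (LinearMap.lsmul ℝ Y c) l g).symm

@[simp] theorem unsh_zero (l : List A) : unsh l (fun _ _ => (0 : Y)) = 0 := by
  induction l with
  | nil => rfl
  | cons v l ih => simp [unsh, ih]

theorem unsh_eq_zero {l : List A} {g : List A → List A → Y}
    (h : ∀ S T, (S ++ T).Perm l → g S T = 0) : unsh l g = 0 :=
  (unsh_congr h).trans (unsh_zero l)

theorem unsh_sum {ι : Type*} (s : Finset ι) (l : List A) (g : ι → List A → List A → Y) :
    unsh l (fun S T => ∑ i ∈ s, g i S T) = ∑ i ∈ s, unsh l (g i) := by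
  induction l generalizing g with
  | nil => rfl
  | cons v l ih => simp only [unsh, Finset.smul_sum, ih, Finset.sum_add_distrib]

/-- Coassociativity of the unshuffle coproduct. -/
theorem unsh_assoc (l : List A) (g : List A → List A → List A → Y) :
    unsh l (fun S T => unsh S (fun P Q => g P Q T)) =
      unsh l (fun P T => unsh T (fun Q R => g P Q R)) := by
  induction l generalizing g with
  | nil => rfl
  | cons v l ih =>
    have h1 := ih (fun P Q R => g (v :: P) Q R)
    have h2 := ih (fun P Q R => eps (deg v * tdeg P) • g P (v :: Q) R)
    have h3 := ih (fun P Q R => eps (deg v * tdeg P) • eps (deg v * tdeg Q) • g P Q (v :: R))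
    simp only [unsh, unsh_add, smul_add]
    rw [h1, h2, add_assoc]
    congr 1
    congr 1
    · simp only [unsh_smul]
    · simp only [← unsh_smul]
      rw [← h3]
      refine unsh_congr fun S T _ => unsh_congr fun P Q hPQ => ?_
      rw [← tdeg_perm hPQ, tdeg_append, mul_add, eps_add, smul_smul]

/-- Graded cocommutativity of the unshuffle coproduct. -/
theorem unsh_comm (l : List A) (g : List A → List A → Y) :
    unsh l g = unsh l (fun S T => eps (tdeg S * tdeg T) • g T S) := by
  induction l generalizing g with
  | nil => simp [unsh]
  | cons v l ih =>
    simp only [unsh]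
    rw [add_comm, ih, ih (fun S T => g (v :: S) T)]
    congr 1
    · congr 1
      funext S T
      rw [smul_smul, ← eps_add, tdeg_cons]
      congr 2
      ring
    · congr 1
      funext S T
      rw [smul_smul, ← eps_add, tdeg_cons, mul_add, ← add_assoc, mul_comm (tdeg S) (deg v),
        eps_add, eps_add, eps_mul_self, one_mul]

theorem unsh_left_comm (l : List A) (g : List A → List A → List A → Y) :
    unsh l (fun P T => unsh T (fun Q R => g P Q R)) =
      unsh l (fun P T => unsh T (fun Q R => eps (tdeg P * tdeg Q) • g Q P R)) := by
  rw [← unsh_assoc, ← unsh_assoc]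
  congr 1
  funext S T
  exact unsh_comm S _

/-- Graded symmetry of a function on words. -/
def GSymm (f : List A → Y) : Prop :=
  ∀ l₁ a b l₂, f (l₁ ++ a :: b :: l₂) =
    eps (Alphabet.deg a * Alphabet.deg b) • f (l₁ ++ b :: a :: l₂)

theorem GSymm.cons {f : List A → Y} (hf : GSymm f) (v : A) : GSymm fun l => f (v :: l) :=
  fun l₁ a b l₂ => hf (v :: l₁) a b l₂

theorem GSymm.move {f : List A → Y} (hf : GSymm f) (l₁ : List A) (a : A) (l₂ : List A) :
    f (l₁ ++ a :: l₂) = eps (deg a * tdeg l₁) • f (a :: l₁ ++ l₂) := by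
  induction l₁ generalizing f with
  | nil => simp
  | cons v l₁ ih =>
    have h1 := ih (hf.cons v)
    have h2 := hf [] v a (l₁ ++ l₂)
    simp only [List.cons_append, List.nil_append, tdeg_cons] at h1 h2 ⊢
    rw [h1, h2, smul_smul, ← eps_add]
    congr 2
    ring

/-- Two letters that are exchanged either go to the same subword, where the symmetry of `g` applies,
or to different subwords, where the two corresponding terms are exchanged. -/
theorem unsh_gsymm {g : List A → List A → Y} (h1 : ∀ T, GSymm fun S => g S T)
    (h2 : ∀ S, GSymm fun T => g S T) : GSymm fun l => unsh l g := by
  intro l₁ a b l₂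
  induction l₁ generalizing g with
  | nil =>
    simp only [List.nil_append, unsh, tdeg_cons, smul_add, ← unsh_smul, smul_smul]
    rw [add_assoc, add_assoc]
    refine congrArg₂ (· + ·) ?_ ?_
    · congr 1
      funext S T
      exact h1 T [] a b S
    · rw [← add_assoc, ← add_assoc, add_comm (unsh l₂ _) (unsh l₂ _)]
      refine congrArg₂ (· + ·) (congrArg₂ (· + ·) ?_ ?_) ?_
      · congr 1
        funext S T
        rw [mul_add, eps_add]
      · congr 1
        funext S T
        rw [mul_add, eps_add, mul_comm (deg b) (deg a), ← mul_assoc, eps_mul_self, one_mul]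
      · congr 1
        funext S T
        have := h2 S [] a b T
        simp only [List.nil_append] at this
        rw [this, smul_smul]
        ring_nf
  | cons v l₁ ih =>
    simp only [List.cons_append, unsh, smul_add]
    congr 1
    · exact ih (fun T => (h1 T).cons v) fun S => h2 (v :: S)
    · refine ih (fun T => ?_) (fun S => ?_)
      · intro m₁ c d m₂
        have h := h1 (v :: T) m₁ c d m₂
        simp only at h ⊢
        rw [h, smul_smul, smul_smul, mul_comm,
          tdeg_perm ((List.Perm.swap d c m₂).append_left m₁)]
      · intro m₁ c d m₂
        have h := (h2 S).cons v m₁ c d m₂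
        simp only at h ⊢
        rw [h, smul_smul, smul_smul, mul_comm]

/-- The signed sum of the values of `f` on the words obtained from `l` by inserting `v`. -/
def ins (v : A) : (List A → Y) → List A → Y
  | f, [] => f [v]
  | f, u :: l => f (v :: u :: l) + eps (Alphabet.deg u * Alphabet.deg v) •
      ins v (fun l' => f (u :: l')) l

/-- The signed sum of the values of `f` on all permutations of a word. -/
def psum : List A → (List A → Y) → Y
  | [], f => f []
  | v :: l, f => psum l (ins v f)

theorem map_ins (φ : Y →ₗ[ℝ] Z) (v : A) (f : List A → Y) (l : List A) :
    φ (ins v f l) = ins v (fun l' => φ (f l')) l := by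
  induction l generalizing f with
  | nil => rfl
  | cons u l ih => simp only [ins, map_add, map_smul, ih]

theorem map_psum (φ : Y →ₗ[ℝ] Z) (f : List A → Y) (l : List A) :
    φ (psum l f) = psum l (fun l' => φ (f l')) := by
  induction l generalizing f with
  | nil => rfl
  | cons u l ih =>
    simp only [psum, ih]
    congr 1
    funext l'
    exact map_ins φ u f l'

theorem ins_add (v : A) (f g : List A → Y) (l : List A) :
    ins v (fun l' => f l' + g l') l = ins v f l + ins v g l := by
  induction l generalizing f g with
  | nil => rfl
  | cons u l ih =>
    simp only [ins, ih, smul_add]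
    abel

theorem psum_add (f g : List A → Y) (l : List A) :
    psum l (fun l' => f l' + g l') = psum l f + psum l g := by
  induction l generalizing f g with
  | nil => rfl
  | cons u l ih =>
    simp only [psum, ← ih]
    congr 1
    funext l'
    exact ins_add u f g l'

theorem psum_smul (c : ℝ) (f : List A → Y) (l : List A) :
    psum l (fun l' => c • f l') = c • psum l f :=
  (map_psum (LinearMap.lsmul ℝ Y c) f l).symm

theorem ins_congr {v : A} {l : List A} {f g : List A → Y}
    (h : ∀ l', l'.Perm (v :: l) → f l' = g l') : ins v f l = ins v g l := by
  induction l generalizing f g with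
  | nil => exact h _ (List.Perm.refl _)
  | cons u l ih =>
    simp only [ins]
    rw [h _ (List.Perm.refl _), ih fun l' hl' => h _ ((hl'.cons u).trans (List.Perm.swap _ _ _))]

theorem psum_congr {l : List A} {f g : List A → Y} (h : ∀ l', l'.Perm l → f l' = g l') :
    psum l f = psum l g := by
  induction l generalizing f g with
  | nil => exact h _ (List.Perm.refl _)
  | cons u l ih =>
    exact ih fun l' hl' => ins_congr fun l'' hl'' => h _ (hl''.trans (hl'.cons u))

@[simp] theorem psum_zero (l : List A) : psum l (fun _ => (0 : Y)) = 0 := by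
  have := psum_smul (0 : ℝ) (fun _ : List A => (0 : Y)) l
  simpa using this

theorem psum_eq_zero {l : List A} {f : List A → Y} (h : ∀ l', l'.Perm l → f l' = 0) :
    psum l f = 0 :=
  (psum_congr h).trans (psum_zero l)

/-- The sum of `g a b` over all ways to write a word as a concatenation `a ++ b`. -/
def sp : List A → (List A → List A → Y) → Y
  | [], g => g [] []
  | v :: l, g => g [] (v :: l) + sp l (fun a b => g (v :: a) b)

theorem sp_eq_sum (l : List A) (g : List A → List A → Y) :
    sp l g = ∑ i ∈ Finset.range (l.length + 1), g (l.take i) (l.drop i) := by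
  induction l generalizing g with
  | nil => simp [sp]
  | cons v l ih => rw [sp, ih, List.length_cons, Finset.sum_range_succ' _ (l.length + 1), add_comm]; simp

theorem sp_congr {l : List A} {g g' : List A → List A → Y}
    (h : ∀ a b, a ++ b = l → g a b = g' a b) : sp l g = sp l g' := by
  rw [sp_eq_sum, sp_eq_sum]
  exact Finset.sum_congr rfl fun i _ => h _ _ (List.take_append_drop i l)

theorem sp_add (l : List A) (g g' : List A → List A → Y) :
    sp l (fun S T => g S T + g' S T) = sp l g + sp l g' := by
  simp only [sp_eq_sum, Finset.sum_add_distrib]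

theorem sp_smul (c : ℝ) (l : List A) (g : List A → List A → Y) :
    sp l (fun S T => c • g S T) = c • sp l g := by
  simp only [sp_eq_sum, Finset.smul_sum]

theorem ins_eq_sp (v : A) (f : List A → Y) (l : List A) :
    ins v f l = sp l (fun a b => eps (deg v * tdeg a) • f (a ++ v :: b)) := by
  induction l generalizing f with
  | nil => simp [ins, sp]
  | cons u l ih =>
    rw [ins, sp, ih, ← sp_smul]
    simp only [tdeg_nil, mul_zero, eps_zero, one_smul, List.nil_append, tdeg_cons, smul_smul,
      ← eps_add, List.cons_append, mul_add, mul_comm (deg u) (deg v)]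

/-- Inserting a letter is a signed derivation of concatenation. -/
theorem ins_sp (v : A) (G : List A → List A → Y) (l : List A) :
    ins v (fun l' => sp l' G) l =
      sp l (fun a b => ins v (fun a' => G a' b) a) +
        sp l (fun a b => eps (deg v * tdeg a) • ins v (fun b' => G a b') b) := by
  induction l generalizing G with
  | nil => simp [ins, sp, add_comm]
  | cons u l ih =>
    have h1 := ih (fun a b => G (u :: a) b)
    simp only [ins, sp, ins_add, h1, smul_add, sp_add, ← sp_smul, tdeg_nil, mul_zero, eps_zero,
      one_smul, tdeg_cons, mul_add, eps_add, smul_smul, mul_comm (deg u) (deg v), one_mul]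
    abel

theorem psum_ins_comm (v : A) (T : List A) (G : List A → List A → Y) (a : List A) :
    psum T (fun b => ins v (fun a' => G a' b) a) = ins v (fun a' => psum T (G a')) a := by
  induction a generalizing G with
  | nil => rfl
  | cons u a ih =>
    simp only [ins, psum_add, psum_smul, ih]

/-- The symmetrization of a concatenation is the unshuffle product of the symmetrizations. -/
theorem psum_sp (l : List A) (G : List A → List A → Y) :
    psum l (fun l' => sp l' G) = unsh l (fun S T => psum S (fun a => psum T (fun b => G a b))) := by
  induction l generalizing G with
  | nil => rfl
  | cons v l ih =>
    simp only [psum, unsh]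
    have : (ins v fun l' => sp l' G) = fun l' => sp l' (fun a b => ins v (fun a' => G a' b) a) +
        sp l' (fun a b => eps (deg v * tdeg a) • ins v (fun b' => G a b') b) := by
      funext l'
      exact ins_sp v G l'
    rw [this, psum_add, ih, ih]
    congr 1
    · congr 1
      funext S T
      congr 1
      funext a
      exact psum_ins_comm v T G a
    · congr 1
      funext S T
      rw [← psum_smul]
      refine psum_congr fun a ha => ?_
      rw [psum_smul, tdeg_perm ha]

/-- Symmetrization is graded symmetric, as the insertions of two letters commute up to the sign. -/
theorem psum_gsymm (f : List A → Y) : GSymm fun l => psum l f := by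
  have key : ∀ (a b : A) (f : List A → Y) (l : List A),
      ins a (ins b f) l = eps (deg a * deg b) • ins b (ins a f) l := by
    intro a b f l
    induction l generalizing f with
    | nil =>
      simp only [ins, smul_add, smul_smul]
      rw [mul_comm (deg b) (deg a), eps_mul_self, one_smul, add_comm]
    | cons u l ih =>
      have h := ih fun l' => f (u :: l')
      simp only [ins, ins_add, smul_add, smul_smul]
      have e1 : ins a (fun l' => eps (deg u * deg b) • ins b (fun l' => f (u :: l')) l') l =
          eps (deg u * deg b) • ins a (ins b (fun l' => f (u :: l'))) l :=
        (map_ins (LinearMap.lsmul ℝ Y (eps (deg u * deg b))) a _ l).symm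
      have e2 : ins b (fun l' => eps (deg u * deg a) • ins a (fun l' => f (u :: l')) l') l =
          eps (deg u * deg a) • ins b (ins a (fun l' => f (u :: l'))) l :=
        (map_ins (LinearMap.lsmul ℝ Y (eps (deg u * deg a))) b _ l).symm
      rw [e1, e2, h]
      simp only [smul_smul, mul_comm (deg b) (deg a), eps_mul_self, one_smul]
      have e5 : eps (deg a * deg b) * (eps (deg a * deg b) * eps (deg u * deg a)) =
          eps (deg u * deg a) := by rw [← mul_assoc, eps_mul_self, one_mul]
      have e4 : eps (deg u * deg a) * (eps (deg u * deg b) * eps (deg a * deg b)) =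
          eps (deg a * deg b) * (eps (deg u * deg b) * eps (deg u * deg a)) := by ring
      simp only [← mul_assoc] at e4 e5 ⊢
      rw [e4, e5]
      abel
  intro l₁ a b l₂
  induction l₁ generalizing f with
  | nil =>
    simp only [List.nil_append, psum, ← psum_smul]
    congr 1
    funext l
    rw [key, mul_comm]
  | cons v l₁ ih => exact ih (ins v f)

/-- Each of the `l.length!` permutations contributes the same term. -/
theorem psum_of_gsymm {f : List A → Y} (hf : GSymm f) (l : List A) :
    psum l f = (l.length.factorial : ℝ) • f l := by
  induction l generalizing f with
  | nil => simp [psum]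
  | cons v l ih =>
    have h1 : ∀ l', ins v f l' = ((l'.length : ℝ) + 1) • f (v :: l') := by
      intro l'
      rw [ins_eq_sp, sp_eq_sum]
      have : ∀ i ∈ Finset.range (l'.length + 1),
          eps (deg v * tdeg (l'.take i)) • f (l'.take i ++ v :: l'.drop i) = f (v :: l') := by
        intro i _
        rw [hf.move, eps_smul_eps_smul, List.cons_append, List.take_append_drop]
      rw [Finset.sum_congr rfl this]
      simp [← Nat.cast_smul_eq_nsmul ℝ]
    rw [psum, psum_congr (g := fun l' => ((l.length : ℝ) + 1) • f (v :: l')) fun l' hl' => by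
      rw [h1, hl'.length_eq], psum_smul, ih (hf.cons v), smul_smul, List.length_cons,
      Nat.factorial_succ]
    push_cast
    rfl

end Words

/-! ### The Koszul sign of a permutation -/

section Koszul

variable {A : Type*} [Alphabet A] {Y : Type*} [AddCommGroup Y] [Module ℝ Y]

/-- The permutation that maps `i` to `0` and restricts to `σ` on the remaining elements. -/
def permCons {n : ℕ} (i : Fin (n + 1)) (σ : Equiv.Perm (Fin n)) : Equiv.Perm (Fin (n + 1)) :=
  (finSuccEquiv' i).trans ((Equiv.optionCongr σ).trans (finSuccEquiv' 0).symm)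

@[simp] theorem permCons_self {n : ℕ} (i : Fin (n + 1)) (σ : Equiv.Perm (Fin n)) :
    permCons i σ i = 0 := by
  simp [permCons]

@[simp] theorem permCons_succAbove {n : ℕ} (i : Fin (n + 1)) (σ : Equiv.Perm (Fin n))
    (j : Fin n) : permCons i σ (i.succAbove j) = (σ j).succ := by
  simp [permCons]

theorem permCons_bijective (n : ℕ) :
    Function.Bijective fun p : Fin (n + 1) × Equiv.Perm (Fin n) => permCons p.1 p.2 := by
  rw [Fintype.bijective_iff_injective_and_card]
  constructor
  · rintro ⟨i, σ⟩ ⟨j, τ⟩ h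
    simp only at h
    have hij : i = j := by
      apply (permCons i σ).injective
      rw [permCons_self, h, permCons_self]
    subst hij
    have : σ = τ := by
      ext k
      have := congrArg (fun ρ : Equiv.Perm (Fin (n + 1)) => ρ (i.succAbove k)) h
      simp only [permCons_succAbove, Fin.succ_inj] at this
      rw [this]
    rw [this]
  · simp [Fintype.card_perm, Nat.factorial_succ]

theorem comp_permCons {n : ℕ} {X : Type*} (v : Fin (n + 1) → X) (i : Fin (n + 1))
    (σ : Equiv.Perm (Fin n)) :
    (fun j => v (permCons i σ j)) =
      (Fin.insertNth i (v 0) (fun j => v (σ j).succ) : Fin (n + 1) → X) := by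
  funext j
  induction j using Fin.succAboveCases i with
  | x => simp
  | p j => simp

/-- The sign of a permutation splits into the sign for moving the first letter to its place and the
sign of the permutation of the remaining letters. -/
theorem koszul_permCons {n : ℕ} (i : Fin (n + 1)) (σ : Equiv.Perm (Fin n))
    (κ : Fin (n + 1) → ℤ) :
    koszul (permCons i σ) κ =
      (∏ j : Fin n, if j.castSucc < i then sgn (κ 0 * κ (σ j).succ) else 1) *
        koszul σ (fun j => κ j.succ) := by
  unfold koszul
  rw [Fintype.prod_prod_type, Fintype.prod_prod_type, Fin.prod_univ_succAbove _ i]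
  have h1 : (∏ y : Fin (n + 1), if i < y ∧ permCons i σ y < permCons i σ i then
      sgn (κ (permCons i σ i) * κ (permCons i σ y)) else 1) = 1 := by
    apply Finset.prod_eq_one
    intro y _
    simp
  rw [h1, one_mul, ← Finset.prod_mul_distrib]
  refine Finset.prod_congr rfl fun j _ => ?_
  rw [Fin.prod_univ_succAbove _ i]
  congr 1
  · simp only [permCons_self, permCons_succAbove, Fin.succ_pos, and_true, mul_comm]
    congr 1
    simp [Fin.succAbove_lt_iff_castSucc_lt]
  · refine Finset.prod_congr rfl fun k _ => ?_
    simp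

theorem prod_sgn_eq {n : ℕ} (a : ℤ) (κ : Fin n → ℤ) (i : Fin (n + 1)) :
    (∏ j : Fin n, if j.castSucc < i then sgn (a * κ j) else 1) =
      sgn (a * ∑ j : Fin n, if j.castSucc < i then κ j else 0) := by
  rw [Finset.mul_sum]
  have : ∀ s : Finset (Fin n), (∏ j ∈ s, if j.castSucc < i then sgn (a * κ j) else 1) =
      sgn (∑ j ∈ s, a * if j.castSucc < i then κ j else 0) := by
    intro s
    induction s using Finset.induction_on with
    | empty => simp [sgn_zero]
    | insert b s hb ih =>
      rw [Finset.prod_insert hb, Finset.sum_insert hb, sgn_add, ih]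
      split_ifs <;> simp [sgn_zero]
  exact this _

theorem tdeg_take_ofFn {n : ℕ} (u : Fin n → A) (i : ℕ) :
    tdeg ((List.ofFn u).take i) = ∑ j : Fin n, if (j : ℕ) < i then deg (u j) else 0 := by
  induction n generalizing i with
  | zero => simp
  | succ n ih =>
    rw [List.ofFn_succ]
    cases i with
    | zero => simp
    | succ i => simp [Fin.sum_univ_succ, ih]

theorem ofFn_insertNth {X : Type*} {n : ℕ} (i : Fin (n + 1)) (a : X) (u : Fin n → X) :
    List.ofFn (Fin.insertNth i a u : Fin (n + 1) → X) =
      (List.ofFn u).take i ++ a :: (List.ofFn u).drop i := by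
  induction n with
  | zero =>
    have : i = 0 := Fin.fin_one_eq_zero i
    subst this
    simp
  | succ n ih =>
    induction i using Fin.cases with
    | zero => simp [Fin.insertNth_zero']
    | succ i =>
      have : (Fin.insertNth i.succ a u : Fin (n + 2) → X) =
          Fin.cons (u 0) (Fin.insertNth i a (fun j => u j.succ) : Fin (n + 1) → X) := by
        funext j
        induction j using Fin.succAboveCases i.succ with
        | x => simp
        | p j =>
          rw [Fin.insertNth_apply_succAbove]
          induction j using Fin.cases with
          | zero => simp
          | succ j => rw [Fin.succ_succAbove_succ, Fin.cons_succ, Fin.insertNth_apply_succAbove]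
      rw [this, List.ofFn_succ]
      simp only [Fin.cons_zero, Fin.cons_succ, ih, List.ofFn_succ (f := u), Fin.val_succ,
        List.take_succ_cons, List.drop_succ_cons, List.cons_append]

theorem ins_ofFn (a : A) {n : ℕ} (u : Fin n → A) (f : List A → Y) :
    ins a f (List.ofFn u) = ∑ i : Fin (n + 1),
      eps (deg a * ∑ j : Fin n, if j.castSucc < i then deg (u j) else 0) •
        f (List.ofFn (Fin.insertNth i a u : Fin (n + 1) → A)) := by
  rw [ins_eq_sp, sp_eq_sum, List.length_ofFn, Finset.sum_range]
  refine Finset.sum_congr rfl fun i _ => ?_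
  rw [tdeg_take_ofFn, ofFn_insertNth]
  simp only [Fin.lt_def, Fin.val_castSucc]

/-- Symmetrization by repeated insertion is the sum over all permutations with Koszul signs. -/
theorem psum_ofFn {n : ℕ} (v : Fin n → A) (f : List A → Y) :
    psum (List.ofFn v) f = ∑ σ : Equiv.Perm (Fin n),
      (koszul σ (fun i => deg (v i)) : ℝ) • f (List.ofFn fun i => v (σ i)) := by
  induction n generalizing f with
  | zero => simp [psum, koszul]
  | succ n ih =>
    rw [List.ofFn_succ, psum, ih, ← (permCons_bijective n).sum_comp, Fintype.sum_prod_type_right]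
    refine Finset.sum_congr rfl fun σ _ => ?_
    rw [ins_ofFn, Finset.smul_sum]
    refine Finset.sum_congr rfl fun i _ => ?_
    simp only
    rw [koszul_permCons, comp_permCons, prod_sgn_eq (deg (v 0)) (fun j => deg (v (σ j).succ)),
      smul_smul, Int.cast_mul, mul_comm]
    rfl

/-- Symmetry under adjacent transpositions implies symmetry under all permutations. -/
theorem GSymm.perm {f : List A → Y} (hf : GSymm f) {n : ℕ} (v : Fin n → A)
    (σ : Equiv.Perm (Fin n)) :
    f (List.ofFn v) = (koszul σ (fun i => deg (v i)) : ℝ) • f (List.ofFn fun i => v (σ i)) := by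
  induction n generalizing f with
  | zero => simp [koszul]
  | succ n ih =>
    obtain ⟨⟨i, τ⟩, rfl⟩ := (permCons_bijective n).2 σ
    simp only
    rw [koszul_permCons, comp_permCons, prod_sgn_eq (deg (v 0)) (fun j => deg (v (τ j).succ)),
      ofFn_insertNth, hf.move, tdeg_take_ofFn, List.cons_append, List.take_append_drop,
      List.ofFn_succ, ih (hf.cons (v 0)) (fun i => v i.succ) τ, Int.cast_mul, mul_comm, mul_smul]
    congr 1
    exact (eps_smul_eps_smul _ _).symm

theorem koszul_swap {n : ℕ} (κ : Fin n → ℤ) (i : ℕ) (hi : i + 1 < n) :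
    koszul (Equiv.swap (⟨i, by omega⟩ : Fin n) ⟨i + 1, hi⟩) κ =
      sgn (κ ⟨i, by omega⟩ * κ ⟨i + 1, hi⟩) := by
  unfold koszul
  rw [Finset.prod_eq_single (⟨⟨i, by omega⟩, ⟨i + 1, hi⟩⟩ : Fin n × Fin n)]
  · simp [mul_comm]
  · rintro ⟨a, b⟩ _ hab
    rw [if_neg]
    rintro ⟨h1, h2⟩
    apply hab
    simp only [Equiv.swap_apply_def, Fin.ext_iff, Fin.lt_def] at h1 h2
    simp only [Prod.mk.injEq, Fin.ext_iff]
    split_ifs at h2 <;> simp_all <;> omega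
  · simp

/-- Degrees for the alphabet of the indices of a tuple. -/
abbrev indexAlphabet {n : ℕ} (κ : Fin n → ℤ) : Alphabet (Fin n) := ⟨κ⟩

theorem koszul_one {n : ℕ} (κ : Fin n → ℤ) : koszul 1 κ = 1 := by
  unfold koszul
  refine Finset.prod_eq_one fun p _ => if_neg ?_
  simp only [Equiv.Perm.one_apply, not_and, not_lt]
  exact fun h => h.le

/-- The cocycle identity. The signed sum over all permutations of the function that detects one
given word is graded symmetric, and both sides are the sign by which it changes. -/
theorem koszul_mul {n : ℕ} (σ τ : Equiv.Perm (Fin n)) (κ : Fin n → ℤ) :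
    koszul (σ * τ) κ = koszul σ κ * koszul τ (fun i => κ (σ i)) := by
  let _ : Alphabet (Fin n) := indexAlphabet κ
  let w : List (Fin n) := List.ofFn fun i => (σ * τ) i
  have hf := psum_gsymm (Y := ℝ) (fun l : List (Fin n) => if l = w then (1 : ℝ) else 0)
  have h1 := hf.perm id (σ * τ)
  have h2 := hf.perm id σ
  have h3 := hf.perm (fun i => σ i) τ
  have h4 : psum w (fun l : List (Fin n) => if l = w then (1 : ℝ) else 0) = 1 := by
    rw [psum_ofFn, Finset.sum_eq_single 1]
    · simp [w, koszul_one]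
    · intro ρ _ hρ
      rw [if_neg, smul_zero]
      intro h
      apply hρ
      ext i
      have := congrFun (List.ofFn_injective h) i
      have := (σ * τ).injective this
      simp [this]
    · simp
  simp only [id] at h1 h2
  rw [h1, h3] at h2
  have h5 : (fun i => σ (τ i)) = fun i => (σ * τ) i := rfl
  rw [h5] at h2
  change _ • psum w _ = _ • _ • psum w _ at h2
  rw [h4] at h2
  simp only [smul_eq_mul, mul_one] at h2
  exact_mod_cast h2

end Koszul

/-! ### The shuffle algebra -/

/-- Real functions on words, with the signed shuffle product: the algebra dual to the free graded
cocommutative coalgebra. -/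
def ShuffleAlg (A : Type*) : Type _ := List A → ℝ

namespace ShuffleAlg

variable {A : Type*} [Alphabet A]

instance : AddCommGroup (ShuffleAlg A) := inferInstanceAs (AddCommGroup (List A → ℝ))
instance : Module ℝ (ShuffleAlg A) := inferInstanceAs (Module ℝ (List A → ℝ))

instance : Mul (ShuffleAlg A) := ⟨fun f g l => unsh l fun S T => f S * g T⟩
instance : One (ShuffleAlg A) := ⟨fun l => if l = [] then 1 else 0⟩

theorem mul_apply (f g : ShuffleAlg A) (l : List A) :
    (f * g) l = unsh l fun S T => f S * g T := rfl
theorem one_apply (l : List A) : (1 : ShuffleAlg A) l = if l = [] then 1 else 0 := rfl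
@[simp] theorem add_apply (f g : ShuffleAlg A) (l : List A) : (f + g) l = f l + g l := rfl
@[simp] theorem zero_apply (l : List A) : (0 : ShuffleAlg A) l = 0 := rfl
@[simp] theorem neg_apply (f : ShuffleAlg A) (l : List A) : (-f) l = -f l := rfl
@[simp] theorem sub_apply (f g : ShuffleAlg A) (l : List A) : (f - g) l = f l - g l := rfl
@[simp] theorem smul_apply (c : ℝ) (f : ShuffleAlg A) (l : List A) : (c • f) l = c * f l := rfl

protected theorem ext {f g : ShuffleAlg A} (h : ∀ l, f l = g l) : f = g := funext h

theorem unsh_one_left (l : List A) (h : List A → ℝ) :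
    unsh l (fun S T => (1 : ShuffleAlg A) S * h T) = h l := by
  induction l generalizing h with
  | nil => simp [unsh, one_apply]
  | cons v l ih =>
    rw [unsh, ← ih fun T => h (v :: T)]
    have : ∀ S T, (1 : ShuffleAlg A) (v :: S) * h T = 0 := fun S T => by simp [one_apply]
    simp only [this, unsh_zero, zero_add]
    congr 1
    funext S T
    by_cases hS : S = [] <;> simp [one_apply, hS]

protected theorem one_mul (f : ShuffleAlg A) : 1 * f = f :=
  ShuffleAlg.ext fun l => unsh_one_left l f

protected theorem mul_one (f : ShuffleAlg A) : f * 1 = f := by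
  refine ShuffleAlg.ext fun l => ?_
  rw [mul_apply, unsh_comm]
  refine Eq.trans ?_ (unsh_one_left l f)
  congr 1
  funext S T
  by_cases hS : S = [] <;> simp [one_apply, hS]

protected theorem mul_assoc (f g h : ShuffleAlg A) : f * g * h = f * (g * h) := by
  refine ShuffleAlg.ext fun l => ?_
  have h1 : ∀ S T, (f * g) S * h T = unsh S fun P Q => f P * g Q * h T := by
    intro S T
    rw [mul_apply, mul_comm, ← smul_eq_mul, ← unsh_smul]
    simp only [smul_eq_mul, mul_comm]
  have h2 : ∀ S T, f S * (g * h) T = unsh T fun P Q => f S * g P * h Q := by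
    intro S T
    rw [mul_apply, ← smul_eq_mul, ← unsh_smul]
    simp only [smul_eq_mul, mul_assoc]
  rw [mul_apply, mul_apply]
  simp only [h1, h2]
  exact unsh_assoc l _

instance : Ring (ShuffleAlg A) :=
  { (inferInstance : AddCommGroup (ShuffleAlg A)) with
    mul := (· * ·)
    one := 1
    one_mul := ShuffleAlg.one_mul
    mul_one := ShuffleAlg.mul_one
    mul_assoc := ShuffleAlg.mul_assoc
    zero_mul := fun f => ShuffleAlg.ext fun l => by simp [mul_apply]
    mul_zero := fun f => ShuffleAlg.ext fun l => by simp [mul_apply]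
    left_distrib := fun f g h => ShuffleAlg.ext fun l => by
      simp [mul_apply, mul_add, unsh_add]
    right_distrib := fun f g h => ShuffleAlg.ext fun l => by
      simp [mul_apply, add_mul, unsh_add] }

theorem smul_mul (c : ℝ) (f g : ShuffleAlg A) : (c • f) * g = c • (f * g) :=
  ShuffleAlg.ext fun l => by
    simp only [mul_apply, smul_apply, mul_assoc]
    exact unsh_smul c l _

theorem mul_smul (c : ℝ) (f g : ShuffleAlg A) : f * (c • g) = c • (f * g) :=
  ShuffleAlg.ext fun l => by
    simp only [mul_apply, smul_apply, mul_left_comm _ c]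
    exact unsh_smul c l _

/-- `f` vanishes on words of total degree other than `-p`. -/
def IsHom (p : ℤ) (f : ShuffleAlg A) : Prop := ∀ l, tdeg l + p ≠ 0 → f l = 0

theorem IsHom.mul {p q : ℤ} {f g : ShuffleAlg A} (hf : IsHom p f) (hg : IsHom q g) :
    IsHom (p + q) (f * g) := fun l hl => by
  rw [mul_apply]
  refine unsh_eq_zero fun S T hST => ?_
  have := tdeg_perm hST
  rw [tdeg_append] at this
  by_cases h : tdeg S + p = 0
  · rw [hg T (by omega), mul_zero]
  · rw [hf S h, zero_mul]

theorem IsHom.mul_comm {p q : ℤ} {f g : ShuffleAlg A} (hf : IsHom p f) (hg : IsHom q g) :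
    f * g = eps (p * q) • (g * f) := by
  refine ShuffleAlg.ext fun l => ?_
  rw [mul_apply, unsh_comm, smul_apply, mul_apply, ← smul_eq_mul, ← unsh_smul]
  congr 1
  funext S T
  by_cases h1 : tdeg S + q = 0
  · by_cases h2 : tdeg T + p = 0
    · rw [show tdeg S = -q by omega, show tdeg T = -p by omega, neg_mul_neg, _root_.mul_comm q p,
        _root_.mul_comm (f T)]
    · simp [hf T h2]
  · simp [hg S h1]

end ShuffleAlg

/-! ### Graded spaces with smooth families, and functionals on words of homogeneous vectors -/

/-- A bounded grading of a real vector space, together with the smooth families of vectors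
parametrized by the spaces `ℝ^s`. -/
structure GrSpace (E : Type u) [AddCommGroup E] [Module ℝ E] where
  /-- The projection to the homogeneous part of a given degree. -/
  pr : ℤ → E →ₗ[ℝ] E
  pr_pr : ∀ j k e, pr j (pr k e) = if j = k then pr k e else 0
  bound : ℕ
  pr_eq_zero : ∀ k : ℤ, (bound : ℤ) < |k| → ∀ e, pr k e = 0
  pr_sum : ∀ e, ∑ k ∈ Finset.Icc (-(bound : ℤ)) bound, pr k e = e
  /-- The smooth families. -/
  plot : ∀ s, Set ((Fin s → ℝ) → E)
  pr_plot : ∀ k s v, v ∈ plot s → (fun y => pr k (v y)) ∈ plot s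
  const_plot : ∀ s e, (fun _ => e) ∈ plot s

section

variable {E : Type u} [AddCommGroup E] [Module ℝ E]

/-- A homogeneous vector together with its degree. -/
structure Letter (G : GrSpace E) where
  degree : ℤ
  val : E
  homog : G.pr degree val = val

instance (G : GrSpace E) : Alphabet (Letter G) := ⟨Letter.degree⟩

/-- A smooth family of homogeneous vectors of the same degree. -/
structure LetterFam (G : GrSpace E) (s : ℕ) where
  degree : ℤ
  val : (Fin s → ℝ) → E
  homog : ∀ y, G.pr degree (val y) = val y
  plot : val ∈ G.plot s

instance (G : GrSpace E) (s : ℕ) : Alphabet (LetterFam G s) := ⟨LetterFam.degree⟩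

variable {G : GrSpace E}

/-- The member of a family of letters at a parameter. -/
def LetterFam.eval {s : ℕ} (y : Fin s → ℝ) (a : LetterFam G s) : Letter G :=
  ⟨a.degree, a.val y, a.homog y⟩

@[simp] theorem LetterFam.deg_eval {s : ℕ} (y : Fin s → ℝ) (a : LetterFam G s) :
    deg (a.eval y) = deg a := rfl

theorem Letter.ext' {a b : Letter G} (h : a.degree = b.degree) (h' : a.val = b.val) : a = b := by
  cases a; cases b; cases h; cases h'; rfl

/-- The constant family. -/
def Letter.toFam (s : ℕ) (a : Letter G) : LetterFam G s :=
  ⟨a.degree, fun _ => a.val, fun _ => a.homog, G.const_plot s _⟩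

/-- The homogeneous part of a vector, as a letter. -/
def GrSpace.letter (G : GrSpace E) (k : ℤ) (e : E) : Letter G :=
  ⟨k, G.pr k e, by rw [G.pr_pr, if_pos rfl]⟩

theorem GrSpace.letter_val (a : Letter G) : G.letter a.degree a.val = a :=
  Letter.ext' rfl a.homog

theorem GrSpace.pr_of_ne {k j : ℤ} {e : E} (h : G.pr k e = e) (hj : j ≠ k) : G.pr j e = 0 := by
  rw [← h, G.pr_pr, if_neg hj]

section WordMaps

variable {A A' : Type*} [Alphabet A] [Alphabet A'] {Y : Type*} [AddCommGroup Y] [Module ℝ Y]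

theorem tdeg_map {φ : A → A'} (hφ : ∀ a, deg (φ a) = deg a) (l : List A) :
    tdeg (l.map φ) = tdeg l := by
  simp [tdeg, Function.comp_def, hφ]

theorem unsh_map {φ : A → A'} (hφ : ∀ a, deg (φ a) = deg a) (l : List A)
    (g : List A' → List A' → Y) :
    unsh (l.map φ) g = unsh l (fun S T => g (S.map φ) (T.map φ)) := by
  induction l generalizing g with
  | nil => rfl
  | cons v l ih => simp only [List.map_cons, unsh, ih, hφ, tdeg_map hφ]

theorem ins_map {φ : A → A'} (hφ : ∀ a, deg (φ a) = deg a) (v : A) (l : List A)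
    (f : List A' → Y) : ins (φ v) f (l.map φ) = ins v (fun l' => f (l'.map φ)) l := by
  induction l generalizing f with
  | nil => rfl
  | cons u l ih => simp only [List.map_cons, ins, ih, hφ]

theorem psum_map {φ : A → A'} (hφ : ∀ a, deg (φ a) = deg a) (l : List A)
    (f : List A' → Y) : psum (l.map φ) f = psum l (fun l' => f (l'.map φ)) := by
  induction l generalizing f with
  | nil => rfl
  | cons u l ih =>
    simp only [List.map_cons, psum, ih]
    congr 1
    funext l'
    exact ins_map hφ u l' f

variable {X : Type*} [NormedAddCommGroup X] [NormedSpace ℝ X]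

theorem contDiff_unsh {g : X → List A → List A → ℝ} {l : List A}
    (h : ∀ S T, ContDiff ℝ ∞ fun z => g z S T) : ContDiff ℝ ∞ fun z => unsh l (g z) := by
  induction l generalizing g with
  | nil => exact h _ _
  | cons v l ih =>
    exact (ih (g := fun z S T => g z (v :: S) T) fun S T => h _ _).add
      (ih (g := fun z S T => eps (deg v * tdeg S) • g z S (v :: T))
        fun S T => (h S (v :: T)).const_smul _)

theorem contDiff_ins {f : X → List A → ℝ} (v : A) (l : List A)
    (h : ∀ l, ContDiff ℝ ∞ fun z => f z l) : ContDiff ℝ ∞ fun z => ins v (f z) l := by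
  induction l generalizing f with
  | nil => exact h _
  | cons u l ih =>
    exact (h (v :: u :: l)).add
      ((ih (f := fun z l' => f z (u :: l')) fun l' => h _).const_smul _)

theorem contDiff_psum {f : X → List A → ℝ} (l : List A)
    (h : ∀ l, ContDiff ℝ ∞ fun z => f z l) : ContDiff ℝ ∞ fun z => psum l (f z) := by
  induction l generalizing f with
  | nil => exact h _
  | cons u l ih => exact ih fun l' => contDiff_ins u l' h

end WordMaps

/-- Linearity in the first letter, in each degree. -/
def HeadLin (f : List (Letter G) → ℝ) : Prop :=
  ∀ (l : List (Letter G)) (k : ℤ), ∃ Λ : E →ₗ[ℝ] ℝ, ∀ a : Letter G, a.degree = k →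
    f (a :: l) = Λ a.val

/-- Linearity in each letter, in each degree. -/
def SlotLin (f : List (Letter G) → ℝ) : Prop :=
  ∀ (l₁ l₂ : List (Letter G)) (k : ℤ), ∃ Λ : E →ₗ[ℝ] ℝ, ∀ a : Letter G, a.degree = k →
    f (l₁ ++ a :: l₂) = Λ a.val

theorem HeadLin.slotLin {f : List (Letter G) → ℝ} (h : HeadLin f) (hf : GSymm f) : SlotLin f := by
  intro l₁ l₂ k
  obtain ⟨Λ, hΛ⟩ := h (l₁ ++ l₂) k
  refine ⟨eps (k * tdeg l₁) • Λ, fun a ha => ?_⟩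
  rw [hf.move, List.cons_append, hΛ a ha, ← ha]
  rfl

theorem SlotLin.cons {f : List (Letter G) → ℝ} (h : SlotLin f) (a : Letter G) :
    SlotLin fun l => f (a :: l) := fun l₁ l₂ k => h (a :: l₁) l₂ k

theorem SlotLin.eq_zero {f : List (Letter G) → ℝ} (h : SlotLin f) {l : List (Letter G)}
    {a : Letter G} (ha : a ∈ l) (h0 : a.val = 0) : f l = 0 := by
  obtain ⟨l₁, l₂, rfl⟩ := List.append_of_mem ha
  obtain ⟨Λ, hΛ⟩ := h l₁ l₂ a.degree
  rw [hΛ a rfl, h0, map_zero]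

theorem HeadLin.mul {f g : ShuffleAlg (Letter G)} (hf : HeadLin f) (hg : HeadLin g) :
    HeadLin (f * g) := by
  intro l k
  choose Λ hΛ using fun S => hf S k
  choose Λ' hΛ' using fun S => hg S k
  refine ⟨unsh l (fun S T => g T • Λ S) +
    unsh l (fun S T => eps (k * tdeg S) • f S • Λ' T), fun a ha => ?_⟩
  have hev : ∀ F : List (Letter G) → List (Letter G) → (E →ₗ[ℝ] ℝ),
      (unsh l F) a.val = unsh l (fun S T => F S T a.val) :=
    fun F => map_unsh (LinearMap.applyₗ a.val) l F
  rw [LinearMap.add_apply, hev, hev, ShuffleAlg.mul_apply, unsh]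
  congr 1
  · congr 1
    funext S T
    rw [hΛ S a ha, LinearMap.smul_apply, smul_eq_mul, mul_comm]
  · congr 1
    funext S T
    rw [hΛ' T a ha, ← ha]
    rfl

/-- Symmetrization preserves linearity. The letter may end up in any slot, so linearity in every
slot is needed for linearity in the first. -/
theorem SlotLin.psum_headLin {f : List (Letter G) → ℝ} (hf : SlotLin f) :
    HeadLin fun l => psum l f := by
  intro l k
  choose Λ hΛ using fun l₁ l₂ => hf l₁ l₂ k
  refine ⟨psum l (fun l' => sp l' (fun S T => eps (k * tdeg S) • Λ S T)), fun a ha => ?_⟩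
  rw [show (psum l (fun l' => sp l' (fun S T => eps (k * tdeg S) • Λ S T))) a.val =
    psum l (fun l' => (sp l' (fun S T => eps (k * tdeg S) • Λ S T)) a.val) from
    map_psum (LinearMap.applyₗ a.val) _ l]
  simp only [psum]
  congr 1
  funext l'
  rw [ins_eq_sp, sp_eq_sum, sp_eq_sum, LinearMap.sum_apply]
  refine Finset.sum_congr rfl fun i _ => ?_
  rw [hΛ _ _ a ha, ← ha]
  rfl

/-- Families, parametrized by `ℝ^r`, of functions on words of homogeneous vectors. -/
def WordFam (G : GrSpace E) (r : ℕ) : Type u := (Fin r → ℝ) → ShuffleAlg (Letter G)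

namespace WordFam

variable {r : ℕ}

instance : Ring (WordFam G r) := inferInstanceAs (Ring ((Fin r → ℝ) → ShuffleAlg (Letter G)))

@[simp] theorem add_apply (v w : WordFam G r) (x : Fin r → ℝ) : (v + w) x = v x + w x := rfl
@[simp] theorem sub_apply (v w : WordFam G r) (x : Fin r → ℝ) : (v - w) x = v x - w x := rfl
@[simp] theorem neg_apply (w : WordFam G r) (x : Fin r → ℝ) : (-w) x = -w x := rfl
@[simp] theorem zero_apply (x : Fin r → ℝ) : (0 : WordFam G r) x = 0 := rfl
theorem mul_apply (v w : WordFam G r) (x : Fin r → ℝ) : (v * w) x = v x * w x := rfl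
theorem one_apply (x : Fin r → ℝ) : (1 : WordFam G r) x = 1 := rfl

theorem ext₂ {v w : WordFam G r} (h : ∀ x l, v x l = w x l) : v = w :=
  funext fun x => funext fun l => h x l

instance : Module (SmoothFn r) (WordFam G r) where
  smul f w := fun x => f.1 x • w x
  one_smul w := funext fun x => one_smul ℝ (w x)
  mul_smul f g w := funext fun x => mul_smul (f.1 x) (g.1 x) (w x)
  smul_zero f := funext fun x => smul_zero (f.1 x)
  smul_add f v w := funext fun x => smul_add (f.1 x) (v x) (w x)
  add_smul f g w := funext fun x => add_smul (f.1 x) (g.1 x) (w x)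
  zero_smul w := funext fun x => zero_smul ℝ (w x)

@[simp] theorem smul_apply (f : SmoothFn r) (w : WordFam G r) (x : Fin r → ℝ) :
    (f • w) x = f.1 x • w x := rfl

instance : Algebra (SmoothFn r) (WordFam G r) :=
  Algebra.ofModule (fun f v w => funext fun x => ShuffleAlg.smul_mul (f.1 x) (v x) (w x))
    (fun f v w => funext fun x => ShuffleAlg.mul_smul (f.1 x) (v x) (w x))

theorem sum_apply {ι : Type*} (s : Finset ι) (w : ι → WordFam G r) (x : Fin r → ℝ)
    (l : List (Letter G)) : (∑ i ∈ s, w i) x l = ∑ i ∈ s, w i x l := by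
  classical
  induction s using Finset.induction_on with
  | empty => simp
  | insert i s hi ih => simp [Finset.sum_insert hi, ih]

/-- The family takes smooth families of words to smooth functions. -/
def IsSmooth (w : WordFam G r) : Prop :=
  ∀ (s : ℕ) (L : List (LetterFam G s)), ContDiff ℝ ∞
    fun z : (Fin r → ℝ) × (Fin s → ℝ) => w z.1 (L.map (LetterFam.eval z.2))

theorem IsSmooth.mul {v w : WordFam G r} (hv : v.IsSmooth) (hw : w.IsSmooth) :
    (v * w).IsSmooth := by
  intro s L
  have : (fun z : (Fin r → ℝ) × (Fin s → ℝ) => (v * w) z.1 (L.map (LetterFam.eval z.2))) =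
      fun z => unsh L (fun S T => v z.1 (S.map (LetterFam.eval z.2)) *
        w z.1 (T.map (LetterFam.eval z.2))) := by
    funext z
    exact unsh_map (φ := LetterFam.eval z.2) (fun a => rfl) L (fun S T => v z.1 S * w z.1 T)
  rw [this]
  exact contDiff_unsh fun S T => (hv s S).mul (hw s T)

theorem IsSmooth.apply {w : WordFam G r} (hw : w.IsSmooth) (l : List (Letter G)) :
    ContDiff ℝ ∞ fun x => w x l := by
  have h := (hw 0 (l.map (Letter.toFam 0))).comp
    (contDiff_id.prodMk contDiff_const : ContDiff ℝ ∞ fun x : Fin r → ℝ => (x, (0 : Fin 0 → ℝ)))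
  have e : ∀ y : Fin 0 → ℝ, (l.map (Letter.toFam 0)).map (LetterFam.eval y) = l := by
    intro y
    rw [List.map_map]
    exact List.map_id l
  simpa only [Function.comp_def, e, id] using h

/-- The graded symmetric smooth multilinear functionals of degree `p`. -/
def homSub (G : GrSpace E) (r : ℕ) (p : ℤ) : Submodule (SmoothFn r) (WordFam G r) where
  carrier := {w | (∀ x, GSymm (w x)) ∧ (∀ x, HeadLin (w x)) ∧ w.IsSmooth ∧
    ∀ x, ShuffleAlg.IsHom p (w x)}
  zero_mem' := ⟨fun x l₁ a b l₂ => by simp, fun x l k => ⟨0, fun a _ => rfl⟩,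
    fun s L => contDiff_const, fun x l _ => rfl⟩
  add_mem' := by
    rintro v w ⟨h1, h2, h3, h4⟩ ⟨k1, k2, k3, k4⟩
    refine ⟨fun x l₁ a b l₂ => ?_, fun x l k => ?_, fun s L => (h3 s L).add (k3 s L),
      fun x l hl => ?_⟩
    · simp only [add_apply, ShuffleAlg.add_apply, h1 x l₁ a b l₂, k1 x l₁ a b l₂, smul_add]
    · obtain ⟨Λ, hΛ⟩ := h2 x l k
      obtain ⟨Λ', hΛ'⟩ := k2 x l k
      exact ⟨Λ + Λ', fun a ha => by simp [hΛ a ha, hΛ' a ha]⟩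
    · simp [h4 x l hl, k4 x l hl]
  smul_mem' := by
    rintro f w ⟨h1, h2, h3, h4⟩
    refine ⟨fun x l₁ a b l₂ => ?_, fun x l k => ?_, fun s L => ?_, fun x l hl => ?_⟩
    · simp only [smul_apply, ShuffleAlg.smul_apply, h1 x l₁ a b l₂, smul_eq_mul]
      ring
    · obtain ⟨Λ, hΛ⟩ := h2 x l k
      exact ⟨f.1 x • Λ, fun a ha => by simp [hΛ a ha]⟩
    · have hf : ContDiff ℝ ∞ f.1 := f.2
      exact (hf.comp contDiff_fst).mul (h3 s L)
    · simp [h4 x l hl]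

theorem mul_mem_homSub {p q : ℤ} {v w : WordFam G r} (hv : v ∈ homSub G r p)
    (hw : w ∈ homSub G r q) : v * w ∈ homSub G r (p + q) := by
  obtain ⟨h1, h2, h3, h4⟩ := hv
  obtain ⟨k1, k2, k3, k4⟩ := hw
  refine ⟨fun x => unsh_gsymm (fun T l₁ a b l₂ => ?_) (fun S l₁ a b l₂ => ?_),
    fun x => (h2 x).mul (k2 x), h3.mul k3, fun x => (h4 x).mul (k4 x)⟩
  · simp only [h1 x l₁ a b l₂, smul_eq_mul]
    ring
  · simp only [k1 x l₁ a b l₂, smul_eq_mul]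
    ring

theorem one_mem_homSub : (1 : WordFam G r) ∈ homSub G r 0 := by
  refine ⟨fun x l₁ a b l₂ => ?_, fun x l k => ⟨0, fun a _ => ?_⟩, fun s L => ?_, fun x l hl => ?_⟩
  · simp [one_apply, ShuffleAlg.one_apply]
  · simp [one_apply, ShuffleAlg.one_apply]
  · simp only [one_apply, ShuffleAlg.one_apply, List.map_eq_nil_iff]
    exact contDiff_const
  · rw [one_apply, ShuffleAlg.one_apply, if_neg]
    rintro rfl
    simp at hl

/-- A functional of degree `p` vanishes on words with too few letters for that degree. -/
theorem eq_zero_of_bound {p : ℤ} {w : WordFam G r} (hw : w ∈ homSub G r p) {x : Fin r → ℝ}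
    {l : List (Letter G)} (h : (l.length * G.bound : ℤ) < |p|) : w x l = 0 := by
  by_contra hne
  have h1 : tdeg l = -p := by
    by_contra h1
    exact hne (hw.2.2.2 x l (by omega))
  have h2 : ∀ a ∈ l, |deg a| ≤ (G.bound : ℤ) := by
    intro a ha
    by_contra h2
    refine hne (((hw.2.1 x).slotLin (hw.1 x)).eq_zero ha ?_)
    rw [← a.homog]
    exact G.pr_eq_zero _ (not_le.1 h2) _
  have h3 : ∀ m : List (Letter G), (∀ a ∈ m, |deg a| ≤ (G.bound : ℤ)) →
      |tdeg m| ≤ m.length * G.bound := by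
    intro m hm
    induction m with
    | nil => simp
    | cons a m ih =>
      rw [tdeg_cons, List.length_cons]
      have h4 := hm a (by simp)
      have h5 := ih fun b hb => hm b (by simp [hb])
      have h6 := abs_add_le (deg a) (tdeg m)
      push_cast
      linarith
  have := h3 l h2
  rw [h1, abs_neg] at this
  omega

/-- The sum of the spaces of functionals of all degrees. -/
def obsSub (G : GrSpace E) (r : ℕ) : Submodule (SmoothFn r) (WordFam G r) := ⨆ p, homSub G r p

theorem homSub_le (p : ℤ) : homSub G r p ≤ obsSub G r := le_iSup _ p

theorem obsSub_induction {P : WordFam G r → Prop} {w : WordFam G r} (hw : w ∈ obsSub G r)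
    (h : ∀ p, ∀ w ∈ homSub G r p, P w) (h0 : P 0) (ha : ∀ v w, P v → P w → P (v + w)) : P w :=
  Submodule.iSup_induction (homSub G r) (motive := P) hw h h0 ha

theorem mul_mem_obsSub {v w : WordFam G r} (hv : v ∈ obsSub G r) (hw : w ∈ obsSub G r) :
    v * w ∈ obsSub G r := by
  refine obsSub_induction (P := fun v => v * w ∈ obsSub G r) hv (fun p v hv => ?_) (by simp)
    fun v v' h h' => ?_
  · refine obsSub_induction (P := fun w => v * w ∈ obsSub G r) hw
      (fun q w hw => homSub_le _ (mul_mem_homSub hv hw)) (by simp) fun w w' h h' => ?_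
    rw [mul_add]
    exact add_mem h h'
  · rw [add_mul]
    exact add_mem h h'

open Classical in
/-- The component of degree `p`. -/
def comp (p : ℤ) : WordFam G r →+ WordFam G r where
  toFun w := fun x l => if tdeg l + p = 0 then w x l else 0
  map_zero' := ext₂ fun x l => ite_self 0
  map_add' v w := ext₂ fun x l => by
    change (if tdeg l + p = 0 then v x l + w x l else 0) =
      (if tdeg l + p = 0 then v x l else 0) + (if tdeg l + p = 0 then w x l else 0)
    split_ifs <;> simp

theorem comp_apply (p : ℤ) (w : WordFam G r) (x : Fin r → ℝ) (l : List (Letter G)) :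
    comp p w x l = if tdeg l + p = 0 then w x l else 0 := by
  change (if tdeg l + p = 0 then w x l else 0) = _
  congr

theorem comp_of_mem {p q : ℤ} {w : WordFam G r} (hw : w ∈ homSub G r p) :
    comp q w = if q = p then w else 0 := by
  refine ext₂ fun x l => ?_
  rw [comp_apply]
  split_ifs with h1 h2 h2
  · rfl
  · exact hw.2.2.2 x l (by omega)
  · subst h2
    exact (hw.2.2.2 x l h1).symm
  · rfl

theorem comp_mem {w : WordFam G r} (hw : w ∈ obsSub G r) (p : ℤ) : comp p w ∈ homSub G r p := by
  refine obsSub_induction (P := fun w => comp p w ∈ homSub G r p) hw (fun q w hw => ?_) (by simp)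
    fun v w hv hw => ?_
  · rw [comp_of_mem hw]
    split_ifs with h
    · exact h ▸ hw
    · exact zero_mem _
  · rw [map_add]
    exact add_mem hv hw

theorem exists_eq_sum_comp {w : WordFam G r} (hw : w ∈ obsSub G r) :
    ∃ s : Finset ℤ, w = ∑ p ∈ s, comp p w := by
  classical
  have h : ∃ s : Finset ℤ, ∀ q ∉ s, comp q w = 0 := by
    refine obsSub_induction (P := fun w => ∃ s : Finset ℤ, ∀ q ∉ s, comp q w = 0) hw
      (fun q w hw => ⟨{q}, fun p hp => ?_⟩) ⟨∅, by simp⟩ ?_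
    · rw [comp_of_mem hw, if_neg (by simpa using hp)]
    · rintro v w ⟨s, hs⟩ ⟨t, ht⟩
      refine ⟨s ∪ t, fun q hq => ?_⟩
      simp only [Finset.mem_union, not_or] at hq
      rw [map_add, hs q hq.1, ht q hq.2, add_zero]
  obtain ⟨s, hs⟩ := h
  refine ⟨s, ext₂ fun x l => ?_⟩
  rw [sum_apply]
  have h0 : ∀ p, p ≠ -tdeg l → comp p w x l = 0 := by
    intro p hp
    rw [comp_apply, if_neg (by omega)]
  have h1 : comp (-tdeg l) w x l = w x l := by rw [comp_apply, if_pos (by omega)]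
  by_cases hl : -tdeg l ∈ s
  · rw [Finset.sum_eq_single_of_mem _ hl fun p _ hp => h0 p hp, h1]
  · rw [Finset.sum_eq_zero, ← h1, hs _ hl]
    · rfl
    · intro p hp
      exact h0 p fun h => hl (h ▸ hp)

end WordFam

end

/-! ### `L∞` algebras and the Chevalley–Eilenberg differential -/

/-- An `L∞` algebra, with its brackets written after the degree shift, as graded symmetric maps of
degree one, such that the brackets take smooth families to smooth families. -/
structure LInfAlg {E : Type u} [AddCommGroup E] [Module ℝ E] (G : GrSpace E) where
  op : ∀ k, MultilinearMap ℝ (fun _ : Fin k => E) E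
  op_zero : ∀ v, op 0 v = 0
  op_plot : ∀ k s (v : Fin k → (Fin s → ℝ) → E), (∀ i, v i ∈ G.plot s) →
    (fun y => op k (fun i => v i y)) ∈ G.plot s
  degree : ∀ k (κ : Fin k → ℤ) (v : Fin k → E), (∀ i, G.pr (κ i) (v i) = v i) →
    G.pr (∑ i, κ i + 1) (op k v) = op k v
  symm : ∀ k (κ : Fin k → ℤ) (v : Fin k → E), (∀ i, G.pr (κ i) (v i) = v i) →
    ∀ σ : Equiv.Perm (Fin k), op k v = koszul σ κ • op k (fun i => v (σ i))
  jacobi : ∀ m (κ : Fin m → ℤ) (v : Fin m → E), (∀ i, G.pr (κ i) (v i) = v i) →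
    ∑ σ : Equiv.Perm (Fin m), ∑ i ∈ Finset.Icc 1 m,
      ((koszul σ κ : ℝ) / ((i.factorial : ℝ) * ((m - i).factorial : ℝ))) •
        op (m - i + 1) (Fin.cons (op i (fun b => ext (fun a => v (σ a)) b))
          (fun b : Fin (m - i) => ext (fun a => v (σ a)) (i + b))) = 0

section

variable {E : Type u} [AddCommGroup E] [Module ℝ E] {G : GrSpace E} (𝔤 : LInfAlg G)

/-- The underlying tuple of vectors of a word. -/
def vals (l : List (Letter G)) : Fin l.length → E := fun i => l[i].val

theorem vals_cons (a : Letter G) (l : List (Letter G)) :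
    vals (a :: l) = (Fin.cons a.val (vals l) : Fin (l.length + 1) → E) := by
  funext i
  induction i using Fin.cases with
  | zero => rfl
  | succ i => rfl

theorem tdeg_eq_sum {A : Type*} [Alphabet A] (l : List A) :
    tdeg l = ∑ i : Fin l.length, deg l[i] := by
  rw [tdeg, ← List.sum_ofFn]
  congr 1
  apply List.ext_getElem <;> simp

/-- The bracket of the letters of a word. -/
def LInfAlg.opw (l : List (Letter G)) : E := 𝔤.op l.length (vals l)

/-- The bracket of the letters of a word, as a letter. -/
def LInfAlg.br (l : List (Letter G)) : Letter G :=
  ⟨tdeg l + 1, 𝔤.opw l, by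
    rw [tdeg_eq_sum]
    exact 𝔤.degree _ (fun i => deg l[i]) _ fun i => l[i].homog⟩

/-- The bracket of the letters of a word of smooth families. -/
def LInfAlg.brFam {s : ℕ} (l : List (LetterFam G s)) : LetterFam G s :=
  ⟨tdeg l + 1, fun y => 𝔤.op l.length (fun i => l[i].val y), fun y => by
    rw [tdeg_eq_sum]
    exact 𝔤.degree _ (fun i => deg l[i]) _ fun i => l[i].homog y,
   𝔤.op_plot _ _ (fun i => l[i].val) fun i => l[i].plot⟩

@[simp] theorem LInfAlg.deg_br (l : List (Letter G)) : deg (𝔤.br l) = tdeg l + 1 := rfl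

theorem LInfAlg.opw_eq {k : ℕ} (l : List (Letter G)) (h : l.length = k) :
    𝔤.opw l = 𝔤.op k (fun i => (l[(i : ℕ)]'(h ▸ i.2)).val) := by
  subst h
  rfl

theorem LInfAlg.br_eval {s : ℕ} (y : Fin s → ℝ) (l : List (LetterFam G s)) :
    𝔤.br (l.map (LetterFam.eval y)) = (𝔤.brFam l).eval y := by
  refine Letter.ext' ?_ ?_
  · change tdeg _ + 1 = tdeg l + 1
    rw [tdeg_map (φ := LetterFam.eval y) fun a => rfl]
  · change 𝔤.opw _ = 𝔤.op l.length (fun i => l[i].val y)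
    rw [𝔤.opw_eq _ (List.length_map _)]
    congr 1
    funext i
    simp [LetterFam.eval]

theorem LInfAlg.opw_cons (a : Letter G) (l : List (Letter G)) :
    𝔤.opw (a :: l) = (𝔤.op (l.length + 1)).toLinearMap (Fin.cons 0 (vals l)) 0 a.val := by
  rw [opw, vals_cons, MultilinearMap.toLinearMap_apply, Fin.update_cons_zero]
  rfl

theorem LInfAlg.opw_gsymm : GSymm 𝔤.opw := by
  intro l₁ a b l₂
  set l := l₁ ++ a :: b :: l₂ with hl
  have hlen : l₁.length + 1 < l.length := by simp [hl]
  have h := 𝔤.symm l.length (fun i => deg l[i]) (vals l) (fun i => l[i].homog)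
    (Equiv.swap ⟨l₁.length, by omega⟩ ⟨l₁.length + 1, hlen⟩)
  rw [koszul_swap _ _ hlen, sgn_smul_eq] at h
  have ha : l[l₁.length] = a := by simp [hl]
  have hb : l[l₁.length + 1] = b := by simp [hl]
  simp only [Fin.getElem_fin, ha, hb] at h
  have hlen' : (l₁ ++ b :: a :: l₂).length = l.length := by simp [hl]
  rw [𝔤.opw_eq _ hlen']
  refine h.trans ?_
  congr 2
  funext i
  simp only [vals]
  obtain ⟨i, hi⟩ := i
  by_cases h1 : i = l₁.length
  · subst h1
    simp [hb]
  · by_cases h2 : i = l₁.length + 1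
    · subst h2
      simp [ha]
    · rw [Equiv.swap_apply_of_ne_of_ne (by simpa [Fin.ext_iff] using h1)
        (by simpa [Fin.ext_iff] using h2)]
      simp only [hl, Fin.getElem_fin, List.getElem_append]
      split_ifs with h3
      · rfl
      · obtain ⟨j, hj⟩ : ∃ j, i - l₁.length = j + 2 := ⟨i - l₁.length - 2, by omega⟩
        simp [hj]

theorem getElem_ofFn_ext {n : ℕ} (u : Fin n → Letter G) (i : ℕ)
    (h : i < (List.ofFn u).length) :
    ((List.ofFn u)[i]).val = ext (fun a => (u a).val) i := by
  have h' : i < n := by simpa using h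
  simp [ext, h']

/-- The Jacobi identity as a sum over unshuffles. -/
theorem LInfAlg.jacobi_unsh (l : List (Letter G)) :
    unsh l (fun S T => 𝔤.opw (𝔤.br S :: T)) = 0 := by
  -- In the sum over all permutations each unshuffle occurs `|S|! |T|!` times, which cancels the
  -- factorials in the Jacobi identity.
  have h1 : psum l (fun l' => sp l' (fun a b =>
      ((a.length.factorial : ℝ)⁻¹ * (b.length.factorial : ℝ)⁻¹) • 𝔤.opw (𝔤.br a :: b))) =
      unsh l (fun S T => 𝔤.opw (𝔤.br S :: T)) := by
    rw [psum_sp]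
    refine unsh_congr fun S T _ => ?_
    have hT : ∀ a, psum T (fun b => ((a.length.factorial : ℝ)⁻¹ * (b.length.factorial : ℝ)⁻¹) •
        𝔤.opw (𝔤.br a :: b)) = (a.length.factorial : ℝ)⁻¹ • 𝔤.opw (𝔤.br a :: T) := by
      intro a
      rw [psum_congr (g := fun b => ((a.length.factorial : ℝ)⁻¹ * (T.length.factorial : ℝ)⁻¹) •
        𝔤.opw (𝔤.br a :: b)) fun b hb => by rw [hb.length_eq], psum_smul,
        psum_of_gsymm (𝔤.opw_gsymm.cons _), smul_smul, mul_assoc,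
        inv_mul_cancel₀ (by positivity), mul_one]
    simp only [hT]
    have hS : GSymm fun a => 𝔤.opw (𝔤.br a :: T) := by
      intro l₁ a b l₂
      simp only [opw_cons]
      rw [← map_smul]
      congr 1
      exact 𝔤.opw_gsymm l₁ a b l₂
    rw [psum_congr (g := fun a => (S.length.factorial : ℝ)⁻¹ • 𝔤.opw (𝔤.br a :: T))
      fun a ha => by rw [ha.length_eq], psum_smul, psum_of_gsymm hS, smul_smul,
      inv_mul_cancel₀ (by positivity), one_smul]
  rw [← h1]
  have h2 := 𝔤.jacobi l.length (fun i => deg l[i]) (vals l) (fun i => l[i].homog)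
  have e : l = List.ofFn fun i : Fin l.length => l[i] := List.ofFn_getElem.symm
  refine (congrArg (fun m => psum m _) e).trans ?_
  rw [psum_ofFn]
  refine Eq.trans (Finset.sum_congr rfl fun σ _ => ?_) h2
  rw [sp_eq_sum, List.length_ofFn, Finset.smul_sum]
  symm
  refine (Finset.sum_subset (fun i hi => ?_) fun i hi hi' => ?_).trans
    (Finset.sum_congr rfl fun i hi => ?_)
  · simp only [Finset.mem_Icc, Finset.mem_range] at hi ⊢
    omega
  -- The term without inner arguments vanishes, as the bracket of arity zero does.
  · have : i = 0 := by
      simp only [Finset.mem_Icc, Finset.mem_range] at hi hi'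
      omega
    subst this
    refine smul_eq_zero_of_right _ ((𝔤.op _).map_coord_zero 0 ?_)
    rw [Fin.cons_zero, 𝔤.op_zero]
  · have hi' : i ≤ l.length := by simpa [Nat.lt_succ_iff] using hi
    rw [smul_smul, div_eq_mul_inv, mul_inv]
    simp only [List.length_take, List.length_drop, List.length_ofFn, min_eq_left hi']
    congr 1
    rw [𝔤.opw_eq (k := l.length - i + 1) _ (by simp)]
    congr 1
    funext b
    induction b using Fin.cases with
    | zero =>
      simp only [Fin.cons_zero, Fin.val_zero, List.getElem_cons_zero]
      change _ = 𝔤.opw _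
      rw [𝔤.opw_eq (k := i) _ (by simpa using hi')]
      congr 1
      funext b
      rw [List.getElem_take, getElem_ofFn_ext]
      rfl
    | succ b =>
      simp only [Fin.cons_succ, Fin.val_succ, List.getElem_cons_succ]
      rw [List.getElem_drop, getElem_ofFn_ext]
      rfl

/-- The Chevalley–Eilenberg differential on functions on words: the sum over all ways to replace
some of the letters by their bracket. -/
def LInfAlg.ce (w : ShuffleAlg (Letter G)) : ShuffleAlg (Letter G) := fun l =>
  unsh l fun S T => w (𝔤.br S :: T)

theorem HeadLin.map_smul' {f : List (Letter G) → ℝ} (h : HeadLin f) {a b : Letter G} (c : ℝ)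
    (hd : a.degree = b.degree) (hv : a.val = c • b.val) (l : List (Letter G)) :
    f (a :: l) = c * f (b :: l) := by
  obtain ⟨Λ, hΛ⟩ := h l b.degree
  rw [hΛ a hd, hΛ b rfl, hv, map_smul, smul_eq_mul]

/-- The terms with two separate brackets cancel in pairs, and those with nested brackets cancel by
the Jacobi identity. -/
theorem LInfAlg.ce_ce {w : ShuffleAlg (Letter G)} (hs : GSymm w) (hl : HeadLin w)
    (l : List (Letter G)) : 𝔤.ce (𝔤.ce w) l = 0 := by
  -- The second bracket either takes the first one as an argument, or is separate from it.
  have h1 : 𝔤.ce (𝔤.ce w) l =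
      unsh l (fun S T => unsh T (fun P Q => w (𝔤.br (𝔤.br S :: P) :: Q))) +
      unsh l (fun S T => unsh T (fun P Q =>
        eps ((tdeg S + 1) * tdeg P) • w (𝔤.br P :: 𝔤.br S :: Q))) := by
    rw [← unsh_add]
    rfl
  -- Nested brackets: the Jacobi identity for the letters `C` in the two brackets, by linearity of
  -- `w` in its first letter.
  have h2 : unsh l (fun S T => unsh T (fun P Q => w (𝔤.br (𝔤.br S :: P) :: Q))) = 0 := by
    rw [← unsh_assoc]
    refine unsh_eq_zero fun C Q _ => ?_
    choose Λ hΛ using fun k => hl Q k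
    have : unsh C (fun S P => w (𝔤.br (𝔤.br S :: P) :: Q)) =
        unsh C (fun S P => Λ (tdeg C + 2) (𝔤.opw (𝔤.br S :: P))) := by
      refine unsh_congr fun S P hSP => hΛ _ _ ?_
      have := tdeg_perm hSP
      rw [tdeg_append] at this
      change tdeg (𝔤.br S :: P) + 1 = _
      rw [tdeg_cons, 𝔤.deg_br, ← this]
      ring
    rw [this, ← map_unsh, jacobi_unsh, map_zero]
  -- Separate brackets: exchanging them reproduces the sum with the opposite sign, as both brackets
  -- shift the degree by one.
  have h3 : unsh l (fun S T => unsh T (fun P Q =>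
        eps ((tdeg S + 1) * tdeg P) • w (𝔤.br P :: 𝔤.br S :: Q))) =
      (-1 : ℝ) • unsh l (fun S T => unsh T (fun P Q =>
        eps ((tdeg S + 1) * tdeg P) • w (𝔤.br P :: 𝔤.br S :: Q))) := by
    conv_lhs => rw [unsh_left_comm]
    rw [← unsh_smul]
    congr 1
    funext S T
    rw [← unsh_smul]
    congr 1
    funext P Q
    have := hs [] (𝔤.br S) (𝔤.br P) Q
    simp only [List.nil_append, 𝔤.deg_br] at this
    rw [this]
    simp only [smul_smul, ← eps_one, ← eps_add]
    have hpar : eps (tdeg S * tdeg P + (tdeg P + 1) * tdeg S + (tdeg S + 1) * (tdeg P + 1)) =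
        eps (1 + (tdeg S + 1) * tdeg P) := by
      have : tdeg S * tdeg P + (tdeg P + 1) * tdeg S + (tdeg S + 1) * (tdeg P + 1) =
          (tdeg S * tdeg P + tdeg S) + (tdeg S * tdeg P + tdeg S) +
            (1 + (tdeg S + 1) * tdeg P) := by ring
      rw [this, eps_add, eps_add (tdeg S * tdeg P + tdeg S), eps_mul_self, one_mul]
    rw [← add_assoc, hpar]
  rw [h1, h2, zero_add]
  rw [neg_one_smul] at h3
  linarith

/-- The Chevalley–Eilenberg differential is a derivation: the bracket of `S` is a letter of one of
the two factors, and moving it past the other letters gives the sign. -/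
theorem LInfAlg.ce_mul {p : ℤ} {f : ShuffleAlg (Letter G)} (hf : ShuffleAlg.IsHom p f)
    (g : ShuffleAlg (Letter G)) :
    𝔤.ce (f * g) = 𝔤.ce f * g + eps p • (f * 𝔤.ce g) := by
  refine ShuffleAlg.ext fun l => ?_
  have h1 : 𝔤.ce (f * g) l =
      unsh l (fun S T => unsh T (fun P Q => f (𝔤.br S :: P) * g Q)) +
      unsh l (fun S T => unsh T (fun P Q =>
        eps ((tdeg S + 1) * tdeg P) • (f P * g (𝔤.br S :: Q)))) := by
    rw [← unsh_add]
    rfl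
  rw [h1, ShuffleAlg.add_apply, ShuffleAlg.smul_apply, ShuffleAlg.mul_apply, ShuffleAlg.mul_apply]
  congr 1
  · rw [← unsh_assoc]
    congr 1
    funext S T
    rw [mul_comm, LInfAlg.ce, ← smul_eq_mul, ← unsh_smul]
    simp only [smul_eq_mul, mul_comm]
  · rw [unsh_left_comm, ← smul_eq_mul, ← unsh_smul]
    congr 1
    funext S T
    rw [LInfAlg.ce, ← smul_eq_mul, ← unsh_smul, ← unsh_smul]
    congr 1
    funext P Q
    by_cases hS : tdeg S + p = 0
    · have : p = -tdeg S := by omega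
      rw [smul_smul, ← eps_add, this]
      congr 1
      have : tdeg S * tdeg P + (tdeg P + 1) * tdeg S =
        (tdeg S * tdeg P + tdeg S * tdeg P) + tdeg S := by ring
      rw [this, eps_add, eps_add, eps_mul_self, one_mul, eps_neg]
    · simp [hf S hS]

theorem GSymm.ce {w : ShuffleAlg (Letter G)} (hs : GSymm w) (hl : HeadLin w) :
    GSymm (𝔤.ce w) := by
  refine unsh_gsymm (fun T l₁ a b l₂ => ?_) (fun S l₁ a b l₂ => hs (𝔤.br S :: l₁) a b l₂)
  refine hl.map_smul' _ ?_ (𝔤.opw_gsymm l₁ a b l₂) T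
  change tdeg _ + 1 = tdeg _ + 1
  rw [tdeg_perm ((List.Perm.swap _ _ _).append_left _)]

/-- The first letter is either an argument of the bracket or a later letter of the word. -/
theorem HeadLin.ce {w : ShuffleAlg (Letter G)} (hs : GSymm w) (hl : HeadLin w) :
    HeadLin (𝔤.ce w) := by
  intro l k
  have hsl := hl.slotLin hs
  choose Λ hΛ using hl
  choose Λ' hΛ' using fun S T => hsl [𝔤.br S] T k
  refine ⟨unsh l (fun S T => (Λ T (k + tdeg S + 1)).comp
      ((𝔤.op (S.length + 1)).toLinearMap (Fin.cons 0 (vals S)) 0)) +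
    unsh l (fun S T => eps (k * tdeg S) • Λ' S T), fun a ha => ?_⟩
  have hev : ∀ F : List (Letter G) → List (Letter G) → (E →ₗ[ℝ] ℝ),
      (unsh l F) a.val = unsh l (fun S T => F S T a.val) :=
    fun F => map_unsh (LinearMap.applyₗ a.val) l F
  rw [LinearMap.add_apply, hev, hev, LInfAlg.ce, unsh]
  congr 1
  · congr 1
    funext S T
    rw [hΛ T (k + tdeg S + 1)]
    · rw [LinearMap.comp_apply, ← 𝔤.opw_cons]
      rfl
    · rw [← ha]
      rfl
  · congr 1
    funext S T
    rw [LinearMap.smul_apply, ← hΛ' S T a ha, ← ha]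
    rfl

namespace WordFam

variable {r : ℕ}

theorem IsSmooth.ce {w : WordFam G r} (hw : w.IsSmooth) :
    IsSmooth (fun x => 𝔤.ce (w x) : WordFam G r) := by
  intro s L
  have : (fun z : (Fin r → ℝ) × (Fin s → ℝ) => 𝔤.ce (w z.1) (L.map (LetterFam.eval z.2))) =
      fun z => unsh L (fun S T => w z.1 ((𝔤.brFam S :: T).map (LetterFam.eval z.2))) := by
    funext z
    rw [LInfAlg.ce, unsh_map (φ := LetterFam.eval z.2) fun a => rfl]
    simp only [𝔤.br_eval, List.map_cons]
  rw [this]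
  exact contDiff_unsh fun S T => hw s _

theorem ce_mem_homSub {p : ℤ} {w : WordFam G r} (hw : w ∈ homSub G r p) :
    (fun x => 𝔤.ce (w x) : WordFam G r) ∈ homSub G r (p + 1) := by
  obtain ⟨h1, h2, h3, h4⟩ := hw
  refine ⟨fun x => (h1 x).ce 𝔤 (h2 x), fun x => HeadLin.ce 𝔤 (h1 x) (h2 x), h3.ce 𝔤,
    fun x l hl => unsh_eq_zero fun S T hST => h4 x _ ?_⟩
  have := tdeg_perm hST
  rw [tdeg_append] at this
  rw [tdeg_cons, 𝔤.deg_br]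
  omega

/-- The Chevalley–Eilenberg differential on families of functionals. -/
def d : WordFam G r →ₗ[SmoothFn r] WordFam G r where
  toFun w := fun x => 𝔤.ce (w x)
  map_add' _ _ := ext₂ fun _ l => unsh_add l _ _
  map_smul' f _ := ext₂ fun x l => unsh_smul (f.1 x) l _

/-- Pullback along a smooth map of parameter spaces. -/
def pull {s : ℕ} (g : SmoothMap s r) : WordFam G r →+ WordFam G s where
  toFun w := fun y => w (g.1 y)
  map_zero' := rfl
  map_add' _ _ := rfl

@[simp] theorem pull_apply {s : ℕ} (g : SmoothMap s r) (w : WordFam G r) (y : Fin s → ℝ) :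
    pull g w y = w (g.1 y) := rfl

theorem pull_mem {s : ℕ} (g : SmoothMap s r) {p : ℤ} {w : WordFam G r}
    (hw : w ∈ homSub G r p) : pull g w ∈ homSub G s p := by
  obtain ⟨h1, h2, h3, h4⟩ := hw
  refine ⟨fun x => h1 _, fun x => h2 _, fun t L => ?_, fun x => h4 _⟩
  have hg : ContDiff ℝ ∞ g.1 := g.2
  exact (h3 t L).comp ((hg.comp contDiff_fst).prodMk contDiff_snd)

/-- The partial derivative of a family of functionals in a parameter. -/
def pdFun (i : Fin r) (w : WordFam G r) : WordFam G r :=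
  fun x l => fderiv ℝ (fun y => w y l) x (Pi.single i 1)

theorem pdFun_mem (i : Fin r) {p : ℤ} {w : WordFam G r} (hw : w ∈ homSub G r p) :
    pdFun i w ∈ homSub G r p := by
  obtain ⟨h1, h2, h3, h4⟩ := hw
  have hd : ∀ l x, DifferentiableAt ℝ (fun y => w y l) x :=
    fun l x => (h3.apply l).differentiable (by simp) x
  refine ⟨fun x l₁ a b l₂ => ?_, fun x l k => ?_, fun s L => ?_, fun x l hl => ?_⟩
  · simp only [pdFun, h1 _ l₁ a b l₂, smul_eq_mul]
    rw [fderiv_const_mul (hd _ x)]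
    rfl
  · choose Λ hΛ using fun y => h2 y l k
    have hlet : ∀ e y, Λ y (G.pr k e) = w y (G.letter k e :: l) := fun e y =>
      (hΛ y (G.letter k e) rfl).symm
    have hd' : ∀ e, DifferentiableAt ℝ (fun y => Λ y (G.pr k e)) x := fun e => by
      simp only [hlet]
      exact hd _ x
    refine ⟨⟨⟨fun e => fderiv ℝ (fun y => Λ y (G.pr k e)) x (Pi.single i 1), fun e e' => ?_⟩,
      fun c e => ?_⟩, fun a ha => ?_⟩
    · simp only [map_add]
      rw [fderiv_fun_add (hd' e) (hd' e')]
      rfl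
    · simp only [map_smul, smul_eq_mul]
      rw [fderiv_const_mul (hd' e)]
      rfl
    · change fderiv ℝ _ _ _ = fderiv ℝ (fun y => Λ y (G.pr k a.val)) x (Pi.single i 1)
      have : G.pr k a.val = a.val := by
        rw [← ha]
        exact a.homog
      simp only [this, hΛ _ a ha]
  · have h := h3 s L
    have h' : ∀ z : (Fin r → ℝ) × (Fin s → ℝ), pdFun i w z.1 (L.map (LetterFam.eval z.2)) =
        fderiv ℝ (fun z : (Fin r → ℝ) × (Fin s → ℝ) => w z.1 (L.map (LetterFam.eval z.2))) z
          (Pi.single i 1, 0) := by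
      intro z
      have hc : HasFDerivAt (fun y : Fin r → ℝ => (y, z.2))
          (ContinuousLinearMap.inl ℝ (Fin r → ℝ) (Fin s → ℝ)) z.1 := hasFDerivAt_prodMk_left _ _
      have := ((h.differentiable (by simp) z).hasFDerivAt.comp z.1 hc).fderiv
      rw [pdFun]
      refine (congrArg (fun T : (Fin r → ℝ) →L[ℝ] ℝ => T (Pi.single i 1)) this).trans ?_
      simp
    simp only [h']
    exact (h.fderiv_right (m := ∞) (by norm_cast)).clm_apply contDiff_const
  · simp only [pdFun]
    have : (fun y => w y l) = fun _ => 0 := funext fun y => h4 y l hl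
    rw [this]
    simp

theorem smooth_of_mem {w : WordFam G r} (hw : w ∈ obsSub G r) : w.IsSmooth := by
  refine obsSub_induction hw (fun p w hw => hw.2.2.1) (fun s L => contDiff_const)
    fun v w hv hw s L => (hv s L).add (hw s L)

theorem diff_of_mem {w : WordFam G r} (hw : w ∈ obsSub G r) (l : List (Letter G))
    (x : Fin r → ℝ) : DifferentiableAt ℝ (fun y => w y l) x :=
  ((smooth_of_mem hw).apply l).differentiable (by simp) x

theorem pdFun_add (i : Fin r) {v w : WordFam G r} (hv : v ∈ obsSub G r) (hw : w ∈ obsSub G r) :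
    pdFun i (v + w) = pdFun i v + pdFun i w := by
  refine ext₂ fun x l => ?_
  change fderiv ℝ (fun y => v y l + w y l) x _ = _
  rw [fderiv_fun_add (diff_of_mem hv l x) (diff_of_mem hw l x)]
  rfl

theorem d_mem_obs {w : WordFam G r} (hw : w ∈ obsSub G r) : d 𝔤 w ∈ obsSub G r := by
  refine obsSub_induction (P := fun w => d 𝔤 w ∈ obsSub G r) hw
    (fun p w hw => homSub_le _ (ce_mem_homSub 𝔤 hw)) (by simp) fun v w hv hw => ?_
  rw [map_add]
  exact add_mem hv hw

theorem pull_mem_obs {s : ℕ} (g : SmoothMap s r) {w : WordFam G r} (hw : w ∈ obsSub G r) :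
    pull g w ∈ obsSub G s := by
  refine obsSub_induction (P := fun w => pull g w ∈ obsSub G s) hw
    (fun p w hw => homSub_le _ (pull_mem g hw)) (by simp) fun v w hv hw => ?_
  rw [map_add]
  exact add_mem hv hw

theorem pd_mem_obs (i : Fin r) {w : WordFam G r} (hw : w ∈ obsSub G r) :
    pdFun i w ∈ obsSub G r := by
  obtain ⟨s, hs⟩ := exists_eq_sum_comp hw
  have : pdFun i w = ∑ p ∈ s, pdFun i (comp p w) := by
    refine ext₂ fun x l => ?_
    rw [sum_apply]
    simp only [pdFun]
    rw [← _root_.sum_apply, ← fderiv_fun_sum]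
    · congr 2
      funext y
      conv_lhs => rw [hs]
      exact sum_apply s _ y l
    · exact fun p _ => diff_of_mem (homSub_le p (comp_mem hw p)) l x
  rw [this]
  exact sum_mem fun p _ => homSub_le p (pdFun_mem i (comp_mem hw p))

end WordFam

end

/-! ### The complex of observables as a complex of differentiable vector spaces -/

theorem SmoothMap.IsOpenEmb.exists_equiv {r : ℕ} {g : SmoothMap r r} (hg : g.IsOpenEmb)
    (y : Fin r → ℝ) : ∃ g' : (Fin r → ℝ) ≃L[ℝ] (Fin r → ℝ),
      HasFDerivAt g.1 (g' : (Fin r → ℝ) →L[ℝ] (Fin r → ℝ)) y := by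
  have hsm : ContDiff ℝ ∞ g.1 := g.2
  refine ⟨(LinearEquiv.ofBijective (fderiv ℝ g.1 y).toLinearMap (hg.2 y)).toContinuousLinearEquiv,
    ?_⟩
  exact (hsm.differentiable (by simp) y).hasFDerivAt

theorem SmoothMap.IsOpenEmb.exists_local_inverse {r : ℕ} {g : SmoothMap r r} (hg : g.IsOpenEmb)
    (y : Fin r → ℝ) : ∃ φ : (Fin r → ℝ) → (Fin r → ℝ), ContDiffAt ℝ ∞ φ (g.1 y) ∧
      φ (g.1 y) = y ∧ ∀ᶠ x in nhds (g.1 y), g.1 (φ x) = x := by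
  have hsm : ContDiff ℝ ∞ g.1 := g.2
  obtain ⟨g', hg'⟩ := hg.exists_equiv y
  refine ⟨hsm.contDiffAt.localInverse hg' (by simp), hsm.contDiffAt.to_localInverse hg' (by simp),
    hsm.contDiffAt.localInverse_apply_image hg' (by simp), ?_⟩
  exact (hsm.contDiffAt.hasStrictFDerivAt' hg' (by simp)).eventually_right_inverse

theorem SmoothMap.IsOpenEmb.isOpen_range {r : ℕ} {g : SmoothMap r r} (hg : g.IsOpenEmb) :
    IsOpen (range g.1) := by
  rw [isOpen_iff_mem_nhds]
  rintro _ ⟨y, rfl⟩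
  obtain ⟨φ, _, _, h⟩ := hg.exists_local_inverse y
  filter_upwards [h] with x hx
  exact ⟨φ x, hx⟩

/-- Smoothness can be checked after pulling back along an open embedding in the parameter. -/
theorem SmoothMap.IsOpenEmb.contDiffAt {r s : ℕ} {g : SmoothMap r r} (hg : g.IsOpenEmb)
    {h : (Fin r → ℝ) × (Fin s → ℝ) → ℝ}
    (hh : ContDiff ℝ ∞ fun z : (Fin r → ℝ) × (Fin s → ℝ) => h (g.1 z.1, z.2))
    (y : Fin r → ℝ) (z : Fin s → ℝ) : ContDiffAt ℝ ∞ h (g.1 y, z) := by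
  obtain ⟨φ, h1, _, h3⟩ := hg.exists_local_inverse y
  have h4 : ContDiffAt ℝ ∞ (fun q : (Fin r → ℝ) × (Fin s → ℝ) => h (g.1 (φ q.1), q.2))
      (g.1 y, z) := by
    have : ContDiffAt ℝ ∞ (fun q : (Fin r → ℝ) × (Fin s → ℝ) => (φ q.1, q.2)) (g.1 y, z) :=
      (h1.comp (g.1 y, z) contDiffAt_fst).prodMk contDiffAt_snd
    exact hh.contDiffAt.comp (g.1 y, z) this
  refine h4.congr_of_eventuallyEq ?_
  have := h3.prod_inl_nhds z
  filter_upwards [this] with q hq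
  rw [hq]

section

variable {E : Type u} [AddCommGroup E] [Module ℝ E] {G : GrSpace E} (𝔤 : LInfAlg G)

namespace WordFam

/-- The functionals that vanish on words with less than `n` letters. -/
def filSub (G : GrSpace E) (r n : ℕ) : Submodule (SmoothFn r) (WordFam G r) where
  carrier := {w | ∀ x l, l.length < n → w x l = 0}
  zero_mem' := fun x l _ => rfl
  add_mem' hv hw x l hl := by simp [hv x l hl, hw x l hl]
  smul_mem' f w hw x l hl := by simp [hw x l hl]

/-- Families of functionals on the charts of a cover of the parameter space that agree on overlaps
are restrictions of a family on the whole space; smoothness is local in the parameter. -/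
theorem exists_glue {r : ℕ} {p : ℤ} {T : Type} (g : T → SmoothMap r r) (a : T → WordFam G r)
    (hg : ∀ i, (g i).IsOpenEmb) (hc : ∀ x, ∃ i, x ∈ range (g i).1)
    (ha : ∀ i, a i ∈ homSub G r p)
    (h : ∀ (i j : T) (s : ℕ) (h h' : SmoothMap s r), (g i).comp h = (g j).comp h' →
      pull h (a i) = pull h' (a j)) :
    ∃ b ∈ homSub G r p, ∀ i, pull (g i) b = a i := by
  choose i y hy using hc
  have hb : ∀ j z, a (i ((g j).1 z)) (y ((g j).1 z)) = a j z := by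
    intro j z
    have := h (i ((g j).1 z)) j 0 ⟨fun _ => y ((g j).1 z), contDiff_const⟩
      ⟨fun _ => z, contDiff_const⟩ (Subtype.ext (funext fun _ => hy _))
    exact congrFun this 0
  refine ⟨fun x => a (i x) (y x), ⟨fun x => (ha _).1 _, fun x => (ha _).2.1 _, fun s L => ?_,
    fun x => (ha _).2.2.2 _⟩, fun j => funext fun z => hb j z⟩
  rw [contDiff_iff_contDiffAt]
  rintro ⟨x, z⟩
  have := (hg (i x)).contDiffAt
    (h := fun z => a (i z.1) (y z.1) (L.map (LetterFam.eval z.2))) (s := s)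
    (by simpa only [hb] using (ha (i x)).2.2.1 s L) (y x) z
  rwa [hy] at this

end WordFam

theorem hasFDerivAt_unsh {A X : Type*} [Alphabet A] [NormedAddCommGroup X] [NormedSpace ℝ X]
    {g : X → List A → List A → ℝ} {g' : List A → List A → X →L[ℝ] ℝ} {x : X} {l : List A}
    (h : ∀ S T, HasFDerivAt (fun z => g z S T) (g' S T) x) :
    HasFDerivAt (fun z => unsh l (g z)) (unsh l g') x := by
  induction l generalizing g g' with
  | nil => exact h _ _
  | cons v l ih =>
    exact (ih (g := fun z S T => g z (v :: S) T) fun S T => h _ _).add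
      (ih (g := fun z S T => eps (deg v * tdeg S) • g z S (v :: T))
        fun S T => (h S (v :: T)).const_mul _)

theorem fderiv_unsh {A X : Type*} [Alphabet A] [NormedAddCommGroup X] [NormedSpace ℝ X]
    {g : X → List A → List A → ℝ} {x : X} {l : List A}
    (h : ∀ S T, DifferentiableAt ℝ (fun z => g z S T) x) (v : X) :
    fderiv ℝ (fun z => unsh l (g z)) x v =
      unsh l (fun S T => fderiv ℝ (fun z => g z S T) x v) := by
  rw [(hasFDerivAt_unsh fun S T => (h S T).hasFDerivAt).fderiv]
  exact map_unsh (ContinuousLinearMap.apply ℝ ℝ v).toLinearMap l _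

namespace WordFam

theorem gsymm_of_mem {r : ℕ} {w : WordFam G r} (hw : w ∈ obsSub G r) (x : Fin r → ℝ) :
    GSymm (w x) := by
  refine obsSub_induction (P := fun w => GSymm (w x)) hw (fun p w hw => hw.1 x)
    (fun l₁ a b l₂ => by simp) fun v w hv hw l₁ a b l₂ => ?_
  simp only [add_apply, ShuffleAlg.add_apply, hv l₁ a b l₂, hw l₁ a b l₂, smul_add]

theorem headLin_of_mem {r : ℕ} {w : WordFam G r} (hw : w ∈ obsSub G r) (x : Fin r → ℝ) :
    HeadLin (w x) := by
  refine obsSub_induction (P := fun w => HeadLin (w x)) hw (fun p w hw => hw.2.1 x)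
    (fun l k => ⟨0, fun _ _ => rfl⟩) fun v w hv hw l k => ?_
  obtain ⟨Λ, hΛ⟩ := hv l k
  obtain ⟨Λ', hΛ'⟩ := hw l k
  exact ⟨Λ + Λ', fun a ha => by simp [hΛ a ha, hΛ' a ha]⟩

theorem slotLin_of_mem {r : ℕ} {w : WordFam G r} (hw : w ∈ obsSub G r) (x : Fin r → ℝ) :
    SlotLin (w x) := (headLin_of_mem hw x).slotLin (gsymm_of_mem hw x)

/-- The value of the differential on words with at most `n` letters depends only on the values of
the functional on words with at most `n` letters, as there is no bracket of arity zero. -/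
theorem ce_congr {v w : ShuffleAlg (Letter G)} (hv : HeadLin v) (hw : HeadLin w)
    (l : List (Letter G))
    (h : ∀ S T, (S ++ T).Perm l → S ≠ [] → v (𝔤.br S :: T) = w (𝔤.br S :: T)) :
    𝔤.ce v l = 𝔤.ce w l := by
  refine unsh_congr fun S T hST => ?_
  by_cases hS : S = []
  · subst hS
    have h0 : (𝔤.br ([] : List (Letter G))).val = (0 : ℝ) • (𝔤.br ([] : List (Letter G))).val := by
      rw [zero_smul]
      exact 𝔤.op_zero _
    rw [hv.map_smul' 0 rfl h0, hw.map_smul' 0 rfl h0, zero_mul, zero_mul]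
  · exact h S T hST hS

theorem length_br_cons {S T l : List (Letter G)} (h : (S ++ T).Perm l) (hS : S ≠ []) :
    (𝔤.br S :: T).length ≤ l.length := by
  rw [← h.length_eq, List.length_append, List.length_cons]
  have := List.length_pos_iff.2 hS
  omega

variable (G) in
/-- The space of smooth families of observables, of all degrees. -/
def Obs (r : ℕ) : Type u := obsSub G r

instance (r : ℕ) : AddCommGroup (Obs G r) := inferInstanceAs (AddCommGroup (obsSub G r))
instance (r : ℕ) : Module (SmoothFn r) (Obs G r) := (obsSub G r).module

variable (G) in
/-- The underlying functions on words. -/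
def Obs.incl (r : ℕ) : Obs G r →ₗ[SmoothFn r] WordFam G r := (obsSub G r).subtype

theorem Obs.val_sum {r : ℕ} {ι : Type*} (s : Finset ι) (a : ι → Obs G r) :
    (∑ i ∈ s, a i).1 = ∑ i ∈ s, (a i).1 :=
  map_sum (Obs.incl G r) a s

protected theorem Obs.ext {r : ℕ} {a b : Obs G r} (h : ∀ x l, a.1 x l = b.1 x l) : a = b :=
  Subtype.ext (ext₂ h)

variable (G) in
/-- The functionals of degree `p` in the space of all functionals. -/
def homObs (r : ℕ) (p : ℤ) : Submodule (SmoothFn r) (Obs G r) :=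
  (homSub G r p).comap (Obs.incl G r)

variable (G) in
/-- The functionals that vanish on words with less than `n` letters. -/
def filObs (r n : ℕ) : Submodule (SmoothFn r) (Obs G r) :=
  (filSub G r n).comap (Obs.incl G r)

theorem mem_homObs {r : ℕ} {p : ℤ} {a : Obs G r} : a ∈ homObs G r p ↔ a.1 ∈ homSub G r p :=
  Iff.rfl

theorem mem_filObs {r n : ℕ} {a : Obs G r} :
    a ∈ filObs G r n ↔ ∀ x l, l.length < n → a.1 x l = 0 := Iff.rfl

/-- Pullback of observables. -/
def pullObs {r s : ℕ} (g : SmoothMap s r) : Obs G r →+ Obs G s where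
  toFun a := ⟨pull g a.1, pull_mem_obs g a.2⟩
  map_zero' := rfl
  map_add' _ _ := rfl

/-- Partial derivatives of observables. -/
def pdObs {r : ℕ} (i : Fin r) : Obs G r →+ Obs G r where
  toFun a := ⟨pdFun i a.1, pd_mem_obs i a.2⟩
  map_zero' := Obs.ext (fun x l => by
    change fderiv ℝ (fun _ => (0 : ℝ)) x _ = 0
    simp)
  map_add' a b := Subtype.ext (pdFun_add i a.2 b.2)

/-- The differential of observables. -/
def dObs {r : ℕ} : Obs G r →ₗ[SmoothFn r] Obs G r :=
  ((d 𝔤).comp (obsSub G r).subtype).codRestrict _ fun a => d_mem_obs 𝔤 a.2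

/-- The component of degree `p` of an observable. -/
def Obs.comp {r : ℕ} (p : ℤ) (a : Obs G r) : Obs G r :=
  ⟨WordFam.comp p a.1, homSub_le p (comp_mem a.2 p)⟩

theorem Obs.comp_mem {r : ℕ} (p : ℤ) (a : Obs G r) : a.comp p ∈ homObs G r p :=
  WordFam.comp_mem a.2 p

theorem Obs.exists_eq_sum {r : ℕ} (a : Obs G r) : ∃ s : Finset ℤ, a = ∑ p ∈ s, a.comp p := by
  obtain ⟨s, hs⟩ := exists_eq_sum_comp a.2
  have h : (∑ p ∈ s, a.comp p).1 = ∑ p ∈ s, WordFam.comp p a.1 := Obs.val_sum s fun p => a.comp p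
  exact ⟨s, Subtype.ext (hs.trans h.symm)⟩

theorem homObs_internal (r : ℕ) : DirectSum.IsInternal (homObs G r) := by
  classical
  refine DirectSum.isInternal_submodule_of_iSupIndep_of_iSup_eq_top ?_ ?_
  · rw [iSupIndep_def]
    intro p
    rw [disjoint_iff_inf_le]
    rintro a ⟨ha, ha'⟩
    have h : comp p a.1 = 0 := by
      have : ∀ b ∈ ⨆ j, ⨆ (_ : j ≠ p), homObs G r j, comp p b.1 = 0 := by
        intro b hb
        refine Submodule.iSup_induction _ (motive := fun b => comp p b.1 = 0) hb
          (fun j b hb => ?_) (map_zero _) fun b c hb hc => ?_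
        · by_cases hj : j = p
          · simp only [hj, ne_eq, not_true_eq_false, iSup_false, Submodule.mem_bot] at hb
            rw [hb]
            exact map_zero _
          · simp only [ne_eq, hj, not_false_eq_true, iSup_pos] at hb
            rw [comp_of_mem (mem_homObs.1 hb), if_neg (Ne.symm hj)]
        · change comp p (b.1 + c.1) = 0
          rw [map_add, hb, hc, add_zero]
      exact this a ha'
    rw [comp_of_mem (mem_homObs.1 ha), if_pos rfl] at h
    exact Subtype.ext h
  · refine eq_top_iff.2 fun a _ => ?_
    obtain ⟨s, hs⟩ := a.exists_eq_sum
    rw [hs]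
    exact sum_mem fun p _ => Submodule.mem_iSup_of_mem p (a.comp_mem p)

theorem filObs_graded (r n : ℕ) : filObs G r n = ⨆ p, filObs G r n ⊓ homObs G r p := by
  refine le_antisymm (fun a ha => ?_) (iSup_le fun p => inf_le_left)
  obtain ⟨s, hs⟩ := a.exists_eq_sum
  rw [hs]
  refine sum_mem fun p _ => Submodule.mem_iSup_of_mem p
    ⟨mem_filObs.2 fun x l hl => ?_, a.comp_mem p⟩
  refine (comp_apply p a.1 x l).trans ?_
  rw [mem_filObs.1 ha x l hl, ite_self]

theorem pdObs_smul {r : ℕ} (i : Fin r) (f : SmoothFn r) (a : Obs G r) :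
    pdObs i (f • a) = SmoothFn.pd i f • a + f • pdObs i a := by
  refine Obs.ext (fun x l => ?_)
  have hf : ContDiff ℝ ∞ f.1 := f.2
  change fderiv ℝ (fun y => f.1 y * a.1 y l) x _ =
    fderiv ℝ f.1 x (Pi.single i 1) * a.1 x l + f.1 x * fderiv ℝ (fun y => a.1 y l) x _
  rw [fderiv_fun_mul (hf.differentiable (by simp) x) (diff_of_mem a.2 l x)]
  simp
  ring

theorem pdObs_comm {r : ℕ} (i j : Fin r) (a : Obs G r) :
    pdObs i (pdObs j a) = pdObs j (pdObs i a) := by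
  refine Obs.ext (fun x l => ?_)
  have h : ContDiff ℝ ∞ fun y => a.1 y l := (smooth_of_mem a.2).apply l
  have h' : Differentiable ℝ (fderiv ℝ fun y => a.1 y l) :=
    (h.fderiv_right (m := ∞) (by norm_cast)).differentiable (by simp)
  have e : ∀ v w : Fin r → ℝ, fderiv ℝ (fun y => fderiv ℝ (fun y => a.1 y l) y v) x w =
      fderiv ℝ (fderiv ℝ fun y => a.1 y l) x w v := by
    intro v w
    rw [fderiv_clm_apply (h' x) (differentiableAt_const v)]
    simp
  change fderiv ℝ (fun y => fderiv ℝ (fun y => a.1 y l) y _) x _ =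
    fderiv ℝ (fun y => fderiv ℝ (fun y => a.1 y l) y _) x _
  rw [e, e]
  exact (h.contDiffAt.isSymmSndFDerivAt (by simp; norm_cast)).eq _ _

theorem pdObs_pullObs {r s : ℕ} (g : SmoothMap s r) (j : Fin s) (a : Obs G r) :
    pdObs j (pullObs g a) = ∑ i, SmoothFn.pd j (g.coord i) • pullObs g (pdObs i a) := by
  refine Obs.ext (fun x l => ?_)
  have hg : ContDiff ℝ ∞ g.1 := g.2
  have hg' : DifferentiableAt ℝ g.1 x := hg.differentiable (by simp) x
  have h1 : fderiv ℝ (fun y => a.1 (g.1 y) l) x =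
      (fderiv ℝ (fun y => a.1 y l) (g.1 x)).comp (fderiv ℝ g.1 x) :=
    fderiv_comp (g := fun y => a.1 y l) x (diff_of_mem a.2 l _) hg'
  have h2 : ∀ i, fderiv ℝ (fun y => g.1 y i) x (Pi.single j 1) =
      fderiv ℝ g.1 x (Pi.single j 1) i := by
    intro i
    have := (hasFDerivAt_pi'.1 hg'.hasFDerivAt i).fderiv
    rw [this]
    rfl
  have h3 : fderiv ℝ g.1 x (Pi.single j 1) =
      ∑ i, fderiv ℝ g.1 x (Pi.single j 1) i • (Pi.single i 1 : Fin r → ℝ) := by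
    conv_lhs => rw [← Finset.univ_sum_single (fderiv ℝ g.1 x (Pi.single j 1))]
    refine Finset.sum_congr rfl fun i _ => ?_
    rw [← Pi.single_smul, smul_eq_mul, mul_one]
  rw [Obs.val_sum, WordFam.sum_apply]
  change fderiv ℝ (fun y => a.1 (g.1 y) l) x _ = ∑ i, fderiv ℝ (fun y => g.1 y i) x _ *
    fderiv ℝ (fun y => a.1 y l) (g.1 x) _
  rw [h1, ContinuousLinearMap.comp_apply]
  conv_lhs => rw [h3]
  simp only [map_sum, map_smul, smul_eq_mul, h2]

theorem dObs_dObs {r : ℕ} (a : Obs G r) : dObs 𝔤 (dObs 𝔤 a) = 0 :=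
  Obs.ext (fun x l => 𝔤.ce_ce (gsymm_of_mem a.2 x) (headLin_of_mem a.2 x) l)

theorem dObs_pdObs {r : ℕ} (i : Fin r) (a : Obs G r) :
    dObs 𝔤 (pdObs i a) = pdObs i (dObs 𝔤 a) := by
  refine Obs.ext (fun x l => ?_)
  exact (fderiv_unsh (fun S T => diff_of_mem a.2 _ x) _).symm

theorem dObs_mem_filObs {r n : ℕ} {a : Obs G r} (ha : a ∈ filObs G r n) :
    dObs 𝔤 a ∈ filObs G r n := by
  refine mem_filObs.2 fun x l hl => ?_
  refine (ce_congr 𝔤 (w := 0) (headLin_of_mem a.2 x) (fun _ _ => ⟨0, fun _ _ => rfl⟩) l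
    fun S T hST hS => ?_).trans (unsh_zero l)
  exact ha x _ ((length_br_cons 𝔤 hST hS).trans_lt hl)

/-- Completeness: the value of a Cauchy sequence on a word becomes constant as soon as the index
exceeds the number of letters. -/
theorem filObs_complete (r : ℕ) (p : ℤ) (a : ℕ → Obs G r) (ha : ∀ n, a n ∈ homObs G r p)
    (h : ∀ n, a (n + 1) - a n ∈ filObs G r n) :
    ∃! b, b ∈ homObs G r p ∧ ∀ n, b - a n ∈ filObs G r n := by
  have h1 : ∀ (x) (l : List (Letter G)) (n k : ℕ), l.length < n →
      (a (n + k)).1 x l = (a n).1 x l := by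
    intro x l n k hl
    induction k with
    | zero => rfl
    | succ k ih =>
      rw [← ih, ← sub_eq_zero]
      exact h (n + k) x l (by omega)
  have h2 : ∀ (x) (l : List (Letter G)) (n m : ℕ), l.length < n → l.length < m →
      (a n).1 x l = (a m).1 x l := by
    intro x l n m hn hm
    rw [← h1 x l n m hn, ← h1 x l m n hm, add_comm]
  -- The approximation with index `l.length + 1` is already exact on `l`.
  let b : WordFam G r := fun x l => (a (l.length + 1)).1 x l
  have hb : b ∈ homSub G r p := by
    refine ⟨fun x l₁ c c' l₂ => ?_, fun x l k => ?_, fun s L => ?_, fun x l hl => ?_⟩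
    · refine ((ha _).1 x l₁ c c' l₂).trans ?_
      congr 1
      exact h2 _ _ _ _ (by simp) (by simp)
    · obtain ⟨Λ, hΛ⟩ := (ha (l.length + 2)).2.1 x l k
      exact ⟨Λ, hΛ⟩
    · have := (ha (L.length + 1)).2.2.1 s L
      simp only [b, List.length_map]
      exact this
    · exact (ha _).2.2.2 x l hl
  refine ⟨⟨b, homSub_le p hb⟩, ⟨hb, fun n x l hl => ?_⟩, fun c hc => ?_⟩
  · exact sub_eq_zero.2 (h2 x l _ _ (by simp) hl)
  · refine Obs.ext (fun x l => ?_)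
    exact sub_eq_zero.1 (hc.2 (l.length + 1) x l (by simp))

end WordFam

open WordFam in
/-- The Chevalley–Eilenberg complex of graded symmetric functionals, filtered by the number of
arguments. -/
def LInfAlg.obs : DiffComplex.{u} where
  carrier r := Obs G r
  hom := homObs G
  hom_internal := homObs_internal
  pull := pullObs
  pull_id _ := rfl
  pull_comp _ _ _ := rfl
  pull_smul _ _ _ := rfl
  pull_hom g _ _ ha := pull_mem g ha
  separated r p a ha h := by
    refine Obs.ext (fun x l => ?_)
    obtain ⟨g, _, ⟨y, rfl⟩, h⟩ := h x
    exact congrFun (congrFun (congrArg Subtype.val h) y) l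
  glue r p T g a hg hc ha h := by
    obtain ⟨b, hb, hb'⟩ := exists_glue g (fun i => (a i).1) hg hc ha
      fun i j s k k' e => congrArg Subtype.val (h i j s k k' e)
    exact ⟨⟨b, homSub_le p hb⟩, hb, fun i => Subtype.ext (hb' i)⟩
  pd := pdObs
  pd_smul := pdObs_smul
  pd_comm := pdObs_comm
  pd_pull := pdObs_pullObs
  pd_hom i _ _ ha := pdFun_mem i ha
  d := dObs 𝔤
  d_hom _ _ ha := ce_mem_homSub 𝔤 ha
  d_d := dObs_dObs 𝔤
  d_pull _ _ := rfl
  d_pd := dObs_pdObs 𝔤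
  fil := filObs G
  fil_zero r := by
    refine eq_top_iff.2 fun a _ => mem_filObs.2 fun x l hl => ?_
    simp at hl
  fil_anti r m n hmn a ha x l hl := ha x l (hl.trans_le hmn)
  fil_graded := filObs_graded
  fil_pull g n a ha y l hl := ha _ l hl
  fil_local r n a h x l hl := by
    obtain ⟨g, _, ⟨y, rfl⟩, h⟩ := h x
    exact h y l hl
  fil_pd i n a ha x l hl := by
    change fderiv ℝ (fun y => a.1 y l) x _ = 0
    have : (fun y => a.1 y l) = fun _ => 0 := funext fun y => ha y l hl
    rw [this]
    simp
  fil_d r n a ha := dObs_mem_filObs 𝔤 ha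
  fil_complete := filObs_complete

end

/-! ### The prefactorization algebra of a sheaf of `L∞` algebras -/

theorem ofFn_sigma {X : Type*} {k : ℕ} (n : Fin k → ℕ) (f : ∀ i, Fin (n i) → X) :
    List.ofFn (fun x : Fin (∑ i, n i) => f (finSigmaFinEquiv.symm x).1 (finSigmaFinEquiv.symm x).2) =
      (List.ofFn fun i => List.ofFn (f i)).flatten := by
  induction k with
  | zero => simp
  | succ k ih =>
    have h1 := ih (fun i => n i.castSucc) (fun i => f i.castSucc)
    rw [List.ofFn_succ_last, List.flatten_append, ← h1]
    simp only [List.flatten_cons, List.flatten_nil, List.append_nil]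
    rw [← List.ofFn_fin_append]
    rw [List.ofFn_congr (Fin.sum_univ_castSucc n)]
    congr 1
    funext x
    induction x using Fin.addCases with
    | left x =>
      rw [Fin.append_left]
      have : finSigmaFinEquiv.symm (Fin.cast (Fin.sum_univ_castSucc n).symm
          (Fin.castAdd (n (Fin.last k)) x)) = (⟨(finSigmaFinEquiv.symm x).1.castSucc,
            (finSigmaFinEquiv.symm x).2⟩ : (i : Fin (k + 1)) × Fin (n i)) := by
        rw [Equiv.symm_apply_eq, Fin.ext_iff, finSigmaFinEquiv_apply]
        have := finSigmaFinEquiv_apply (finSigmaFinEquiv.symm x)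
        rw [Equiv.apply_symm_apply] at this
        simp only [Fin.val_cast, Fin.val_castAdd]
        exact this
      rw [this]
    | right x =>
      rw [Fin.append_right]
      have : finSigmaFinEquiv.symm (Fin.cast (Fin.sum_univ_castSucc n).symm
          (Fin.natAdd (∑ i : Fin k, n i.castSucc) x)) =
            (⟨Fin.last k, x⟩ : (i : Fin (k + 1)) × Fin (n i)) := by
        rw [Equiv.symm_apply_eq, Fin.ext_iff, finSigmaFinEquiv_apply]
        simp only [Fin.val_cast, Fin.val_natAdd]
        rfl
      rw [this]

theorem prod_ofFn_sigma {X : Type*} [Monoid X] {k : ℕ} (n : Fin k → ℕ) (f : ∀ i, Fin (n i) → X) :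
    (List.ofFn fun i => (List.ofFn (f i)).prod).prod =
      (List.ofFn (fun x : Fin (∑ i, n i) =>
        f (finSigmaFinEquiv.symm x).1 (finSigmaFinEquiv.symm x).2)).prod := by
  rw [ofFn_sigma, List.prod_flatten, List.map_ofFn]
  rfl

theorem ofFn_update_zero {X : Type*} {k : ℕ} (a : Fin (k + 1) → X) (z : X) :
    List.ofFn (Function.update a 0 z) = z :: List.ofFn fun i => a i.succ := by
  rw [List.ofFn_succ]
  simp

theorem ofFn_update_succ {X : Type*} {k : ℕ} (a : Fin (k + 1) → X) (i : Fin k) (z : X) :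
    List.ofFn (Function.update a i.succ z) =
      a 0 :: List.ofFn (Function.update (fun i => a i.succ) i z) := by
  rw [List.ofFn_succ, Function.update_of_ne (Fin.succ_ne_zero i).symm]
  congr 2
  funext j
  by_cases h : j = i
  · subst h
    simp
  · rw [Function.update_of_ne h, Function.update_of_ne (by simpa using h)]

theorem sum_Iio_succ {k : ℕ} {Y : Type*} [AddCommMonoid Y] (i : Fin k) (p : Fin (k + 1) → Y) :
    ∑ j ∈ Finset.Iio i.succ, p j = p 0 + ∑ j ∈ Finset.Iio i, p j.succ := by
  rw [← Finset.sum_filter_add_sum_filter_not (Finset.Iio i.succ) (· = 0)]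
  congr 1
  · rw [Finset.sum_eq_single_of_mem (0 : Fin (k + 1)) (by simp)]
    intro b hb hb'
    exact absurd (Finset.mem_filter.1 hb).2 hb'
  · symm
    refine Finset.sum_nbij Fin.succ (by simp) (Fin.succ_injective _).injOn ?_ (by simp)
    intro b hb
    obtain ⟨hb, hb'⟩ := Finset.mem_filter.1 hb
    obtain ⟨c, rfl⟩ := Fin.exists_succ_eq.2 hb'
    exact ⟨c, by simpa using hb, rfl⟩

namespace ShuffleAlg

variable {A A' : Type*} [Alphabet A] [Alphabet A']

/-- Precomposition with a degree preserving map of alphabets. -/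
def comap (φ : A → A') (hφ : ∀ a, deg (φ a) = deg a) : ShuffleAlg A' →+* ShuffleAlg A where
  toFun f := fun l => f (l.map φ)
  map_zero' := rfl
  map_add' _ _ := rfl
  map_one' := ShuffleAlg.ext fun l => by simp [one_apply]
  map_mul' f g := ShuffleAlg.ext fun l => unsh_map hφ l _

/-- Homogeneous elements of the shuffle algebra with their degrees. -/
structure HomElt (A : Type*) [Alphabet A] where
  degree : ℤ
  val : ShuffleAlg A
  isHom : IsHom degree val

instance : Alphabet (HomElt A) := ⟨HomElt.degree⟩

/-- Products of homogeneous functionals are graded commutative. -/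
theorem prod_homElt_gsymm : GSymm fun l : List (HomElt A) => (l.map HomElt.val).prod := by
  intro l₁ a b l₂
  simp only [List.map_append, List.map_cons, List.prod_append, List.prod_cons]
  rw [← mul_assoc a.val, a.isHom.mul_comm b.isHom, smul_mul, mul_smul, mul_assoc]
  rfl

theorem prod_ofFn_perm {k : ℕ} {a : Fin k → ShuffleAlg A} {p : Fin k → ℤ}
    (ha : ∀ i, IsHom (p i) (a i)) (σ : Equiv.Perm (Fin k)) :
    (List.ofFn a).prod = (koszul σ p : ℝ) • (List.ofFn fun i => a (σ i)).prod := by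
  have := prod_homElt_gsymm.perm (fun i => (⟨p i, a i, ha i⟩ : HomElt A)) σ
  simp only [List.map_ofFn] at this
  exact this

end ShuffleAlg

section

variable {E : Type u} [AddCommGroup E] [Module ℝ E] {G : GrSpace E} (𝔤 : LInfAlg G)

theorem LInfAlg.ce_one : 𝔤.ce 1 = 0 :=
  ShuffleAlg.ext fun l => unsh_eq_zero fun S T _ => by simp [ShuffleAlg.one_apply]

theorem LInfAlg.ce_prod {k : ℕ} {a : Fin k → ShuffleAlg (Letter G)} {p : Fin k → ℤ}
    (ha : ∀ i, ShuffleAlg.IsHom (p i) (a i)) :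
    𝔤.ce (List.ofFn a).prod = ∑ i, eps (∑ j ∈ Finset.Iio i, p j) •
      (List.ofFn (Function.update a i (𝔤.ce (a i)))).prod := by
  induction k with
  | zero => simp [ce_one]
  | succ k ih =>
    rw [List.ofFn_succ, List.prod_cons, 𝔤.ce_mul (ha 0), ih fun i => ha i.succ,
      Fin.sum_univ_succ, ofFn_update_zero, List.prod_cons]
    congr 1
    · rw [show (Finset.Iio (0 : Fin (k + 1))) = ∅ from rfl, Finset.sum_empty, eps_zero, one_smul]
    · rw [Finset.mul_sum, Finset.smul_sum]
      refine Finset.sum_congr rfl fun i _ => ?_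
      rw [ofFn_update_succ, List.prod_cons, ShuffleAlg.mul_smul, smul_smul, ← eps_add]
      rw [sum_Iio_succ]

namespace WordFam

variable {r : ℕ}

/-- Evaluation at a parameter. -/
def evalHom (x : Fin r → ℝ) : WordFam G r →+* ShuffleAlg (Letter G) where
  toFun w := w x
  map_zero' := rfl
  map_one' := rfl
  map_add' _ _ := rfl
  map_mul' _ _ := rfl

theorem prod_ofFn_apply {k : ℕ} (a : Fin k → WordFam G r) (x : Fin r → ℝ) :
    (List.ofFn a).prod x = (List.ofFn fun i => a i x).prod := by
  have := map_list_prod (evalHom x) (List.ofFn a)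
  rw [List.map_ofFn] at this
  exact this

theorem prod_mem_obsSub {k : ℕ} {a : Fin k → WordFam G r} (ha : ∀ i, a i ∈ obsSub G r) :
    (List.ofFn a).prod ∈ obsSub G r := by
  induction k with
  | zero => simpa using homSub_le 0 one_mem_homSub
  | succ k ih =>
    rw [List.ofFn_succ, List.prod_cons]
    exact mul_mem_obsSub (ha 0) (ih fun i => ha i.succ)

theorem prod_mem_homSub {k : ℕ} {a : Fin k → WordFam G r} {p : Fin k → ℤ}
    (ha : ∀ i, a i ∈ homSub G r (p i)) : (List.ofFn a).prod ∈ homSub G r (∑ i, p i) := by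
  induction k with
  | zero => simpa using one_mem_homSub
  | succ k ih =>
    rw [List.ofFn_succ, List.prod_cons, Fin.sum_univ_succ]
    exact mul_mem_homSub (ha 0) (ih fun i => ha i.succ)

theorem mul_mem_filSub {m n : ℕ} {v w : WordFam G r} (hv : v ∈ filSub G r m)
    (hw : w ∈ filSub G r n) : v * w ∈ filSub G r (m + n) := by
  intro x l hl
  refine unsh_eq_zero fun S T hST => ?_
  have := hST.length_eq
  rw [List.length_append] at this
  by_cases h : S.length < m
  · rw [hv x S h, zero_mul]
  · rw [hw x T (by omega), mul_zero]

theorem prod_mem_filSub {k : ℕ} {a : Fin k → WordFam G r} {n : Fin k → ℕ}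
    (ha : ∀ i, a i ∈ filSub G r (n i)) : (List.ofFn a).prod ∈ filSub G r (∑ i, n i) := by
  induction k with
  | zero =>
    intro x l hl
    simp at hl
  | succ k ih =>
    rw [List.ofFn_succ, List.prod_cons, Fin.sum_univ_succ]
    exact mul_mem_filSub (ha 0) (ih fun i => ha i.succ)

theorem pdFun_mul (i : Fin r) {v w : WordFam G r} (hv : v ∈ obsSub G r) (hw : w ∈ obsSub G r) :
    pdFun i (v * w) = pdFun i v * w + v * pdFun i w := by
  refine ext₂ fun x l => ?_
  refine (fderiv_unsh (g := fun y S T => v y S * w y T)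
    (fun S T => (diff_of_mem hv S x).mul (diff_of_mem hw T x)) _).trans ?_
  rw [add_apply, mul_apply, mul_apply, ShuffleAlg.add_apply, ShuffleAlg.mul_apply,
    ShuffleAlg.mul_apply, ← unsh_add]
  congr 1
  funext S T
  rw [fderiv_fun_mul (diff_of_mem hv S x) (diff_of_mem hw T x)]
  simp only [pdFun, _root_.add_apply, _root_.smul_apply, smul_eq_mul]
  ring

theorem pdFun_one (i : Fin r) : pdFun i (1 : WordFam G r) = 0 := by
  refine ext₂ fun x l => ?_
  change fderiv ℝ (fun _ => (1 : ShuffleAlg (Letter G)) l) x _ = 0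
  simp

theorem pdFun_prod (j : Fin r) {k : ℕ} {a : Fin k → WordFam G r} (ha : ∀ i, a i ∈ obsSub G r) :
    pdFun j (List.ofFn a).prod =
      ∑ i, (List.ofFn (Function.update a i (pdFun j (a i)))).prod := by
  induction k with
  | zero => simp [pdFun_one]
  | succ k ih =>
    rw [List.ofFn_succ, List.prod_cons, pdFun_mul j (ha 0) (prod_mem_obsSub fun i => ha i.succ),
      ih fun i => ha i.succ, Fin.sum_univ_succ, ofFn_update_zero, List.prod_cons, Finset.mul_sum]
    simp only [ofFn_update_succ, List.prod_cons]

end WordFam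

end

/-- A morphism of graded spaces with smooth families. -/
structure GrHom {E E' : Type u} [AddCommGroup E] [Module ℝ E] [AddCommGroup E'] [Module ℝ E']
    (G : GrSpace E) (G' : GrSpace E') where
  toFun : E →ₗ[ℝ] E'
  pr : ∀ k e, G'.pr k (toFun e) = toFun (G.pr k e)
  plot : ∀ s, ∀ v ∈ G.plot s, (fun y => toFun (v y)) ∈ G'.plot s

namespace GrHom

variable {E E' : Type u} [AddCommGroup E] [Module ℝ E] [AddCommGroup E'] [Module ℝ E']
  {G : GrSpace E} {G' : GrSpace E'} (φ : GrHom G G')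

/-- The induced map of letters. -/
def letter (a : Letter G) : Letter G' := ⟨a.degree, φ.toFun a.val, by rw [φ.pr, a.homog]⟩

/-- The induced map of families of letters. -/
def letterFam {s : ℕ} (a : LetterFam G s) : LetterFam G' s :=
  ⟨a.degree, fun y => φ.toFun (a.val y), fun y => by rw [φ.pr, a.homog], φ.plot s _ a.plot⟩

theorem deg_letter (a : Letter G) : deg (φ.letter a) = deg a := rfl

/-- Pullback of functions on words. -/
def shuffle : ShuffleAlg (Letter G') →+* ShuffleAlg (Letter G) :=
  ShuffleAlg.comap φ.letter φ.deg_letter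

theorem shuffle_apply (f : ShuffleAlg (Letter G')) (l : List (Letter G)) :
    φ.shuffle f l = f (l.map φ.letter) := rfl

/-- Pullback of families of functions on words. -/
def word (r : ℕ) : WordFam G' r →ₗ[SmoothFn r] WordFam G r where
  toFun w := fun x => φ.shuffle (w x)
  map_add' _ _ := rfl
  map_smul' _ _ := rfl

theorem word_apply {r : ℕ} (w : WordFam G' r) (x : Fin r → ℝ) :
    φ.word r w x = φ.shuffle (w x) := rfl

theorem word_mem_homSub {r : ℕ} {p : ℤ} {w : WordFam G' r} (hw : w ∈ WordFam.homSub G' r p) :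
    φ.word r w ∈ WordFam.homSub G r p := by
  obtain ⟨h1, h2, h3, h4⟩ := hw
  refine ⟨fun x l₁ a b l₂ => ?_, fun x l k => ?_, fun s L => ?_, fun x l hl => ?_⟩
  · rw [word_apply, shuffle_apply, shuffle_apply, List.map_append, List.map_append]
    exact h1 x _ (φ.letter a) (φ.letter b) _
  · obtain ⟨Λ, hΛ⟩ := h2 x (l.map φ.letter) k
    exact ⟨Λ.comp φ.toFun, fun a ha => hΛ (φ.letter a) ha⟩
  · have := h3 s (L.map φ.letterFam)
    simp only [List.map_map] at this
    simp only [word_apply, shuffle_apply, List.map_map]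
    exact this
  · refine h4 x _ ?_
    rwa [tdeg_map φ.deg_letter]

theorem word_mem_obsSub {r : ℕ} {w : WordFam G' r} (hw : w ∈ WordFam.obsSub G' r) :
    φ.word r w ∈ WordFam.obsSub G r := by
  refine WordFam.obsSub_induction (P := fun w => φ.word r w ∈ WordFam.obsSub G r) hw
    (fun p w hw => WordFam.homSub_le _ (φ.word_mem_homSub hw)) (by simp) fun v w hv hw => ?_
  rw [map_add]
  exact add_mem hv hw

/-- The morphism is a strict morphism of `L∞` algebras. -/
def IsStrict (𝔤 : LInfAlg G) (𝔤' : LInfAlg G') : Prop :=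
  ∀ k v, φ.toFun (𝔤.op k v) = 𝔤'.op k (fun i => φ.toFun (v i))

variable {φ} in
theorem IsStrict.br {𝔤 : LInfAlg G} {𝔤' : LInfAlg G'} (h : φ.IsStrict 𝔤 𝔤')
    (l : List (Letter G)) : φ.letter (𝔤.br l) = 𝔤'.br (l.map φ.letter) := by
  refine Letter.ext' ?_ ?_
  · change tdeg l + 1 = tdeg _ + 1
    rw [tdeg_map φ.deg_letter]
  · refine (h _ _).trans ?_
    refine Eq.trans ?_ (𝔤'.opw_eq (l.map φ.letter) (List.length_map _)).symm
    congr 1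
    funext i
    simp [GrHom.letter, vals]

variable {φ} in
theorem IsStrict.ce {𝔤 : LInfAlg G} {𝔤' : LInfAlg G'} (h : φ.IsStrict 𝔤 𝔤')
    (f : ShuffleAlg (Letter G')) : 𝔤.ce (φ.shuffle f) = φ.shuffle (𝔤'.ce f) := by
  refine ShuffleAlg.ext fun l => ?_
  rw [shuffle_apply, LInfAlg.ce, LInfAlg.ce, unsh_map φ.deg_letter]
  simp only [shuffle_apply, List.map_cons, h.br]

end GrHom

/-- A presheaf of `L∞` algebras with smooth families. -/
structure LInfPresheaf (M : Type u) [TopologicalSpace M] where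
  E : Opens M → Type u
  [acg : ∀ U, AddCommGroup (E U)]
  [mod : ∀ U, Module ℝ (E U)]
  gr : ∀ U, GrSpace (E U)
  alg : ∀ U, LInfAlg (gr U)
  res : ∀ {U V : Opens M}, U ≤ V → GrHom (gr V) (gr U)
  res_self : ∀ {U : Opens M} (h : U ≤ U) (e : E U), (res h).toFun e = e
  res_res : ∀ {U V W : Opens M} (h : U ≤ V) (h' : V ≤ W) (e : E W),
    (res h).toFun ((res h').toFun e) = (res (h.trans h')).toFun e
  strict : ∀ {U V : Opens M} (h : U ≤ V), (res h).IsStrict (alg V) (alg U)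

attribute [instance] LInfPresheaf.acg LInfPresheaf.mod

namespace LInfPresheaf

open WordFam

variable {M : Type u} [TopologicalSpace M] (P : LInfPresheaf M)

theorem letter_self {U : Opens M} (h : U ≤ U) (a : Letter (P.gr U)) : (P.res h).letter a = a :=
  Letter.ext' rfl (P.res_self h _)

theorem letter_letter {U V W : Opens M} (h : U ≤ V) (h' : V ≤ W) (a : Letter (P.gr W)) :
    (P.res h).letter ((P.res h').letter a) = (P.res (h.trans h')).letter a :=
  Letter.ext' rfl (P.res_res h h' _)

theorem shuffle_self {U : Opens M} (h : U ≤ U) (f : ShuffleAlg (Letter (P.gr U))) :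
    (P.res h).shuffle f = f := by
  refine ShuffleAlg.ext fun l => ?_
  rw [GrHom.shuffle_apply]
  congr 1
  exact (List.map_congr_left fun a _ => P.letter_self h a).trans (List.map_id l)

theorem shuffle_shuffle {U V W : Opens M} (h : U ≤ V) (h' : V ≤ W)
    (f : ShuffleAlg (Letter (P.gr U))) :
    (P.res h').shuffle ((P.res h).shuffle f) = (P.res (h.trans h')).shuffle f := by
  refine ShuffleAlg.ext fun l => ?_
  simp only [GrHom.shuffle_apply, List.map_map]
  congr 1
  exact List.map_congr_left fun a _ => P.letter_letter h h' a

/-- The product of observables on `U₁, …, U_k` in the observables on `V`. -/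
def mulObs {k : ℕ} (U : Fin k → Opens M) (V : Opens M) (hV : ∀ i, U i ≤ V) (r : ℕ) :
    MultilinearMap (SmoothFn r) (fun i => Obs (P.gr (U i)) r) (Obs (P.gr V) r) :=
  ((MultilinearMap.mkPiAlgebraFin (SmoothFn r) k (WordFam (P.gr V) r)).compLinearMap
    fun i => ((P.res (hV i)).word r).comp (Obs.incl (P.gr (U i)) r)).codRestrict
      (obsSub (P.gr V) r) fun a => by
        rw [MultilinearMap.compLinearMap_apply, MultilinearMap.mkPiAlgebraFin_apply]
        exact prod_mem_obsSub fun i => (P.res (hV i)).word_mem_obsSub (a i).2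

theorem mulObs_val {k : ℕ} (U : Fin k → Opens M) (V : Opens M) (hV : ∀ i, U i ≤ V) (r : ℕ)
    (a : ∀ i, Obs (P.gr (U i)) r) :
    (P.mulObs U V hV r a).1 = (List.ofFn fun i => (P.res (hV i)).word r (a i).1).prod := rfl

theorem mulObs_apply {k : ℕ} (U : Fin k → Opens M) (V : Opens M) (hV : ∀ i, U i ≤ V) (r : ℕ)
    (a : ∀ i, Obs (P.gr (U i)) r) (x : Fin r → ℝ) :
    (P.mulObs U V hV r a).1 x =
      (List.ofFn fun i => (P.res (hV i)).shuffle ((a i).1 x)).prod := by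
  rw [mulObs_val, prod_ofFn_apply]
  rfl

theorem update_word {k : ℕ} {U : Fin k → Opens M} {V : Opens M} (hV : ∀ i, U i ≤ V) {r : ℕ}
    (a : ∀ i, Obs (P.gr (U i)) r) (i : Fin k) (b : Obs (P.gr (U i)) r) :
    (fun j => (P.res (hV j)).word r (Function.update a i b j).1) =
      Function.update (fun j => (P.res (hV j)).word r (a j).1) i ((P.res (hV i)).word r b.1) := by
  funext j
  exact Function.apply_update (fun j (c : Obs (P.gr (U j)) r) => (P.res (hV j)).word r c.1) a i b j

theorem update_shuffle {k : ℕ} {U : Fin k → Opens M} {V : Opens M} (hV : ∀ i, U i ≤ V) {r : ℕ}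
    (a : ∀ i, Obs (P.gr (U i)) r) (i : Fin k) (b : Obs (P.gr (U i)) r) (x : Fin r → ℝ) :
    (fun j => (P.res (hV j)).shuffle ((Function.update a i b j).1 x)) =
      Function.update (fun j => (P.res (hV j)).shuffle ((a j).1 x)) i
        ((P.res (hV i)).shuffle (b.1 x)) := by
  funext j
  exact Function.apply_update
    (fun j (c : Obs (P.gr (U j)) r) => (P.res (hV j)).shuffle (c.1 x)) a i b j

theorem mulObs_mem_filObs {k : ℕ} {U : Fin k → Opens M} {V : Opens M} (hV : ∀ i, U i ≤ V) {r : ℕ}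
    {n : Fin k → ℕ} {a : ∀ i, Obs (P.gr (U i)) r} (ha : ∀ i, a i ∈ filObs (P.gr (U i)) r (n i)) :
    P.mulObs U V hV r a ∈ filObs (P.gr V) r (∑ i, n i) := by
  refine prod_mem_filSub (a := fun i => (P.res (hV i)).word r (a i).1) fun i x l hl => ?_
  rw [GrHom.word_apply, GrHom.shuffle_apply]
  exact ha i x _ (by simpa using hl)

theorem pdObs_mulObs {k : ℕ} {U : Fin k → Opens M} {V : Opens M} (hV : ∀ i, U i ≤ V) {r : ℕ}
    (j : Fin r) (a : ∀ i, Obs (P.gr (U i)) r) :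
    pdObs j (P.mulObs U V hV r a) =
      ∑ i, P.mulObs U V hV r (Function.update a i (pdObs j (a i))) := by
  refine Subtype.ext ?_
  refine (pdFun_prod (a := fun i => (P.res (hV i)).word r (a i).1) j
    fun i => (P.res (hV i)).word_mem_obsSub (a i).2).trans ?_
  refine Eq.trans ?_ (Obs.val_sum Finset.univ _).symm
  refine Finset.sum_congr rfl fun i _ => ?_
  refine Eq.trans ?_ (P.mulObs_val U V hV r _).symm
  rw [P.update_word hV a i]
  rfl

theorem zsmul_val {E : Type u} [AddCommGroup E] [Module ℝ E] {G : GrSpace E} {r : ℕ} (z : ℤ)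
    (a : Obs G r) (x : Fin r → ℝ) : (sgn z • a).1 x = eps z • a.1 x := by
  have h : (sgn z • a).1 = sgn z • a.1 := map_zsmul (Obs.incl G r) _ _
  rw [h, ← sgn_smul_eq]
  rfl

theorem dObs_mulObs {k : ℕ} {U : Fin k → Opens M} {V : Opens M} (hV : ∀ i, U i ≤ V) {r : ℕ}
    {p : Fin k → ℤ} {a : ∀ i, Obs (P.gr (U i)) r} (ha : ∀ i, a i ∈ homObs (P.gr (U i)) r (p i)) :
    dObs (P.alg V) (P.mulObs U V hV r a) = ∑ i, sgn (∑ j ∈ Finset.Iio i, p j) •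
      P.mulObs U V hV r (Function.update a i (dObs (P.alg (U i)) (a i))) := by
  refine Subtype.ext (funext fun x => ?_)
  have h1 : (dObs (P.alg V) (P.mulObs U V hV r a)).1 x =
      (P.alg V).ce (List.ofFn fun i => (P.res (hV i)).shuffle ((a i).1 x)).prod :=
    congrArg (P.alg V).ce (P.mulObs_apply U V hV r a x)
  have h2 := (P.alg V).ce_prod (a := fun i => (P.res (hV i)).shuffle ((a i).1 x)) (p := p)
    fun i => ((P.res (hV i)).word_mem_homSub (ha i)).2.2.2 x
  rw [h1, h2]
  refine Eq.trans ?_ (map_sum ((evalHom x).toAddMonoidHom.comp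
    (Obs.incl (P.gr V) r).toAddMonoidHom) _ Finset.univ).symm
  refine Finset.sum_congr rfl fun i _ => ?_
  change _ = (sgn _ • P.mulObs U V hV r _).1 x
  rw [zsmul_val, mulObs_apply, P.update_shuffle hV a i]
  congr 4
  exact (P.strict (hV i)).ce _

theorem mulObs_perm {k : ℕ} {U : Fin k → Opens M} {V : Opens M} (hV : ∀ i, U i ≤ V) {r : ℕ}
    {p : Fin k → ℤ} {a : ∀ i, Obs (P.gr (U i)) r} (ha : ∀ i, a i ∈ homObs (P.gr (U i)) r (p i))
    (σ : Equiv.Perm (Fin k)) :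
    P.mulObs U V hV r a =
      koszul σ p • P.mulObs (fun i => U (σ i)) V (fun i => hV (σ i)) r (fun i => a (σ i)) := by
  refine Subtype.ext (funext fun x => ?_)
  have h2 := ShuffleAlg.prod_ofFn_perm (a := fun i => (P.res (hV i)).shuffle ((a i).1 x)) (p := p)
    (fun i => ((P.res (hV i)).word_mem_homSub (ha i)).2.2.2 x) σ
  rw [mulObs_apply, h2, Int.cast_smul_eq_zsmul]
  refine Eq.trans ?_ (congrFun (map_zsmul (Obs.incl (P.gr V) r) _ _) x).symm
  change _ = koszul σ p • (P.mulObs _ V _ r _).1 x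
  rw [mulObs_apply]

theorem mulObs_mulObs {k : ℕ} (n : Fin k → ℕ) {W : ∀ i, Fin (n i) → Opens M}
    {U : Fin k → Opens M} {V : Opens M} (hWU : ∀ i j, W i j ≤ U i) (hUV : ∀ i, U i ≤ V)
    (hV : ∀ x : Fin (∑ i, n i), W (finSigmaFinEquiv.symm x).1 (finSigmaFinEquiv.symm x).2 ≤ V)
    (r : ℕ) (a : ∀ i (j : Fin (n i)), Obs (P.gr (W i j)) r) :
    P.mulObs U V hUV r (fun i => P.mulObs (W i) (U i) (hWU i) r (a i)) =
      P.mulObs (fun x : Fin (∑ i, n i) => W (finSigmaFinEquiv.symm x).1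
        (finSigmaFinEquiv.symm x).2) V hV r
        (fun x => a (finSigmaFinEquiv.symm x).1 (finSigmaFinEquiv.symm x).2) := by
  refine Subtype.ext (funext fun x => ?_)
  rw [mulObs_apply, mulObs_apply,
    ← prod_ofFn_sigma n fun i j => (P.res ((hWU i j).trans (hUV i))).shuffle ((a i j).1 x)]
  congr 2
  funext i
  rw [mulObs_apply, map_list_prod, List.map_ofFn]
  congr 2
  funext j
  exact P.shuffle_shuffle _ _ _

theorem mulObs_one (U : Opens M) (hV : Fin 1 → U ≤ U) (r : ℕ) (a : Obs (P.gr U) r) :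
    P.mulObs (fun _ : Fin 1 => U) U hV r (fun _ => a) = a := by
  refine Subtype.ext (funext fun x => ?_)
  rw [mulObs_apply, List.ofFn_succ, List.ofFn_zero, List.prod_singleton, P.shuffle_self]

/-- The Chevalley–Eilenberg cochains of a presheaf of `L∞` algebras. -/
def prefact : PrefactorizationAlgebra M where
  obj U := (P.alg U).obs
  mul U V _ hV r := P.mulObs U V hV r
  mul_hom _ _ _ hV _ _ _ ha :=
    prod_mem_homSub fun i => (P.res (hV i)).word_mem_homSub (ha i)
  mul_fil _ _ _ hV _ _ _ ha := P.mulObs_mem_filObs hV ha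
  mul_pull U V _ hV s r g a := Subtype.ext <| funext fun x =>
    (P.mulObs_apply U V hV r a (g.1 x)).trans
      (P.mulObs_apply U V hV s (fun i => pullObs g (a i)) x).symm
  mul_pd _ _ _ hV _ j a := P.pdObs_mulObs hV j a
  mul_d _ _ _ hV _ _ _ ha := P.dObs_mulObs hV ha
  mul_one U _ hV r a := P.mulObs_one U hV r a
  mul_symm _ _ _ hV _ _ _ ha σ _ _ := P.mulObs_perm hV ha σ
  mul_assoc n _ _ _ _ hWU _ hUV _ hV r a := P.mulObs_mulObs n hWU hUV hV r a

end LInfPresheaf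

/-! ### Graded symmetrization of series of multilinear functionals -/

section

variable {E : Type u} [AddCommGroup E] [Module ℝ E] {G : GrSpace E} {r : ℕ}

/-- Families of `m`-linear functionals, parametrized by `ℝ^r`. -/
abbrev MFam (E : Type u) [AddCommGroup E] [Module ℝ E] (r m : ℕ) : Type u :=
  (Fin r → ℝ) → MultilinearMap ℝ (fun _ : Fin m => E) ℝ

/-- The family takes smooth families of vectors to smooth functions. -/
def MFam.Smooth (G : GrSpace E) {m : ℕ} (F : MFam E r m) : Prop :=
  ∀ (s : ℕ) (v : Fin m → (Fin s → ℝ) → E), (∀ i, v i ∈ G.plot s) →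
    ContDiff ℝ ∞ fun z : (Fin r → ℝ) × (Fin s → ℝ) => F z.1 (fun i => v i z.2)

/-- A smooth series of multilinear functionals of degree `p`. -/
structure IsSeries (G : GrSpace E) (p : ℤ) (F : ∀ m, MFam E r m) : Prop where
  smooth : ∀ m, (F m).Smooth G
  hom : ∀ m x (κ : Fin m → ℤ) (v : Fin m → E), (∀ i, G.pr (κ i) (v i) = v i) →
    ∑ i, κ i + p ≠ 0 → F m x v = 0

/-- The functions on words given by a series of multilinear functionals. -/
def word (G : GrSpace E) (F : ∀ m, MFam E r m) : WordFam G r :=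
  fun x l => F l.length x (vals l)

/-- The graded symmetrization of a series of multilinear functionals. -/
def sym (G : GrSpace E) (F : ∀ m, MFam E r m) : WordFam G r :=
  fun x l => psum l (word G F x)

theorem word_eq (F : ∀ m, MFam E r m) (x : Fin r → ℝ) {k : ℕ} (l : List (Letter G))
    (h : l.length = k) : word G F x l = F k x (fun i => (l[(i : ℕ)]'(h ▸ i.2)).val) := by
  subst h
  rfl

theorem word_ofFn (F : ∀ m, MFam E r m) (x : Fin r → ℝ) {k : ℕ} (u : Fin k → Letter G) :
    word G F x (List.ofFn u) = F k x (fun i => (u i).val) := by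
  rw [word_eq F x _ List.length_ofFn]
  simp

/-- The zero vector as a letter. -/
def zeroLetter (G : GrSpace E) (k : ℤ) : Letter G := ⟨k, 0, map_zero _⟩

theorem val_append_cons (l₁ l₂ : List (Letter G)) (a b : Letter G) {m : ℕ}
    (h : l₁.length < m) (h' : (l₁ ++ a :: l₂).length = m) (h'' : (l₁ ++ b :: l₂).length = m) :
    (fun i : Fin m => ((l₁ ++ a :: l₂)[(i : ℕ)]'(h' ▸ i.2)).val) =
      Function.update (fun i : Fin m => ((l₁ ++ b :: l₂)[(i : ℕ)]'(h'' ▸ i.2)).val)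
        ⟨l₁.length, h⟩ a.val := by
  funext i
  by_cases hi : i = ⟨l₁.length, h⟩
  · subst hi
    simp
  · rw [Function.update_of_ne hi]
    have : (i : ℕ) ≠ l₁.length := fun h => hi (Fin.ext h)
    simp only [List.getElem_append]
    split_ifs with h3
    · rfl
    · obtain ⟨j, hj⟩ : ∃ j, (i : ℕ) - l₁.length = j + 1 := ⟨i - l₁.length - 1, by omega⟩
      simp [hj]

theorem word_slotLin (F : ∀ m, MFam E r m) (x : Fin r → ℝ) : SlotLin (word G F x) := by
  intro l₁ l₂ k
  have h : l₁.length < (l₁ ++ zeroLetter G k :: l₂).length := by simp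
  refine ⟨(F _ x).toLinearMap (vals (l₁ ++ zeroLetter G k :: l₂)) ⟨l₁.length, h⟩, fun a _ => ?_⟩
  rw [word_eq F x (k := (l₁ ++ zeroLetter G k :: l₂).length) _ (by simp),
    val_append_cons l₁ l₂ a (zeroLetter G k) h (by simp) rfl]
  rfl

theorem word_isSmooth {F : ∀ m, MFam E r m} (hF : ∀ m, (F m).Smooth G) :
    (word G F).IsSmooth := by
  intro s L
  have := hF L.length s (fun i => L[i].val) fun i => L[i].plot
  refine cast (congrArg _ (funext fun z => ?_)) this
  rw [word_eq F z.1 _ (List.length_map _)]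
  simp [LetterFam.eval]

theorem word_isHom {p : ℤ} {F : ∀ m, MFam E r m} (hF : IsSeries G p F) (x : Fin r → ℝ) :
    ShuffleAlg.IsHom p (word G F x) := by
  intro l hl
  rw [tdeg_eq_sum] at hl
  exact hF.hom _ x (fun i => deg l[i]) _ (fun i => l[i].homog) hl

/-- The symmetrization of functions that are linear in each letter is a graded symmetric functional. -/
theorem psum_mem_homSub {p : ℤ} {w : WordFam G r} (h1 : ∀ x, SlotLin (w x)) (h2 : w.IsSmooth)
    (h3 : ∀ x, ShuffleAlg.IsHom p (w x)) :
    (fun x l => psum l (w x) : WordFam G r) ∈ WordFam.homSub G r p := by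
  refine ⟨fun x => psum_gsymm _, fun x => (h1 x).psum_headLin, fun s L => ?_, fun x l hl => ?_⟩
  · refine cast (congrArg _ (funext fun z => ?_)) (contDiff_psum (f := fun z l =>
      w z.1 (l.map (LetterFam.eval z.2))) L fun l => h2 s l)
    exact (psum_map (φ := LetterFam.eval z.2) (fun a => rfl) L (w z.1)).symm
  · exact psum_eq_zero fun l' hl' => h3 x l' (by rwa [tdeg_perm hl'])

theorem sym_mem_homSub {p : ℤ} {F : ∀ m, MFam E r m} (hF : IsSeries G p F) :
    sym G F ∈ WordFam.homSub G r p :=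
  psum_mem_homSub (word_slotLin F) (word_isSmooth hF.smooth) (word_isHom hF)

theorem sym_ofFn (F : ∀ m, MFam E r m) (x : Fin r → ℝ) {k : ℕ} (u : Fin k → Letter G) :
    sym G F x (List.ofFn u) = ∑ σ : Equiv.Perm (Fin k),
      (koszul σ (fun i => deg (u i)) : ℝ) * F k x (fun i => (u (σ i)).val) := by
  refine (psum_ofFn u _).trans (Finset.sum_congr rfl fun σ _ => ?_)
  rw [word_ofFn, smul_eq_mul]

theorem sym_apply (F : ∀ m, MFam E r m) (x : Fin r → ℝ) (l : List (Letter G)) :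
    sym G F x l = ∑ σ : Equiv.Perm (Fin l.length),
      (koszul σ (fun i => deg l[i]) : ℝ) * F l.length x (fun i => (l[σ i]).val) := by
  conv_lhs => rw [← List.ofFn_getElem (xs := l)]
  exact sym_ofFn F x fun i : Fin l.length => l[i]

/-! #### Multilinear functionals with prescribed values on homogeneous vectors -/

/-- The possible degrees of `m` vectors. -/
def degs (G : GrSpace E) (m : ℕ) : Finset (Fin m → ℤ) :=
  Fintype.piFinset fun _ => Finset.Icc (-(G.bound : ℤ)) G.bound

/-- The multilinear functional that agrees with `Λ κ` on vectors of degrees `κ`. -/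
def glueDeg (G : GrSpace E) {m : ℕ} (Λ : (Fin m → ℤ) → MultilinearMap ℝ (fun _ : Fin m => E) ℝ) :
    MultilinearMap ℝ (fun _ : Fin m => E) ℝ :=
  ∑ κ ∈ degs G m, (Λ κ).compLinearMap fun i => G.pr (κ i)

theorem glueDeg_eq {m : ℕ} (Λ : (Fin m → ℤ) → MultilinearMap ℝ (fun _ : Fin m => E) ℝ)
    {κ : Fin m → ℤ} {v : Fin m → E} (hv : ∀ i, G.pr (κ i) (v i) = v i) :
    glueDeg G Λ v = Λ κ v := by
  rw [glueDeg, _root_.sum_apply, Finset.sum_eq_single κ]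
  · simp [hv]
  · intro κ' _ hne
    obtain ⟨i, hi⟩ := Function.ne_iff.1 hne
    exact (Λ κ').map_coord_zero i (GrSpace.pr_of_ne (hv i) hi)
  · intro hκ
    simp only [degs, Fintype.mem_piFinset, Finset.mem_Icc, not_forall] at hκ
    obtain ⟨i, hi⟩ := hκ
    refine (Λ κ).map_coord_zero i (G.pr_eq_zero _ ?_ _)
    rw [← not_le, abs_le]
    exact hi

theorem eq_glueDeg {m : ℕ} (f : MultilinearMap ℝ (fun _ : Fin m => E) ℝ) :
    f = glueDeg G fun _ => f := by
  ext v
  rw [glueDeg, _root_.sum_apply]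
  conv_lhs => rw [show v = fun i => ∑ k ∈ Finset.Icc (-(G.bound : ℤ)) G.bound, G.pr k (v i) from
    funext fun i => (G.pr_sum (v i)).symm]
  rw [MultilinearMap.map_sum_finset]
  rfl

variable (G) in
theorem multilinear_ext {m : ℕ} {f g : MultilinearMap ℝ (fun _ : Fin m => E) ℝ}
    (h : ∀ (κ : Fin m → ℤ) (v : Fin m → E), (∀ i, G.pr (κ i) (v i) = v i) → f v = g v) :
    f = g := by
  rw [eq_glueDeg (G := G) f, eq_glueDeg (G := G) g]
  refine Finset.sum_congr rfl fun κ _ => MultilinearMap.ext fun v => h κ _ fun i => ?_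
  rw [G.pr_pr, if_pos rfl]

theorem glueDeg_smooth {m : ℕ} {Λ : (Fin r → ℝ) → (Fin m → ℤ) →
    MultilinearMap ℝ (fun _ : Fin m => E) ℝ}
    (h : ∀ κ, MFam.Smooth G fun x => (Λ x κ).compLinearMap fun i => G.pr (κ i)) :
    MFam.Smooth G fun x => glueDeg G (Λ x) := by
  intro s v hv
  simp only [glueDeg, _root_.sum_apply]
  exact ContDiff.sum fun κ _ => h κ s v hv

/-- The multilinear functional on vectors of degrees `κ` given by a function on words. -/
def SlotLin.multilinear {f : List (Letter G) → ℝ} (hf : SlotLin f) {m : ℕ} (κ : Fin m → ℤ) :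
    MultilinearMap ℝ (fun _ : Fin m => E) ℝ := by
  have key : ∀ (v : Fin m → E) (i : Fin m), ∃ Λ : E →ₗ[ℝ] ℝ, ∀ e,
      f (List.ofFn fun j => G.letter (κ j) (Function.update v i e j)) = Λ e := by
    intro v i
    cases m with
    | zero => exact i.elim0
    | succ m =>
      obtain ⟨Λ, hΛ⟩ := hf ((List.ofFn fun j => G.letter (κ (i.succAbove j))
        (v (i.succAbove j))).take i) ((List.ofFn fun j => G.letter (κ (i.succAbove j))
        (v (i.succAbove j))).drop i) (κ i)
      refine ⟨Λ.comp (G.pr (κ i)), fun e => ?_⟩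
      refine Eq.trans (congrArg f ?_) (hΛ (G.letter (κ i) e) rfl)
      rw [← ofFn_insertNth]
      congr 1
      funext j
      induction j using Fin.succAboveCases i with
      | x => simp
      | p j => simp
  exact
  { toFun v := f (List.ofFn fun j => G.letter (κ j) (v j))
    map_update_add' := by
      intro dec v i e e'
      obtain rfl : dec = instDecidableEqFin m := Subsingleton.elim _ _
      obtain ⟨Λ, hΛ⟩ := key v i
      rw [hΛ, hΛ, hΛ, map_add]
    map_update_smul' := by
      intro dec v i c e
      obtain rfl : dec = instDecidableEqFin m := Subsingleton.elim _ _
      obtain ⟨Λ, hΛ⟩ := key v i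
      rw [hΛ, hΛ, map_smul] }

/-- The series of multilinear functionals given by a function on words. -/
def lift (w : WordFam G r) (hw : ∀ x, SlotLin (w x)) (m : ℕ) : MFam E r m :=
  fun x => glueDeg G fun κ => (hw x).multilinear κ

theorem lift_eq {w : WordFam G r} (hw : ∀ x, SlotLin (w x)) {m : ℕ} (x : Fin r → ℝ)
    (u : Fin m → Letter G) : lift w hw m x (fun i => (u i).val) = w x (List.ofFn u) := by
  rw [lift, glueDeg_eq (κ := fun i => (u i).degree) _ fun i => (u i).homog]
  change w x _ = _
  congr 2
  funext j
  exact G.letter_val _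

theorem lift_smooth {w : WordFam G r} (hw : ∀ x, SlotLin (w x)) (h : w.IsSmooth) (m : ℕ) :
    (lift w hw m).Smooth G := by
  refine glueDeg_smooth fun κ s v hv => ?_
  have := h s (List.ofFn fun j => (⟨κ j, fun y => G.pr (κ j) (v j y), fun y => by
    rw [G.pr_pr, if_pos rfl], G.pr_plot _ _ _ (hv j)⟩ : LetterFam G s))
  refine cast (congrArg _ (funext fun z => ?_)) this
  symm
  change w z.1 _ = w z.1 _
  rw [List.map_ofFn]
  congr 2
  funext j
  refine Letter.ext' rfl ?_
  change G.pr _ (G.pr _ _) = G.pr _ _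
  rw [G.pr_pr, if_pos rfl]

theorem word_lift {w : WordFam G r} (hw : ∀ x, SlotLin (w x)) : word G (lift w hw) = w := by
  refine WordFam.ext₂ fun x l => ?_
  rw [word]
  refine (lift_eq hw x fun i : Fin l.length => l[i]).trans ?_
  congr 1
  exact List.ofFn_getElem

theorem lift_isSeries {p : ℤ} {w : WordFam G r} (hw : ∀ x, SlotLin (w x)) (h : w.IsSmooth)
    (h' : ∀ x, ShuffleAlg.IsHom p (w x)) : IsSeries G p (lift w hw) := by
  refine ⟨lift_smooth hw h, fun m x κ v hv hne => ?_⟩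
  obtain ⟨u, rfl, rfl⟩ : ∃ u : Fin m → Letter G, (fun i => deg (u i)) = κ ∧
      (fun i => (u i).val) = v := ⟨fun i => ⟨κ i, v i, hv i⟩, rfl, rfl⟩
  rw [lift_eq]
  refine h' x _ ?_
  rwa [tdeg, List.map_ofFn, List.sum_ofFn]

end

/-! ### Coinvariants and the shuffle product -/

section

variable {E : Type u} [AddCommGroup E] [Module ℝ E] {G : GrSpace E} {r : ℕ}

/-- The span of all `σ · F - F`, for the action of the symmetric group with Koszul signs. -/
def coinv (G : GrSpace E) (r m : ℕ) : Submodule ℝ (MFam E r m) :=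
  Submodule.span ℝ {R | ∃ F : MFam E r m, F.Smooth G ∧ ∃ F' : MFam E r m, F'.Smooth G ∧
    ∃ σ : Equiv.Perm (Fin m),
      (∀ x (κ : Fin m → ℤ) (v : Fin m → E), (∀ i, G.pr (κ i) (v i) = v i) →
        F' x v = (koszul σ κ : ℝ) * F x (fun i => v (σ i))) ∧
      R = F' - F}

/-- The transform of a family of functionals by a permutation, with Koszul signs. -/
def twist (G : GrSpace E) {m : ℕ} (σ : Equiv.Perm (Fin m)) (f : MFam E r m) : MFam E r m :=
  fun x => glueDeg G fun κ => (koszul σ κ : ℝ) • (f x).domDomCongr σ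

theorem twist_eq {m : ℕ} (σ : Equiv.Perm (Fin m)) (f : MFam E r m) (x : Fin r → ℝ)
    (κ : Fin m → ℤ) (v : Fin m → E) (hv : ∀ i, G.pr (κ i) (v i) = v i) :
    twist G σ f x v = (koszul σ κ : ℝ) * f x (fun i => v (σ i)) := by
  rw [twist, glueDeg_eq _ hv]
  rfl

theorem MFam.Smooth.twist {m : ℕ} {f : MFam E r m} (hf : f.Smooth G) (σ : Equiv.Perm (Fin m)) :
    (twist G σ f).Smooth G := by
  refine glueDeg_smooth fun κ s v hv => ?_
  exact contDiff_const.mul (hf s (fun i y => G.pr (κ (σ i)) (v (σ i) y))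
    fun i => G.pr_plot _ _ _ (hv _))

/-- Symmetrization vanishes on the span of all `σ · F - F`. -/
theorem sum_koszul_eq_zero {m : ℕ} {f : MFam E r m} (hf : f ∈ coinv G r m) (x : Fin r → ℝ)
    (κ : Fin m → ℤ) (v : Fin m → E) (hv : ∀ i, G.pr (κ i) (v i) = v i) :
    ∑ σ : Equiv.Perm (Fin m), (koszul σ κ : ℝ) * f x (fun i => v (σ i)) = 0 := by
  induction hf using Submodule.span_induction with
  | mem R hR =>
    obtain ⟨F, _, F', _, σ, h, rfl⟩ := hR
    have h1 : ∑ ρ : Equiv.Perm (Fin m), (koszul ρ κ : ℝ) * F' x (fun i => v (ρ i)) =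
        ∑ ρ : Equiv.Perm (Fin m), (koszul ρ κ : ℝ) * F x (fun i => v (ρ i)) := by
      rw [← Equiv.sum_comp (Equiv.mulRight σ) fun ρ : Equiv.Perm (Fin m) =>
        (koszul ρ κ : ℝ) * F x (fun i => v (ρ i))]
      refine Finset.sum_congr rfl fun ρ _ => ?_
      rw [h x (fun i => κ (ρ i)) _ fun i => hv _, Equiv.coe_mulRight, koszul_mul, Int.cast_mul,
        mul_assoc]
      rfl
    simp only [Pi.sub_apply, _root_.sub_apply, mul_sub, Finset.sum_sub_distrib, h1,
      sub_self]
  | zero => simp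
  | add f g _ _ hf hg =>
    simp only [Pi.add_apply, _root_.add_apply, mul_add, Finset.sum_add_distrib, hf, hg,
      add_zero]
  | smul c f _ hf =>
    simp only [Pi.smul_apply, _root_.smul_apply, smul_eq_mul, mul_left_comm _ c,
      ← Finset.mul_sum, hf, mul_zero]

/-- A functional whose symmetrization vanishes is minus the average of `σ · f - f` over all
permutations. -/
theorem mem_coinv {m : ℕ} {f : MFam E r m} (hf : f.Smooth G)
    (h : ∀ (x : Fin r → ℝ) (κ : Fin m → ℤ) (v : Fin m → E), (∀ i, G.pr (κ i) (v i) = v i) →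
      ∑ σ : Equiv.Perm (Fin m), (koszul σ κ : ℝ) * f x (fun i => v (σ i)) = 0) :
    f ∈ coinv G r m := by
  have h1 : ∑ σ : Equiv.Perm (Fin m), twist G σ f = 0 := by
    funext x
    refine multilinear_ext G fun κ v hv => ?_
    rw [Finset.sum_apply, _root_.sum_apply]
    simp only [twist_eq _ _ _ _ _ hv]
    exact h x κ v hv
  -- By `h1` the sum of the differences is `-m! · f`.
  have h2 : f = (-(m.factorial : ℝ)⁻¹) • ∑ σ : Equiv.Perm (Fin m), (twist G σ f - f) := by
    rw [Finset.sum_sub_distrib, h1, zero_sub, Finset.sum_const, Finset.card_univ,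
      Fintype.card_perm, Fintype.card_fin, neg_smul_neg, ← Nat.cast_smul_eq_nsmul ℝ, smul_smul,
      inv_mul_cancel₀ (by positivity), one_smul]
  rw [h2]
  refine Submodule.smul_mem _ _ (Submodule.sum_mem _ fun σ _ => Submodule.subset_span ?_)
  exact ⟨f, hf, _, hf.twist σ, σ, fun x κ v hv => twist_eq σ f x κ v hv, rfl⟩

/-- The kernel of symmetrization consists of the functionals that are zero in the coinvariants. -/
theorem mem_coinv_iff {F : ∀ m, MFam E r m} {m : ℕ} (hF : (F m).Smooth G) :
    F m ∈ coinv G r m ↔ ∀ x l, l.length = m → sym G F x l = 0 := by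
  constructor
  · rintro h x l rfl
    rw [sym_apply]
    exact sum_koszul_eq_zero h x (fun i => deg l[i]) _ fun i => l[i].homog
  · intro h
    refine mem_coinv hF fun x κ v hv => ?_
    have := h x (List.ofFn fun i => (⟨κ i, v i, hv i⟩ : Letter G)) List.length_ofFn
    rwa [sym_ofFn] at this

/-- Each graded symmetric functional is a symmetrization. -/
theorem exists_sym_eq {p : ℤ} {w : WordFam G r} (hw : w ∈ WordFam.homSub G r p) :
    ∃ F : ∀ m, MFam E r m, IsSeries G p F ∧ sym G F = w := by
  obtain ⟨h1, h2, h3, h4⟩ := hw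
  let w' : WordFam G r := fun x l => (l.length.factorial : ℝ)⁻¹ * w x l
  have hs : ∀ x, SlotLin (w' x) := by
    intro x l₁ l₂ k
    obtain ⟨Λ, hΛ⟩ := (h2 x).slotLin (h1 x) l₁ l₂ k
    refine ⟨((l₁.length + 1 + l₂.length).factorial : ℝ)⁻¹ • Λ, fun a ha => ?_⟩
    change _ * w x _ = _
    rw [hΛ a ha, List.length_append, List.length_cons, show l₁.length + (l₂.length + 1) =
      l₁.length + 1 + l₂.length by omega]
    rfl
  refine ⟨lift w' hs, lift_isSeries hs (fun s L => ?_) (fun x l hl => ?_), ?_⟩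
  · simp only [w', List.length_map]
    exact contDiff_const.mul (h3 s L)
  · simp [w', h4 x l hl]
  · refine WordFam.ext₂ fun x l => ?_
    have h5 : psum l (w' x) = psum l fun l' => (l.length.factorial : ℝ)⁻¹ • (w x : _ → ℝ) l' :=
      psum_congr fun l' hl' => by
        rw [smul_eq_mul, ← hl'.length_eq]
    change psum l (word G (lift w' hs) x) = _
    rw [word_lift]
    refine h5.trans ((psum_smul _ _ _).trans ?_)
    rw [psum_of_gsymm (h1 x), smul_smul, inv_mul_cancel₀ (by positivity), one_smul]

theorem ext_update {m : ℕ} (v : Fin m → E) (i : Fin m) (e : E) (n : ℕ) :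
    ext (Function.update v i e) n = if n = i then e else ext v n := by
  unfold ext
  split_ifs with h1 h2 h2
  · have : (⟨n, h1⟩ : Fin m) = i := Fin.ext h2
    simp [this]
  · rw [Function.update_of_ne fun h => h2 (by rw [← h])]
  · omega
  · rfl

/-- A block of consecutive entries of a tuple. -/
theorem block_update {m p c : ℕ} (v : Fin m → E) (i : Fin m) (e : E) :
    (fun a : Fin p => ext (Function.update v i e) (c + a)) =
      if h : c ≤ i ∧ (i : ℕ) < c + p then
        Function.update (fun a : Fin p => ext v (c + a)) ⟨i - c, by omega⟩ e
      else fun a : Fin p => ext v (c + a) := by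
  funext a
  rw [ext_update]
  split_ifs with h1 h2 h2
  · have : a = ⟨i - c, by omega⟩ := Fin.ext (by simp only; omega)
    rw [this, Function.update_self]
  · exact absurd ⟨by omega, by omega⟩ h2
  · rw [Function.update_of_ne]
    rintro rfl
    exact h1 (by simp only; omega)
  · rfl

/-- The product of two multilinear functionals, applied to consecutive arguments. -/
def consec {m a b : ℕ} (h : a + b = m) (f : MultilinearMap ℝ (fun _ : Fin a => E) ℝ)
    (g : MultilinearMap ℝ (fun _ : Fin b => E) ℝ) : MultilinearMap ℝ (fun _ : Fin m => E) ℝ where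
  toFun v := f (fun j => ext v (0 + j)) * g (fun j => ext v (a + j))
  map_update_add' := by
    intro dec v i e e'
    obtain rfl : dec = instDecidableEqFin m := Subsingleton.elim _ _
    simp only [block_update]
    by_cases hi : (i : ℕ) < a
    · have hp : 0 ≤ (i : ℕ) ∧ (i : ℕ) < 0 + a := ⟨Nat.zero_le _, by omega⟩
      have hn : ¬(a ≤ (i : ℕ) ∧ (i : ℕ) < a + b) := by omega
      simp only [dif_pos hp, dif_neg hn, MultilinearMap.map_update_add, add_mul]
    · have hn : ¬(0 ≤ (i : ℕ) ∧ (i : ℕ) < 0 + a) := by omega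
      have hp : a ≤ (i : ℕ) ∧ (i : ℕ) < a + b := ⟨by omega, by omega⟩
      simp only [dif_pos hp, dif_neg hn, MultilinearMap.map_update_add, mul_add]
  map_update_smul' := by
    intro dec v i c e
    obtain rfl : dec = instDecidableEqFin m := Subsingleton.elim _ _
    simp only [block_update]
    by_cases hi : (i : ℕ) < a
    · have hp : 0 ≤ (i : ℕ) ∧ (i : ℕ) < 0 + a := ⟨Nat.zero_le _, by omega⟩
      have hn : ¬(a ≤ (i : ℕ) ∧ (i : ℕ) < a + b) := by omega
      simp only [dif_pos hp, dif_neg hn, MultilinearMap.map_update_smul, smul_eq_mul, mul_assoc]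
    · have hn : ¬(0 ≤ (i : ℕ) ∧ (i : ℕ) < 0 + a) := by omega
      have hp : a ≤ (i : ℕ) ∧ (i : ℕ) < a + b := ⟨by omega, by omega⟩
      simp only [dif_pos hp, dif_neg hn, MultilinearMap.map_update_smul, smul_eq_mul,
        mul_left_comm]

/-- The product of two series of multilinear functionals. -/
def star (F F' : ∀ m, MFam E r m) (m : ℕ) : MFam E r m := fun x =>
  ∑ q ∈ (Finset.HasAntidiagonal.antidiagonal m).attach,
    consec (Finset.HasAntidiagonal.mem_antidiagonal.1 q.2) (F q.1.1 x) (F' q.1.2 x)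

theorem star_apply (F F' : ∀ m, MFam E r m) (m : ℕ) (x : Fin r → ℝ) (v : Fin m → E) :
    star F F' m x v = ∑ q ∈ Finset.HasAntidiagonal.antidiagonal m,
      F q.1 x (fun j => ext v j) * F' q.2 x (fun j => ext v (q.1 + j)) := by
  rw [star, _root_.sum_apply, ← Finset.sum_attach (Finset.HasAntidiagonal.antidiagonal m)]
  refine Finset.sum_congr rfl fun q _ => ?_
  change F q.1.1 x (fun j => ext v (0 + j)) * _ = _
  simp only [zero_add]

theorem star_isSeries {p q : ℤ} {F F' : ∀ m, MFam E r m} (hF : IsSeries G p F)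
    (hF' : IsSeries G q F') : IsSeries G (p + q) (star F F') := by
  refine ⟨fun m s v hv => ?_, fun m x κ v hv hne => ?_⟩
  · simp only [star_apply]
    refine ContDiff.sum fun a ha => ?_
    have ha' := Finset.HasAntidiagonal.mem_antidiagonal.1 ha
    have h1 : ∀ (y : Fin s → ℝ) (n : ℕ) (hn : n < m), ext (fun i => v i y) n = v ⟨n, hn⟩ y :=
      fun y n hn => by simp [ext, hn]
    refine (cast (congrArg _ (funext fun z => ?_)) (hF.smooth a.1 s
      (fun j => v ⟨j, by omega⟩) fun j => hv _)).mul
      (cast (congrArg _ (funext fun z => ?_)) (hF'.smooth a.2 s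
        (fun j => v ⟨a.1 + j, by omega⟩) fun j => hv _))
    · congr 1
      funext j
      exact (h1 z.2 j (by omega)).symm
    · congr 1
      funext j
      exact (h1 z.2 (a.1 + j) (by omega)).symm
  · rw [star_apply]
    refine Finset.sum_eq_zero fun a ha => ?_
    obtain ⟨a, b⟩ := a
    obtain rfl := Finset.HasAntidiagonal.mem_antidiagonal.1 ha
    have h1 : ∀ (n : ℕ) (hn : n < a + b), ext v n = v ⟨n, hn⟩ := fun n hn => by simp [ext, hn]
    rw [Fin.sum_univ_add] at hne
    change (∑ i : Fin a, κ (Fin.castAdd b i) + ∑ i : Fin b, κ (Fin.natAdd a i)) + (p + q) ≠ 0 at hne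
    by_cases h2 : ∑ i : Fin a, κ (Fin.castAdd b i) + p = 0
    · refine mul_eq_zero_of_right _ (hF'.hom b x (fun j => κ (Fin.natAdd a j)) _ (fun j => ?_)
        (by omega))
      rw [h1 _ (by omega)]
      exact hv _
    · refine mul_eq_zero_of_left (hF.hom a x (fun j => κ (Fin.castAdd b j)) _ (fun j => ?_) h2) _
      rw [h1 _ (by omega)]
      exact hv _

/-- Symmetrization takes the concatenation product to the shuffle product. -/
theorem sym_star (F F' : ∀ m, MFam E r m) : sym G (star F F') = sym G F * sym G F' := by
  refine WordFam.ext₂ fun x l => ?_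
  change psum l (word G (star F F') x) = unsh l fun S T =>
    psum S (word G F x) * psum T (word G F' x)
  have h1 : word G (star F F') x = fun l' : List (Letter G) =>
      sp l' fun a b => word G F x a * word G F' x b := by
    funext l'
    change star F F' l'.length x (vals l') = _
    rw [star_apply, sp_eq_sum, Finset.Nat.sum_antidiagonal_eq_sum_range_succ_mk]
    refine Finset.sum_congr rfl fun i hi => ?_
    have hi' : i ≤ l'.length := by simpa [Nat.lt_succ_iff] using hi
    rw [word_eq F x (k := i) _ (by simpa using hi'),
      word_eq F' x (k := l'.length - i) _ (by simp)]
    congr 2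
    · funext j
      simp [ext, vals, show (j : ℕ) < l'.length by omega]
    · funext j
      simp [ext, vals, show i + (j : ℕ) < l'.length by omega]
  rw [h1, psum_sp]
  refine unsh_congr fun S T _ => ?_
  have h2 : ∀ a, psum T (fun b => word G F x a * word G F' x b) =
      psum T (word G F' x) * word G F x a := by
    intro a
    rw [mul_comm]
    exact psum_smul _ _ _
  simp only [h2]
  rw [mul_comm]
  exact psum_smul _ _ _

end

/-! ### The Chevalley–Eilenberg differential before symmetrization -/

section Words

variable {A A' : Type*} [Alphabet A] [Alphabet A'] {Y Z : Type*} [AddCommGroup Y] [Module ℝ Y]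
  [AddCommGroup Z] [Module ℝ Z]

theorem sp_append_cons (l₁ : List A) (v : A) (l₂ : List A) (g : List A → List A → Y) :
    sp (l₁ ++ v :: l₂) g =
      sp l₁ (fun S T => g S (T ++ v :: l₂)) + sp l₂ (fun S T => g (l₁ ++ v :: S) T) := by
  induction l₁ generalizing g with
  | nil => rfl
  | cons u l₁ ih => simp only [List.cons_append, sp, ih, add_assoc]

theorem map_sp (φ : Y →ₗ[ℝ] Z) (l : List A) (g : List A → List A → Y) :
    φ (sp l g) = sp l (fun a b => φ (g a b)) := by
  rw [sp_eq_sum, sp_eq_sum, map_sum]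

theorem sp_map (φ : A → A') (l : List A) (g : List A' → List A' → Y) :
    sp (l.map φ) g = sp l (fun a b => g (a.map φ) (b.map φ)) := by
  simp only [sp_eq_sum, List.length_map, List.map_take, List.map_drop]

theorem psum_unsh (l m : List A) (g : List A → List A → List A → Y) :
    psum l (fun a => unsh m (g a)) = unsh m (fun S T => psum l fun a => g a S T) := by
  induction m generalizing g with
  | nil => rfl
  | cons v m ih => simp only [unsh, psum_add, ih, psum_smul]

theorem contDiff_sp {X : Type*} [NormedAddCommGroup X] [NormedSpace ℝ X]
    {g : X → List A → List A → ℝ} {l : List A} (h : ∀ S T, ContDiff ℝ ∞ fun z => g z S T) :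
    ContDiff ℝ ∞ fun z => sp l (g z) := by
  simp only [sp_eq_sum]
  exact ContDiff.sum fun i _ => h _ _

end Words

section

variable {E : Type u} [AddCommGroup E] [Module ℝ E] {G : GrSpace E} {r : ℕ} (𝔤 : LInfAlg G)

theorem SlotLin.append_left {f : List (Letter G) → ℝ} (hf : SlotLin f) (m : List (Letter G)) :
    SlotLin fun l => f (m ++ l) := fun l₁ l₂ k => by
  simp only [← List.append_assoc]
  exact hf (m ++ l₁) l₂ k

theorem SlotLin.append_right {f : List (Letter G) → ℝ} (hf : SlotLin f) (m : List (Letter G)) :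
    SlotLin fun l => f (l ++ m) := fun l₁ l₂ k => by
  simp only [List.append_assoc, List.cons_append]
  exact hf l₁ (l₂ ++ m) k

theorem SlotLin.sp_const {g : List (Letter G) → List (Letter G) → List (Letter G) → ℝ}
    (h : ∀ S T, SlotLin fun l => g l S T) (m : List (Letter G)) :
    SlotLin fun l => sp m (g l) := by
  intro l₁ l₂ k
  choose Λ hΛ using fun S T => h S T l₁ l₂ k
  refine ⟨sp m Λ, fun a ha => ?_⟩
  refine Eq.trans ?_ (map_sp (LinearMap.applyₗ a.val) m Λ).symm
  exact sp_congr fun S T _ => hΛ S T a ha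

theorem SlotLin.sp {g : List (Letter G) → List (Letter G) → ℝ}
    (h1 : ∀ T, SlotLin fun S => g S T) (h2 : ∀ S, SlotLin fun T => g S T) :
    SlotLin fun l => sp l g := by
  intro l₁ l₂ k
  choose Λ hΛ using fun S T => h2 S T l₂ k
  choose Λ' hΛ' using fun S T => h1 T l₁ S k
  refine ⟨BulkBoundary.sp l₁ Λ + BulkBoundary.sp l₂ Λ', fun a ha => ?_⟩
  have hev : ∀ (l : List (Letter G)) (F : List (Letter G) → List (Letter G) → (E →ₗ[ℝ] ℝ)),
      (BulkBoundary.sp l F) a.val = BulkBoundary.sp l (fun S T => F S T a.val) :=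
    fun l F => map_sp (LinearMap.applyₗ a.val) l F
  rw [LinearMap.add_apply, hev, hev]
  refine (sp_append_cons l₁ a l₂ g).trans ?_
  congr 1
  · exact sp_congr fun S T _ => hΛ S T a ha
  · exact sp_congr fun S T _ => hΛ' S T a ha

theorem SlotLin.mul_tdeg {f : List (Letter G) → ℝ} (hf : SlotLin f) (φ : ℤ → ℕ → ℝ) :
    SlotLin fun l => φ (tdeg l) l.length • f l := by
  intro l₁ l₂ k
  obtain ⟨Λ, hΛ⟩ := hf l₁ l₂ k
  refine ⟨φ (tdeg l₁ + (k + tdeg l₂)) (l₁.length + (l₂.length + 1)) • Λ, fun a ha => ?_⟩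
  change φ _ _ • f _ = _
  rw [hΛ a ha, tdeg_append, tdeg_cons, List.length_append, List.length_cons, ← ha]
  rfl

theorem SlotLin.comp_br {f : List (Letter G) → ℝ} (hf : SlotLin f) (a c : List (Letter G)) :
    SlotLin fun b => f (a ++ 𝔤.br b :: c) := by
  intro l₁ l₂ k
  obtain ⟨Λ, hΛ⟩ := hf a c (tdeg l₁ + (k + tdeg l₂) + 1)
  have h : l₁.length < (l₁ ++ zeroLetter G k :: l₂).length := by simp
  refine ⟨Λ.comp ((𝔤.op _).toLinearMap (vals (l₁ ++ zeroLetter G k :: l₂)) ⟨l₁.length, h⟩),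
    fun e he => ?_⟩
  change f (a ++ 𝔤.br _ :: c) = _
  rw [hΛ]
  · change Λ (𝔤.opw _) = Λ _
    rw [𝔤.opw_eq (k := (l₁ ++ zeroLetter G k :: l₂).length) _ (by simp),
      val_append_cons l₁ l₂ e (zeroLetter G k) h (by simp) rfl]
    rfl
  · change tdeg _ + 1 = _
    rw [tdeg_append, tdeg_cons, ← he]
    rfl

/-- Insertion of the brackets, divided by factorials, into all slots. -/
def LInfAlg.ceWord (f : List (Letter G) → ℝ) (l : List (Letter G)) : ℝ :=
  sp l fun a t => eps (tdeg a) • sp t fun b c =>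
    (b.length.factorial : ℝ)⁻¹ • f (a ++ 𝔤.br b :: c)

theorem SlotLin.ceWord {f : List (Letter G) → ℝ} (hf : SlotLin f) : SlotLin (𝔤.ceWord f) := by
  refine SlotLin.sp (fun t => SlotLin.mul_tdeg (f := fun a => BulkBoundary.sp t fun b c =>
      (b.length.factorial : ℝ)⁻¹ • f (a ++ 𝔤.br b :: c)) (SlotLin.sp_const (fun b c =>
      (hf.append_right (𝔤.br b :: c)).mul_tdeg fun _ _ => _) t) fun d _ => eps d)
    fun a => SlotLin.mul_tdeg (SlotLin.sp (fun c => (hf.comp_br 𝔤 a c).mul_tdeg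
      fun _ n => (n.factorial : ℝ)⁻¹) fun b => ?_) fun _ _ => eps (tdeg a)
  exact ((hf.append_left a).cons (𝔤.br b)).mul_tdeg fun _ _ => (b.length.factorial : ℝ)⁻¹

/-- Symmetrization intertwines the two forms of the Chevalley–Eilenberg differential. The factorials
in `ceWord` cancel against the permutations of the arguments of the bracket. -/
theorem LInfAlg.ce_psum {f : List (Letter G) → ℝ} (hf : SlotLin f) (l : List (Letter G)) :
    𝔤.ce (fun l => psum l f) l = psum l (𝔤.ceWord f) := by
  have h1 : 𝔤.ce (fun l => psum l f) l = unsh l (fun P R => unsh R (fun S Q =>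
      psum S fun a => psum Q fun c => eps ((tdeg P + 1) * tdeg a) • f (a ++ 𝔤.br P :: c))) := by
    refine unsh_congr fun P R _ => ?_
    rw [← psum_sp]
    change psum R (ins (𝔤.br P) f) = _
    congr 1
    funext l'
    rw [ins_eq_sp, 𝔤.deg_br]
  -- In the unshuffle, the letters before the bracket are drawn first.
  rw [h1, unsh_left_comm]
  refine Eq.trans ?_ (psum_sp l _).symm
  refine unsh_congr fun S T _ => ?_
  have h2 : ∀ a, psum T (fun t => eps (tdeg a) • sp t fun b c =>
      (b.length.factorial : ℝ)⁻¹ • f (a ++ 𝔤.br b :: c)) =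
      eps (tdeg a) • unsh T fun P Q => psum Q fun c => f (a ++ 𝔤.br P :: c) := by
    intro a
    rw [psum_smul, psum_sp]
    congr 1
    refine unsh_congr fun P Q _ => ?_
    have hs : GSymm fun b => psum Q fun c => f (a ++ 𝔤.br b :: c) := by
      intro l₁ e e' l₂
      rw [← psum_smul]
      refine psum_congr fun c _ => ?_
      obtain ⟨Λ, hΛ⟩ := hf a c (tdeg (l₁ ++ e :: e' :: l₂) + 1)
      rw [hΛ _ rfl, hΛ (𝔤.br (l₁ ++ e' :: e :: l₂)), ← map_smul]
      · congr 1
        exact 𝔤.opw_gsymm l₁ e e' l₂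
      · change tdeg _ + 1 = _
        rw [tdeg_perm ((List.Perm.swap _ _ _).append_left _)]
    rw [psum_congr (g := fun b => (P.length.factorial : ℝ)⁻¹ • psum Q fun c =>
      f (a ++ 𝔤.br b :: c)) fun b hb => by rw [psum_smul, hb.length_eq], psum_smul,
      psum_of_gsymm hs, smul_smul, inv_mul_cancel₀ (by positivity), one_smul]
  simp only [h2]
  rw [psum_congr (g := fun a => eps (tdeg S) • unsh T fun P Q => psum Q fun c =>
    f (a ++ 𝔤.br P :: c)) fun a ha => by rw [tdeg_perm ha], psum_smul, psum_unsh, ← unsh_smul]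
  refine unsh_congr fun P Q _ => ?_
  rw [psum_congr (l := S) (g := fun a => eps ((tdeg P + 1) * tdeg S) • psum Q fun c =>
    f (a ++ 𝔤.br P :: c)) fun a ha => by rw [psum_smul, tdeg_perm ha], psum_smul, smul_smul,
    ← eps_add]
  congr 1
  rw [show tdeg S * tdeg P + (tdeg P + 1) * tdeg S =
    tdeg S * tdeg P + tdeg S * tdeg P + tdeg S by ring, eps_add, eps_add, eps_mul_self, one_mul]

theorem WordFam.IsSmooth.ceWord {w : WordFam G r} (hw : w.IsSmooth) :
    IsSmooth (fun x => 𝔤.ceWord (w x) : WordFam G r) := by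
  intro s L
  refine cast (congrArg _ (funext fun z => ?_)) (contDiff_sp (l := L)
    (g := fun (z : (Fin r → ℝ) × (Fin s → ℝ)) a t => eps (tdeg a) • sp t fun b c =>
      (b.length.factorial : ℝ)⁻¹ • w z.1 ((a ++ 𝔤.brFam b :: c).map (LetterFam.eval z.2)))
    fun a t => (contDiff_sp fun b c => (hw s _).const_smul _).const_smul _)
  simp only [LInfAlg.ceWord, sp_map, tdeg_map (φ := LetterFam.eval z.2) (fun a => rfl),
    List.length_map, List.map_append, List.map_cons, 𝔤.br_eval]

theorem LInfAlg.ceWord_isHom {p : ℤ} {w : List (Letter G) → ℝ} (hw : ShuffleAlg.IsHom p w) :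
    ShuffleAlg.IsHom (p + 1) (𝔤.ceWord w) := by
  intro l hl
  refine (sp_congr fun a t hat => ?_).trans (map_sp (0 : ℝ →ₗ[ℝ] ℝ) l fun _ _ => 0).symm
  rw [LinearMap.zero_apply]
  refine smul_eq_zero_of_right _ ?_
  refine (sp_congr fun b c hbc => ?_).trans (map_sp (0 : ℝ →ₗ[ℝ] ℝ) t fun _ _ => 0).symm
  rw [LinearMap.zero_apply]
  refine smul_eq_zero_of_right _ (hw _ ?_)
  subst hbc hat
  simp only [tdeg_append, tdeg_cons, 𝔤.deg_br] at hl ⊢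
  omega

/-- The value of the Chevalley–Eilenberg differential on a tuple. -/
theorem LInfAlg.ceWord_word (F : ∀ m, MFam E r m) (m : ℕ) (x : Fin r → ℝ)
    (u : Fin m → Letter G) :
    𝔤.ceWord (word G F x) (List.ofFn u) =
      ∑ q ∈ Finset.HasAntidiagonal.antidiagonal (m + 1), ∑ i ∈ Finset.range q.1,
        ((q.2.factorial : ℝ)⁻¹ *
          (sgn (∑ a : Fin m, if (a : ℕ) < i then deg (u a) else 0) : ℝ)) *
        F q.1 x (fun a : Fin q.1 =>
          if (a : ℕ) < i then ext (fun a => (u a).val) a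
          else if (a : ℕ) = i then 𝔤.op q.2 (fun b => ext (fun a => (u a).val) (i + b))
          else ext (fun a => (u a).val) (a + q.2 - 1)) := by
  refine (sp_eq_sum _ _).trans ?_
  rw [List.length_ofFn]
  simp only [sp_eq_sum, Finset.smul_sum, List.length_drop, List.length_ofFn]
  rw [Finset.sum_sigma', Finset.sum_sigma']
  refine Finset.sum_nbij' (fun y => ⟨(m + 1 - y.2, y.2), y.1⟩) (fun y => ⟨y.2, y.1.2⟩)
    ?_ ?_ ?_ ?_ ?_
  · rintro ⟨i, j⟩ h
    simp only [Finset.mem_sigma, Finset.mem_range, Finset.HasAntidiagonal.mem_antidiagonal] at h ⊢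
    omega
  · rintro ⟨⟨a, b⟩, i⟩ h
    simp only [Finset.mem_sigma, Finset.mem_range, Finset.HasAntidiagonal.mem_antidiagonal] at h ⊢
    omega
  · rintro ⟨i, j⟩ h
    rfl
  · rintro ⟨⟨a, b⟩, i⟩ h
    simp only [Finset.mem_sigma, Finset.mem_range, Finset.HasAntidiagonal.mem_antidiagonal] at h
    have : a = m + 1 - b := by omega
    subst this
    rfl
  · rintro ⟨i, j⟩ h
    simp only [Finset.mem_sigma, Finset.mem_range] at h
    have hi : i ≤ m := by omega
    have hj : j ≤ m - i := by omega
    simp only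
    rw [tdeg_take_ofFn, smul_smul, smul_eq_mul, mul_comm (eps _)]
    have hlen : (List.take j (List.drop i (List.ofFn u))).length = j := by simp [hj]
    rw [hlen]
    congr 1
    rw [word_eq F x (k := m + 1 - j) _ (by simp; omega)]
    congr 1
    funext a
    obtain ⟨a, ha⟩ := a
    have hlen' : (List.take i (List.ofFn u)).length = i := by simp [hi]
    simp only
    split_ifs with h1 h2
    · rw [List.getElem_append_left (by omega), List.getElem_take, getElem_ofFn_ext]
    · subst h2
      simp only [List.getElem_append_right (le_of_eq hlen'), hlen', Nat.sub_self,
        List.getElem_cons_zero]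
      change 𝔤.opw _ = _
      rw [𝔤.opw_eq (k := j) _ hlen]
      congr 1
      funext b
      rw [List.getElem_take, List.getElem_drop, getElem_ofFn_ext]
    · obtain ⟨c, hc⟩ : ∃ c, a - i = c + 1 := ⟨a - i - 1, by omega⟩
      rw [List.getElem_append_right (by omega)]
      simp only [hlen', hc, List.getElem_cons_succ, List.getElem_drop]
      rw [getElem_ofFn_ext]
      congr 1
      omega

end

/-! ### Products and derivatives of series of multilinear functionals -/

section

variable {E : Type u} [AddCommGroup E] [Module ℝ E] {G : GrSpace E} {r : ℕ}

/-- The series with the constant term `1`. -/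
def oneSeries (E : Type u) [AddCommGroup E] [Module ℝ E] (r : ℕ) : ∀ m, MFam E r m
  | 0 => fun _ => MultilinearMap.constOfIsEmpty ℝ _ 1
  | _ + 1 => fun _ => 0

theorem oneSeries_isSeries : IsSeries G 0 (oneSeries E r) := by
  constructor
  · rintro (_ | m) s v _
    · exact contDiff_const
    · exact contDiff_const
  · rintro (_ | m) x κ v _ hne
    · simp at hne
    · rfl

theorem sym_oneSeries : sym G (oneSeries E r) = 1 := by
  refine WordFam.ext₂ fun x l => ?_
  cases l with
  | nil => rfl
  | cons a l =>
    refine psum_eq_zero fun l' hl' => ?_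
    cases l' with
    | nil => simp at hl'
    | cons b l' => rfl

theorem ext_block {m a b : ℕ} (h : a + b = m) (v : Fin m → E) (n : ℕ) :
    ext (fun j : Fin b => ext v (a + j)) n = ext v (a + n) := by
  by_cases h1 : n < b
  · rw [ext, dif_pos h1]
  · rw [ext, dif_neg h1, ext, dif_neg (by omega)]

theorem sum_antidiagonalTuple_succ {k m : ℕ} {Y : Type*} [AddCommMonoid Y]
    (f : (Fin (k + 1) → ℕ) → Y) :
    ∑ n ∈ Finset.Nat.antidiagonalTuple (k + 1) m, f n =
      ∑ q ∈ Finset.HasAntidiagonal.antidiagonal m,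
        ∑ n ∈ Finset.Nat.antidiagonalTuple k q.2, f (Fin.cons q.1 n) := by
  rw [Finset.sum_sigma']
  refine Finset.sum_nbij' (fun n => ⟨(n 0, ∑ i : Fin k, n i.succ), fun i => n i.succ⟩)
    (fun y => Fin.cons y.1.1 y.2) ?_ ?_ ?_ ?_ ?_
  · intro n hn
    rw [Finset.Nat.mem_antidiagonalTuple, Fin.sum_univ_succ] at hn
    simp only [Finset.mem_sigma, Finset.HasAntidiagonal.mem_antidiagonal,
      Finset.Nat.mem_antidiagonalTuple]
    exact ⟨hn, trivial⟩
  · rintro ⟨⟨a, b⟩, n⟩ h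
    simp only [Finset.mem_sigma, Finset.HasAntidiagonal.mem_antidiagonal,
      Finset.Nat.mem_antidiagonalTuple] at h
    simp [Finset.Nat.mem_antidiagonalTuple, Fin.sum_univ_succ, h.1, h.2]
  · intro n _
    exact Fin.cons_self_tail n
  · rintro ⟨⟨a, b⟩, n⟩ h
    simp only [Finset.mem_sigma, Finset.HasAntidiagonal.mem_antidiagonal,
      Finset.Nat.mem_antidiagonalTuple] at h
    simp [h.2]
  · intro n _
    congr 1
    exact (Fin.cons_self_tail n).symm

/-- The product of several series, in closed form, together with its symmetrization. -/
theorem exists_prod_series {k : ℕ} {p : Fin k → ℤ} {F : Fin k → ∀ m, MFam E r m}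
    (hF : ∀ i, IsSeries G (p i) (F i)) :
    ∃ H : ∀ m, MFam E r m, IsSeries G (∑ i, p i) H ∧
      (∀ m x v, H m x v = ∑ n ∈ Finset.Nat.antidiagonalTuple k m, ∏ i,
        F i (n i) x (fun j : Fin (n i) => ext v (∑ l ∈ Finset.Iio i, n l + j))) ∧
      sym G H = (List.ofFn fun i => sym G (F i)).prod := by
  induction k with
  | zero =>
    refine ⟨oneSeries E r, oneSeries_isSeries, ?_, sym_oneSeries⟩
    rintro (_ | m) x v
    · simp [oneSeries]
    · simp [oneSeries]
  | succ k ih =>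
    obtain ⟨H, h1, h2, h3⟩ := ih fun i => hF i.succ
    refine ⟨star (F 0) H, ?_, fun m x v => ?_, ?_⟩
    · rw [Fin.sum_univ_succ]
      exact star_isSeries (hF 0) h1
    · rw [star_apply, sum_antidiagonalTuple_succ]
      refine Finset.sum_congr rfl fun q hq => ?_
      have hq' := Finset.HasAntidiagonal.mem_antidiagonal.1 hq
      rw [h2, Finset.mul_sum]
      refine Finset.sum_congr rfl fun n _ => ?_
      rw [Fin.prod_univ_succ]
      congr 1
      · have : Finset.Iio (0 : Fin (k + 1)) = ∅ := rfl
        simp only [this, Finset.sum_empty, zero_add]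
        rfl
      · refine Finset.prod_congr rfl fun i _ => ?_
        simp only [sum_Iio_succ, ext_block hq', Fin.cons_zero, Fin.cons_succ, add_assoc]
        rfl
    · rw [sym_star, h3, List.ofFn_succ, List.prod_cons]

theorem MFam.Smooth.differentiable {m : ℕ} {F : MFam E r m} (hF : F.Smooth G) (v : Fin m → E)
    (x : Fin r → ℝ) : DifferentiableAt ℝ (fun y => F y v) x := by
  have h := (hF 0 (fun i _ => v i) fun i => G.const_plot 0 _).comp
    (contDiff_id.prodMk contDiff_const : ContDiff ℝ ∞ fun x : Fin r → ℝ => (x, (0 : Fin 0 → ℝ)))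
  exact h.differentiable (by simp) x

/-- The partial derivative of a family of functionals in a parameter. -/
def MFam.pd {m : ℕ} {F : MFam E r m} (hF : F.Smooth G) (i : Fin r) : MFam E r m := fun x =>
  { toFun v := fderiv ℝ (fun y => F y v) x (Pi.single i 1)
    map_update_add' := by
      intro dec v j e e'
      simp only [MultilinearMap.map_update_add]
      rw [fderiv_fun_add (hF.differentiable _ x) (hF.differentiable _ x)]
      rfl
    map_update_smul' := by
      intro dec v j c e
      simp only [MultilinearMap.map_update_smul]
      rw [fderiv_fun_const_smul (hF.differentiable _ x)]
      rfl }

theorem MFam.pd_apply {m : ℕ} {F : MFam E r m} (hF : F.Smooth G) (i : Fin r) (x : Fin r → ℝ)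
    (v : Fin m → E) : MFam.pd hF i x v = fderiv ℝ (fun y => F y v) x (Pi.single i 1) := rfl

theorem MFam.pd_smooth {m : ℕ} {F : MFam E r m} (hF : F.Smooth G) (i : Fin r) :
    (MFam.pd hF i).Smooth G := by
  intro s v hv
  have h := hF s v hv
  have h' : ∀ z : (Fin r → ℝ) × (Fin s → ℝ), MFam.pd hF i z.1 (fun j => v j z.2) =
      fderiv ℝ (fun z : (Fin r → ℝ) × (Fin s → ℝ) => F z.1 (fun j => v j z.2)) z
        (Pi.single i 1, 0) := by
    intro z
    have hc : HasFDerivAt (fun y : Fin r → ℝ => (y, z.2))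
        (ContinuousLinearMap.inl ℝ (Fin r → ℝ) (Fin s → ℝ)) z.1 := hasFDerivAt_prodMk_left _ _
    have := ((h.differentiable (by simp) z).hasFDerivAt.comp z.1 hc).fderiv
    refine (congrArg (fun T : (Fin r → ℝ) →L[ℝ] ℝ => T (Pi.single i 1)) this).trans ?_
    simp
  simp only [h']
  exact (h.fderiv_right (m := ∞) (by norm_cast)).clm_apply contDiff_const

theorem pd_isSeries {p : ℤ} {F : ∀ m, MFam E r m} (hF : IsSeries G p F) (i : Fin r) :
    IsSeries G p fun m => MFam.pd (hF.smooth m) i := by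
  refine ⟨fun m => MFam.pd_smooth _ i, fun m x κ v hv hne => ?_⟩
  simp only [MFam.pd_apply, hF.hom m _ κ v hv hne]
  simp

theorem sym_pd {p : ℤ} {F : ∀ m, MFam E r m} (hF : IsSeries G p F) (i : Fin r) :
    sym G (fun m => MFam.pd (hF.smooth m) i) = WordFam.pdFun i (sym G F) := by
  refine WordFam.ext₂ fun x l => ?_
  simp only [WordFam.pdFun, sym_apply, MFam.pd_apply]
  rw [fderiv_fun_sum fun σ _ => ((hF.smooth _).differentiable _ x).const_mul _, _root_.sum_apply]
  refine Finset.sum_congr rfl fun σ _ => ?_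
  rw [fderiv_const_mul ((hF.smooth _).differentiable _ x)]
  rfl

theorem exists_ce_series (𝔤 : LInfAlg G) {p : ℤ} {F : ∀ m, MFam E r m} (hF : IsSeries G p F) :
    ∃ H : ∀ m, MFam E r m, IsSeries G (p + 1) H ∧
      (∀ m x (u : Fin m → Letter G), H m x (fun i => (u i).val) =
        𝔤.ceWord (word G F x) (List.ofFn u)) ∧
      sym G H = fun x => 𝔤.ce (sym G F x) := by
  have hs : ∀ x, SlotLin ((fun x => 𝔤.ceWord (word G F x) : WordFam G r) x) :=
    fun x => (word_slotLin F x).ceWord 𝔤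
  refine ⟨lift _ hs, lift_isSeries hs ((word_isSmooth hF.smooth).ceWord 𝔤)
    (fun x => 𝔤.ceWord_isHom (word_isHom hF x)), fun m x u => lift_eq hs x u, ?_⟩
  refine WordFam.ext₂ fun x l => ?_
  refine (congrArg (fun w : WordFam G r => psum l (w x)) (word_lift hs)).trans ?_
  exact (𝔤.ce_psum (word_slotLin F x) l).symm

/-- Precomposition of a series with a linear map. -/
def GrHom.series {E' : Type u} [AddCommGroup E'] [Module ℝ E'] {G' : GrSpace E'} (φ : GrHom G G')
    (F : ∀ m, MFam E' r m) (m : ℕ) : MFam E r m :=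
  fun x => (F m x).compLinearMap fun _ => φ.toFun

theorem GrHom.series_isSeries {E' : Type u} [AddCommGroup E'] [Module ℝ E'] {G' : GrSpace E'}
    (φ : GrHom G G') {p : ℤ} {F : ∀ m, MFam E' r m} (hF : IsSeries G' p F) :
    IsSeries G p (φ.series F) := by
  refine ⟨fun m s v hv => hF.smooth m s (fun i y => φ.toFun (v i y)) fun i => φ.plot s _ (hv i),
    fun m x κ v hv hne => hF.hom m x κ (fun i => φ.toFun (v i)) (fun i => ?_) hne⟩
  rw [φ.pr, hv]

theorem GrHom.sym_series {E' : Type u} [AddCommGroup E'] [Module ℝ E'] {G' : GrSpace E'}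
    (φ : GrHom G G') (F : ∀ m, MFam E' r m) :
    sym G (φ.series F) = φ.word r (sym G' F) := by
  refine WordFam.ext₂ fun x l => ?_
  rw [GrHom.word_apply, GrHom.shuffle_apply]
  refine Eq.trans ?_ (psum_map φ.deg_letter l (BulkBoundary.word G' F x)).symm
  refine psum_congr fun l' _ => ?_
  rw [word_eq F x _ (List.length_map _)]
  change F _ x _ = _
  congr 1
  funext i
  simp [GrHom.letter, vals]

end

/-! ### The `L∞` algebras of conditioned fields -/

section Sections

variable {n : ℕ} {H : Type} [TopologicalSpace H]
  {I : ModelWithCorners ℝ (EuclideanSpace ℝ (Fin n)) H}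
  {X : Type u} [TopologicalSpace X] [ChartedSpace H X]

theorem GrBundle.SmoothOn.const {A : GrBundle I X} {U : Set X} {s : ∀ x, A.Fib x}
    (h : A.SmoothOn U s) (r : ℕ) : A.SmoothFam r U fun _ => s :=
  ContMDiffOn.comp (t := U) h contMDiff_snd.contMDiffOn fun _ hp => hp.2

theorem GrBundle.SmoothFam.apply {A : GrBundle I X} {U : Set X} {r : ℕ}
    {s : (Fin r → ℝ) → ∀ x, A.Fib x} (h : A.SmoothFam r U s) (y : Fin r → ℝ) :
    A.SmoothOn U (s y) :=
  ContMDiffOn.comp (t := univ ×ˢ U) h (contMDiff_const.prodMk contMDiff_id).contMDiffOn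
    fun _ hx => ⟨mem_univ y, hx⟩

/-- The homogeneous part of a section. -/
def GrBundle.prSec (A : GrBundle I X) (U : Opens X) (k : ℤ) : A.Sec U →ₗ[ℝ] A.Sec U where
  toFun s := ⟨fun x => A.pr k x (s.1 x), fun x hx =>
      (congrArg (A.pr k x) (s.2.1 x hx)).trans (map_zero _),
    GrBundle.SmoothFam.apply (r := 0) (s := fun _ x => A.pr k x (s.1 x))
      (A.pr_smooth k 0 U (fun _ => s.1) (GrBundle.SmoothOn.const s.2.2 0)) 0⟩
  map_add' _ _ := Subtype.ext (funext fun _ => map_add _ _ _)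
  map_smul' _ _ := Subtype.ext (funext fun _ => map_smul _ _ _)

theorem GrBundle.res_of_mem {A : GrBundle I X} {U V : Opens X} (h : U ≤ V) (s : A.Sec V) {x : X}
    (hx : x ∈ U) : (A.res h s).1 x = s.1 x := if_pos hx

theorem GrBundle.res_of_notMem {A : GrBundle I X} {U V : Opens X} (h : U ≤ V) (s : A.Sec V)
    {x : X} (hx : x ∉ U) : (A.res h s).1 x = 0 := if_neg hx

end Sections

namespace System

variable {d : ℕ} {M N : Type u} [TopologicalSpace M]
  [ChartedSpace (EuclideanHalfSpace (d + 1)) M] [MeasurableSpace M] [TopologicalSpace N]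
  [ChartedSpace (EuclideanSpace ℝ (Fin d)) N] [MeasurableSpace N] (B : System d M N)

theorem prSec_mem {U : Opens M} (k : ℤ) {e : B.bulk.bdl.Sec U} (he : e ∈ B.fields U) :
    B.bulk.bdl.prSec U k e ∈ B.fields U := by
  intro x hx
  rw [rho_apply B _ hx]
  change (B.φ (x, 0) (B.bulk.bdl.pr k _ (e.1 _))).1 ∈ B.L x
  rw [B.φ_degree _ (B.mem_dom_zero x)]
  have := he x hx
  rw [rho_apply B _ hx] at this
  exact B.L_graded k x _ this

/-- The graded space of conditioned fields. -/
def fieldsGr (U : Opens M) : GrSpace (B.fields U) where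
  pr k := (B.bulk.bdl.prSec U k).restrict fun _ he => B.prSec_mem k he
  pr_pr j k e := by
    refine Subtype.ext (Subtype.ext (funext fun x => ?_))
    refine (B.bulk.bdl.pr_pr j k x (e.1.1 x)).trans ?_
    split_ifs <;> rfl
  bound := B.bulk.bdl.bound
  pr_eq_zero k hk e := by
    refine Subtype.ext (Subtype.ext (funext fun x => ?_))
    change B.bulk.bdl.pr k x (e.1.1 x) = 0
    rw [B.bulk.bdl.pr_eq_zero k hk, LinearMap.zero_apply]
  pr_sum e := by
    refine Subtype.ext (Subtype.ext (funext fun x => ?_))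
    refine Eq.trans ?_ (B.bulk.bdl.pr_sum x (e.1.1 x))
    rw [Submodule.coe_sum, Submodule.coe_sum, Finset.sum_apply]
    rfl
  plot s := {v | B.bulk.bdl.SmoothFam s U fun y => (v y).1.1}
  pr_plot k s v hv := B.bulk.bdl.pr_smooth k s U (fun y => (v y).1.1) hv
  const_plot s e := e.1.2.2.const s

variable {B}

theorem pr_eq_iff {U : Opens M} {k : ℤ} {e : B.fields U} :
    (B.fieldsGr U).pr k e = e ↔ B.HomogField k e := by
  rw [Subtype.ext_iff, Subtype.ext_iff, funext_iff]
  rfl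

theorem fields_ext {U : Opens M} {e e' : B.fields U} (h : ∀ x, e.1.1 x = e'.1.1 x) : e = e' :=
  Subtype.ext (Subtype.ext (funext h))

variable (B)

theorem coe_ext {U : Opens M} {m : ℕ} (v : Fin m → B.fields U) (b : ℕ) :
    (ext v b).1 = ext (fun a => (v a).1) b := by
  unfold ext
  split_ifs <;> rfl

/-- The `L∞` algebra of conditioned fields. -/
def fieldsAlg (U : Opens M) : LInfAlg (B.fieldsGr U) where
  op k :=
    { toFun := B.ell k U
      map_update_add' := by
        intro dec v i e e'
        obtain rfl : dec = instDecidableEqFin k := Subsingleton.elim _ _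
        have h : ∀ e : B.fields U, (fun j => (Function.update v i e j).1) =
            Function.update (fun j => (v j).1) i e.1 := fun e => by
          funext j
          exact Function.apply_update (fun _ (c : B.fields U) => c.1) v i e j
        refine Subtype.ext ?_
        change B.bulk.op k U _ = B.bulk.op k U _ + B.bulk.op k U _
        rw [h, h, h]
        exact (B.bulk.op k U).map_update_add _ _ _ _
      map_update_smul' := by
        intro dec v i c e
        obtain rfl : dec = instDecidableEqFin k := Subsingleton.elim _ _
        have h : ∀ e : B.fields U, (fun j => (Function.update v i e j).1) =
            Function.update (fun j => (v j).1) i e.1 := fun e => by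
          funext j
          exact Function.apply_update (fun _ (c : B.fields U) => c.1) v i e j
        refine Subtype.ext ?_
        change B.bulk.op k U _ = c • B.bulk.op k U _
        rw [h, h]
        exact (B.bulk.op k U).map_update_smul _ _ _ _ }
  op_zero v := Subtype.ext (B.bulk.op_zero U _)
  op_plot k s v hv := B.bulk.op_smooth k s U (fun i y => (v i y).1) hv
  degree k κ v hv :=
    pr_eq_iff.2 (B.bulk_isBV.lInfty.degree k U κ _ fun i => pr_eq_iff.1 (hv i))
  symm k κ v hv σ :=
    Subtype.ext (B.bulk_isBV.lInfty.symm k U κ _ (fun i => pr_eq_iff.1 (hv i)) σ)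
  jacobi m κ v hv := by
    refine Subtype.ext (Eq.trans ?_ (B.bulk_isBV.lInfty.jacobi m U κ (fun i => (v i).1)
      fun i => pr_eq_iff.1 (hv i)))
    rw [Submodule.coe_sum]
    refine Finset.sum_congr rfl fun σ _ => ?_
    rw [Submodule.coe_sum]
    refine Finset.sum_congr rfl fun i _ => ?_
    refine congrArg (_ • ·) ?_
    refine congrArg (B.bulk.op (m - i + 1) U) ?_
    funext b
    induction b using Fin.cases with
    | zero =>
      refine congrArg (B.bulk.op i U) (funext fun b => ?_)
      exact B.coe_ext _ _
    | succ b => exact B.coe_ext _ _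

/-- Restriction of conditioned fields. -/
def fieldsHom {U V : Opens M} (h : U ≤ V) : GrHom (B.fieldsGr V) (B.fieldsGr U) where
  toFun :=
    { toFun := B.fieldsRes h
      map_add' := fun e e' => Subtype.ext (map_add (B.bulk.bdl.res h) _ _)
      map_smul' := fun c e => Subtype.ext (map_smul (B.bulk.bdl.res h) _ _) }
  pr k e := fields_ext fun x => by
    change B.bulk.bdl.pr k x ((B.bulk.bdl.res h e.1).1 x) =
      (B.bulk.bdl.res h (B.bulk.bdl.prSec V k e.1)).1 x
    by_cases hx : x ∈ U
    · rw [GrBundle.res_of_mem h _ hx, GrBundle.res_of_mem h _ hx]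
      rfl
    · rw [GrBundle.res_of_notMem h _ hx, GrBundle.res_of_notMem h _ hx, map_zero]
  plot s v hv := by
    refine ContMDiffOn.congr (ContMDiffOn.mono hv (prod_mono_right h)) fun p hp => ?_
    exact congrArg (TotalSpace.mk' _ p.2) (GrBundle.res_of_mem h _ hp.2)

/-- The sheaf of conditioned fields. -/
abbrev presheaf : LInfPresheaf M where
  E U := B.fields U
  gr := B.fieldsGr
  alg := B.fieldsAlg
  res := B.fieldsHom
  res_self {U} h e := fields_ext fun x => by
    by_cases hx : x ∈ U
    · exact GrBundle.res_of_mem h _ hx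
    · exact (GrBundle.res_of_notMem h _ hx).trans (e.1.2.1 x hx).symm
  res_res {U V W} h h' e := fields_ext fun x => by
    by_cases hx : x ∈ U
    · exact (GrBundle.res_of_mem h _ hx).trans ((GrBundle.res_of_mem h' _ (h hx)).trans
        (GrBundle.res_of_mem (h.trans h') _ hx).symm)
    · exact (GrBundle.res_of_notMem h _ hx).trans
        (GrBundle.res_of_notMem (h.trans h') _ hx).symm
  strict h k v := Subtype.ext (B.bulk.op_res k h _)

/-- The prefactorization algebra of classical observables. -/
def observables : PrefactorizationAlgebra M := B.presheaf.prefact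

variable {B}

theorem isSeries {U : Opens M} {r : ℕ} {p : ℤ} (F : B.Series U r p) :
    IsSeries (B.fieldsGr U) p F.1 :=
  ⟨fun m => (F.2 m).1, fun m x κ v hv hne => (F.2 m).2 x κ v (fun i => pr_eq_iff.1 (hv i)) hne⟩

/-- A series of multilinear functionals on the conditioned fields. -/
def ofSeries {U : Opens M} {r : ℕ} {p : ℤ} {F : ∀ m, B.Fam U r m}
    (h : IsSeries (B.fieldsGr U) p F) : B.Series U r p :=
  ⟨F, fun m => ⟨h.smooth m, fun x κ v hv hne => h.hom m x κ v (fun i => pr_eq_iff.2 (hv i)) hne⟩⟩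

theorem coinvRel_eq (U : Opens M) (r m : ℕ) : B.coinvRel U r m = coinv (B.fieldsGr U) r m := by
  simp only [coinvRel, coinv, pr_eq_iff]
  rfl

/-- The graded symmetrization of a series of functionals. -/
def clsObs {U : Opens M} {r : ℕ} {p : ℤ} (F : B.Series U r p) : WordFam.Obs (B.fieldsGr U) r :=
  ⟨sym (B.fieldsGr U) F.1, WordFam.homSub_le p (sym_mem_homSub (isSeries F))⟩

theorem mulObs_cls {k : ℕ} {U : Fin k → Opens M} {V : Opens M} (hV : ∀ i, U i ≤ V) {r : ℕ}
    {p : Fin k → ℤ} (F : ∀ i, B.Series (U i) r (p i)) (H : B.Series V r (∑ i, p i))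
    (h : sym (B.fieldsGr V) H.1 =
      (List.ofFn fun i => (B.fieldsHom (hV i)).word r (sym (B.fieldsGr (U i)) (F i).1)).prod) :
    B.presheaf.mulObs U V hV r (fun i => clsObs (F i)) = clsObs H :=
  Subtype.ext ((B.presheaf.mulObs_val U V hV r _).trans h.symm)

theorem dObs_cls {U : Opens M} {r : ℕ} {p : ℤ} (F : B.Series U r p) (H : B.Series U r (p + 1))
    (h : sym (B.fieldsGr U) H.1 = fun x => (B.fieldsAlg U).ce (sym (B.fieldsGr U) F.1 x)) :
    WordFam.dObs (B.fieldsAlg U) (clsObs F) = clsObs H :=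
  Subtype.ext h.symm

theorem exists_mul_cls {k : ℕ} {U : Fin k → Opens M} {V : Opens M} (hV : ∀ i, U i ≤ V) {r : ℕ}
    {p : Fin k → ℤ} (F : ∀ i, B.Series (U i) r (p i)) : ∃ H : B.Series V r (∑ i, p i),
    (∀ m x v, H.1 m x v = ∑ n ∈ Finset.Nat.antidiagonalTuple k m, ∏ i,
      (F i).1 (n i) x (fun j : Fin (n i) =>
        B.fieldsRes (hV i) (ext v (∑ l ∈ Finset.Iio i, n l + j)))) ∧
    B.presheaf.mulObs U V hV r (fun i => clsObs (F i)) = clsObs H := by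
  have hF : ∀ i, IsSeries (B.fieldsGr V) (p i) ((B.fieldsHom (hV i)).series (F i).1) :=
    fun i => (B.fieldsHom (hV i)).series_isSeries (isSeries (F i))
  obtain ⟨H, h1, h2, h3⟩ := exists_prod_series hF
  refine ⟨ofSeries h1, fun m x v => h2 m x v, mulObs_cls hV F (ofSeries h1) (h3.trans ?_)⟩
  simp only [GrHom.sym_series]

theorem exists_d_cls {U : Opens M} {r : ℕ} {p : ℤ} (F : B.Series U r p) :
    ∃ H : B.Series U r (p + 1),
    (∀ m x (κ : Fin m → ℤ) (v : Fin m → B.fields U), (∀ i, B.HomogField (κ i) (v i)) →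
      H.1 m x v = B.dCE F.1 m x κ v) ∧ WordFam.dObs (B.fieldsAlg U) (clsObs F) = clsObs H := by
  obtain ⟨H, h1, h2, h3⟩ := exists_ce_series (B.fieldsAlg U) (isSeries F)
  refine ⟨ofSeries h1, fun m x κ v hv => ?_, dObs_cls F (ofSeries h1) h3⟩
  refine (h2 m x fun i => ⟨κ i, v i, pr_eq_iff.2 (hv i)⟩).trans ?_
  rw [LInfAlg.ceWord_word]
  rfl

variable (B) in
/-- The class of a series of functionals. -/
def cls (U : Opens M) (r : ℕ) (p : ℤ) : B.Series U r p →+ (B.observables.obj U).carrier r :=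
  { toFun := fun F => (clsObs F : WordFam.Obs (B.fieldsGr U) r)
    map_zero' := WordFam.Obs.ext fun _ l => psum_zero l
    map_add' := fun _ _ => WordFam.Obs.ext fun _ l => psum_add _ _ l }

variable (B) in
/-- The complex of symmetrized functionals is the complex of coinvariants of series of functionals,
with `cls` as the quotient map. -/
theorem isClassicalObservables : B.IsClassicalObservables B.observables B.cls where
  range_cls U r p := by
    refine subset_antisymm ?_ fun a ha => ?_
    · rintro _ ⟨F, rfl⟩
      exact sym_mem_homSub (isSeries F)
    · obtain ⟨F, hF, h⟩ := exists_sym_eq (WordFam.mem_homObs.1 ha)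
      exact ⟨ofSeries hF, Subtype.ext h⟩
  cls_eq_zero U r p F := by
    simp only [coinvRel_eq, mem_coinv_iff ((isSeries F).smooth _)]
    constructor
    · intro h m x l _
      exact congrFun (congrFun (congrArg Subtype.val h) x) l
    · intro h
      exact WordFam.Obs.ext fun x l => h l.length x l rfl
  cls_smul U r p f F := by
    have hf : ContDiff ℝ ∞ f.1 := f.2
    have h : IsSeries (B.fieldsGr U) p fun m x => f.1 x • F.1 m x :=
      ⟨fun m s v hv => (hf.comp contDiff_fst).mul ((isSeries F).smooth m s v hv),
        fun m x κ v hv hne => by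
          change f.1 x * _ = 0
          rw [(isSeries F).hom m x κ v hv hne, mul_zero]⟩
    refine ⟨ofSeries h, fun m x => rfl, WordFam.Obs.ext fun x l => ?_⟩
    exact (psum_smul (f.1 x) (word (B.fieldsGr U) F.1 x) l).symm
  cls_pull U s r p g F := by
    have hg : ContDiff ℝ ∞ g.1 := g.2
    have h : IsSeries (B.fieldsGr U) p fun m x => F.1 m (g.1 x) :=
      ⟨fun m t v hv => ((isSeries F).smooth m t v hv).comp
        ((hg.comp contDiff_fst).prodMk contDiff_snd), fun m x => (isSeries F).hom m _⟩
    exact ⟨ofSeries h, fun m x => rfl, rfl⟩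
  cls_pd U r p i F :=
    ⟨ofSeries (pd_isSeries (isSeries F) i), fun m x v => rfl,
      Subtype.ext (sym_pd (isSeries F) i).symm⟩
  cls_fil U r p n F := by
    simp only [coinvRel_eq, mem_coinv_iff ((isSeries F).smooth _)]
    constructor
    · rintro h m hm x l rfl
      exact h x l hm
    · intro h x l hl
      exact h l.length hl x l rfl
  cls_d _ _ _ F := exists_d_cls F
  cls_mul _ _ _ _ hV _ _ F := exists_mul_cls hV F

end System

/-! ### Series of smooth functions on convex sets -/

section

open Filter Topology

variable {E F : Type*} [NormedAddCommGroup E] [NormedSpace ℝ E] [NormedAddCommGroup F]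
  [NormedSpace ℝ F] [CompleteSpace F]

/-- Termwise differentiation within a convex set: dominated convergence applies to the difference
quotients, which are bounded by the mean value inequality. -/
theorem hasFDerivWithinAt_tsum {D : Set E} (hD : Convex ℝ D) {f : ℕ → E → F}
    {f' : ℕ → E → E →L[ℝ] F} {b : ℕ → ℝ} (hb : Summable b)
    (hf : ∀ n, ∀ x ∈ D, HasFDerivWithinAt (f n) (f' n x) D x)
    (hfb : ∀ n, ∀ x ∈ D, ‖f' n x‖ ≤ b n) (hs : ∀ x ∈ D, Summable fun n => f n x)
    {x : E} (hx : x ∈ D) :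
    HasFDerivWithinAt (fun z => ∑' n, f n z) (∑' n, f' n x) D x := by
  rw [hasFDerivWithinAt_iff_tendsto]
  have hs' : Summable fun n => f' n x := Summable.of_norm_bounded hb fun n => hfb n x hx
  have hb0 : ∀ n, 0 ≤ b n := fun n => (norm_nonneg _).trans (hfb n x hx)
  have hbound : ∀ n, ∀ z ∈ D,
      ‖‖z - x‖⁻¹ * ‖f n z - f n x - f' n x (z - x)‖‖ ≤ 2 * b n := by
    intro n z hz
    rw [norm_mul, norm_norm, norm_inv, norm_norm]
    have h1 : ‖f n z - f n x‖ ≤ b n * ‖z - x‖ :=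
      hD.norm_image_sub_le_of_norm_hasFDerivWithin_le (hf n) (hfb n) hx hz
    have h2 : ‖f' n x (z - x)‖ ≤ b n * ‖z - x‖ :=
      ((f' n x).le_opNorm _).trans (mul_le_mul_of_nonneg_right (hfb n x hx) (norm_nonneg _))
    have h3 : ‖f n z - f n x - f' n x (z - x)‖ ≤ 2 * b n * ‖z - x‖ := by
      refine (norm_sub_le _ _).trans ?_
      linarith
    rcases eq_or_ne (‖z - x‖) 0 with h | h
    · rw [h, inv_zero, zero_mul]
      linarith [hb0 n]
    · rw [inv_mul_le_iff₀ (lt_of_le_of_ne (norm_nonneg _) h.symm)]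
      linarith
  have hlim : Tendsto (fun z => ∑' n, ‖z - x‖⁻¹ * ‖f n z - f n x - f' n x (z - x)‖)
      (𝓝[D] x) (𝓝 (∑' _ : ℕ, (0 : ℝ))) :=
    tendsto_tsum_of_dominated_convergence (hb.mul_left 2)
      (fun n => hasFDerivWithinAt_iff_tendsto.1 (hf n x hx))
      (eventually_mem_nhdsWithin.mono fun z hz n => hbound n z hz)
  rw [tsum_zero] at hlim
  refine squeeze_zero' (Eventually.of_forall fun z => by positivity) ?_ hlim
  filter_upwards [eventually_mem_nhdsWithin] with z hz
  have h4 : (∑' n, f n z) - (∑' n, f n x) - (∑' n, f' n x) (z - x) =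
      ∑' n, (f n z - f n x - f' n x (z - x)) := by
    exact ((((hs z hz).hasSum.sub (hs x hx).hasSum).sub
      ((ContinuousLinearMap.apply ℝ F (z - x)).hasSum hs'.hasSum)).tsum_eq).symm
  have h5 : Summable fun n => ‖z - x‖⁻¹ * ‖f n z - f n x - f' n x (z - x)‖ :=
    Summable.of_norm_bounded (hb.mul_left 2) fun n => hbound n z hz
  rcases eq_or_ne (‖z - x‖) 0 with h | h
  · simp only [h, inv_zero, zero_mul, tsum_zero, le_refl]
  · rw [h4, tsum_mul_left]
    refine mul_le_mul_of_nonneg_left (norm_tsum_le_tsum_norm ?_) (by positivity)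
    have := h5.mul_left ‖z - x‖
    simpa only [mul_inv_cancel_left₀ h] using this

/-- A series of smooth functions on a convex set is smooth if each of its derivatives is dominated
by a summable sequence. The set need not be open, which allows for boundary points. -/
theorem contDiffOn_tsum {D : Set E} (hD : Convex ℝ D) (hU : UniqueDiffOn ℝ D) {f : ℕ → E → F}
    {b : ℕ → ℕ → ℝ} (hf : ∀ n, ContDiffOn ℝ ∞ (f n) D) (hb : ∀ k, Summable (b k))
    (hfb : ∀ k n, ∀ x ∈ D, ‖iteratedFDerivWithin ℝ k (f n) D x‖ ≤ b k n) :
    ContDiffOn ℝ ∞ (fun x => ∑' n, f n x) D := by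
  have hT : ∀ n, HasFTaylorSeriesUpToOn ∞ (f n) (ftaylorSeriesWithin ℝ (f n) D) D :=
    fun n => (hf n).ftaylorSeriesWithin hU
  have hlt : ∀ k : ℕ, ((k : ℕ∞) : WithTop ℕ∞) < ∞ := fun k => by
    exact_mod_cast ENat.natCast_lt_top k
  have hs : ∀ k, ∀ x ∈ D, Summable fun n => iteratedFDerivWithin ℝ k (f n) D x :=
    fun k x hx => Summable.of_norm_bounded (hb k) fun n => hfb k n x hx
  have key : HasFTaylorSeriesUpToOn ∞ (fun x => ∑' n, f n x)
      (fun x k => ∑' n, iteratedFDerivWithin ℝ k (f n) D x) D := by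
    refine ⟨fun x hx => ?_, fun k hk x hx => ?_, fun k hk => ?_⟩
    · refine ((continuousMultilinearCurryFin0 ℝ E F).toContinuousLinearEquiv.map_tsum).trans ?_
      rfl
    · have := hasFDerivWithinAt_tsum hD (b := b (k + 1))
        (f := fun n => iteratedFDerivWithin ℝ k (f n) D)
        (f' := fun n x => (iteratedFDerivWithin ℝ (k + 1) (f n) D x).curryLeft) (hb _)
        (fun n x hx => (hT n).fderivWithin k (hlt k) x hx)
        (fun n x hx => ?_) (hs k) hx
      · refine this.congr_fderiv ?_
        exact ((continuousMultilinearCurryLeftEquiv ℝ (fun _ : Fin (k + 1) => E)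
          F).toContinuousLinearEquiv.map_tsum).symm
      · exact ((continuousMultilinearCurryLeftEquiv ℝ (fun _ : Fin (k + 1) => E) F).norm_map
          _).trans_le (hfb _ _ _ hx)
    · exact continuousOn_tsum (fun n => (hT n).cont k hk) (hb k) fun n x hx => hfb k n x hx
  exact key.contDiffOn

end

/-! ### Smooth superposition of sections -/

section

open Filter Topology

variable {n : ℕ} {H : Type} [TopologicalSpace H]
  {I : ModelWithCorners ℝ (EuclideanSpace ℝ (Fin n)) H}
  {X : Type u} [TopologicalSpace X] [ChartedSpace H X]

/-- A compact convex set `dom` in a chart of `X`, contained in `U` and over which `A` is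
trivialized, together with an open set `nhd` that the chart maps to `dom`. -/
structure GrBundle.Box (A : GrBundle I X) (U : Set X) where
  center : X
  dom : Set (EuclideanSpace ℝ (Fin n))
  nhd : Set X
  convex : Convex ℝ dom
  unique : UniqueDiffOn ℝ dom
  compact : IsCompact dom
  isOpen_nhd : IsOpen nhd
  mem_target : ∀ z ∈ dom, z ∈ (extChartAt I center).target
  mem_set : ∀ z ∈ dom, (extChartAt I center).symm z ∈ U
  mem_base : ∀ z ∈ dom, (extChartAt I center).symm z ∈
    (trivializationAt (Fin A.rank → ℝ) A.Fib center).baseSet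
  mem_source : ∀ p ∈ nhd, p ∈ (extChartAt I center).source
  mem_dom : ∀ p ∈ nhd, extChartAt I center p ∈ dom

namespace GrBundle

variable {A : GrBundle I X} {U : Set X}

/-- A small closed ball around the image of `p` in a chart, intersected with the model half space.
-/
theorem exists_box (A : GrBundle I X) {U : Set X} (hU : IsOpen U) {p : X} (hp : p ∈ U) :
    ∃ b : A.Box U, p ∈ b.nhd := by
  have hbase : (trivializationAt (Fin A.rank → ℝ) A.Fib p).baseSet ∈ 𝓝 p :=
    (trivializationAt (Fin A.rank → ℝ) A.Fib p).open_baseSet.mem_nhds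
      (FiberBundle.mem_baseSet_trivializationAt' p)
  have h1 : (extChartAt I p).symm ⁻¹'
      (U ∩ (trivializationAt (Fin A.rank → ℝ) A.Fib p).baseSet) ∈ 𝓝 (extChartAt I p p) :=
    (continuousAt_extChartAt_symm p).preimage_mem_nhds (by
      rw [extChartAt_to_inv]
      exact inter_mem (hU.mem_nhds hp) hbase)
  have h2 : (extChartAt I p).target ∩ (extChartAt I p).symm ⁻¹'
      (U ∩ (trivializationAt (Fin A.rank → ℝ) A.Fib p).baseSet) ∈
        𝓝[range I] (extChartAt I p p) :=
    inter_mem (extChartAt_target_mem_nhdsWithin (I := I) p) (mem_nhdsWithin_of_mem_nhds h1)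
  obtain ⟨ε, hε, hsub⟩ := Metric.mem_nhdsWithin_iff.1 h2
  have hε2 : Metric.closedBall (extChartAt I p p) (ε / 2) ∩ range I ⊆
      (extChartAt I p).target ∩ (extChartAt I p).symm ⁻¹'
        (U ∩ (trivializationAt (Fin A.rank → ℝ) A.Fib p).baseSet) :=
    (inter_subset_inter_left _ (Metric.closedBall_subset_ball (by linarith))).trans hsub
  have hconv : Convex ℝ (Metric.closedBall (extChartAt I p p) (ε / 2) ∩ range I) :=
    (convex_closedBall _ _).inter I.convex_range
  have hmem : extChartAt I p p ∈ range I := by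
    rw [extChartAt_coe]
    exact mem_range_self _
  have hint : (interior (Metric.closedBall (extChartAt I p p) (ε / 2) ∩ range I)).Nonempty := by
    have h3 := mem_closure_iff.1 (I.range_subset_closure_interior hmem)
      (Metric.ball (extChartAt I p p) (ε / 2)) Metric.isOpen_ball
      (Metric.mem_ball_self (by linarith))
    refine h3.mono ?_
    rw [interior_inter]
    exact inter_subset_inter_left _ Metric.ball_subset_interior_closedBall
  refine ⟨⟨p, _, (extChartAt I p).source ∩ extChartAt I p ⁻¹' Metric.ball (extChartAt I p p)
      (ε / 2), hconv, uniqueDiffOn_convex hconv hint,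
      (isCompact_closedBall _ _).inter_right I.isClosed_range,
      isOpen_extChartAt_preimage' p Metric.isOpen_ball, fun z hz => (hε2 hz).1,
      fun z hz => (hε2 hz).2.1, fun z hz => (hε2 hz).2.2, fun q hq => hq.1, fun q hq => ?_⟩, ?_⟩
  · refine ⟨Metric.ball_subset_closedBall hq.2, ?_⟩
    rw [extChartAt_coe]
    exact mem_range_self _
  · exact ⟨mem_extChartAt_source p, Metric.mem_ball_self (by linarith)⟩

variable [IsManifold I ∞ X]

/-- The coordinates of a section in a box. -/
def Box.coord (b : A.Box U) (v : ∀ x, A.Fib x) (z : EuclideanSpace ℝ (Fin n)) :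
    Fin A.rank → ℝ :=
  (trivializationAt (Fin A.rank → ℝ) A.Fib b.center).linearMapAt ℝ
    ((extChartAt I b.center).symm z) (v ((extChartAt I b.center).symm z))

theorem Box.coord_eq (b : A.Box U) (v : ∀ x, A.Fib x) {z : EuclideanSpace ℝ (Fin n)}
    (hz : z ∈ b.dom) : b.coord v z = (trivializationAt (Fin A.rank → ℝ) A.Fib b.center
      (TotalSpace.mk' (Fin A.rank → ℝ) ((extChartAt I b.center).symm z)
        (v ((extChartAt I b.center).symm z)))).2 := by
  rw [Box.coord, Trivialization.coe_linearMapAt_of_mem _ (b.mem_base z hz)]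

theorem Box.contDiffOn_coord (b : A.Box U) {v : ∀ x, A.Fib x} (hv : A.SmoothOn U v) :
    ContDiffOn ℝ ∞ (b.coord v) b.dom := by
  rw [← contMDiffOn_iff_contDiffOn]
  have h1 : ContMDiffOn 𝓘(ℝ, EuclideanSpace ℝ (Fin n)) I ∞ (extChartAt I b.center).symm b.dom :=
    (contMDiffOn_extChartAt_symm b.center).mono b.mem_target
  have h2 := hv.comp h1 b.mem_set
  have h3 := ((trivializationAt (Fin A.rank → ℝ) A.Fib b.center).contMDiffOn_iff
    (IB := I) (n := ∞) (f := fun z => TotalSpace.mk' (Fin A.rank → ℝ)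
      ((extChartAt I b.center).symm z) (v ((extChartAt I b.center).symm z))) (s := b.dom)
      (fun z hz => (Trivialization.mem_source _).2 (b.mem_base z hz))).1 h2
  exact h3.2.congr fun z hz => b.coord_eq v hz

/-- A family of sections is smooth if its coordinates are smooth in boxes around all points. -/
theorem SmoothFam.of_coord {r : ℕ} {s : (Fin r → ℝ) → ∀ x, A.Fib x}
    (h : ∀ p ∈ U, ∃ b : A.Box U, p ∈ b.nhd ∧ ∀ R : ℕ,
      ContDiffOn ℝ ∞ (fun q : (Fin r → ℝ) × EuclideanSpace ℝ (Fin n) => b.coord (s q.1) q.2)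
        (Metric.closedBall 0 (R + 1) ×ˢ b.dom)) : A.SmoothFam r U s := by
  rintro ⟨y, p⟩ ⟨-, hp⟩
  obtain ⟨b, hpb, hb⟩ := h p hp
  obtain ⟨R, hR⟩ := exists_nat_gt ‖y‖
  have hbase : ∀ q ∈ b.nhd, q ∈ (trivializationAt (Fin A.rank → ℝ) A.Fib b.center).baseSet := by
    intro q hq
    have := b.mem_base _ (b.mem_dom q hq)
    rwa [(extChartAt I b.center).left_inv (b.mem_source q hq)] at this
  refine ((trivializationAt (Fin A.rank → ℝ) A.Fib b.center).contMDiffWithinAt_iff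
    ((Trivialization.mem_source _).2 (hbase p hpb))).2 ⟨contMDiffWithinAt_snd, ?_⟩
  have h1 : ContMDiffOn (𝓘(ℝ, Fin r → ℝ).prod I)
      𝓘(ℝ, (Fin r → ℝ) × EuclideanSpace ℝ (Fin n)) ∞
      (fun q : (Fin r → ℝ) × X => (q.1, extChartAt I b.center q.2))
      (Metric.ball 0 (R + 1) ×ˢ b.nhd) :=
    contMDiffOn_fst.prodMk_space (((contMDiffOn_extChartAt (n := ∞)).mono fun q hq => by
      simpa using b.mem_source q hq).comp contMDiffOn_snd fun q hq => hq.2)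
  have h2 := (contMDiffOn_iff_contDiffOn.2 (hb R)).comp h1 fun q hq =>
    ⟨Metric.ball_subset_closedBall hq.1, b.mem_dom _ hq.2⟩
  have hmem : (Metric.ball (0 : Fin r → ℝ) (R + 1) ×ˢ b.nhd) ∈ 𝓝 (y, p) :=
    (Metric.isOpen_ball.prod b.isOpen_nhd).mem_nhds
      ⟨mem_ball_zero_iff.2 (by linarith), hpb⟩
  refine ((h2.congr fun q hq => ?_).contMDiffAt hmem).contMDiffWithinAt
  rw [Function.comp_apply, b.coord_eq _ (b.mem_dom _ hq.2),
    (extChartAt I b.center).left_inv (b.mem_source _ hq.2)]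

theorem uniqueDiffOn_closedBall (r R : ℕ) :
    UniqueDiffOn ℝ (Metric.closedBall (0 : Fin r → ℝ) (R + 1)) :=
  uniqueDiffOn_convex (convex_closedBall _ _)
    ⟨0, Metric.ball_subset_interior_closedBall (Metric.mem_ball_self (by positivity))⟩

theorem Box.contDiffOn_smul_coord (b : A.Box U) {v : ∀ x, A.Fib x} (hv : A.SmoothOn U v) {r : ℕ}
    {γ : (Fin r → ℝ) → ℝ} (hγ : ContDiff ℝ ∞ γ) (s : Set (Fin r → ℝ)) :
    ContDiffOn ℝ ∞ (fun q : (Fin r → ℝ) × EuclideanSpace ℝ (Fin n) => γ q.1 • b.coord v q.2)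
      (s ×ˢ b.dom) :=
  (hγ.comp_contDiffOn contDiffOn_fst).smul
    ((b.contDiffOn_coord hv).comp contDiffOn_snd fun _ hq => hq.2)

/-- A pointwise finite series of smooth families is smooth, if in each box all derivatives of its
terms are summable. -/
theorem SmoothFam.of_summable {r : ℕ} {v : ℕ → ∀ x, A.Fib x} {γ : ℕ → (Fin r → ℝ) → ℝ}
    (hv : ∀ k, A.SmoothOn U (v k)) (hγ : ∀ k, ContDiff ℝ ∞ (γ k))
    (hfin : ∀ y, {k | γ k y ≠ 0}.Finite)
    (h : ∀ p ∈ U, ∃ b : A.Box U, p ∈ b.nhd ∧ ∀ R k : ℕ, ∃ β : ℕ → ℝ, Summable β ∧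
      ∀ m, ∀ q ∈ Metric.closedBall (0 : Fin r → ℝ) (R + 1) ×ˢ b.dom,
        ‖iteratedFDerivWithin ℝ k (fun q : (Fin r → ℝ) × EuclideanSpace ℝ (Fin n) =>
          γ m q.1 • b.coord (v m) q.2) (Metric.closedBall 0 (R + 1) ×ˢ b.dom) q‖ ≤ β m) :
    A.SmoothFam r U fun y x => ∑ k ∈ (hfin y).toFinset, γ k y • v k x := by
  refine SmoothFam.of_coord fun p hp => ?_
  obtain ⟨b, hpb, hb⟩ := h p hp
  refine ⟨b, hpb, fun R => ?_⟩
  choose β hβ hβ' using hb R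
  refine (contDiffOn_tsum ((convex_closedBall _ _).prod b.convex) ((uniqueDiffOn_closedBall r R).prod b.unique)
    (f := fun m q => γ m q.1 • b.coord (v m) q.2) (fun m => ?_) hβ
    (fun k m q hq => hβ' k m q hq)).congr fun q hq => ?_
  · exact b.contDiffOn_smul_coord (hv m) (hγ m) _
  · rw [tsum_eq_sum (s := (hfin q.1).toFinset) fun k hk => ?_]
    · simp only [Box.coord, map_sum, map_smul]
    · have : γ k q.1 = 0 := by simpa using hk
      rw [this, zero_smul]

/-- Countably many sequences can be made summable by common positive factors: the `m`-th factor
controls the `m`-th terms of the first `m + 1` sequences. -/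
theorem exists_pos_summable {ι : Type*} [Countable ι] (M : ι → ℕ → ℝ) :
    ∃ c : ℕ → ℝ, (∀ m, 0 < c m) ∧ ∀ i, Summable fun m => c m * M i m := by
  obtain ⟨f, hf⟩ := exists_injective_nat ι
  let M' : ℕ → ℕ → ℝ := fun j m => Function.extend f (fun i => |M i m|) 0 j
  have hM' : ∀ i m, M' (f i) m = |M i m| := fun i m => hf.extend_apply _ _ i
  have hM0 : ∀ j m, 0 ≤ M' j m := by
    intro j m
    by_cases hj : ∃ i, f i = j
    · obtain ⟨i, rfl⟩ := hj
      rw [hM']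
      exact abs_nonneg _
    · simp only [M', Function.extend_apply' _ _ _ hj, Pi.zero_apply, le_refl]
  have hS : ∀ m, 0 < 1 + ∑ j ∈ Finset.range (m + 1), M' j m := fun m =>
    add_pos_of_pos_of_nonneg one_pos (Finset.sum_nonneg fun j _ => hM0 j m)
  -- For `m ≥ f i` the denominator dominates `M i m`, and the geometric factor remains.
  refine ⟨fun m => (1 / 2) ^ m * (1 + ∑ j ∈ Finset.range (m + 1), M' j m)⁻¹,
    fun m => mul_pos (by positivity) (inv_pos.2 (hS m)), fun i => ?_⟩
  refine Summable.of_norm_bounded_eventually_nat summable_geometric_two ?_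
  filter_upwards [eventually_ge_atTop (f i)] with m hm
  rw [norm_mul, norm_mul, Real.norm_of_nonneg (by positivity : (0 : ℝ) ≤ (1 / 2) ^ m),
    Real.norm_of_nonneg (inv_pos.2 (hS m)).le, Real.norm_eq_abs, ← hM', mul_assoc]
  refine mul_le_of_le_one_right (by positivity) ?_
  rw [inv_mul_le_iff₀ (hS m), mul_one]
  have := Finset.single_le_sum (f := fun j => M' j m) (fun j _ => hM0 j m)
    (Finset.mem_range.2 (Nat.lt_succ_of_le hm))
  linarith

/-- Each sequence of sections has positive multiples whose superposition with given coefficients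
is smooth. -/
theorem exists_superposition [SecondCountableTopology X] {r : ℕ} (hU : IsOpen U)
    {v : ℕ → ∀ x, A.Fib x} {γ : ℕ → (Fin r → ℝ) → ℝ}
    (hv : ∀ k, A.SmoothOn U (v k)) (hγ : ∀ k, ContDiff ℝ ∞ (γ k)) :
    ∃ c : ℕ → ℝ, (∀ m, 0 < c m) ∧ ∀ hfin : ∀ y, {k | c k * γ k y ≠ 0}.Finite,
      A.SmoothFam r U fun y x => ∑ k ∈ (hfin y).toFinset, (c k * γ k y) • v k x := by
  choose b hb using fun p : U => A.exists_box hU p.2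
  obtain ⟨t, htc, ht⟩ := countable_cover_nhds (f := fun p : U => Subtype.val ⁻¹' (b p).nhd)
    fun p => continuous_subtype_val.continuousAt.preimage_mem_nhds
      ((b p).isOpen_nhd.mem_nhds (hb p))
  have := htc.to_subtype
  -- Countably many conditions: a box, a ball of parameters, and an order of differentiation.
  have hbd : ∀ (i : t × ℕ × ℕ) (m : ℕ), ∃ C : ℝ,
      ∀ q ∈ Metric.closedBall (0 : Fin r → ℝ) (i.2.1 + 1) ×ˢ (b i.1).dom,
        ‖iteratedFDerivWithin ℝ i.2.2 (fun q : (Fin r → ℝ) × EuclideanSpace ℝ (Fin n) =>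
          γ m q.1 • (b i.1).coord (v m) q.2)
            (Metric.closedBall 0 (i.2.1 + 1) ×ˢ (b i.1).dom) q‖ ≤ C := fun i m =>
    ((isCompact_closedBall _ _).prod (b i.1).compact).exists_bound_of_continuousOn
      (((b i.1).contDiffOn_smul_coord (hv m) (hγ m) _).continuousOn_iteratedFDerivWithin
        (by exact_mod_cast le_top) ((uniqueDiffOn_closedBall r _).prod (b i.1).unique))
  choose C hC using hbd
  obtain ⟨c, hc, hs⟩ := exists_pos_summable C
  refine ⟨c, hc, fun hfin => SmoothFam.of_summable hv (fun k => contDiff_const.mul (hγ k)) hfin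
    fun p hp => ?_⟩
  have hp' : (⟨p, hp⟩ : U) ∈ ⋃ x ∈ t, Subtype.val ⁻¹' (b x).nhd := ht ▸ mem_univ _
  obtain ⟨i, hi, hpi⟩ := mem_iUnion₂.1 hp'
  refine ⟨b i, hpi, fun R k => ⟨_, hs (⟨i, hi⟩, R, k), fun m q hq => ?_⟩⟩
  have h1 : (fun q : (Fin r → ℝ) × EuclideanSpace ℝ (Fin n) =>
      (c m * γ m q.1) • (b i).coord (v m) q.2) =
      c m • fun q => γ m q.1 • (b i).coord (v m) q.2 := by
    funext q
    exact mul_smul _ _ _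
  rw [h1, iteratedFDerivWithin_const_smul_apply
    ((((b i).contDiffOn_smul_coord (hv m) (hγ m) _) q hq).of_le (by exact_mod_cast le_top))
    ((uniqueDiffOn_closedBall r _).prod (b i).unique) hq, norm_smul,
    Real.norm_of_nonneg (hc m).le]
  exact mul_le_mul_of_nonneg_left (hC (⟨i, hi⟩, R, k) m q hq) (hc m).le

end GrBundle

end

/-! ### Functionals have compact support -/

section

open Filter Topology

variable {n : ℕ} {H : Type} [TopologicalSpace H]
  {I : ModelWithCorners ℝ (EuclideanSpace ℝ (Fin n)) H}
  {X : Type u} [TopologicalSpace X] [ChartedSpace H X] [IsManifold I ∞ X]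

/-- A pointwise finite series of smooth families is smooth, if on each compact set almost all of
its terms vanish. -/
theorem GrBundle.SmoothFam.of_locallyFinite {A : GrBundle I X} {U : Set X} (hU : IsOpen U) {r : ℕ}
    {v : ℕ → ∀ x, A.Fib x} {γ : ℕ → (Fin r → ℝ) → ℝ}
    (hv : ∀ k, A.SmoothOn U (v k)) (hγ : ∀ k, ContDiff ℝ ∞ (γ k))
    (hfin : ∀ y, {k | γ k y ≠ 0}.Finite)
    (h : ∀ K, IsCompact K → K ⊆ U → ∃ k₀ : ℕ, ∀ k, k₀ ≤ k → ∀ x ∈ K, v k x = 0) :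
    A.SmoothFam r U fun y x => ∑ k ∈ (hfin y).toFinset, γ k y • v k x := by
  refine .of_summable hv hγ hfin fun p hp => ?_
  obtain ⟨b, hpb⟩ := A.exists_box hU hp
  refine ⟨b, hpb, fun R k => ?_⟩
  obtain ⟨k₀, hk₀⟩ := h ((extChartAt I b.center).symm '' b.dom)
    (b.compact.image_of_continuousOn
      ((continuousOn_extChartAt_symm b.center).mono b.mem_target))
    (image_subset_iff.2 b.mem_set)
  have hbd : ∀ m : ℕ, ∃ C : ℝ, ∀ q ∈ Metric.closedBall (0 : Fin r → ℝ) (R + 1) ×ˢ b.dom,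
      ‖iteratedFDerivWithin ℝ k (fun q : (Fin r → ℝ) × EuclideanSpace ℝ (Fin n) =>
        γ m q.1 • b.coord (v m) q.2) (Metric.closedBall 0 (R + 1) ×ˢ b.dom) q‖ ≤ C := fun m =>
    ((isCompact_closedBall _ _).prod b.compact).exists_bound_of_continuousOn
      ((b.contDiffOn_smul_coord (hv m) (hγ m) _).continuousOn_iteratedFDerivWithin
        (by exact_mod_cast le_top) ((uniqueDiffOn_closedBall r _).prod b.unique))
  choose C hC using hbd
  refine ⟨fun m => if m < k₀ then C m else 0, ?_, fun m q hq => ?_⟩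
  · refine summable_of_ne_finset_zero (s := Finset.range k₀) fun m hm => ?_
    rw [if_neg (by simpa using hm)]
  · change _ ≤ if m < k₀ then C m else 0
    split_ifs with hm
    · exact hC m q hq
    · have h0 : EqOn (fun q : (Fin r → ℝ) × EuclideanSpace ℝ (Fin n) =>
          γ m q.1 • b.coord (v m) q.2) (fun _ => 0) (Metric.closedBall 0 (R + 1) ×ˢ b.dom) := by
        intro q hq
        have : v m ((extChartAt I b.center).symm q.2) = 0 :=
          hk₀ m (not_lt.1 hm) _ (mem_image_of_mem _ hq.2)
        simp only [Box.coord, this, map_zero, smul_zero]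
      rw [iteratedFDerivWithin_congr h0 hq, iteratedFDerivWithin_fun_zero]
      simp

end

section

/-- A smooth bump around `2⁻ᵏ`, with support away from the bumps for other `k`. -/
def dyadicBump (k : ℕ) (y : ℝ) : ℝ :=
  (⟨1 / 8, 1 / 4, by norm_num, by norm_num⟩ : ContDiffBump (1 : ℝ)) (2 ^ k * y)

theorem contDiff_dyadicBump (k : ℕ) : ContDiff ℝ ∞ (dyadicBump k) :=
  (ContDiffBump.contDiff _).comp (contDiff_const.mul contDiff_id)

theorem dyadicBump_self (k : ℕ) : dyadicBump k ((1 / 2) ^ k) = 1 := by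
  rw [dyadicBump, ← mul_pow]
  norm_num
  refine ContDiffBump.one_of_mem_closedBall _ ?_
  simp

theorem abs_lt_of_dyadicBump_ne_zero {k : ℕ} {y : ℝ} (h : dyadicBump k y ≠ 0) :
    |2 ^ k * y - 1| < 1 / 4 := by
  by_contra h1
  refine h (ContDiffBump.zero_of_le_dist _ ?_)
  rw [Real.dist_eq]
  exact not_lt.1 h1

theorem eq_of_dyadicBump_ne_zero {k j : ℕ} {y : ℝ} (h : dyadicBump k y ≠ 0)
    (h' : dyadicBump j y ≠ 0) : k = j := by
  have key : ∀ {k j : ℕ}, |2 ^ k * y - 1| < 1 / 4 → |2 ^ j * y - 1| < 1 / 4 → ¬k < j := by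
    intro k j hk hj hkj
    obtain ⟨i, rfl⟩ := Nat.exists_eq_add_of_lt hkj
    rw [abs_lt] at hk hj
    have h1 : (2 : ℝ) ^ (k + i + 1) * y = 2 * 2 ^ i * (2 ^ k * y) := by ring
    have h2 : (1 : ℝ) ≤ 2 ^ i := one_le_pow₀ (by norm_num)
    rw [h1] at hj
    nlinarith
  have hk := abs_lt_of_dyadicBump_ne_zero h
  have hj := abs_lt_of_dyadicBump_ne_zero h'
  rcases lt_trichotomy k j with h | h | h
  · exact absurd h (key hk hj)
  · exact h
  · exact absurd h (key hj hk)

theorem dyadicBump_zero (k : ℕ) : dyadicBump k 0 = 0 := by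
  by_contra h
  have := abs_lt_of_dyadicBump_ne_zero h
  norm_num at this

end

namespace System

open Filter Topology WordFam

variable {d : ℕ} {M N : Type u} [TopologicalSpace M]
  [ChartedSpace (EuclideanHalfSpace (d + 1)) M] [MeasurableSpace M] [TopologicalSpace N]
  [ChartedSpace (EuclideanSpace ℝ (Fin d)) N] [MeasurableSpace N] {B : System d M N}
  [IsManifold (𝓡∂ (d + 1)) ∞ M] [SecondCountableTopology M] [T2Space M]

/-- A smooth family of multilinear functionals vanishes, uniformly for parameters in a compact set,
on fields one of which vanishes on a certain compact set. Otherwise there are counterexamples for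
the members of a compact exhaustion; suitable multiples of these are the values at `2⁻ᵏ` of smooth
curves that vanish at `0`, along which the functional takes the value `1` at all `2⁻ᵏ`. -/
theorem exists_compact_support_slot {U : Opens M} {r m : ℕ} {F : MFam (B.fields U) r m}
    (hF : F.Smooth (B.fieldsGr U)) {Q : Set (Fin r → ℝ)} (hQ : IsCompact Q) (i : Fin m) :
    ∃ K : Set M, IsCompact K ∧ K ⊆ U ∧ ∀ x ∈ Q, ∀ v : Fin m → B.fields U,
      (∀ p ∈ K, (v i).1.1 p = 0) → F x v = 0 := by
  have : LocallyCompactSpace M := Manifold.locallyCompact_of_finiteDimensional (𝓡∂ (d + 1))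
  have : LocallyCompactSpace U := U.isOpen.locallyCompactSpace
  let Ke := CompactExhaustion.choice U
  by_contra hcon
  push Not at hcon
  -- Counterexamples: `v k i` vanishes on the `k`-th set of the exhaustion.
  choose x hxQ v hv hne using fun k => hcon (Subtype.val '' Ke k)
    ((Ke.isCompact k).image continuous_subtype_val) (by rintro _ ⟨p, -, rfl⟩; exact p.2)
  have hloc : ∀ K, IsCompact K → K ⊆ (U : Set M) →
      ∃ k₀ : ℕ, ∀ k, k₀ ≤ k → ∀ p ∈ K, (v k i).1.1 p = 0 := by
    intro K hK hKU
    have h1 : IsCompact (Subtype.val ⁻¹' K : Set U) :=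
      Topology.IsInducing.subtypeVal.isCompact_preimage' hK (by simpa using hKU)
    obtain ⟨k₀, hk₀⟩ := Ke.exists_superset_of_isCompact h1
    exact ⟨k₀, fun k hk p hp => hv k p ⟨⟨p, hKU hp⟩, Ke.subset hk (hk₀ hp), rfl⟩⟩
  let γ : ℕ → (Fin 1 → ℝ) → ℝ := fun k y => dyadicBump k (y 0)
  have hγ : ∀ k, ContDiff ℝ ∞ (γ k) := fun k => (contDiff_dyadicBump k).comp (contDiff_apply _ _ 0)
  have hfin : ∀ (c : ℕ → ℝ) (y : Fin 1 → ℝ), {k | c k * γ k y ≠ 0}.Finite := fun c y =>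
    Set.Subsingleton.finite fun k hk j hj =>
      eq_of_dyadicBump_ne_zero (right_ne_zero_of_mul hk) (right_ne_zero_of_mul hj)
  -- The factors `c j` make the superposition smooth in the slots `j ≠ i`. In the slot `i` the
  -- superposition is locally finite, so the factor is free, and is used to normalize the value to
  -- `1`.
  choose c hc hcs using fun j => GrBundle.exists_superposition (A := B.bulk.bdl) U.isOpen
    (v := fun k => (v k j).1.1) (fun k => (v k j).1.2.2) hγ
  let C : ℕ → ℝ := fun k => ∏ j ∈ Finset.univ.erase i, c j k
  have hC : ∀ k, C k ≠ 0 := fun k => Finset.prod_ne_zero_iff.2 fun j _ => (hc j k).ne'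
  let e : Fin m → ℕ → ℝ := fun j k => if j = i then (F (x k) (v k) * C k)⁻¹ else c j k
  have he : ∀ k, ∏ j, e j k = (F (x k) (v k))⁻¹ := by
    intro k
    rw [← Finset.mul_prod_erase _ _ (Finset.mem_univ i)]
    have h1 : ∏ j ∈ Finset.univ.erase i, e j k = C k :=
      Finset.prod_congr rfl fun j hj => if_neg (Finset.ne_of_mem_erase hj)
    have h2 : e i k = (F (x k) (v k) * C k)⁻¹ := if_pos rfl
    rw [h1, h2, mul_inv, mul_assoc, inv_mul_cancel₀ (hC k), mul_one]
  let V : Fin m → (Fin 1 → ℝ) → B.fields U := fun j y =>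
    ∑ k ∈ (hfin (e j) y).toFinset, (e j k * γ k y) • v k j
  have hVapply : ∀ j y p, (V j y).1.1 p =
      ∑ k ∈ (hfin (e j) y).toFinset, (e j k * γ k y) • (v k j).1.1 p := by
    intro j y p
    simp only [V, Submodule.coe_sum, Finset.sum_apply]
    rfl
  have hVplot : ∀ j, V j ∈ (B.fieldsGr U).plot 1 := by
    intro j
    change B.bulk.bdl.SmoothFam 1 U fun y => (V j y).1.1
    have h1 : (fun y => (V j y).1.1) = fun y p =>
        ∑ k ∈ (hfin (e j) y).toFinset, (e j k * γ k y) • (v k j).1.1 p :=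
      funext fun y => funext fun p => hVapply j y p
    rw [h1]
    by_cases hj : j = i
    · subst hj
      exact .of_locallyFinite U.isOpen (fun k => (v k j).1.2.2)
        (fun k => contDiff_const.mul (hγ k)) (hfin (e j)) hloc
    · have h2 : e j = c j := funext fun k => if_neg hj
      simp only [h2]
      exact hcs j (hfin (c j))
  have hVpow : ∀ j k, V j (fun _ => (1 / 2) ^ k) = e j k • v k j := by
    intro j k
    have h1 : γ k (fun _ => (1 / 2) ^ k) = 1 := dyadicBump_self k
    refine (Finset.sum_eq_single k (fun k' hk' hne => ?_) fun hk => ?_).trans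
      (by rw [h1, mul_one])
    · refine absurd (eq_of_dyadicBump_ne_zero (y := (1 / 2) ^ k) ?_ ?_) hne
      · exact right_ne_zero_of_mul ((Finite.mem_toFinset _).1 hk')
      · rw [dyadicBump_self]
        exact one_ne_zero
    · have h2 : e j k * γ k (fun _ => (1 / 2) ^ k) = 0 := by
        by_contra h2
        exact hk ((Finite.mem_toFinset _).2 h2)
      rw [h2, zero_smul]
  have hV0 : ∀ j, V j 0 = 0 := fun j => Finset.sum_eq_zero fun k _ => by
    have : γ k 0 = 0 := dyadicBump_zero k
    rw [this, mul_zero, zero_smul]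
  have hcont := (hF 1 V hVplot).continuous
  have hone : ∀ k, F (x k) (fun j => V j fun _ => (1 / 2) ^ k) = 1 := by
    intro k
    simp only [hVpow]
    rw [MultilinearMap.map_smul_univ, he, smul_eq_mul, inv_mul_cancel₀ (hne k)]
  -- Along a subsequence the parameters converge to some `x₀`; the values `1` contradict continuity
  -- at `(x₀, 0)`, where the functional vanishes.
  obtain ⟨x₀, -, φ, hφ, hlim⟩ := hQ.tendsto_subseq hxQ
  have h1 : Tendsto (fun k => ((x ∘ φ) k, (fun _ : Fin 1 => (1 / 2 : ℝ) ^ φ k))) atTop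
      (𝓝 (x₀, (0 : Fin 1 → ℝ))) := by
    refine hlim.prodMk_nhds (tendsto_pi_nhds.2 fun _ => ?_)
    exact (tendsto_pow_atTop_nhds_zero_of_lt_one (by norm_num) (by norm_num)).comp
      hφ.tendsto_atTop
  have h2 := (hcont.tendsto _).comp h1
  have h3 : F x₀ (fun j => V j 0) = 0 := by
    simp only [hV0]
    exact (F x₀).map_coord_zero i rfl
  have h4 : (fun z : (Fin r → ℝ) × (Fin 1 → ℝ) => F z.1 (fun j => V j z.2)) ∘
      (fun k => ((x ∘ φ) k, (fun _ : Fin 1 => (1 / 2 : ℝ) ^ φ k))) = fun _ => 1 :=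
    funext fun k => hone (φ k)
  rw [h4] at h2
  have h5 := tendsto_nhds_unique h2 tendsto_const_nhds
  exact one_ne_zero (h5.symm.trans h3)

/-- Functionals have compact support, uniformly for parameters in a compact set. -/
theorem exists_compact_support {U : Opens M} {r : ℕ} {w : WordFam (B.fieldsGr U) r}
    (hw : w ∈ obsSub (B.fieldsGr U) r) {Q : Set (Fin r → ℝ)} (hQ : IsCompact Q) (m : ℕ) :
    ∃ K : Set M, IsCompact K ∧ K ⊆ U ∧ ∀ x ∈ Q, ∀ l : List (Letter (B.fieldsGr U)),
      l.length = m → (∃ a ∈ l, ∀ p ∈ K, a.val.1.1 p = 0) → w x l = 0 := by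
  choose K hK hKU h using fun i => exists_compact_support_slot
    (lift_smooth (fun x => slotLin_of_mem hw x) (smooth_of_mem hw) m) hQ i
  refine ⟨⋃ i, K i, isCompact_iUnion hK, iUnion_subset hKU, fun x hx l hl ⟨a, ha, ha0⟩ => ?_⟩
  subst hl
  obtain ⟨i, hi, rfl⟩ := List.getElem_of_mem ha
  have h1 := h ⟨i, hi⟩ x hx (fun j => (l.get j).val) fun p hp =>
    ha0 p (mem_iUnion_of_mem _ hp)
  rw [lift_eq] at h1
  rwa [List.ofFn_get] at h1

end System

/-! ### Multiplication of fields by cutoff functions -/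

section

open Filter Topology

variable {n : ℕ} {H : Type} [TopologicalSpace H]
  {I : ModelWithCorners ℝ (EuclideanSpace ℝ (Fin n)) H}
  {X : Type u} [TopologicalSpace X] [ChartedSpace H X]

open Classical in
/-- A smooth family of sections over `W`, multiplied by a function whose support in `V` lies in `W`,
is a smooth family of sections over `V`. -/
theorem GrBundle.SmoothFam.cutoff {A : GrBundle I X} {W V : Opens X} {χ : X → ℝ}
    (hχ : ContMDiff I 𝓘(ℝ, ℝ) ∞ χ) (h : (V : Set X) ∩ tsupport χ ⊆ W) {r : ℕ}
    {v : (Fin r → ℝ) → ∀ x, A.Fib x} (hv : A.SmoothFam r W v) :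
    A.SmoothFam r V fun y x => if x ∈ V then χ x • v y x else 0 := by
  rintro ⟨y, p⟩ ⟨-, hp : p ∈ V⟩
  refine ContMDiffAt.contMDiffWithinAt ?_
  have hV : ∀ᶠ q : (Fin r → ℝ) × X in 𝓝 (y, p), q.2 ∈ V :=
    continuous_snd.continuousAt.eventually (V.isOpen.mem_nhds hp)
  by_cases hpχ : p ∈ tsupport χ
  · have hW : (univ : Set (Fin r → ℝ)) ×ˢ (W : Set X) ∈ 𝓝 (y, p) :=
      (isOpen_univ.prod W.isOpen).mem_nhds ⟨mem_univ _, h ⟨hp, hpχ⟩⟩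
    let e := trivializationAt (Fin A.rank → ℝ) A.Fib p
    have hpe : p ∈ e.baseSet := FiberBundle.mem_baseSet_trivializationAt' p
    have h1 := (e.contMDiffAt_iff (IB := I) (n := ∞)
      (f := fun q : (Fin r → ℝ) × X => TotalSpace.mk' (Fin A.rank → ℝ) q.2 (v q.1 q.2))
      ((Trivialization.mem_source _).2 hpe)).1 (ContMDiffOn.contMDiffAt hv hW)
    refine (e.contMDiffAt_iff ((Trivialization.mem_source _).2 hpe)).2
      ⟨contMDiffAt_snd, ?_⟩
    refine ((hχ.contMDiffAt.comp (y, p) contMDiffAt_snd).smul h1.2).congr_of_eventuallyEq ?_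
    filter_upwards [hV, continuous_snd.continuousAt.eventually (e.open_baseSet.mem_nhds hpe)]
      with q hq hqe
    rw [if_pos hq]
    exact (e.linear ℝ hqe).map_smul (χ q.2) (v q.1 q.2)
  · have h1 : ∀ᶠ q : (Fin r → ℝ) × X in 𝓝 (y, p), χ q.2 = 0 :=
      Filter.mem_of_superset (continuous_snd.continuousAt.preimage_mem_nhds
        ((isClosed_tsupport χ).isOpen_compl.mem_nhds (x := p) hpχ))
        fun q hq => image_eq_zero_of_notMem_tsupport hq
    refine ((contMDiff_zeroSection (n := ∞) (IB := I) ℝ A.Fib).contMDiffAt.comp (y, p)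
      contMDiffAt_snd).congr_of_eventuallyEq ?_
    filter_upwards [h1] with q hq
    rw [hq, zero_smul, ite_self]
    rfl

end

namespace System

variable {d : ℕ} {M N : Type u} [TopologicalSpace M]
  [ChartedSpace (EuclideanHalfSpace (d + 1)) M] [MeasurableSpace M] [TopologicalSpace N]
  [ChartedSpace (EuclideanSpace ℝ (Fin d)) N] [MeasurableSpace N] (B : System d M N)

open Classical in
/-- Multiplication of conditioned fields over `W` by a function `χ`, as fields over `V`. This is
defined to be zero unless the support of `χ` in `V` lies in `W`. -/
def cutoff (χ : C^∞⟮𝓡∂ (d + 1), M; ℝ⟯) (W V : Opens M) : GrHom (B.fieldsGr W) (B.fieldsGr V) :=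
  if h : (V : Set M) ∩ tsupport χ ⊆ W then
    { toFun :=
        { toFun := fun e => ⟨⟨fun p => if p ∈ V then χ p • e.1.1 p else 0,
            fun p hp => if_neg hp, (GrBundle.SmoothFam.cutoff χ.contMDiff h
              (e.1.2.2.const 0)).apply 0⟩, fun x hx => by
            have hx' : B.collar.toFun (x, 0) ∈ V := hx
            rw [rho_apply B _ hx]
            simp only [if_pos hx', map_smul, Prod.smul_fst]
            refine (B.L x).smul_mem _ ?_
            by_cases hW : B.collar.toFun (x, 0) ∈ W
            · have := e.2 x hW
              rwa [rho_apply B _ hW] at this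
            · rw [e.1.2.1 _ hW, map_zero]
              exact (B.L x).zero_mem⟩
          map_add' := fun e e' => fields_ext fun p => by
            change (if p ∈ V then χ p • (e.1.1 p + e'.1.1 p) else 0) =
              (if p ∈ V then χ p • e.1.1 p else 0) + (if p ∈ V then χ p • e'.1.1 p else 0)
            split_ifs
            · exact smul_add _ _ _
            · exact (add_zero _).symm
          map_smul' := fun c e => fields_ext fun p => by
            change (if p ∈ V then χ p • (c • e.1.1 p) else 0) =
              c • (if p ∈ V then χ p • e.1.1 p else 0)
            split_ifs
            · exact smul_comm _ _ _
            · exact (smul_zero _).symm }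
      pr := fun k e => fields_ext fun p => by
        change B.bulk.bdl.pr k p (if p ∈ V then χ p • e.1.1 p else 0) =
          if p ∈ V then χ p • B.bulk.bdl.pr k p (e.1.1 p) else 0
        split_ifs
        · exact map_smul _ _ _
        · exact map_zero _
      plot := fun s v hv => GrBundle.SmoothFam.cutoff (A := B.bulk.bdl)
        (v := fun y => (v y).1.1) χ.contMDiff h hv }
  else
    { toFun := 0
      pr := fun k e => map_zero _
      plot := fun s v _ => (B.fieldsGr V).const_plot s 0 }

variable {B}

theorem cutoff_apply {χ : C^∞⟮𝓡∂ (d + 1), M; ℝ⟯} {W V : Opens M}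
    (h : (V : Set M) ∩ tsupport χ ⊆ W) (e : B.fields W) {p : M} (hp : p ∈ V) :
    ((B.cutoff χ W V).toFun e).1.1 p = χ p • e.1.1 p := by
  rw [cutoff, dif_pos h]
  exact if_pos hp

open Classical in
theorem cutoff_eq_zero {χ : C^∞⟮𝓡∂ (d + 1), M; ℝ⟯} {W V : Opens M} {e : B.fields W} {p : M}
    (hp : e.1.1 p = 0) : ((B.cutoff χ W V).toFun e).1.1 p = 0 := by
  rw [cutoff]
  split_ifs with h
  · change (if p ∈ V then χ p • e.1.1 p else 0) = 0
    rw [hp, smul_zero, ite_self]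
  · rfl

/-- Cutoff functions commute with restrictions. -/
theorem fieldsHom_cutoff {χ : C^∞⟮𝓡∂ (d + 1), M; ℝ⟯} {W V W' V' : Opens M} (hV : V' ≤ V)
    (hW : W' ≤ W) (h : (V : Set M) ∩ tsupport χ ⊆ W) (h' : (V' : Set M) ∩ tsupport χ ⊆ W')
    (e : B.fields W) : (B.fieldsHom hV).toFun ((B.cutoff χ W V).toFun e) =
      (B.cutoff χ W' V').toFun ((B.fieldsHom hW).toFun e) := by
  refine fields_ext fun p => ?_
  by_cases hp : p ∈ V'
  · refine (GrBundle.res_of_mem hV _ hp).trans ?_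
    rw [cutoff_apply h' _ hp, cutoff_apply h _ (hV hp)]
    by_cases hpW : p ∈ W'
    · congr 1
      exact (GrBundle.res_of_mem hW _ hpW).symm
    · have : χ p = 0 := image_eq_zero_of_notMem_tsupport fun hs => hpW (h' ⟨hp, hs⟩)
      rw [this, zero_smul, zero_smul]
  · exact (GrBundle.res_of_notMem hV _ hp).trans (((B.cutoff χ W' V').toFun _).1.2.1 p hp).symm

theorem cutoff_fieldsHom {χ : C^∞⟮𝓡∂ (d + 1), M; ℝ⟯} {W V : Opens M} (hW : W ≤ V)
    (h : (V : Set M) ∩ tsupport χ ⊆ W) (e : B.fields V) :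
    (B.cutoff χ W V).toFun ((B.fieldsHom hW).toFun e) = (B.cutoff χ V V).toFun e := by
  rw [← fieldsHom_cutoff le_rfl hW inter_subset_left h]
  exact B.presheaf.res_self le_rfl _

/-! ### Supports of functionals -/

/-- The field vanishes on the set `O`. -/
def VanishOn {U : Opens M} (O : Set M) (e : B.fields U) : Prop := ∀ p ∈ O, e.1.1 p = 0

/-- The brackets are local. -/
theorem vanishOn_op {U O : Opens M} {k : ℕ} {v : Fin k → B.fields U} {i : Fin k}
    (h : VanishOn (O : Set M) (v i)) : VanishOn (O : Set M) ((B.fieldsAlg U).op k v) := by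
  intro p hp
  by_cases hpU : p ∈ U
  · have h0 : (B.fieldsHom (inf_le_right : O ⊓ U ≤ U)).toFun (v i) = 0 := fields_ext fun q => by
      by_cases hq : q ∈ O ⊓ U
      · exact (GrBundle.res_of_mem _ _ hq).trans (h q hq.1)
      · exact GrBundle.res_of_notMem _ _ hq
    have h1 : (B.fieldsHom (inf_le_right : O ⊓ U ≤ U)).toFun ((B.fieldsAlg U).op k v) = 0 :=
      (B.presheaf.strict inf_le_right k v).trans (((B.fieldsAlg (O ⊓ U)).op k).map_coord_zero i h0)
    have h2 := GrBundle.res_of_mem (inf_le_right : O ⊓ U ≤ U) ((B.fieldsAlg U).op k v).1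
      (show p ∈ O ⊓ U from ⟨hp, hpU⟩)
    rw [← h2]
    exact congrArg (fun e : B.fields (O ⊓ U) => e.1.1 p) h1
  · exact ((B.fieldsAlg U).op k v).1.2.1 p hpU

variable (B) in
/-- The functional vanishes on words of length `m` with a letter that vanishes on `O m`. -/
def SuppIn {U : Opens M} (O : ℕ → Opens M) (w : ShuffleAlg (Letter (B.fieldsGr U))) : Prop :=
  ∀ l, (∃ a ∈ l, VanishOn (O l.length : Set M) a.val) → w l = 0

/-- The differential preserves supports, as the brackets are local, and a bracket does not increase
the number of letters, so that monotonicity of `O` applies. -/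
theorem SuppIn.ce {U : Opens M} {O : ℕ → Opens M} (hO : Monotone O)
    {w : ShuffleAlg (Letter (B.fieldsGr U))} (hw : B.SuppIn O w) (hl : HeadLin w) :
    B.SuppIn O ((B.fieldsAlg U).ce w) := by
  rintro l ⟨a, ha, ha0⟩
  refine (WordFam.ce_congr (B.fieldsAlg U) (w := 0) hl (fun _ _ => ⟨0, fun _ _ => rfl⟩) l
    fun S T hST hS => ?_).trans (unsh_zero l)
  have hle : (O ((B.fieldsAlg U).br S :: T).length : Set M) ⊆ O l.length :=
    hO (WordFam.length_br_cons (B.fieldsAlg U) hST hS)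
  refine hw _ ?_
  rcases List.mem_append.1 (hST.mem_iff.2 ha) with h | h
  · obtain ⟨i, hi, rfl⟩ := List.getElem_of_mem h
    exact ⟨_, List.mem_cons_self .., vanishOn_op (i := ⟨i, hi⟩) fun p hp => ha0 p (hle hp)⟩
  · exact ⟨a, List.mem_cons_of_mem _ h, fun p hp => ha0 p (hle hp)⟩

end System

/-! ### Sums over labellings of the letters of a word -/

section

variable {Q A A' : Type*} [Alphabet A] [Alphabet A']

instance : Alphabet (Q × A) := ⟨fun a => deg a.2⟩

/-- The sum of a function of labelled words over all labellings of the letters of `l` by elements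
of `J`. -/
def labelSum (J : Finset Q) : List A → ((List (Q × A) → ℝ) →ₗ[ℝ] ℝ)
  | [] => LinearMap.proj []
  | v :: l => ∑ p ∈ J, (labelSum J l).comp (LinearMap.funLeft ℝ ℝ fun t => (p, v) :: t)

theorem labelSum_cons (J : Finset Q) (v : A) (l : List A) (g : List (Q × A) → ℝ) :
    labelSum J (v :: l) g = ∑ p ∈ J, labelSum J l fun t => g ((p, v) :: t) := by
  rw [labelSum, LinearMap.sum_apply]
  rfl

theorem labelSum_append (J : Finset Q) (l₁ l₂ : List A) (g : List (Q × A) → ℝ) :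
    labelSum J (l₁ ++ l₂) g =
      labelSum J l₁ fun t₁ => labelSum J l₂ fun t₂ => g (t₁ ++ t₂) := by
  induction l₁ generalizing g with
  | nil => rfl
  | cons v l₁ ih =>
    rw [List.cons_append, labelSum_cons, labelSum_cons]
    exact Finset.sum_congr rfl fun p _ => ih _

theorem labelSum_map (J : Finset Q) (φ : A → A') (l : List A) (g : List (Q × A') → ℝ) :
    labelSum J (l.map φ) g = labelSum J l fun t => g (t.map (Prod.map id φ)) := by
  induction l generalizing g with
  | nil => rfl
  | cons v l ih =>
    rw [List.map_cons, labelSum_cons, labelSum_cons]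
    exact Finset.sum_congr rfl fun p _ => ih _

theorem labelSum_congr {J : Finset Q} {l : List A} {g g' : List (Q × A) → ℝ}
    (h : ∀ t : List (Q × A), t.map Prod.snd = l → (∀ a ∈ t, a.1 ∈ J) → g t = g' t) :
    labelSum J l g = labelSum J l g' := by
  induction l generalizing g g' with
  | nil => exact h [] rfl (by simp)
  | cons v l ih =>
    rw [labelSum_cons, labelSum_cons]
    refine Finset.sum_congr rfl fun p hp => ih fun t ht hJ => h _ (by simp [ht]) ?_
    intro a ha
    rcases List.mem_cons.1 ha with rfl | ha
    · exact hp
    · exact hJ a ha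

theorem labelSum_eq_zero {J : Finset Q} {l : List A} {g : List (Q × A) → ℝ}
    (h : ∀ t : List (Q × A), t.map Prod.snd = l → (∀ a ∈ t, a.1 ∈ J) → g t = 0) :
    labelSum J l g = 0 :=
  (labelSum_congr (g' := 0) h).trans (map_zero _)

theorem GSymm.labelSum {J : Finset Q} {g : List (Q × A) → ℝ} (hg : GSymm g) :
    GSymm fun l : List A => labelSum J l g := by
  intro l₁ a b l₂
  simp only [labelSum_append, labelSum_cons]
  rw [← map_smul]
  congr 1
  funext t₁
  simp only [Pi.smul_apply, Finset.smul_sum]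
  rw [Finset.sum_comm]
  refine Finset.sum_congr rfl fun q _ => Finset.sum_congr rfl fun p _ => ?_
  rw [← map_smul]
  congr 1
  funext t₂
  exact hg t₁ (p, a) (q, b) t₂

theorem contDiff_labelSum {Y : Type*} [NormedAddCommGroup Y] [NormedSpace ℝ Y] {J : Finset Q}
    {l : List A} {g : Y → List (Q × A) → ℝ} (h : ∀ t, ContDiff ℝ ∞ fun z => g z t) :
    ContDiff ℝ ∞ fun z => labelSum J l (g z) := by
  induction l generalizing g with
  | nil => exact h []
  | cons v l ih =>
    simp only [labelSum_cons]
    exact ContDiff.sum fun p _ => ih fun t => h _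

end

section

variable {E E' : Type u} [AddCommGroup E] [Module ℝ E] [AddCommGroup E'] [Module ℝ E']
  {G : GrSpace E} {G' : GrSpace E'} {Q : Type*}

theorem exists_linear_labelSum {J : Finset Q} {l : List (Letter G')} {k : ℤ}
    {g : Letter G' → List (Q × Letter G') → ℝ}
    (h : ∀ t, ∃ Λ : E' →ₗ[ℝ] ℝ, ∀ a : Letter G', a.degree = k → g a t = Λ a.val) :
    ∃ Λ : E' →ₗ[ℝ] ℝ, ∀ a : Letter G', a.degree = k → labelSum J l (g a) = Λ a.val := by
  choose Λ hΛ using h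
  refine ⟨(labelSum J l).comp (LinearMap.pi Λ), fun a ha => ?_⟩
  rw [LinearMap.comp_apply]
  congr 1
  funext t
  exact hΛ t a ha

open Classical in
/-- The functional that maps a word to the sum of the values of `F` on the words obtained by
applying maps `μ m q` with labels `q ∈ J m` to its letters, where `m` is the length of the word and
the sum is restricted to the labellings that satisfy `P m`. -/
def relabel (J : ℕ → Finset Q) (P : ℕ → List Q → Prop) (μ : ℕ → Q → GrHom G' G)
    (F : ShuffleAlg (Letter G)) : ShuffleAlg (Letter G') := fun l =>
  labelSum (J l.length) l fun t => if P l.length (t.map Prod.fst) then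
    F (t.map fun a => (μ l.length a.1).letter a.2) else 0

variable {J : ℕ → Finset Q} {P : ℕ → List Q → Prop} {μ : ℕ → Q → GrHom G' G}

theorem GSymm.relabel (hP : ∀ m s s', s.Perm s' → P m s → P m s') {F : ShuffleAlg (Letter G)}
    (hF : GSymm F) : GSymm (relabel J P μ F) := by
  classical
  intro l₁ a b l₂
  have hlen : (l₁ ++ b :: a :: l₂).length = (l₁ ++ a :: b :: l₂).length := by simp
  unfold BulkBoundary.relabel
  rw [hlen]
  generalize (l₁ ++ a :: b :: l₂).length = m
  refine GSymm.labelSum (g := fun t => if P m (t.map Prod.fst) then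
    F (t.map fun a => (μ m a.1).letter a.2) else 0) (fun t₁ c c' t₂ => ?_) l₁ a b l₂
  have h1 : P m ((t₁ ++ c :: c' :: t₂).map Prod.fst) ↔
      P m ((t₁ ++ c' :: c :: t₂).map Prod.fst) :=
    ⟨hP m _ _ (((List.Perm.swap c' c t₂).append_left t₁).map _),
      hP m _ _ (((List.Perm.swap c c' t₂).append_left t₁).map _)⟩
  by_cases h : P m ((t₁ ++ c :: c' :: t₂).map Prod.fst)
  · refine (if_pos h).trans (Eq.trans ?_ (congrArg _ (if_pos (h1.1 h)).symm))
    rw [List.map_append, List.map_append]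
    exact hF _ _ _ _
  · refine (if_neg h).trans (Eq.trans ?_ (congrArg _ (if_neg fun h' => h (h1.2 h')).symm))
    exact (smul_zero _).symm

theorem HeadLin.relabel {F : ShuffleAlg (Letter G)} (hF : HeadLin F) :
    HeadLin (relabel J P μ F) := by
  classical
  intro l k
  unfold BulkBoundary.relabel
  simp only [List.length_cons, labelSum_cons]
  have h : ∀ p ∈ J (l.length + 1), ∃ Λ : E' →ₗ[ℝ] ℝ, ∀ a : Letter G', a.degree = k →
      labelSum (J (l.length + 1)) l (fun t =>
        if P (l.length + 1) (((p, a) :: t).map Prod.fst) then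
          F (((p, a) :: t).map fun a => (μ (l.length + 1) a.1).letter a.2) else 0) = Λ a.val := by
    intro p _
    refine exists_linear_labelSum fun t => ?_
    by_cases hPt : P (l.length + 1) (p :: t.map Prod.fst)
    · obtain ⟨Λ, hΛ⟩ := hF (t.map fun a => (μ (l.length + 1) a.1).letter a.2) k
      exact ⟨Λ.comp (μ (l.length + 1) p).toFun, fun a ha => (if_pos hPt).trans
        (hΛ ((μ (l.length + 1) p).letter a) ha)⟩
    · exact ⟨0, fun a _ => if_neg hPt⟩
  choose! Λ hΛ using h
  refine ⟨∑ p ∈ J (l.length + 1), Λ p, fun a ha => ?_⟩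
  rw [LinearMap.sum_apply]
  exact Finset.sum_congr rfl fun p hp => hΛ p hp a ha

theorem isHom_relabel {p : ℤ} {F : ShuffleAlg (Letter G)} (hF : ShuffleAlg.IsHom p F) :
    ShuffleAlg.IsHom p (relabel J P μ F) := by
  classical
  intro l hl
  refine labelSum_eq_zero fun t ht _ => ?_
  split_ifs
  · refine hF _ ?_
    have : tdeg (t.map fun a => (μ l.length a.1).letter a.2) = tdeg t :=
      tdeg_map (φ := fun a : Q × Letter G' => (μ l.length a.1).letter a.2) (fun _ => rfl) t
    rw [this, ← tdeg_map (φ := Prod.snd) (fun a : Q × Letter G' => rfl) t, ht]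
    exact hl
  · rfl

namespace WordFam

theorem relabel_mem_homSub (hP : ∀ m s s', s.Perm s' → P m s → P m s') {r : ℕ} {p : ℤ}
    {w : WordFam G r} (hw : w ∈ homSub G r p) :
    (fun x => relabel J P μ (w x) : WordFam G' r) ∈ homSub G' r p := by
  classical
  refine ⟨fun x => (hw.1 x).relabel hP, fun x => (hw.2.1 x).relabel, fun s L => ?_,
    fun x => isHom_relabel (hw.2.2.2 x)⟩
  unfold relabel
  simp only [List.length_map, labelSum_map]
  refine contDiff_labelSum fun t => ?_
  simp only [List.map_map]
  have h1 : Prod.fst ∘ Prod.map id (LetterFam.eval (G := G') (0 : Fin s → ℝ)) =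
      (Prod.fst : Q × LetterFam G' s → Q) := rfl
  by_cases hPt : P L.length (t.map Prod.fst)
  · have := hw.2.2.1 s (t.map fun a => (μ L.length a.1).letterFam a.2)
    refine cast (congrArg _ (funext fun z => ?_)) this
    rw [List.map_map]
    exact (if_pos hPt).symm
  · refine cast (congrArg _ (funext fun z => ?_)) (contDiff_const (c := (0 : ℝ)))
    exact (if_neg hPt).symm

end WordFam

end

/-! ### Decompositions adapted to a Weiss cover -/

section

variable {d : ℕ} {M : Type u} [TopologicalSpace M] [ChartedSpace (EuclideanHalfSpace (d + 1)) M]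
  {T : Type u}

/-- Functions `χ m q`, for `q` in a finite set `J m`, whose sum is `1` on `O m`, such that the
supports of any `m` of them lie in a common member `𝓤 (sel m S)` of the cover. -/
structure Cutoffs (d : ℕ) {M : Type u} [TopologicalSpace M]
    [ChartedSpace (EuclideanHalfSpace (d + 1)) M] {T : Type u} (𝓤 : T → Opens M)
    (O : ℕ → Opens M) where
  J : ℕ → Finset M
  χ : ℕ → M → C^∞⟮𝓡∂ (d + 1), M; ℝ⟯
  sel : ℕ → Finset M → T
  sum_eq : ∀ m, ∀ p ∈ O m, ∑ q ∈ J m, χ m q p = 1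
  supp : ∀ m (S : Finset M), S ⊆ J m → S.card ≤ m → ∀ q ∈ S, tsupport (χ m q) ⊆ 𝓤 (sel m S)

variable [IsManifold (𝓡∂ (d + 1)) ∞ M] [SecondCountableTopology M] [T2Space M]

/-- The sets `(𝓤 i)ᵐ` cover the compact set `Kᵐ`; the functions are a partition of unity on `K`
subordinate to balls whose radius is a Lebesgue number of this cover. -/
theorem exists_cutoffs_arity {U : Opens M} {𝓤 : T → Opens M} (h : IsWeissCover U 𝓤) {K : Set M}
    (hK : IsCompact K) (hKU : K ⊆ U) (m : ℕ) :
    ∃ (J : Finset M) (χ : M → C^∞⟮𝓡∂ (d + 1), M; ℝ⟯), (∀ p ∈ K, ∑ q ∈ J, χ q p = 1) ∧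
      ∀ S : Finset M, ∃ i, S ⊆ J → S.card ≤ m → ∀ q ∈ S, tsupport (χ q) ⊆ 𝓤 i := by
  classical
  have : LocallyCompactSpace M := Manifold.locallyCompact_of_finiteDimensional (𝓡∂ (d + 1))
  have : MetrizableSpace M := Manifold.metrizableSpace (𝓡∂ (d + 1)) M
  let _ := metrizableSpaceMetric M
  obtain ⟨δ, hδ, hball⟩ := lebesgue_number_lemma_of_metric
    (s := (univ : Set (Fin m)).pi fun _ => K)
    (c := fun i : T => (univ : Set (Fin m)).pi fun _ => (𝓤 i : Set M))
    (isCompact_univ_pi fun _ => hK)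
    (fun i => isOpen_set_pi finite_univ fun _ _ => (𝓤 i).isOpen) (fun f hf => by
      obtain ⟨i, hi⟩ := h.2 (Finset.univ.image f) fun p hp => by
        obtain ⟨j, -, rfl⟩ := Finset.mem_image.1 (Finset.mem_coe.1 hp)
        exact hKU (hf j (mem_univ j))
      exact mem_iUnion.2 ⟨i, fun j _ => hi (by simp)⟩)
  obtain ⟨J, hJK, hJ⟩ := hK.elim_nhds_subcover (fun q => Metric.ball q δ)
    fun q _ => Metric.ball_mem_nhds q hδ
  obtain ⟨f, hf⟩ := SmoothPartitionOfUnity.exists_isSubordinate (𝓡∂ (d + 1)) hK.isClosed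
    (fun q : M => {x | q ∈ J ∧ x ∈ Metric.ball q δ})
    (fun q => by
      by_cases hq : q ∈ J
      · simp only [hq, true_and]
        exact Metric.isOpen_ball
      · simp [hq])
    (fun p hp => by
      obtain ⟨q, hq, hpq⟩ := mem_iUnion₂.1 (hJ hp)
      exact mem_iUnion.2 ⟨q, hq, hpq⟩)
  refine ⟨J, f, fun p hp => f.sum_finsupport' p hp fun q hq => ?_, fun S => ?_⟩
  · exact (hf q (subset_tsupport _ ((f.mem_finsupport p).1 hq))).1
  · by_cases hS : S ⊆ J ∧ S.card ≤ m ∧ S.Nonempty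
    · obtain ⟨hSJ, hSm, q₀, hq₀⟩ := hS
      obtain ⟨e⟩ : Nonempty (S ↪ Fin m) := Function.Embedding.nonempty_of_card_le (by simpa)
      -- The centres of the balls form a point of `Kᵐ`, and the ball around this point contains
      -- each tuple that differs from it in one entry by less than `δ`.
      let g : Fin m → M := Function.extend e Subtype.val fun _ => q₀
      have hg : ∀ q (hq : q ∈ S), g (e ⟨q, hq⟩) = q := fun q hq =>
        e.injective.extend_apply _ _ ⟨q, hq⟩
      have hgK : ∀ j, g j ∈ K := by
        intro j
        by_cases hj : ∃ q, e q = j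
        · obtain ⟨q, rfl⟩ := hj
          rw [hg]
          exact hJK _ (hSJ q.2)
        · rw [show g j = q₀ from Function.extend_apply' _ _ _ hj]
          exact hJK _ (hSJ hq₀)
      obtain ⟨i, hi⟩ := hball g fun j _ => hgK j
      refine ⟨i, fun _ _ q hq x hx => ?_⟩
      have h1 : Function.update g (e ⟨q, hq⟩) x ∈ Metric.ball g δ := by
        rw [Metric.mem_ball, dist_pi_lt_iff hδ]
        intro j
        by_cases hj : j = e ⟨q, hq⟩
        · subst hj
          rw [Function.update_self, hg]
          exact (hf q hx).2
        · rw [Function.update_of_ne hj, dist_self]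
          exact hδ
      simpa using hi h1 (e ⟨q, hq⟩) (mem_univ _)
    -- Without a label in `S` the condition is empty; the cover has a member as the empty set lies
    -- in one.
    · obtain ⟨i, -⟩ := h.2 ∅ (by simp)
      exact ⟨i, fun h1 h2 q hq => absurd ⟨h1, h2, q, hq⟩ hS⟩

theorem exists_cutoffs {U : Opens M} {𝓤 : T → Opens M} (h : IsWeissCover U 𝓤) {O : ℕ → Opens M}
    (hO : ∀ m, ∃ K : Set M, IsCompact K ∧ K ⊆ U ∧ (O m : Set M) ⊆ K) :
    Nonempty (Cutoffs d 𝓤 O) := by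
  choose K hK hKU hOK using hO
  choose J χ h1 sel h2 using fun m => exists_cutoffs_arity (d := d) h (hK m) (hKU m) m
  exact ⟨⟨J, χ, sel, fun m p hp => h1 m p (hOK m hp), h2⟩⟩

end

/-- Linearity in one slot, applied to a sum of letters minus a letter. -/
theorem SlotLin.exists_letter_sub {E : Type u} [AddCommGroup E] [Module ℝ E] {G : GrSpace E}
    {f : List (Letter G) → ℝ} (hf : SlotLin f) (l₁ l₂ : List (Letter G)) (a : Letter G)
    {Q : Type*} (J : Finset Q) (b : Q → Letter G) (hb : ∀ q, (b q).degree = a.degree) :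
    ∃ u : Letter G, u.val = ∑ q ∈ J, (b q).val - a.val ∧
      f (l₁ ++ u :: l₂) = ∑ q ∈ J, f (l₁ ++ b q :: l₂) - f (l₁ ++ a :: l₂) := by
  obtain ⟨Λ, hΛ⟩ := hf l₁ l₂ a.degree
  refine ⟨⟨a.degree, ∑ q ∈ J, (b q).val - a.val, ?_⟩, rfl, ?_⟩
  · rw [map_sub, map_sum, a.homog]
    congr 1
    exact Finset.sum_congr rfl fun q _ => by rw [← hb q, (b q).homog]
  · rw [hΛ a rfl, Finset.sum_congr rfl fun q _ => hΛ (b q) (hb q), ← map_sum Λ, ← map_sub Λ]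
    exact hΛ _ rfl

namespace Cutoffs

variable {d : ℕ} {M N : Type u} [TopologicalSpace M]
  [ChartedSpace (EuclideanHalfSpace (d + 1)) M] [MeasurableSpace M] [TopologicalSpace N]
  [ChartedSpace (EuclideanSpace ℝ (Fin d)) N] [MeasurableSpace N] (B : System d M N)
  {T : Type u} {𝓤 : T → Opens M} {O : ℕ → Opens M} (κ : Cutoffs d 𝓤 O)

open Classical in
/-- The labels `s` select the member `i` of the cover. -/
def Selects (i : T) (m : ℕ) (s : List M) : Prop :=
  κ.sel m s.toFinset = i ∧ ∀ q ∈ s, tsupport (κ.χ m q) ⊆ 𝓤 i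

theorem Selects.perm {κ : Cutoffs d 𝓤 O} {i : T} (m : ℕ) (s s' : List M) (h : s.Perm s')
    (hs : κ.Selects i m s) : κ.Selects i m s' := by
  classical
  refine ⟨?_, fun q hq => hs.2 q (h.mem_iff.2 hq)⟩
  rw [← hs.1]
  congr 1
  exact (List.toFinset_eq_of_perm _ _ h).symm

/-- The part of a functional on fields over `V` that is supported in `𝓤 i`, as a functional on
fields over `W`: the arguments are multiplied by those products of the functions `χ m q` that are
assigned to `i`. -/
def part (i : T) (W V : Opens M) (w : ShuffleAlg (Letter (B.fieldsGr V))) :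
    ShuffleAlg (Letter (B.fieldsGr W)) :=
  relabel κ.J (κ.Selects i) (fun m q => B.cutoff (κ.χ m q) W V) w

open Classical in
/-- The members of the cover that occur in the decomposition of functionals with `m` arguments. -/
def used (m : ℕ) : Finset T := (κ.J m).powerset.image (κ.sel m)

variable {B κ}

theorem part_eq_zero_of_used {i : T} {W V : Opens M} {w : ShuffleAlg (Letter (B.fieldsGr V))}
    {l : List (Letter (B.fieldsGr W))} (h : i ∉ κ.used l.length) : κ.part B i W V w l = 0 := by
  classical
  refine labelSum_eq_zero fun t _ ht => if_neg fun hs => h ?_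
  refine Finset.mem_image.2 ⟨(t.map Prod.fst).toFinset, ?_, hs.1⟩
  rw [Finset.mem_powerset]
  intro q hq
  obtain ⟨a, ha, rfl⟩ := List.mem_map.1 (List.mem_toFinset.1 hq)
  exact ht a ha

theorem part_eq_zero_of_length {i : T} {W V : Opens M} {w : ShuffleAlg (Letter (B.fieldsGr V))}
    {l : List (Letter (B.fieldsGr W))} (h : ∀ l', l'.length = l.length → w l' = 0) :
    κ.part B i W V w l = 0 := by
  classical
  refine labelSum_eq_zero fun t ht _ => ?_
  split_ifs
  · refine h _ ?_
    rw [List.length_map, ← ht, List.length_map]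
  · rfl

theorem _root_.BulkBoundary.System.SuppIn.part {i : T} {W V : Opens M}
    {w : ShuffleAlg (Letter (B.fieldsGr V))} (hw : B.SuppIn O w) :
    B.SuppIn O (κ.part B i W V w) := by
  classical
  rintro l ⟨a, ha, ha0⟩
  refine labelSum_eq_zero fun t ht _ => ?_
  rw [← ht] at ha
  obtain ⟨c, hc, rfl⟩ := List.mem_map.1 ha
  split_ifs
  · refine hw _ ⟨_, List.mem_map_of_mem hc, fun p hp => System.cutoff_eq_zero (ha0 p ?_)⟩
    rwa [List.length_map, ← List.length_map Prod.snd, ht] at hp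
  · rfl

/-- The parts of a functional are compatible with restrictions of fields. -/
theorem part_shuffle {i : T} {W V W' V' : Opens M} (hV : V' ≤ V) (hW : W' ≤ W)
    (h : V ⊓ 𝓤 i ≤ W) (h' : V' ⊓ 𝓤 i ≤ W') (w : ShuffleAlg (Letter (B.fieldsGr V'))) :
    κ.part B i W V ((B.fieldsHom hV).shuffle w) =
      (B.fieldsHom hW).shuffle (κ.part B i W' V' w) := by
  classical
  refine ShuffleAlg.ext fun l => ?_
  rw [GrHom.shuffle_apply]
  unfold part relabel
  rw [labelSum_map, List.length_map]
  congr 1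
  funext t
  rw [List.map_map]
  by_cases hs : κ.Selects i l.length (t.map Prod.fst)
  · refine (if_pos hs).trans (Eq.trans ?_ (if_pos hs).symm)
    rw [GrHom.shuffle_apply, List.map_map, List.map_map]
    congr 1
    refine List.map_congr_left fun a ha => Letter.ext' rfl ?_
    have hsupp := hs.2 a.1 (List.mem_map_of_mem ha)
    exact System.fieldsHom_cutoff hV hW (fun p hp => h ⟨hp.1, hsupp hp.2⟩)
      (fun p hp => h' ⟨hp.1, hsupp hp.2⟩) a.2.val
  · exact (if_neg hs).trans (if_neg hs).symm

/-- Each letter may be replaced by the sum of its cutoffs: the difference vanishes on `O m`, where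
the cutoff functions sum to `1`. -/
theorem labelSum_cutoff {V : Opens M} {w : ShuffleAlg (Letter (B.fieldsGr V))}
    (hw : SlotLin w) (hO : B.SuppIn O w) (l₁ l : List (Letter (B.fieldsGr V))) {m : ℕ}
    (hm : l₁.length + l.length = m) :
    labelSum (κ.J m) l (fun t => w (l₁ ++ t.map fun a => (B.cutoff (κ.χ m a.1) V V).letter a.2)) =
      w (l₁ ++ l) := by
  induction l generalizing l₁ with
  | nil => rfl
  | cons v l ih =>
    rw [labelSum_cons]
    have h1 : ∀ q, labelSum (κ.J m) l (fun t => w (l₁ ++ ((q, v) :: t).map fun a =>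
        (B.cutoff (κ.χ m a.1) V V).letter a.2)) =
        w (l₁ ++ (B.cutoff (κ.χ m q) V V).letter v :: l) := by
      intro q
      have := ih (l₁ ++ [(B.cutoff (κ.χ m q) V V).letter v]) (by
        rw [← hm]
        simp only [List.length_append, List.length_cons, List.length_nil]
        omega)
      simpa only [List.append_assoc, List.singleton_append, List.map_cons] using this
    simp only [h1]
    obtain ⟨u, hu, hwu⟩ := hw.exists_letter_sub l₁ l v (κ.J m)
      (fun q => (B.cutoff (κ.χ m q) V V).letter v) fun q => rfl
    rw [← sub_eq_zero, ← hwu]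
    refine hO _ ⟨u, List.mem_append_right _ (List.mem_cons_self ..), fun p hp => ?_⟩
    have hp' : p ∈ O m := by
      rw [← hm]
      simpa using hp
    rw [hu]
    change (∑ q ∈ κ.J m, (B.cutoff (κ.χ m q) V V).toFun v.val).1.1 p - v.val.1.1 p = 0
    rw [Submodule.coe_sum, Submodule.coe_sum, Finset.sum_apply, sub_eq_zero]
    by_cases hpV : p ∈ V
    · rw [Finset.sum_congr rfl fun q _ =>
        System.cutoff_apply (χ := κ.χ m q) inter_subset_left v.val hpV, ← Finset.sum_smul,
        κ.sum_eq m p hp', one_smul]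
    · rw [v.val.1.2.1 p hpV]
      exact Finset.sum_eq_zero fun q _ => ((B.cutoff (κ.χ m q) V V).toFun v.val).1.2.1 p hpV

open Classical in
theorem shuffle_part {i : T} {W V : Opens M} (hWV : W ≤ V) (hVW : V ⊓ 𝓤 i ≤ W)
    (w : ShuffleAlg (Letter (B.fieldsGr V))) (l : List (Letter (B.fieldsGr V))) :
    (B.fieldsHom hWV).shuffle (κ.part B i W V w) l =
      labelSum (κ.J l.length) l fun t => if κ.Selects i l.length (t.map Prod.fst) then
        w (t.map fun a => (B.cutoff (κ.χ l.length a.1) V V).letter a.2) else 0 := by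
  rw [GrHom.shuffle_apply]
  unfold part relabel
  rw [labelSum_map, List.length_map]
  congr 1
  funext t
  rw [List.map_map]
  by_cases hs : κ.Selects i l.length (t.map Prod.fst)
  · refine (if_pos hs).trans (Eq.trans ?_ (if_pos hs).symm)
    rw [List.map_map]
    congr 1
    refine List.map_congr_left fun a ha => Letter.ext' rfl ?_
    have hsupp := hs.2 a.1 (List.mem_map_of_mem ha)
    exact System.cutoff_fieldsHom hWV (fun p hp => hVW ⟨hp.1, hsupp hp.2⟩) a.2.val
  · exact (if_neg hs).trans (if_neg hs).symm

/-- A functional is the sum of its parts. -/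
theorem sum_part {V : Opens M} {W : T → Opens M} (hWV : ∀ i, W i ≤ V)
    (hVW : ∀ i, V ⊓ 𝓤 i ≤ W i) {w : ShuffleAlg (Letter (B.fieldsGr V))} (hw : SlotLin w)
    (hO : B.SuppIn O w) (l : List (Letter (B.fieldsGr V))) {S : Finset T}
    (hS : κ.used l.length ⊆ S) :
    ∑ i ∈ S, (B.fieldsHom (hWV i)).shuffle (κ.part B i (W i) V w) l = w l := by
  classical
  have h1 := labelSum_cutoff (κ := κ) hw hO [] l (Nat.zero_add _)
  simp only [List.nil_append] at h1
  rw [← h1, Finset.sum_congr rfl fun i _ => shuffle_part (hWV i) (hVW i) w l, ← map_sum]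
  refine labelSum_congr fun t ht htJ => ?_
  rw [Finset.sum_apply]
  have hsub : (t.map Prod.fst).toFinset ⊆ κ.J l.length := by
    intro q hq
    obtain ⟨a, ha, rfl⟩ := List.mem_map.1 (List.mem_toFinset.1 hq)
    exact htJ a ha
  have hcard : (t.map Prod.fst).toFinset.card ≤ l.length := by
    refine (List.toFinset_card_le _).trans ?_
    rw [← ht, List.length_map, List.length_map]
  have hsel : κ.Selects (κ.sel l.length (t.map Prod.fst).toFinset) l.length (t.map Prod.fst) :=
    ⟨rfl, fun q hq => κ.supp _ _ hsub hcard q (List.mem_toFinset.2 hq)⟩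
  refine (Finset.sum_eq_single (κ.sel l.length (t.map Prod.fst).toFinset) (fun i _ hi =>
    if_neg fun hs => hi hs.1.symm) fun hns => ?_).trans (if_pos hsel)
  exact absurd (hS (Finset.mem_image.2 ⟨_, Finset.mem_powerset.2 hsub, rfl⟩)) hns

end Cutoffs

/-! ### The contracting homotopy of the Čech complex -/

section

variable {E : Type u} [AddCommGroup E] [Module ℝ E] {G : GrSpace E} (𝔤 : LInfAlg G)

theorem HeadLin.of_sum {ι : ℕ → Type*} {s : ∀ m, Finset (ι m)} {k : ∀ m, ι m → ℝ}
    {v : ∀ m, ι m → ShuffleAlg (Letter G)} (hv : ∀ m i, HeadLin (v m i))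
    {w : ShuffleAlg (Letter G)} (h : ∀ l, w l = ∑ i ∈ s l.length, k _ i * v _ i l) :
    HeadLin w := by
  intro l j
  choose Λ hΛ using fun i => hv (l.length + 1) i l j
  refine ⟨∑ i ∈ s (l.length + 1), k _ i • Λ i, fun a ha => ?_⟩
  rw [h, LinearMap.sum_apply]
  exact Finset.sum_congr rfl fun i _ => congrArg (k (l.length + 1) i * ·) (hΛ i a ha)

theorem HeadLin.shuffle {E' : Type u} [AddCommGroup E'] [Module ℝ E'] {G' : GrSpace E'}
    {w : ShuffleAlg (Letter G')} (hw : HeadLin w) (φ : GrHom G G') : HeadLin (φ.shuffle w) :=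
  fun l k => by
    obtain ⟨Λ, hΛ⟩ := hw (l.map φ.letter) k
    exact ⟨Λ.comp φ.toFun, fun a ha => hΛ (φ.letter a) ha⟩

theorem LInfAlg.ce_sum {ι : Type*} {s : Finset ι} {k : ι → ℝ} {v : ι → ShuffleAlg (Letter G)}
    {w : ShuffleAlg (Letter G)} (hw : HeadLin w) (hv : ∀ i, HeadLin (v i)) {l : List (Letter G)}
    (h : ∀ l', l'.length ≤ l.length → w l' = ∑ i ∈ s, k i * v i l') :
    𝔤.ce w l = ∑ i ∈ s, k i * 𝔤.ce (v i) l := by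
  have h1 : HeadLin (fun l => ∑ i ∈ s, k i * v i l : ShuffleAlg (Letter G)) :=
    HeadLin.of_sum (s := fun _ => s) (k := fun _ => k) (v := fun _ => v) (fun _ => hv) fun _ => rfl
  refine (WordFam.ce_congr 𝔤 hw h1 l fun S T hST hS =>
    h _ (WordFam.length_br_cons 𝔤 hST hS)).trans ?_
  refine (unsh_sum s l fun i S T => k i * v i (𝔤.br S :: T)).trans ?_
  exact Finset.sum_congr rfl fun i _ => unsh_smul (k i) l fun S T => v i (𝔤.br S :: T)

theorem LInfAlg.ce_sub (v w : ShuffleAlg (Letter G)) : 𝔤.ce (v - w) = 𝔤.ce v - 𝔤.ce w :=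
  congrFun (map_sub (WordFam.d (r := 0) 𝔤) (fun _ => v) (fun _ => w)) 0

theorem LInfAlg.ce_smul (c : ℝ) (w : ShuffleAlg (Letter G)) : 𝔤.ce (c • w) = c • 𝔤.ce w :=
  ShuffleAlg.ext fun l => unsh_smul c l _

theorem LInfAlg.ce_zero : 𝔤.ce 0 = 0 := ShuffleAlg.ext fun l => unsh_zero l

theorem GSymm.sub {A : Type*} [Alphabet A] {v w : ShuffleAlg A} (hv : GSymm v) (hw : GSymm w) :
    GSymm (v - w) := fun l₁ a b l₂ => by
  rw [ShuffleAlg.sub_apply, ShuffleAlg.sub_apply, hv, hw, smul_sub]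

theorem GSymm.smul {A : Type*} [Alphabet A] {w : ShuffleAlg A} (hw : GSymm w) (c : ℝ) :
    GSymm (c • w) := fun l₁ a b l₂ => by
  rw [ShuffleAlg.smul_apply, ShuffleAlg.smul_apply, hw, smul_eq_mul, smul_eq_mul,
    mul_left_comm]

theorem HeadLin.sub {v w : ShuffleAlg (Letter G)} (hv : HeadLin v) (hw : HeadLin w) :
    HeadLin (v - w) := fun l k => by
  obtain ⟨Λ, hΛ⟩ := hv l k
  obtain ⟨Λ', hΛ'⟩ := hw l k
  exact ⟨Λ - Λ', fun a ha => by rw [ShuffleAlg.sub_apply, hΛ a ha, hΛ' a ha]; rfl⟩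

theorem HeadLin.smul {w : ShuffleAlg (Letter G)} (hw : HeadLin w) (c : ℝ) :
    HeadLin (c • w) := fun l k => by
  obtain ⟨Λ, hΛ⟩ := hw l k
  exact ⟨c • Λ, fun a ha => by rw [ShuffleAlg.smul_apply, hΛ a ha]; rfl⟩

end

section

variable {M : Type u} [TopologicalSpace M] {T : Type u}

/-- The open sets of the augmented Čech complex: `U` in level `0`, and `U_{i₁} ∩ ⋯ ∩ U_{iₙ}` in
level `n`. -/
def cell (U : Opens M) (𝓤 : T → Opens M) : ∀ n, (Fin n → T) → Opens M
  | 0, _ => U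
  | _ + 1, α => inter 𝓤 α

theorem cell_insertNth_le {U : Opens M} {𝓤 : T → Opens M} (h : IsWeissCover U 𝓤) {n : ℕ}
    (j : Fin (n + 1)) (i : T) (α : Fin n → T) :
    cell U 𝓤 (n + 1) (Fin.insertNth j i α) ≤ cell U 𝓤 n α := by
  cases n with
  | zero => exact inter_le h _
  | succ n => exact inter_insertNth_le 𝓤 j i α

theorem cell_cons_le {U : Opens M} {𝓤 : T → Opens M} (h : IsWeissCover U 𝓤) {n : ℕ}
    (i : T) (α : Fin n → T) : cell U 𝓤 (n + 1) (Fin.cons i α) ≤ cell U 𝓤 n α := by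
  rw [← Fin.insertNth_zero']
  exact cell_insertNth_le h 0 i α

theorem cell_inf_le (U : Opens M) (𝓤 : T → Opens M) {n : ℕ} (i : T) (α : Fin n → T) :
    cell U 𝓤 n α ⊓ 𝓤 i ≤ cell U 𝓤 (n + 1) (Fin.cons i α) := by
  change _ ≤ Finset.univ.inf fun j => 𝓤 (Fin.cons (α := fun _ => T) i α j)
  refine Finset.le_inf fun k _ => ?_
  induction k using Fin.cases with
  | zero => exact inf_le_right
  | succ k =>
    cases n with
    | zero => exact k.elim0
    | succ n => exact inf_le_left.trans (Finset.inf_le (Finset.mem_univ k))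

end

namespace Cutoffs

variable {d : ℕ} {M N : Type u} [TopologicalSpace M]
  [ChartedSpace (EuclideanHalfSpace (d + 1)) M] [MeasurableSpace M] [TopologicalSpace N]
  [ChartedSpace (EuclideanSpace ℝ (Fin d)) N] [MeasurableSpace N] {B : System d M N}
  {T : Type u} {U : Opens M} {𝓤 : T → Opens M} {O : ℕ → Opens M} {κ : Cutoffs d 𝓤 O}

theorem part_sum {i : T} {W V : Opens M} {ι : Type*} {s : Finset ι} {k : ι → ℝ}
    {v : ι → ShuffleAlg (Letter (B.fieldsGr V))} {w : ShuffleAlg (Letter (B.fieldsGr V))}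
    {l : List (Letter (B.fieldsGr W))}
    (h : ∀ l', l'.length = l.length → w l' = ∑ a ∈ s, k a * v a l') :
    κ.part B i W V w l = ∑ a ∈ s, k a * κ.part B i W V (v a) l := by
  classical
  unfold part relabel
  simp only [← smul_eq_mul, ← map_smul]
  rw [← map_sum]
  refine labelSum_congr fun t ht _ => ?_
  rw [Finset.sum_apply]
  simp only [Pi.smul_apply]
  by_cases hs : κ.Selects i l.length (t.map Prod.fst)
  · simp only [if_pos hs]
    refine h _ ?_
    rw [List.length_map, ← ht, List.length_map]
  · simp only [if_neg hs, smul_zero, Finset.sum_const_zero]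

variable (B U 𝓤) in
/-- Families of functionals on the fields over the open sets of the augmented Čech complex. -/
abbrev Fam : Type u := ∀ n (α : Fin n → T), ShuffleAlg (Letter (B.fieldsGr (cell U 𝓤 n α)))

/-- The Čech differential, with the sums restricted to the finite sets `τ m` of indices in
arity `m`. -/
def cech (h : IsWeissCover U 𝓤) (τ : ℕ → Finset T) (c : Fam B U 𝓤) : Fam B U 𝓤 := fun n α l =>
  ∑ t ∈ (Finset.univ : Finset (Fin (n + 1))) ×ˢ τ l.length, eps (t.1 : ℕ) *
    (B.fieldsHom (cell_insertNth_le h t.1 t.2 α)).shuffle (c (n + 1) (Fin.insertNth t.1 t.2 α)) l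

/-- The Chevalley–Eilenberg differential, with the signs of the augmented Čech complex. -/
def dSgn (c : Fam B U 𝓤) : Fam B U 𝓤 := fun n α =>
  eps (n + 1 : ℕ) • (B.fieldsAlg (cell U 𝓤 n α)).ce (c n α)

variable (κ) in
/-- The contracting homotopy of the augmented Čech complex. -/
def htpy (c : Fam B U 𝓤) : Fam B U 𝓤
  | 0, _ => 0
  | n + 1, β => κ.part B (β 0) (cell U 𝓤 (n + 1) β) (cell U 𝓤 n (Fin.tail β)) (c n (Fin.tail β))

variable (κ) in
/-- The solution `y` of the equation `y + d h y = c`, where `h` is the contracting homotopy. -/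
def corr (c : Fam B U 𝓤) : Fam B U 𝓤
  | 0, α => c 0 α
  | n + 1, β => c (n + 1) β - eps (n + 1 + 1 : ℕ) • (B.fieldsAlg (cell U 𝓤 (n + 1) β)).ce
      (κ.part B (β 0) (cell U 𝓤 (n + 1) β) (cell U 𝓤 n (Fin.tail β)) (corr c n (Fin.tail β)))

theorem corr_eq (c : Fam B U 𝓤) : κ.corr c = c - dSgn (κ.htpy (κ.corr c)) := by
  funext n α
  cases n with
  | zero =>
    change c 0 α = c 0 α - eps (0 + 1 : ℕ) • (B.fieldsAlg (cell U 𝓤 0 α)).ce 0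
    rw [LInfAlg.ce_zero, smul_zero, sub_zero]
  | succ n => rfl

/-- The equation `y + d h y = c` has only one solution. -/
theorem eq_corr {c z : Fam B U 𝓤} (hz : z = c - dSgn (κ.htpy z)) : z = κ.corr c := by
  funext n
  induction n with
  | zero =>
    funext α
    rw [hz, corr_eq]
    rfl
  | succ n ih =>
    funext α
    rw [hz, corr_eq]
    change c _ α - eps _ • LInfAlg.ce _ (κ.part B _ _ _ (z n _)) =
      c _ α - eps _ • LInfAlg.ce _ (κ.part B _ _ _ (κ.corr c n _))
    rw [ih]

variable (O) in
/-- Multilinear graded symmetric functionals with supports in the sets `O m`, that vanish in arity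
`m` unless all indices lie in `τ m`. -/
structure IsGood (τ : ℕ → Finset T) (c : Fam B U 𝓤) : Prop where
  gsymm : ∀ n α, GSymm (c n α)
  headLin : ∀ n α, HeadLin (c n α)
  supp : ∀ n α, B.SuppIn O (c n α)
  bdd : ∀ n α l, (∃ j, α j ∉ τ l.length) → c n α l = 0

variable {τ : ℕ → Finset T}

theorem IsGood.sub {c c' : Fam B U 𝓤} (hc : IsGood O τ c) (hc' : IsGood O τ c') :
    IsGood O τ (c - c') where
  gsymm n α := (hc.gsymm n α).sub (hc'.gsymm n α)
  headLin n α := (hc.headLin n α).sub (hc'.headLin n α)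
  supp n α l hl := by
    change c n α l - c' n α l = 0
    rw [hc.supp n α l hl, hc'.supp n α l hl, sub_zero]
  bdd n α l hl := by
    change c n α l - c' n α l = 0
    rw [hc.bdd n α l hl, hc'.bdd n α l hl, sub_zero]

theorem IsGood.dSgn {c : Fam B U 𝓤} (hO : Monotone O) (hτ : Monotone τ) (hc : IsGood O τ c) :
    IsGood O τ (dSgn c) where
  gsymm n α := ((hc.gsymm n α).ce _ (hc.headLin n α)).smul _
  headLin n α := ((HeadLin.ce _ (hc.gsymm n α) (hc.headLin n α))).smul _
  supp n α l hl := by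
    refine (congrArg (eps (n + 1 : ℕ) * ·) ?_).trans (mul_zero _)
    exact (hc.supp n α).ce hO (hc.headLin n α) l hl
  bdd n α l := fun ⟨j, hj⟩ => by
    refine (congrArg (eps (n + 1 : ℕ) * ·) ?_).trans (mul_zero _)
    refine (WordFam.ce_congr (B.fieldsAlg _) (w := 0) (hc.headLin n α) (fun _ _ => ⟨0, fun _ _ => rfl⟩) l
      fun S T hST hS => ?_).trans (unsh_zero l)
    exact hc.bdd n α _ ⟨j, fun hj' => hj (hτ (WordFam.length_br_cons _ hST hS) hj')⟩

theorem IsGood.htpy {c : Fam B U 𝓤} (hκ : ∀ m, κ.used m ⊆ τ m) (hc : IsGood O τ c) :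
    IsGood O τ (κ.htpy c) where
  gsymm n α := by
    cases n with
    | zero => exact fun _ _ _ _ => (smul_zero _).symm
    | succ n =>
      change GSymm (κ.part B _ _ _ _)
      exact (hc.gsymm n _).relabel Selects.perm
  headLin n α := by
    cases n with
    | zero => exact fun _ _ => ⟨0, fun _ _ => rfl⟩
    | succ n =>
      change HeadLin (κ.part B _ _ _ _)
      exact (hc.headLin n _).relabel
  supp n α := by
    cases n with
    | zero => exact fun _ _ => rfl
    | succ n => exact (hc.supp n _).part
  bdd n α l := fun ⟨j, hj⟩ => by
    cases n with
    | zero => rfl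
    | succ n =>
      induction j using Fin.cases with
      | zero => exact part_eq_zero_of_used fun h => hj (hκ _ h)
      | succ j => exact part_eq_zero_of_length fun l' hl' => hc.bdd n _ _ ⟨j, by rwa [hl']⟩

theorem IsGood.corr {c : Fam B U 𝓤} (hO : Monotone O) (hτ : Monotone τ)
    (hκ : ∀ m, κ.used m ⊆ τ m) (hc : IsGood O τ c) : IsGood O τ (κ.corr c) := by
  -- the family is the limit of the iterates of `y ↦ c - d h y`, which agree up to level `n`
  have key : ∀ n, ∃ y : Fam B U 𝓤, IsGood O τ y ∧ ∀ m ≤ n, κ.corr c m = y m := by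
    intro n
    induction n with
    | zero => exact ⟨c, hc, fun m hm => by obtain rfl := Nat.le_zero.1 hm; rfl⟩
    | succ n ih =>
      obtain ⟨y, hy, hyc⟩ := ih
      refine ⟨c - Cutoffs.dSgn (κ.htpy y), hc.sub ((hy.htpy hκ).dSgn hO hτ), fun m hm => ?_⟩
      rw [corr_eq]
      funext α
      cases m with
      | zero => rfl
      | succ m =>
        change c _ α - eps _ • LInfAlg.ce _ (κ.part B _ _ _ (κ.corr c m _)) =
          c _ α - eps _ • LInfAlg.ce _ (κ.part B _ _ _ (y m _))
        rw [hyc m (Nat.le_of_succ_le_succ hm)]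
  choose y hy hyc using key
  constructor
  · intro n α
    rw [hyc n n le_rfl]
    exact (hy n).gsymm n α
  · intro n α
    rw [hyc n n le_rfl]
    exact (hy n).headLin n α
  · intro n α
    rw [hyc n n le_rfl]
    exact (hy n).supp n α
  · intro n α
    rw [hyc n n le_rfl]
    exact (hy n).bdd n α

theorem IsGood.slotLin {c : Fam B U 𝓤} (hc : IsGood O τ c) (n : ℕ) (α : Fin n → T) :
    SlotLin (c n α) := (hc.headLin n α).slotLin (hc.gsymm n α)

theorem shuffle_congr {c : Fam B U 𝓤} {n m : ℕ} {α : Fin n → T} {β β' : Fin m → T}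
    (hβ : cell U 𝓤 m β ≤ cell U 𝓤 n α) (h : β = β') :
    (B.fieldsHom hβ).shuffle (c m β) =
      (B.fieldsHom (show cell U 𝓤 m β' ≤ cell U 𝓤 n α from h ▸ hβ)).shuffle (c m β') := by
  subst h
  rfl

theorem cech_apply (h : IsWeissCover U 𝓤) (c : Fam B U 𝓤) {n : ℕ} (α : Fin n → T)
    (l : List (Letter (B.fieldsGr (cell U 𝓤 n α)))) :
    cech h τ c n α l = ∑ j : Fin (n + 1), ∑ i ∈ τ l.length, eps (j : ℕ) *
      (B.fieldsHom (cell_insertNth_le h j i α)).shuffle (c (n + 1) (Fin.insertNth j i α)) l :=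
  Finset.sum_product _ _ _

theorem htpy_cons (c : Fam B U 𝓤) {n : ℕ} (i : T) (α : Fin n → T) :
    κ.htpy c (n + 1) (Fin.cons i α) =
      κ.part B i (cell U 𝓤 (n + 1) (Fin.cons i α)) (cell U 𝓤 n α) (c n α) := rfl

/-- Up to sign, the homotopy of the Čech differential consists of the terms of the Čech differential
of `h c` that omit an index other than the first. -/
theorem htpy_cech_cons (h : IsWeissCover U 𝓤) (c : Fam B U 𝓤) {n : ℕ} (a : T) (γ : Fin n → T)
    (l : List (Letter (B.fieldsGr (cell U 𝓤 (n + 1) (Fin.cons a γ))))) :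
    κ.htpy (cech h τ c) (n + 1) (Fin.cons a γ) l = ∑ j : Fin (n + 1), ∑ i ∈ τ l.length,
      eps (j : ℕ) * (B.fieldsHom (cell_insertNth_le h j.succ i (Fin.cons a γ))).shuffle
        (κ.htpy c (n + 2) (Fin.insertNth j.succ i (Fin.cons a γ))) l := by
  rw [htpy_cons]
  refine (part_sum (s := (Finset.univ : Finset (Fin (n + 1))) ×ˢ τ l.length)
    (k := fun t => eps (t.1 : ℕ)) (v := fun t =>
      (B.fieldsHom (cell_insertNth_le h t.1 t.2 γ)).shuffle
        (c (n + 1) (Fin.insertNth t.1 t.2 γ))) fun l' hl' => ?_).trans ?_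
  · rw [← hl']
    rfl
  · rw [Finset.sum_product]
    refine Finset.sum_congr rfl fun j _ => Finset.sum_congr rfl fun i _ => ?_
    rw [shuffle_congr (cell_insertNth_le h j.succ i _) (Fin.insertNth_succ_cons j i a γ), htpy_cons,
      ← part_shuffle (cell_insertNth_le h j i γ) _ (cell_inf_le U 𝓤 a γ) (cell_inf_le U 𝓤 a _)]

/-- The contraction of the augmented Čech complex. Omitting the first index of `h c` gives the sum
of the parts of `c`, which is `c`; omitting the other indices cancels against `h` of the Čech
differential. -/
theorem cech_htpy (h : IsWeissCover U 𝓤) (hκ : ∀ m, κ.used m ⊆ τ m) {c : Fam B U 𝓤}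
    (hc : IsGood O τ c) : cech h τ (κ.htpy c) + κ.htpy (cech h τ c) = c := by
  funext n α
  refine ShuffleAlg.ext fun l => ?_
  change cech h τ (κ.htpy c) n α l + κ.htpy (cech h τ c) n α l = c n α l
  have h0 : ∑ i ∈ τ l.length, eps ((0 : Fin (n + 1)) : ℕ) *
      (B.fieldsHom (cell_insertNth_le h 0 i α)).shuffle
        (κ.htpy c (n + 1) (Fin.insertNth 0 i α)) l = c n α l := by
    refine Eq.trans ?_ (sum_part (κ := κ) (fun i => cell_cons_le h i α)
      (fun i => cell_inf_le U 𝓤 i α) (hc.slotLin n α) (hc.supp n α) l (hκ l.length))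
    refine Finset.sum_congr rfl fun i _ => ?_
    rw [shuffle_congr (cell_insertNth_le h 0 i α) (Fin.insertNth_zero' i α), htpy_cons]
    simp
  rw [cech_apply, Fin.sum_univ_succ, h0, add_assoc, add_eq_left]
  cases n with
  | zero => exact (add_zero _).trans Finset.sum_empty
  | succ n =>
    obtain ⟨a, γ, rfl⟩ : ∃ a γ, α = Fin.cons a γ := ⟨α 0, Fin.tail α, (Fin.cons_self_tail α).symm⟩
    rw [htpy_cech_cons, ← Finset.sum_add_distrib]
    refine Finset.sum_eq_zero fun k _ => ?_
    rw [← Finset.sum_add_distrib]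
    refine Finset.sum_eq_zero fun i _ => ?_
    rw [Fin.val_succ, Nat.cast_succ, eps_add, eps_one]
    ring

/-- The two differentials anticommute, by the signs in `dSgn`. The Chevalley–Eilenberg differential
evaluates functionals on words that are not longer than the given one, so monotonicity of `τ`
applies. -/
theorem cech_dSgn (h : IsWeissCover U 𝓤) (hτ : Monotone τ) {c : Fam B U 𝓤}
    (hc : IsGood O τ c) : cech h τ (dSgn c) = -dSgn (cech h τ c) := by
  funext n α
  refine ShuffleAlg.ext fun l => ?_
  change cech h τ (dSgn c) n α l = -(eps (n + 1 : ℕ) * LInfAlg.ce _ (cech h τ c n α) l)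
  have hv : ∀ t : Fin (n + 1) × T, HeadLin ((B.fieldsHom (cell_insertNth_le h t.1 t.2 α)).shuffle
      (c (n + 1) (Fin.insertNth t.1 t.2 α))) := fun t => HeadLin.shuffle (hc.headLin _ _) _
  have hw : HeadLin (cech h τ c n α) :=
    HeadLin.of_sum (s := fun m => (Finset.univ : Finset (Fin (n + 1))) ×ˢ τ m)
      (k := fun _ t => eps (t.1 : ℕ)) (fun _ => hv) fun l => rfl
  have key : LInfAlg.ce _ (cech h τ c n α) l = _ :=
    (B.fieldsAlg (cell U 𝓤 n α)).ce_sum (s := (Finset.univ : Finset (Fin (n + 1))) ×ˢ τ l.length)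
      (k := fun t => eps (t.1 : ℕ)) hw hv fun l' hl' => by
      refine Finset.sum_subset (Finset.product_subset_product_right (hτ hl')) fun t _ ht => ?_
      refine (congrArg (eps (t.1 : ℕ) * ·) (hc.bdd _ _ _ ⟨t.1, ?_⟩)).trans (mul_zero _)
      rw [Fin.insertNth_apply_same, List.length_map]
      exact fun h' => ht (Finset.mem_product.2 ⟨Finset.mem_univ _, h'⟩)
  rw [key, Finset.mul_sum, ← Finset.sum_neg_distrib]
  refine Finset.sum_congr rfl fun t _ => ?_
  rw [(B.presheaf.strict (cell_insertNth_le h t.1 t.2 α)).ce]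
  change eps _ * (eps (n + 1 + 1 : ℕ) * _) = _
  rw [Nat.cast_succ, eps_add, eps_one, mul_left_comm, mul_neg_one, neg_mul]
  rfl

theorem dSgn_dSgn {c : Fam B U 𝓤} (hc : IsGood O τ c) : dSgn (dSgn c) = 0 := by
  funext n α
  change eps _ • LInfAlg.ce _ (eps _ • LInfAlg.ce _ (c n α)) = 0
  rw [LInfAlg.ce_smul]
  have : LInfAlg.ce _ (LInfAlg.ce (B.fieldsAlg (cell U 𝓤 n α)) (c n α)) = 0 :=
    ShuffleAlg.ext fun l => LInfAlg.ce_ce _ (hc.gsymm n α) (hc.headLin n α) l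
  rw [this, smul_zero, smul_zero]

theorem dSgn_sub (c c' : Fam B U 𝓤) : dSgn (c - c') = dSgn c - dSgn c' := by
  funext n α
  change eps _ • LInfAlg.ce _ (c n α - c' n α) = eps _ • LInfAlg.ce _ (c n α) -
    eps _ • LInfAlg.ce _ (c' n α)
  rw [LInfAlg.ce_sub, smul_sub]

theorem cech_sub (h : IsWeissCover U 𝓤) (c c' : Fam B U 𝓤) :
    cech h τ (c - c') = cech h τ c - cech h τ c' := by
  funext n α
  refine ShuffleAlg.ext fun l => ?_
  change _ = cech h τ c n α l - cech h τ c' n α l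
  unfold cech
  rw [← Finset.sum_sub_distrib]
  refine Finset.sum_congr rfl fun t _ => ?_
  rw [← mul_sub]
  rfl

/-- Perturbation of the contracting homotopy: if `c'` is the total differential of `c`, then `c` is
the total differential of `h y`, up to the error `h y'`, where `y` and `y'` solve the equations
`y + d h y = c` and `y' + d h y' = c'`. -/
theorem cech_add_dSgn_htpy_corr (h : IsWeissCover U 𝓤) (hO : Monotone O) (hτ : Monotone τ)
    (hκ : ∀ m, κ.used m ⊆ τ m) {c c' : Fam B U 𝓤} (hc : IsGood O τ c)
    (hcc' : cech h τ c + dSgn c = c') :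
    cech h τ (κ.htpy (κ.corr c)) + dSgn (κ.htpy (κ.corr c)) = c - κ.htpy (κ.corr c') := by
  have hy := hc.corr hO hτ hκ
  have hy1 : κ.corr c = c - dSgn (κ.htpy (κ.corr c)) := corr_eq c
  have h1 := cech_htpy h hκ hy
  have h2 : cech h τ (κ.corr c) = κ.corr c' := by
    refine eq_corr ?_
    have h3 : cech h τ (κ.corr c) = cech h τ c - cech h τ (dSgn (κ.htpy (κ.corr c))) := by
      rw [← cech_sub, ← hy1]
    have h4 : dSgn (κ.corr c) = dSgn c := by
      rw [hy1, dSgn_sub, dSgn_dSgn (hy.htpy hκ), sub_zero]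
    have h5 : dSgn (cech h τ (κ.htpy (κ.corr c))) =
        dSgn (κ.corr c) - dSgn (κ.htpy (cech h τ (κ.corr c))) := by
      rw [← dSgn_sub]
      congr 1
      exact eq_sub_of_add_eq h1
    rw [cech_dSgn h hτ (hy.htpy hκ), h5, h4] at h3
    rw [← hcc']
    exact h3.trans (by abel)
  rw [h2] at h1
  rw [eq_sub_of_add_eq h1]
  nth_rw 1 [hy1]
  abel

end Cutoffs

/-! ### The Weiss cosheaf condition -/

theorem SmoothMap.isOpenEmb_id (r : ℕ) : (SmoothMap.id r).IsOpenEmb :=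
  ⟨Function.injective_id, fun y => by
    change Function.Bijective (fderiv ℝ _root_.id y)
    rw [fderiv_id]
    exact Function.bijective_id⟩

/-- A chart around `x` with relatively compact image: the translate by `x` of the arctangent in each
coordinate. -/
theorem SmoothMap.exists_isOpenEmb_mem_compact {r : ℕ} (x : Fin r → ℝ) :
    ∃ g : SmoothMap r r, g.IsOpenEmb ∧ x ∈ range g.1 ∧
      ∃ Q : Set (Fin r → ℝ), IsCompact Q ∧ ∀ y, g.1 y ∈ Q := by
  have hd : ∀ y : Fin r → ℝ, HasFDerivAt (fun y i => x i + Real.arctan (y i))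
      (ContinuousLinearMap.pi fun i => (1 / (1 + y i ^ 2)) •
        (ContinuousLinearMap.proj i : (Fin r → ℝ) →L[ℝ] ℝ)) y := by
    intro y
    refine hasFDerivAt_pi.2 fun i => ?_
    exact ((hasFDerivAt_apply (𝕜 := ℝ) i y).arctan).const_add (x i)
  refine ⟨⟨fun y i => x i + Real.arctan (y i), contDiff_pi.2 fun i =>
    contDiff_const.add (Real.contDiff_arctan.comp (contDiff_apply ℝ ℝ i))⟩,
    ⟨fun y y' h => funext fun i => ?_, fun y => ?_⟩, ⟨0, funext fun i => ?_⟩,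
    univ.pi fun i => Icc (x i - Real.pi / 2) (x i + Real.pi / 2),
    isCompact_univ_pi fun i => isCompact_Icc, fun y i _ => ⟨?_, ?_⟩⟩
  · exact Real.arctan_injective (add_left_cancel (congrFun h i))
  · have hpos : ∀ i, (1 + y i ^ 2) ≠ 0 := fun i => by positivity
    change Function.Bijective (fderiv ℝ (fun y i => x i + Real.arctan (y i)) y)
    rw [(hd y).fderiv]
    refine ⟨fun v v' h => funext fun i => ?_, fun w => ⟨fun i => (1 + y i ^ 2) * w i, ?_⟩⟩
    · have := congrFun h i
      simpa [hpos i] using this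
    · funext i
      simp [hpos i]
  · simp
  · have := Real.neg_pi_div_two_lt_arctan (y i)
    change _ ≤ x i + Real.arctan (y i)
    linarith
  · have := Real.arctan_lt_pi_div_two (y i)
    change x i + Real.arctan (y i) ≤ _
    linarith

section

open WordFam

variable {E : Type u} [AddCommGroup E] [Module ℝ E] {G : GrSpace E} (𝔤 : LInfAlg G) {r : ℕ}
  {T : Type u} {f : T → Obs G r} {s : Obs G r}

theorem WordFam.Obs.sum_apply (S : Finset T) (x : Fin r → ℝ) (l : List (Letter G)) :
    (∑ t ∈ S, f t : Obs G r).1 x l = ∑ t ∈ S, (f t).1 x l := by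
  rw [Obs.val_sum]
  exact (congrFun (Finset.sum_apply x S _) l).trans (Finset.sum_apply l S _)

/-- Locally finite sums modulo each `F^n` are finite sums on each word. -/
theorem LInfAlg.obs_hasLocSum_apply (h : 𝔤.obs.HasLocSum f s) (x : Fin r → ℝ)
    (l : List (Letter G)) :
    ∃ S₀ : Finset T, ∀ S : Finset T, S₀ ⊆ S → s.1 x l = ∑ t ∈ S, (f t).1 x l := by
  obtain ⟨g, _, ⟨y, rfl⟩, S₀, hS⟩ := h (l.length + 1) x
  refine ⟨S₀, fun S hSS => sub_eq_zero.1 ?_⟩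
  refine Eq.trans ?_ (hS S hSS y l (Nat.lt_succ_self _))
  exact congrArg (s.1 (g.1 y) l - ·) (Obs.sum_apply S (g.1 y) l).symm

/-- A converse, for sums that are finite uniformly for words of bounded length. -/
theorem LInfAlg.obs_hasLocSum {S₀ : ℕ → Finset T} (hS₀ : Monotone S₀)
    (h : ∀ x l (S : Finset T), S₀ l.length ⊆ S → s.1 x l = ∑ t ∈ S, (f t).1 x l) :
    𝔤.obs.HasLocSum f s := by
  refine fun n x => ⟨SmoothMap.id r, SmoothMap.isOpenEmb_id r, ⟨x, rfl⟩, S₀ n,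
    fun S hS y l hl => ?_⟩
  change s.1 y l - (∑ t ∈ S, f t : Obs G r).1 y l = 0
  rw [h y l S ((hS₀ hl.le).trans hS), Obs.sum_apply, sub_self]

theorem LInfAlg.mem_obs_filE {N : ℕ∞} {a : Obs G r} :
    a ∈ 𝔤.obs.filE r N ↔ ∀ x l, (l.length : ℕ∞) < N → a.1 x l = 0 := by
  constructor
  · intro h x l hl
    exact (Submodule.mem_iInf (M := 𝔤.obs.carrier r) _).1 ((Submodule.mem_iInf (M := 𝔤.obs.carrier r) _).1 h (l.length + 1))
      (by exact_mod_cast Order.add_one_le_of_lt hl) x l (Nat.lt_succ_self _)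
  · intro h
    refine (Submodule.mem_iInf (M := 𝔤.obs.carrier r) _).2 fun k => (Submodule.mem_iInf (M := 𝔤.obs.carrier r) _).2 fun hk x l hl => ?_
    exact h x l ((Nat.cast_lt.2 hl).trans_le hk)

end

namespace System

variable {d : ℕ} {M N : Type u} [TopologicalSpace M]
  [ChartedSpace (EuclideanHalfSpace (d + 1)) M] [MeasurableSpace M] [TopologicalSpace N]
  [ChartedSpace (EuclideanSpace ℝ (Fin d)) N] [MeasurableSpace N] {B : System d M N}
  {T : Type u} {U : Opens M} {𝓤 : T → Opens M} {r : ℕ}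

theorem observables_incl_apply {U V : Opens M} (h : U ≤ V)
    (a : WordFam.Obs (B.fieldsGr U) r) (x : Fin r → ℝ) :
    (B.observables.incl h r a : WordFam.Obs (B.fieldsGr V) r).1 x =
      (B.fieldsHom h).shuffle (a.1 x) := by
  refine (B.presheaf.mulObs_apply _ V _ r _ x).trans ?_
  rw [List.ofFn_succ, List.ofFn_zero, List.prod_singleton]

variable (B U 𝓤 r) in
/-- Families of observables on the open sets of the augmented Čech complex. -/
abbrev ObsFam : Type u := ∀ n (α : Fin n → T), WordFam.Obs (B.fieldsGr (cell U 𝓤 n α)) r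

/-- The value at a parameter. -/
def ObsFam.at (X : B.ObsFam U 𝓤 r) (x : Fin r → ℝ) : Cutoffs.Fam B U 𝓤 := fun n α => (X n α).1 x

/-- An element of the augmented Čech complex, from its component in `𝓕(U)` and its Čech chain. -/
def joinFam (b : WordFam.Obs (B.fieldsGr U) r) (c : B.observables.CechFamily 𝓤 r) :
    B.ObsFam U 𝓤 r
  | 0, _ => b
  | n + 1, α => c n α

/-- Modulo each `F^m`, locally only finitely many members of the family are non-zero. -/
def ObsFam.LocFinite (X : B.ObsFam U 𝓤 r) : Prop :=
  ∀ (m : ℕ) (x : Fin r → ℝ), ∃ g : SmoothMap r r, g.IsOpenEmb ∧ x ∈ range g.1 ∧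
    {t : Σ n : ℕ, (Fin n → T) | WordFam.pullObs g (X t.1 t.2) ∉
      WordFam.filObs (B.fieldsGr (cell U 𝓤 t.1 t.2)) r m}.Finite

/-- On words of length `m` and for parameters in a compact set, almost all members of the family
vanish. -/
theorem ObsFam.LocFinite.exists_finset {X : B.ObsFam U 𝓤 r} (hX : X.LocFinite)
    {Q : Set (Fin r → ℝ)} (hQ : IsCompact Q) (m : ℕ) :
    ∃ S : Finset (Σ n : ℕ, (Fin n → T)), ∀ t ∉ S, ∀ x ∈ Q,
      ∀ l : List (Letter (B.fieldsGr (cell U 𝓤 t.1 t.2))), l.length = m →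
        (X t.1 t.2).1 x l = 0 := by
  classical
  choose g hg hx hfin using hX (m + 1)
  obtain ⟨J, hJ⟩ := hQ.elim_finite_subcover (fun x => range (g x).1)
    (fun x => (hg x).isOpen_range) fun x _ => mem_iUnion.2 ⟨x, hx x⟩
  refine ⟨J.biUnion fun x => (hfin x).toFinset, fun t ht x hxQ l hl => ?_⟩
  obtain ⟨y, hyJ, z, rfl⟩ := mem_iUnion₂.1 (hJ hxQ)
  have h1 : WordFam.pullObs (g y) (X t.1 t.2) ∈
      WordFam.filObs (B.fieldsGr (cell U 𝓤 t.1 t.2)) r (m + 1) := by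
    by_contra h1
    exact ht (Finset.mem_biUnion.2 ⟨y, hyJ, (hfin y).mem_toFinset.2 h1⟩)
  exact h1 z l (by omega)

theorem cell_le {U : Opens M} {𝓤 : T → Opens M} (h : IsWeissCover U 𝓤) {n : ℕ}
    (α : Fin n → T) : cell U 𝓤 n α ≤ U := by
  cases n with
  | zero => exact le_rfl
  | succ n => exact inter_le h α

section

variable [IsManifold (𝓡∂ (d + 1)) ∞ M] [SecondCountableTopology M] [T2Space M]

/-- Relatively compact open sets `O m` and finite sets of indices `τ m` that contain the supports
of all members of a family in arities up to `m`, for parameters in a compact set. -/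
theorem ObsFam.LocFinite.exists_isGood (h : IsWeissCover U 𝓤) {X : B.ObsFam U 𝓤 r}
    (hX : X.LocFinite) {Q : Set (Fin r → ℝ)} (hQ : IsCompact Q) :
    ∃ (O : ℕ → Opens M) (τ : ℕ → Finset T) (κ : Cutoffs d 𝓤 O), Monotone O ∧ Monotone τ ∧
      (∀ m, κ.used m ⊆ τ m) ∧ ∀ x ∈ Q, Cutoffs.IsGood O τ (X.at x) := by
  classical
  have : LocallyCompactSpace M := Manifold.locallyCompact_of_finiteDimensional (𝓡∂ (d + 1))
  choose S hS using fun m => hX.exists_finset hQ m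
  choose K hK hKU hK0 using fun (t : Σ n : ℕ, (Fin n → T)) (m : ℕ) =>
    exists_compact_support (X t.1 t.2).2 hQ m
  choose L hL hKL hLU using fun m => exists_compact_between
    ((S m).isCompact_biUnion fun t _ => hK t m) U.isOpen
    (iUnion₂_subset fun t _ => (hKU t m).trans (cell_le h t.2))
  -- Unions over smaller arities make `O` and `τ` monotone.
  let O : ℕ → Opens M := fun m => ⨆ m' : Fin (m + 1), ⟨interior (L m'), isOpen_interior⟩
  have hO : Monotone O := fun m m' hm => iSup_le fun i =>
    le_iSup (fun i : Fin (m' + 1) => (⟨interior (L i), isOpen_interior⟩ : Opens M))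
      ⟨i, by omega⟩
  have hKO : ∀ m, ∀ t ∈ S m, K t m ⊆ O m := fun m t ht p hp => by
    have h1 := hKL m (mem_iUnion₂.2 ⟨t, ht, hp⟩)
    exact (le_iSup (fun i : Fin (m + 1) => (⟨interior (L i), isOpen_interior⟩ : Opens M))
      ⟨m, Nat.lt_succ_self m⟩) h1
  obtain ⟨κ⟩ := exists_cutoffs (d := d) h (O := O) fun m =>
    ⟨⋃ m' : Fin (m + 1), L m', isCompact_iUnion fun i => hL i, iUnion_subset fun i => hLU i, by
      rw [Opens.coe_iSup]
      exact iUnion_mono fun i => interior_subset⟩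
  let τ : ℕ → Finset T := fun m => (Finset.range (m + 1)).biUnion fun m' =>
    (κ.used m') ∪ (S m').biUnion fun t => Finset.univ.image t.2
  have hτ : ∀ m, κ.used m ∪ (S m).biUnion (fun t => Finset.univ.image t.2) ⊆ τ m := fun m =>
    Finset.subset_biUnion_of_mem (fun m' => (κ.used m') ∪ (S m').biUnion fun t =>
      Finset.univ.image t.2) (Finset.self_mem_range_succ m)
  refine ⟨O, τ, κ, hO, fun m m' hm => Finset.biUnion_subset_biUnion_of_subset_left _
    (Finset.range_mono (by omega)), fun m => Finset.subset_union_left.trans (hτ m), fun x hx => ?_⟩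
  constructor
  · exact fun n α => WordFam.gsymm_of_mem (X n α).2 x
  · exact fun n α => WordFam.headLin_of_mem (X n α).2 x
  · rintro n α l ⟨a, ha, ha0⟩
    by_cases ht : (⟨n, α⟩ : Σ n : ℕ, (Fin n → T)) ∈ S l.length
    · exact hK0 ⟨n, α⟩ l.length x hx l rfl ⟨a, ha, fun p hp => ha0 p (hKO _ _ ht hp)⟩
    · exact hS _ _ ht x hx l rfl
  · rintro n α l ⟨j, hj⟩
    refine hS _ ⟨n, α⟩ (fun ht => hj ?_) x hx l rfl
    exact hτ _ (Finset.mem_union_right _ (Finset.mem_biUnion.2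
      ⟨_, ht, Finset.mem_image_of_mem _ (Finset.mem_univ j)⟩))

end

theorem part_mem_homSub {O : ℕ → Opens M} (κ : Cutoffs d 𝓤 O) {i : T} {W V : Opens M} {p : ℤ}
    {w : WordFam (B.fieldsGr V) r} (hw : w ∈ WordFam.homSub (B.fieldsGr V) r p) :
    (fun x => κ.part B i W V (w x) : WordFam (B.fieldsGr W) r) ∈
      WordFam.homSub (B.fieldsGr W) r p :=
  WordFam.relabel_mem_homSub Cutoffs.Selects.perm hw

/-- The homotopy has degree `-1`, for the degrees shifted by the Čech level. -/
theorem htpy_mem_homSub {O : ℕ → Opens M} (κ : Cutoffs d 𝓤 O) {p : ℤ}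
    {z : (Fin r → ℝ) → Cutoffs.Fam B U 𝓤}
    (hz : ∀ n α, (fun x => z x n α : WordFam (B.fieldsGr (cell U 𝓤 n α)) r) ∈
      WordFam.homSub (B.fieldsGr (cell U 𝓤 n α)) r (p + n)) (n : ℕ) (α : Fin n → T) :
    (fun x => κ.htpy (z x) n α : WordFam (B.fieldsGr (cell U 𝓤 n α)) r) ∈
      WordFam.homSub (B.fieldsGr (cell U 𝓤 n α)) r (p - 1 + n) := by
  cases n with
  | zero => exact zero_mem _
  | succ n =>
    have h1 := part_mem_homSub κ (i := α 0) (W := cell U 𝓤 (n + 1) α) (hz n (Fin.tail α))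
    rw [show p - 1 + ((n + 1 : ℕ) : ℤ) = p + n by push_cast; ring]
    exact h1

theorem dSgn_mem_homSub {p : ℤ} {z : (Fin r → ℝ) → Cutoffs.Fam B U 𝓤} {n : ℕ} {α : Fin n → T}
    (hz : (fun x => z x n α : WordFam (B.fieldsGr (cell U 𝓤 n α)) r) ∈
      WordFam.homSub (B.fieldsGr (cell U 𝓤 n α)) r p) :
    (fun x => Cutoffs.dSgn (z x) n α : WordFam (B.fieldsGr (cell U 𝓤 n α)) r) ∈
      WordFam.homSub (B.fieldsGr (cell U 𝓤 n α)) r (p + 1) :=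
  Submodule.smul_mem _ (algebraMap ℝ (SmoothFn r) (eps (n + 1 : ℕ)))
    (WordFam.ce_mem_homSub (B.fieldsAlg _) hz)

theorem corr_mem_homSub {O : ℕ → Opens M} (κ : Cutoffs d 𝓤 O) {p : ℤ}
    {z : (Fin r → ℝ) → Cutoffs.Fam B U 𝓤}
    (hz : ∀ n α, (fun x => z x n α : WordFam (B.fieldsGr (cell U 𝓤 n α)) r) ∈
      WordFam.homSub (B.fieldsGr (cell U 𝓤 n α)) r (p + n)) (n : ℕ) (α : Fin n → T) :
    (fun x => κ.corr (z x) n α : WordFam (B.fieldsGr (cell U 𝓤 n α)) r) ∈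
      WordFam.homSub (B.fieldsGr (cell U 𝓤 n α)) r (p + n) := by
  induction n with
  | zero => exact hz 0 α
  | succ n ih =>
    have h1 := part_mem_homSub κ (i := α 0) (W := cell U 𝓤 (n + 1) α) (ih (Fin.tail α))
    have h2 := Submodule.smul_mem _ (algebraMap ℝ (SmoothFn r) (eps (n + 1 + 1 : ℕ)))
      (WordFam.ce_mem_homSub (B.fieldsAlg _) h1)
    rw [show p + (n : ℤ) + 1 = p + (n + 1 : ℕ) by push_cast; ring] at h2
    exact sub_mem (hz (n + 1) α) h2

/-- The perturbation preserves the filtration `F^N`, also for `N = ∞`. -/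
theorem corr_eq_zero {O : ℕ → Opens M} (κ : Cutoffs d 𝓤 O) {N : ℕ∞} {z : Cutoffs.Fam B U 𝓤}
    (hl : ∀ n α, HeadLin (κ.corr z n α))
    (hz : ∀ n α l, (l.length : ℕ∞) < N → z n α l = 0) (n : ℕ) (α : Fin n → T)
    (l : List (Letter (B.fieldsGr (cell U 𝓤 n α)))) (hN : (l.length : ℕ∞) < N) :
    κ.corr z n α l = 0 := by
  induction n with
  | zero => exact hz 0 α l hN
  | succ n ih =>
    change z (n + 1) α l - eps _ * LInfAlg.ce _ (κ.part B _ _ _ _) l = 0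
    rw [hz _ _ _ hN, zero_sub, neg_eq_zero]
    refine (congrArg (eps (n + 1 + 1 : ℕ) * ·) ?_).trans (mul_zero _)
    refine (WordFam.ce_congr (B.fieldsAlg _) (w := 0) (HeadLin.relabel (hl n _))
      (fun _ _ => ⟨0, fun _ _ => rfl⟩) l fun S T' hST hS => ?_).trans (unsh_zero l)
    refine Cutoffs.part_eq_zero_of_length fun l' hl' => ih _ l' ?_
    rw [hl']
    exact (Nat.cast_le.2 (WordFam.length_br_cons _ hST hS)).trans_lt hN

theorem htpy_eq_zero {O : ℕ → Opens M} (κ : Cutoffs d 𝓤 O) {N : ℕ∞} {z : Cutoffs.Fam B U 𝓤}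
    (hz : ∀ n α l, (l.length : ℕ∞) < N → z n α l = 0) (n : ℕ) (α : Fin n → T)
    (l : List (Letter (B.fieldsGr (cell U 𝓤 n α)))) (hN : (l.length : ℕ∞) < N) :
    κ.htpy z n α l = 0 := by
  cases n with
  | zero => rfl
  | succ n => exact Cutoffs.part_eq_zero_of_length fun l' hl' => hz _ _ l' (by rwa [hl'])

/-- The total differential has degree `1`. -/
theorem mem_homSub_of_total (h : IsWeissCover U 𝓤) {p : ℤ} {X X' : B.ObsFam U 𝓤 r}
    {τ : ℕ → Finset T}
    (hX : ∀ n α, X n α ∈ WordFam.homObs (B.fieldsGr (cell U 𝓤 n α)) r (p + n))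
    (hXX' : ∀ x, Cutoffs.cech h τ (X.at x) + Cutoffs.dSgn (X.at x) = X'.at x)
    (n : ℕ) (α : Fin n → T) :
    X' n α ∈ WordFam.homObs (B.fieldsGr (cell U 𝓤 n α)) r (p + 1 + n) := by
  refine ⟨fun x => WordFam.gsymm_of_mem (X' n α).2 x, fun x => WordFam.headLin_of_mem (X' n α).2 x,
    WordFam.smooth_of_mem (X' n α).2, fun x l hl => ?_⟩
  have h1 : (X' n α).1 x l = Cutoffs.cech h τ (X.at x) n α l + Cutoffs.dSgn (X.at x) n α l :=
    (congrFun (congrFun (congrFun (hXX' x) n) α) l).symm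
  have h2 : Cutoffs.dSgn (X.at x) n α l = 0 :=
    (dSgn_mem_homSub (z := X.at) (hX n α)).2.2.2 x l (by omega)
  refine h1.trans ?_
  rw [h2, add_zero]
  refine Finset.sum_eq_zero fun t _ => ?_
  have h3 := (GrHom.word_mem_homSub (B.fieldsHom (cell_insertNth_le h t.1 t.2 α))
    (hX (n + 1) (Fin.insertNth t.1 t.2 α))).2.2.2 x l (by push_cast; omega)
  exact (congrArg (eps (t.1 : ℕ) * ·) h3).trans (mul_zero _)

section

variable [IsManifold (𝓡∂ (d + 1)) ∞ M] [SecondCountableTopology M] [T2Space M]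

/-- Near each parameter, a cocycle of the augmented Čech complex modulo `F^N` is a coboundary
modulo `F^N`. -/
theorem exists_primitive (h : IsWeissCover U 𝓤) {p : ℤ} {ν : ℕ∞} {X X' : B.ObsFam U 𝓤 r}
    (hX : ∀ n α, X n α ∈ WordFam.homObs (B.fieldsGr (cell U 𝓤 n α)) r (p + n))
    (hfin : X.LocFinite)
    (hX' : ∀ n α x l, (l.length : ℕ∞) < ν → (X' n α).1 x l = 0)
    (hXX' : ∀ (O : ℕ → Opens M) (τ : ℕ → Finset T) x, Cutoffs.IsGood O τ (X.at x) →
      Cutoffs.cech h τ (X.at x) + Cutoffs.dSgn (X.at x) = X'.at x) (x : Fin r → ℝ) :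
    ∃ g : SmoothMap r r, g.IsOpenEmb ∧ x ∈ range g.1 ∧ ∃ τ : ℕ → Finset T, Monotone τ ∧
      ∃ Y Z : B.ObsFam U 𝓤 r, (∀ α, Y 0 α = 0 ∧ Z 0 α = 0) ∧
        (∀ n α, Y n α ∈ WordFam.homObs (B.fieldsGr (cell U 𝓤 n α)) r (p - 1 + n)) ∧
        (∀ n α x l, (l.length : ℕ∞) < ν → (Z n α).1 x l = 0) ∧
        (∀ x n α l, (∃ j, α j ∉ τ l.length) → (Y n α).1 x l = 0) ∧
        ∀ y, Cutoffs.cech h τ (Y.at y) + Cutoffs.dSgn (Y.at y) = X.at (g.1 y) - Z.at y := by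
  -- Within a relatively compact chart the supports and the indices are bounded, and the homotopy
  -- formula gives `Y = h y`, with the error `Z = h y'`.
  obtain ⟨g, hg, hx, Q, hQ, hgQ⟩ := SmoothMap.exists_isOpenEmb_mem_compact x
  obtain ⟨O, τ, κ, hO, hτ, hκ, hgood⟩ := hfin.exists_isGood h hQ
  have hg1 : ∀ y, Cutoffs.IsGood O τ (X.at (g.1 y)) := fun y => hgood _ (hgQ y)
  have h1 : ∀ y, Cutoffs.cech h τ (X.at (g.1 y)) + Cutoffs.dSgn (X.at (g.1 y)) =
      X'.at (g.1 y) := fun y => hXX' O τ _ (hg1 y)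
  have hXg : ∀ n α, WordFam.pullObs g (X n α) ∈
      WordFam.homObs (B.fieldsGr (cell U 𝓤 n α)) r (p + n) := fun n α => WordFam.pull_mem g (hX n α)
  have hX'g := mem_homSub_of_total h (X := fun n α => WordFam.pullObs g (X n α))
    (X' := fun n α => WordFam.pullObs g (X' n α)) hXg h1
  have hcX := corr_mem_homSub κ (z := fun y => X.at (g.1 y)) hXg
  have hcX' := corr_mem_homSub κ (z := fun y => X'.at (g.1 y)) hX'g
  have hY := htpy_mem_homSub κ hcX
  have hZ := htpy_mem_homSub κ hcX'
  refine ⟨g, hg, hx, τ, hτ, fun n α => ⟨_, WordFam.homSub_le _ (hY n α)⟩,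
    fun n α => ⟨_, WordFam.homSub_le _ (hZ n α)⟩, fun α => ⟨rfl, rfl⟩, hY,
    fun n α y l hl => ?_, fun y n α l hl => ?_, fun y => ?_⟩
  · exact htpy_eq_zero κ (corr_eq_zero κ (fun n α => (hcX' n α).2.1 y)
      fun n α l hl => hX' n α (g.1 y) l hl) n α l hl
  · exact (((hg1 y).corr hO hτ hκ).htpy hκ).bdd n α l hl
  · exact Cutoffs.cech_add_dSgn_htpy_corr h hO hτ hκ (hg1 y) (h1 y)

end

/-- The terms of the Čech differential with an index outside `τ` vanish. -/
theorem sum_eq_cech (h : IsWeissCover U 𝓤) {X : B.ObsFam U 𝓤 r} {τ : ℕ → Finset T}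
    {x : Fin r → ℝ} (hX : ∀ n α l, (∃ j, α j ∉ τ l.length) → (X n α).1 x l = 0)
    {n : ℕ} {α : Fin n → T} {l : List (Letter (B.fieldsGr (cell U 𝓤 n α)))}
    {S : Finset (ULift.{u} (Fin (n + 1)) × T)} (hS : Finset.univ ×ˢ τ l.length ⊆ S) :
    ∑ t ∈ S, eps (t.1.down : ℕ) * (B.fieldsHom (cell_insertNth_le h t.1.down t.2 α)).shuffle
      ((X (n + 1) (Fin.insertNth t.1.down t.2 α)).1 x) l = Cutoffs.cech h τ (X.at x) n α l := by
  rw [Cutoffs.cech_apply, ← Finset.sum_subset hS, Finset.sum_product]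
  · exact Equiv.ulift.sum_comp fun j : Fin (n + 1) => ∑ i ∈ τ l.length, eps (j : ℕ) *
      (B.fieldsHom (cell_insertNth_le h j i α)).shuffle
        ((X (n + 1) (Fin.insertNth j i α)).1 x) l
  · intro t _ ht
    refine (congrArg (eps (t.1.down : ℕ) * ·) (hX _ _ _ ⟨t.1.down, ?_⟩)).trans (mul_zero _)
    rw [Fin.insertNth_apply_same, List.length_map]
    exact fun h' => ht (Finset.mem_product.2 ⟨Finset.mem_univ _, h'⟩)

theorem sum_eq_cech_zero (h : IsWeissCover U 𝓤) {X : B.ObsFam U 𝓤 r} {τ : ℕ → Finset T}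
    {x : Fin r → ℝ} (hX : ∀ n α l, (∃ j, α j ∉ τ l.length) → (X n α).1 x l = 0)
    {α : Fin 0 → T} {l : List (Letter (B.fieldsGr U))} {S : Finset T} (hS : τ l.length ⊆ S) :
    ∑ i ∈ S, (B.fieldsHom (inter_le h fun _ : Fin 1 => i)).shuffle ((X 1 fun _ => i).1 x) l =
      Cutoffs.cech h τ (X.at x) 0 α l := by
  refine Eq.trans ?_ (Cutoffs.cech_apply (n := 0) h (X.at x) α l).symm
  rw [Fin.sum_univ_one, ← Finset.sum_subset hS]
  · refine Finset.sum_congr rfl fun i _ => ?_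
    have hi : Fin.insertNth (0 : Fin 1) i α = fun _ => i := funext fun j => by
      obtain rfl : j = 0 := Fin.ext (by omega)
      exact Fin.insertNth_apply_same _ _ _
    rw [Cutoffs.shuffle_congr (cell_insertNth_le h 0 i α) hi]
    simp only [Fin.val_zero, Nat.cast_zero, eps_zero, one_mul]
    rfl
  · intro i _ hi
    exact hX _ _ _ ⟨0, (congrArg (i ∉ τ ·) (List.length_map _)).mpr hi⟩

theorem sgn_smul_incl_apply {U V : Opens M} (h : U ≤ V) (z : ℤ)
    (a : WordFam.Obs (B.fieldsGr U) r) (x : Fin r → ℝ) (l : List (Letter (B.fieldsGr V))) :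
    (sgn z • B.observables.incl h r a : WordFam.Obs (B.fieldsGr V) r).1 x l =
      eps z * (B.fieldsHom h).shuffle (a.1 x) l :=
  (congrFun (LInfPresheaf.zsmul_val (G := B.fieldsGr V) z _ x) l).trans
    (congrArg (eps z * ·) (congrFun (observables_incl_apply h a x) l))

theorem sub_sgn_smul_d_apply {V : Opens M} (z : ℤ) (a a' : WordFam.Obs (B.fieldsGr V) r)
    (x : Fin r → ℝ) (l : List (Letter (B.fieldsGr V))) :
    (a' - sgn z • WordFam.dObs (B.fieldsAlg V) a).1 x l =
      a'.1 x l - eps z * (B.fieldsAlg V).ce (a.1 x) l :=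
  congrArg (a'.1 x l - ·)
    (congrFun (LInfPresheaf.zsmul_val (G := B.fieldsGr V) z (WordFam.dObs (B.fieldsAlg V) a) x) l)

theorem eps_add_two (n : ℕ) : eps (n + 1 + 1 : ℕ) = eps n := by
  push_cast
  simp [eps_add]

/-- A Čech differential, in the sense of locally finite sums, is the total differential in positive
level. -/
theorem total_succ_of_isCechDiff (h : IsWeissCover U 𝓤) {b : WordFam.Obs (B.fieldsGr U) r}
    {c c' : B.observables.CechFamily 𝓤 r} (hcc' : PrefactorizationAlgebra.IsCechDiff c c')
    {O : ℕ → Opens M} {τ : ℕ → Finset T} {x : Fin r → ℝ}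
    (hgood : Cutoffs.IsGood O τ (ObsFam.at (joinFam b c) x)) (n : ℕ) (α : Fin (n + 1) → T) :
    Cutoffs.cech h τ (ObsFam.at (joinFam b c) x) (n + 1) α +
      Cutoffs.dSgn (ObsFam.at (joinFam b c) x) (n + 1) α =
      (c' n α : WordFam.Obs (B.fieldsGr _) r).1 x := by
  classical
  refine ShuffleAlg.ext fun l => ?_
  obtain ⟨S₀, hS₀⟩ := LInfAlg.obs_hasLocSum_apply _ (hcc' n α) x l
  have h1 := hS₀ (S₀ ∪ Finset.univ ×ˢ τ l.length) Finset.subset_union_left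
  have h2 := sum_eq_cech h (X := joinFam b c) hgood.bdd (α := α) (l := l)
    (S := S₀ ∪ Finset.univ ×ˢ τ l.length) Finset.subset_union_right
  have h3 := h1.trans ((Finset.sum_congr rfl fun t _ =>
    sgn_smul_incl_apply (inter_insertNth_le 𝓤 t.1.down t.2 α) _ _ x l).trans h2)
  change Cutoffs.cech h τ (ObsFam.at (joinFam b c) x) (n + 1) α l + eps (n + 1 + 1 : ℕ) * _ = _
  rw [eps_add_two, ← h3]
  exact (congrArg (· + _) (sub_sgn_smul_d_apply _ _ _ x l)).trans (sub_add_cancel _ _)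

/-- The augmentation of a chain, corrected by the differential of `b`, is the total differential in
level `0`. -/
theorem total_zero_of_isCechAug (h : IsWeissCover U 𝓤) {b s : WordFam.Obs (B.fieldsGr U) r}
    {c : B.observables.CechFamily 𝓤 r} (hs : PrefactorizationAlgebra.IsCechAug h c s)
    {O : ℕ → Opens M} {τ : ℕ → Finset T} {x : Fin r → ℝ}
    (hgood : Cutoffs.IsGood O τ (ObsFam.at (joinFam b c) x)) (α : Fin 0 → T) :
    Cutoffs.cech h τ (ObsFam.at (joinFam b c) x) 0 α +
      Cutoffs.dSgn (ObsFam.at (joinFam b c) x) 0 α =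
      (s - WordFam.dObs (B.fieldsAlg U) b).1 x := by
  classical
  refine ShuffleAlg.ext fun l => ?_
  obtain ⟨S₀, hS₀⟩ := LInfAlg.obs_hasLocSum_apply _ hs x l
  have h1 := hS₀ (S₀ ∪ τ l.length) Finset.subset_union_left
  have h2 := sum_eq_cech_zero h (X := joinFam b c) hgood.bdd (α := α) (l := l)
    (S := S₀ ∪ τ l.length) Finset.subset_union_right
  have h3 := h1.trans ((Finset.sum_congr rfl fun i _ => congrFun
    (observables_incl_apply (inter_le h fun _ : Fin 1 => i) (c 0 fun _ => i) x) l).trans h2)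
  change Cutoffs.cech h τ (ObsFam.at (joinFam b c) x) 0 α l + eps (0 + 1 : ℕ) * _ = _
  rw [← h3, Nat.zero_add, Nat.cast_one, eps_one, neg_one_mul]
  exact (sub_eq_add_neg _ _).symm

theorem isCechDiff_of_total (h : IsWeissCover U 𝓤) {Y Y' : B.ObsFam U 𝓤 r}
    {τ : ℕ → Finset T} (hτ : Monotone τ)
    (hY : ∀ x n α l, (∃ j, α j ∉ τ l.length) → (Y n α).1 x l = 0)
    (hYY' : ∀ x, Cutoffs.cech h τ (Y.at x) + Cutoffs.dSgn (Y.at x) = Y'.at x) :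
    PrefactorizationAlgebra.IsCechDiff (𝓕 := B.observables) (𝓤 := 𝓤)
      (fun n α => Y (n + 1) α) (fun n α => Y' (n + 1) α) := by
  refine fun n α => LInfAlg.obs_hasLocSum _ (S₀ := fun m => Finset.univ ×ˢ τ m)
    (fun m m' hm => Finset.product_subset_product_right (hτ hm)) fun x l S hS => ?_
  have h2 := sum_eq_cech h (hY x) (α := α) (l := l) hS
  have h3 := (Finset.sum_congr rfl fun t _ => sgn_smul_incl_apply
    (inter_insertNth_le 𝓤 t.1.down t.2 α) _ _ x l).trans h2
  refine Eq.trans ?_ h3.symm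
  refine (sub_sgn_smul_d_apply _ _ _ x l).trans ?_
  have h4 : (Y' (n + 1) α).1 x l = Cutoffs.cech h τ (Y.at x) (n + 1) α l +
      eps (n + 1 + 1 : ℕ) * (B.fieldsAlg _).ce ((Y (n + 1) α).1 x) l :=
    (congrFun (congrFun (congrFun (hYY' x) (n + 1)) α) l).symm
  refine (congrArg (· - _) h4).trans ?_
  rw [eps_add_two]
  exact add_sub_cancel_right _ _

theorem isCechAug_of_total (h : IsWeissCover U 𝓤) {Y Y' : B.ObsFam U 𝓤 r}
    {τ : ℕ → Finset T} (hτ : Monotone τ) (hY0 : ∀ α, Y 0 α = 0)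
    (hY : ∀ x n α l, (∃ j, α j ∉ τ l.length) → (Y n α).1 x l = 0)
    (hYY' : ∀ x, Cutoffs.cech h τ (Y.at x) + Cutoffs.dSgn (Y.at x) = Y'.at x) (α : Fin 0 → T) :
    PrefactorizationAlgebra.IsCechAug (𝓕 := B.observables) h
      (fun n α => Y (n + 1) α) (Y' 0 α) := by
  refine LInfAlg.obs_hasLocSum _ hτ fun x l S hS => ?_
  have h2 := sum_eq_cech_zero h (hY x) (α := α) (l := l) hS
  have h3 := (Finset.sum_congr rfl fun i _ => congrFun
    (observables_incl_apply (inter_le h fun _ : Fin 1 => i) (Y 1 fun _ => i) x) l).trans h2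
  refine Eq.trans ?_ h3.symm
  have h4 : (Y' 0 α).1 x l = Cutoffs.cech h τ (Y.at x) 0 α l +
      eps (0 + 1 : ℕ) * (B.fieldsAlg U).ce ((Y 0 α).1 x) l :=
    (congrFun (congrFun (congrFun (hYY' x) 0) α) l).symm
  refine h4.trans ?_
  rw [hY0 α]
  refine (congrArg (_ + eps _ * ·) (?_ : _ = (0 : ℝ))).trans (by rw [mul_zero, add_zero])
  exact congrFun (LInfAlg.ce_zero (B.fieldsAlg U)) l

theorem locFinite_joinFam {q : ℤ} (b : WordFam.Obs (B.fieldsGr U) r)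
    {c : B.observables.CechFamily 𝓤 r} (hc : PrefactorizationAlgebra.IsCechChain q c) :
    ObsFam.LocFinite (joinFam b c) := by
  intro m x
  obtain ⟨g, hg, hx, hfin⟩ := hc.2 m x
  refine ⟨g, hg, hx, ((hfin.image fun t => (⟨t.1 + 1, t.2⟩ : Σ n : ℕ, (Fin n → T))).insert
    ⟨0, fun i => i.elim0⟩).subset ?_⟩
  rintro ⟨n, α⟩ ht
  cases n with
  | zero => exact Or.inl (by congr 1; exact Subsingleton.elim _ _)
  | succ n => exact Or.inr ⟨⟨n, α⟩, ht, rfl⟩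

/-- Local finiteness: modulo `F^N` all indices lie in `τ N`, and the Čech level is bounded because
the degree of the functional grows with it, whereas a word of bounded length has bounded degree. -/
theorem isCechChain_of_bdd {p : ℤ} {Y : B.ObsFam U 𝓤 r} {τ : ℕ → Finset T} (hτ : Monotone τ)
    (hY : ∀ x n α l, (∃ j, α j ∉ τ l.length) → (Y n α).1 x l = 0)
    (hp : ∀ n α, Y n α ∈ WordFam.homObs (B.fieldsGr (cell U 𝓤 n α)) r (p - 1 + n)) :
    PrefactorizationAlgebra.IsCechChain (𝓕 := B.observables) (𝓤 := 𝓤) p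
      (fun n α => Y (n + 1) α) := by
  refine ⟨fun n α => ?_, fun N x => ⟨SmoothMap.id r, SmoothMap.isOpenEmb_id r, ⟨x, rfl⟩, ?_⟩⟩
  · have := hp (n + 1) α
    rwa [show p - 1 + ((n + 1 : ℕ) : ℤ) = p + n by push_cast; ring] at this
  · refine ((finite_Iic (N * B.bulk.bdl.bound + p.natAbs)).biUnion (t := fun n =>
      Sigma.mk n '' {α : Fin (n + 1) → T | ∀ j, α j ∈ τ N}) fun n _ =>
        Finite.image _ (Finite.pi' fun _ => (τ N).finite_toSet)).subset ?_
    rintro ⟨n, α⟩ ht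
    by_contra hcon
    refine ht fun y l hl => ?_
    by_cases hα : ∀ j, α j ∈ τ N
    · by_cases hn : n ≤ N * B.bulk.bdl.bound + p.natAbs
      · exact (hcon (mem_biUnion (mem_Iic.2 hn) (mem_image_of_mem (Sigma.mk n)
          (show α ∈ {α : Fin (n + 1) → T | ∀ j, α j ∈ τ N} from hα)))).elim
      · refine WordFam.eq_zero_of_bound (hp (n + 1) α) ?_
        have h1 : (l.length * B.bulk.bdl.bound : ℤ) ≤ N * B.bulk.bdl.bound := by
          exact_mod_cast Nat.mul_le_mul_right _ hl.le
        change (l.length * B.bulk.bdl.bound : ℤ) < _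
        refine lt_of_le_of_lt h1 (lt_of_lt_of_le ?_ (le_abs_self _))
        push_cast
        have h2 : (N * B.bulk.bdl.bound + p.natAbs : ℤ) < n := by exact_mod_cast not_le.1 hn
        omega
    · obtain ⟨j, hj⟩ := not_forall.1 hα
      exact hY y (n + 1) α l ⟨j, fun h => hj (hτ hl.le h)⟩

section

variable [IsManifold (𝓡∂ (d + 1)) ∞ M] [SecondCountableTopology M] [T2Space M]

theorem dSgn_zero_apply (c : Cutoffs.Fam B U 𝓤) (α : Fin 0 → T) :
    Cutoffs.dSgn c 0 α = -(B.fieldsAlg U).ce (c 0 α) := by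
  change eps (0 + 1 : ℕ) • _ = _
  rw [Nat.zero_add, Nat.cast_one, eps_one, neg_one_smul]
  rfl

theorem dSgn_eq_zero {c : Cutoffs.Fam B U 𝓤} {n : ℕ} {α : Fin n → T} (hc : c n α = 0) :
    Cutoffs.dSgn c n α = 0 := by
  unfold Cutoffs.dSgn
  rw [hc, LInfAlg.ce_zero, smul_zero]

/-- Injectivity in cohomology modulo `F^ν`: a cocycle whose augmentation is the differential of `b`
is a cocycle of the augmented complex with `b` in level `0`, and hence a coboundary. -/
theorem cech_injective (h : IsWeissCover U 𝓤) {ν : ℕ∞} {q : ℤ}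
    {c c' : B.observables.CechFamily 𝓤 r} {s b : WordFam.Obs (B.fieldsGr U) r}
    (hc : PrefactorizationAlgebra.IsCechChain q c) (hcc' : PrefactorizationAlgebra.IsCechDiff c c')
    (hc' : ∀ n α, c' n α ∈ (B.observables.obj (inter 𝓤 α)).filE r ν)
    (hs : PrefactorizationAlgebra.IsCechAug h c s)
    (hb : b ∈ WordFam.homObs (B.fieldsGr U) r (q - 1))
    (hsb : s - WordFam.dObs (B.fieldsAlg U) b ∈ (B.fieldsAlg U).obs.filE r ν) (x : Fin r → ℝ) :
    ∃ g : SmoothMap r r, g.IsOpenEmb ∧ x ∈ range g.1 ∧ ∃ e e' : B.observables.CechFamily 𝓤 r,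
      PrefactorizationAlgebra.IsCechChain (q - 1) e ∧ PrefactorizationAlgebra.IsCechDiff e e' ∧
      ∀ n α, (B.observables.obj (inter 𝓤 α)).pull g (c n α) - e' n α ∈
        (B.observables.obj (inter 𝓤 α)).filE r ν := by
  have hcX : ∀ n α, joinFam b c n α ∈
      WordFam.homObs (B.fieldsGr (cell U 𝓤 n α)) r (q - 1 + n) := by
    intro n α
    cases n with
    | zero =>
      rw [Nat.cast_zero, add_zero]
      exact hb
    | succ n =>
      rw [show q - 1 + ((n + 1 : ℕ) : ℤ) = q + n by push_cast; ring]
      exact hc.1 n α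
  have hX' : ∀ n α x l, (l.length : ℕ∞) < ν →
      (joinFam (s - WordFam.dObs (B.fieldsAlg U) b) c' n α).1 x l = 0 := by
    intro n α
    cases n with
    | zero => exact (LInfAlg.mem_obs_filE _).1 hsb
    | succ n => exact (LInfAlg.mem_obs_filE _).1 (hc' n α)
  have htot : ∀ (O : ℕ → Opens M) (τ : ℕ → Finset T) x,
      Cutoffs.IsGood O τ (ObsFam.at (joinFam b c) x) →
      Cutoffs.cech h τ (ObsFam.at (joinFam b c) x) + Cutoffs.dSgn (ObsFam.at (joinFam b c) x) =
        ObsFam.at (joinFam (s - WordFam.dObs (B.fieldsAlg U) b) c') x := by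
    intro O τ x hgood
    funext n α
    cases n with
    | zero => exact total_zero_of_isCechAug h hs hgood α
    | succ n => exact total_succ_of_isCechDiff h hcc' hgood n α
  obtain ⟨g, hg, hx, τ, hτ, Y, Z, h0, hY, hZ, hbdd, htot⟩ := exists_primitive h hcX
    (locFinite_joinFam b hc) hX' htot x
  let Y' : B.ObsFam U 𝓤 r := fun n α => WordFam.pullObs g (joinFam b c n α) - Z n α
  have h1 : PrefactorizationAlgebra.IsCechChain (𝓕 := B.observables) (𝓤 := 𝓤) (q - 1)
      (fun n α => Y (n + 1) α) := isCechChain_of_bdd hτ hbdd hY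
  have h2 : PrefactorizationAlgebra.IsCechDiff (𝓕 := B.observables) (𝓤 := 𝓤)
      (fun n α => Y (n + 1) α) (fun n α => Y' (n + 1) α) := isCechDiff_of_total h hτ hbdd htot
  have h3 : ∀ n α, (WordFam.pullObs g (joinFam b c (n + 1) α) - Y' (n + 1) α) ∈
      (B.fieldsAlg (cell U 𝓤 (n + 1) α)).obs.filE r ν := fun n α =>
    (LInfAlg.mem_obs_filE _).2 fun y l hl => (sub_sub_cancel
      ((joinFam b c (n + 1) α).1 (g.1 y) l) _).trans (hZ (n + 1) α y l hl)
  exact ⟨g, hg, hx, _, _, h1, h2, h3⟩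

/-- Surjectivity in cohomology modulo `F^ν`: the cocycle `b`, in level `0` of the augmented complex,
is a coboundary, that is, the augmentation of a Čech cocycle. -/
theorem cech_surjective (h : IsWeissCover U 𝓤) {ν : ℕ∞} {q : ℤ}
    {b : WordFam.Obs (B.fieldsGr U) r} (hb : b ∈ WordFam.homObs (B.fieldsGr U) r q)
    (hdb : WordFam.dObs (B.fieldsAlg U) b ∈ (B.fieldsAlg U).obs.filE r ν) (x : Fin r → ℝ) :
    ∃ g : SmoothMap r r, g.IsOpenEmb ∧ x ∈ range g.1 ∧
      ∃ (c c' : B.observables.CechFamily 𝓤 r),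
        PrefactorizationAlgebra.IsCechChain q c ∧ PrefactorizationAlgebra.IsCechDiff c c' ∧
        (∀ n α, c' n α ∈ (B.observables.obj (inter 𝓤 α)).filE r ν) ∧
        PrefactorizationAlgebra.IsCechAug h c (WordFam.pullObs g b) := by
  have hcX : ∀ n α, joinFam (𝓤 := 𝓤) b 0 n α ∈
      WordFam.homObs (B.fieldsGr (cell U 𝓤 n α)) r (q + n) := by
    intro n α
    cases n with
    | zero =>
      rw [Nat.cast_zero, add_zero]
      exact hb
    | succ n => exact zero_mem _
  have hX' : ∀ n α x l, (l.length : ℕ∞) < ν →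
      (joinFam (𝓤 := 𝓤) (-WordFam.dObs (B.fieldsAlg U) b) 0 n α).1 x l = 0 := by
    intro n α x l hl
    cases n with
    | zero => exact (congrArg Neg.neg ((LInfAlg.mem_obs_filE _).1 hdb x l hl)).trans neg_zero
    | succ n => rfl
  have h0chain : PrefactorizationAlgebra.IsCechChain (𝓕 := B.observables) (𝓤 := 𝓤) (r := r) q 0 := by
    refine ⟨fun n α => zero_mem _, fun m x => ⟨SmoothMap.id r, SmoothMap.isOpenEmb_id r, ⟨x, rfl⟩, ?_⟩⟩
    refine finite_empty.subset fun t ht => ht (zero_mem _)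
  have htot : ∀ (O : ℕ → Opens M) (τ : ℕ → Finset T) x,
      Cutoffs.IsGood O τ (ObsFam.at (joinFam (𝓤 := 𝓤) b 0) x) →
      Cutoffs.cech h τ (ObsFam.at (joinFam b 0) x) + Cutoffs.dSgn (ObsFam.at (joinFam b 0) x) =
        ObsFam.at (joinFam (-WordFam.dObs (B.fieldsAlg U) b) 0) x := by
    intro O τ x _
    funext n α
    have h1 : Cutoffs.cech h τ (ObsFam.at (joinFam b 0) x) n α = 0 :=
      ShuffleAlg.ext fun l => Finset.sum_eq_zero fun t _ => mul_zero _
    refine (congrArg (· + Cutoffs.dSgn (ObsFam.at (joinFam b 0) x) n α) h1).trans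
      ((zero_add _).trans ?_)
    cases n with
    | zero => exact dSgn_zero_apply _ α
    | succ n => exact dSgn_eq_zero (c := ObsFam.at (joinFam b 0) x) rfl
  obtain ⟨g, hg, hx, τ, hτ, Y, Z, h0, hY, hZ, hbdd, htot⟩ := exists_primitive h hcX
    (locFinite_joinFam b h0chain) hX' htot x
  let Y' : B.ObsFam U 𝓤 r := fun n α =>
    WordFam.pullObs g (joinFam (𝓤 := 𝓤) b 0 n α) - Z n α
  have h1 : PrefactorizationAlgebra.IsCechChain (𝓕 := B.observables) (𝓤 := 𝓤) q
      (fun n α => Y (n + 1) α) := isCechChain_of_bdd hτ hbdd hY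
  have h2 : PrefactorizationAlgebra.IsCechDiff (𝓕 := B.observables) (𝓤 := 𝓤)
      (fun n α => Y (n + 1) α) (fun n α => Y' (n + 1) α) := isCechDiff_of_total h hτ hbdd htot
  have h3 : ∀ n α, Y' (n + 1) α ∈ (B.fieldsAlg (cell U 𝓤 (n + 1) α)).obs.filE r ν := fun n α =>
    (LInfAlg.mem_obs_filE _).2 fun y l hl =>
      (congrArg ((0 : ℝ) - ·) (hZ (n + 1) α y l hl)).trans (sub_zero _)
  have h4 : PrefactorizationAlgebra.IsCechAug (𝓕 := B.observables) h
      (fun n α => Y (n + 1) α) (Y' 0 fun i => i.elim0) :=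
    isCechAug_of_total (Y' := Y') h hτ (fun α => (h0 α).1) hbdd htot _
  have h5 : Y' 0 (fun i => i.elim0) = WordFam.pullObs g b :=
    (congrArg (WordFam.pullObs g b - ·) (h0 _).2).trans (sub_zero _)
  rw [h5] at h4
  exact ⟨g, hg, hx, _, _, h1, h2, h3, h4⟩

variable (B) in
/-- In the surjectivity part the augmentation hits the given cocycle itself, so the correcting
coboundary is `0`. -/
theorem observables_isFactorizationAlgebra : B.observables.IsFactorizationAlgebra := by
  refine fun U T 𝓤 h N r q => ⟨fun c c' s b hc hcc' hc' hs hb hsb x =>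
    cech_injective h hc hcc' hc' hs hb hsb x, fun b hb hdb x => ?_⟩
  obtain ⟨g, hg, hx, c, c', hc, hcc', hc', hs⟩ := cech_surjective h hb hdb x
  refine ⟨g, hg, hx, c, c', WordFam.pullObs g b, 0, hc, hcc', hc', hs, zero_mem _, ?_⟩
  have h0 : (B.observables.obj U).pull g b - (B.observables.obj U).pull g b -
      (B.observables.obj U).d 0 = 0 := by rw [map_zero, sub_self, sub_zero]
  exact (congrArg (· ∈ (B.observables.obj U).filE r N) h0).mpr (zero_mem _)

end

end System

end BulkBoundary

end

theorem mainTheorem1 {d : ℕ} {M N : Type u}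
    [TopologicalSpace M] [ChartedSpace (EuclideanHalfSpace (d + 1)) M]
    [IsManifold (𝓡∂ (d + 1)) ∞ M] [T2Space M] [SecondCountableTopology M]
    [MeasurableSpace M] [BorelSpace M]
    [TopologicalSpace N] [ChartedSpace (EuclideanSpace ℝ (Fin d)) N]
    [IsManifold (𝓡 d) ∞ N] [MeasurableSpace N] [BorelSpace N]
    (B : BulkBoundary.System d M N) :
    ∃ (𝓕 : BulkBoundary.PrefactorizationAlgebra M)
      (cls : ∀ (U : Opens M) (r : ℕ) (p : ℤ), B.Series U r p →+ (𝓕.obj U).carrier r),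
      B.IsClassicalObservables 𝓕 cls ∧ 𝓕.IsFactorizationAlgebra := ⟨B.observables, B.cls, B.isClassicalObservables, B.observables_isFactorizationAlgebra⟩
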